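/- There are a real RAM program and a constant $K$ such that the following holds for every pseudotriangle $P$, i.e. every closed region bounded by a simple polygon with $n$ vertices of which exactly three are convex (have interior angle less than $\pi$). Given $n$ and the coordinates of the vertices of $P$ in boundary order (in either direction), the program stops after at most $K n$ steps and outputs a hidden set $H$ of $P$ and a convex cover $C$ of $P$ with $|C| \le 2|H|$. Consequently, both outputs are 2-approximations: $|H'| \le 2|H|$ for every finite hidden set $H'$ of $P$, and $|C| \le 2|C'|$ for every convex cover $C'$ of $P$. Here two points of $P$ see each other if the segment between them is contained in $P$; a hidden set of $P$ is a finite set of points of $P$ no two of which see each other; a convex cover of $P$ is a finite set of convex polygons whose union is $P$. Points are output by their coordinates, and convex polygons by the coordinates of their vertices in boundary order. A real RAM has a memory of arrays of natural numbers and arrays of real numbers with indirect addressing; the field operations and comparisons of exact real numbers, additions, (truncated) subtractions and comparisons of natural numbers, memory accesses, and assignments cost one step each. -/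

import Mathlib

/-! ## Polygons in the plane -/

/-- The plane. Only its affine structure, its topology and its bornology are used. -/
abbrev Plane : Type := ℝ × ℝ

/-- Twice the signed area of the triangle `a b c`: positive if `a, b, c` make a left turn, negative
if they make a right turn, zero if they are collinear. -/
def orient (a b c : Plane) : ℝ :=
  (b.1 - a.1) * (c.2 - a.2) - (b.2 - a.2) * (c.1 - a.1)

/-- A simple polygon: at least three vertices, all distinct, and two different edges meet in nothing
but a common endpoint. The vertex after the vertex with index `i` has index `finRotate n i`. -/
def Polygon.IsSimple {n : ℕ} (v : Polygon Plane n) : Prop :=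
  3 ≤ n ∧ Function.Injective v.vertices ∧
    ∀ i j : Fin n, i ≠ j →
      v.edgeSet ℝ i ∩ v.edgeSet ℝ j ⊆
        ({v i, v (finRotate n i)} ∩ {v j, v (finRotate n j)} : Set Plane)

/-- The closed region bounded by a polygon: its boundary together with all points that lie in a
bounded connected component of the complement of the boundary. -/
def Polygon.region {n : ℕ} (v : Polygon Plane n) : Set Plane :=
  v.boundary ℝ ∪
    {x | x ∉ v.boundary ℝ ∧ Bornology.IsBounded (connectedComponentIn (v.boundary ℝ)ᶜ x)}

/-- The signed area: for a simple polygon it is positive if the vertices are listed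
counterclockwise (interior on the left) and negative if they are listed clockwise. -/
noncomputable def Polygon.signedArea {n : ℕ} (v : Polygon Plane n) : ℝ :=
  (∑ i : Fin n, ((v i).1 * (v (finRotate n i)).2 - (v (finRotate n i)).1 * (v i).2)) / 2

/-- A vertex of a simple polygon is convex if its interior angle is less than `π`, that is, if the
boundary turns strictly left there when it is traversed counterclockwise, or strictly right when it
is traversed clockwise. -/
def Polygon.IsConvexVertex {n : ℕ} (v : Polygon Plane n) (i : Fin n) : Prop :=
  0 < v.signedArea * orient (v ((finRotate n).symm i)) (v i) (v (finRotate n i))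

/-- A pseudotriangle: a simple polygon with exactly three convex vertices. -/
def Polygon.IsPseudotriangle {n : ℕ} (v : Polygon Plane n) : Prop :=
  v.IsSimple ∧ {i : Fin n | v.IsConvexVertex i}.ncard = 3

/-- The vertices of `w` are those of a (nondegenerate) convex polygon, in boundary order, in one of
the two directions: every other vertex lies strictly on the same side of each edge. -/
def Polygon.IsConvex {k : ℕ} (w : Polygon Plane k) : Prop :=
  3 ≤ k ∧
    ((∀ i j : Fin k, j ≠ i → j ≠ finRotate k i → 0 < orient (w i) (w (finRotate k i)) (w j)) ∨
     (∀ i j : Fin k, j ≠ i → j ≠ finRotate k i → orient (w i) (w (finRotate k i)) (w j) < 0))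

/-- The closed region of a convex polygon is the convex hull of its vertices. -/
def Polygon.hull {k : ℕ} (w : Polygon Plane k) : Set Plane :=
  convexHull ℝ (Set.range w.vertices)

/-! ## Visibility, hidden sets, convex covers -/

/-- Two points see each other in `P` if the segment between them lies in `P`. -/
def Sees (P : Set Plane) (p q : Plane) : Prop := segment ℝ p q ⊆ P

/-- A hidden set of `P`: points of `P`, no two of which see each other. -/
def IsHiddenSet (P : Set Plane) (H : Finset Plane) : Prop :=
  (∀ p ∈ H, p ∈ P) ∧ ∀ p ∈ H, ∀ q ∈ H, p ≠ q → ¬ Sees P p q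

/-- A convex cover of `P`: finitely many convex polygons whose union is `P`. -/
def IsConvexCover (P : Set Plane) (C : Finset (Set Plane)) : Prop :=
  (∀ Q ∈ C, ∃ (k : ℕ) (w : Polygon Plane k), w.IsConvex ∧ Q = w.hull) ∧
    ⋃₀ (C : Set (Set Plane)) = P

/-! ## The real RAM

Programs are while programs over a memory that consists of arrays of natural numbers and arrays of
real numbers, with indirect addressing (an index is computed at run time). The number of an array
is fixed by the program text. Every arithmetic operation, memory access, comparison and assignment
costs one unit of time. There is no rounding and no conversion between the two kinds of number, and
the only constants are natural and rational numbers. -/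

/-- The memory: `nat a i` is cell `i` of the `a`-th array of natural numbers, `real a i` is cell `i`
of the `a`-th array of real numbers. -/
structure RamState where
  nat : ℕ → ℕ → ℕ
  real : ℕ → ℕ → ℝ

/-- Expressions with natural values. -/
inductive NatExpr where
  | const (c : ℕ)
  | get (a : ℕ) (i : NatExpr)
  | add (e f : NatExpr)
  | sub (e f : NatExpr)

/-- Expressions with real values. -/
inductive RealExpr where
  | const (c : ℚ)
  | get (a : ℕ) (i : NatExpr)
  | add (e f : RealExpr)
  | sub (e f : RealExpr)
  | mul (e f : RealExpr)
  | div (e f : RealExpr)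

/-- Tests. -/
inductive Test where
  | natLe (e f : NatExpr)
  | realLe (e f : RealExpr)
  | not (b : Test)
  | and (b c : Test)

/-- Programs. -/
inductive Program where
  | skip
  | setNat (a : ℕ) (i e : NatExpr)
  | setReal (a : ℕ) (i : NatExpr) (e : RealExpr)
  | seq (p q : Program)
  | branch (b : Test) (p q : Program)
  | loop (b : Test) (p : Program)

/-- The value of an expression (`sub` is truncated subtraction). -/
def NatExpr.eval (s : RamState) : NatExpr → ℕ
  | const c => c
  | get a i => s.nat a (i.eval s)
  | add e f => e.eval s + f.eval s
  | sub e f => e.eval s - f.eval s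

/-- The time needed to evaluate an expression. -/
def NatExpr.cost : NatExpr → ℕ
  | const _ => 1
  | get _ i => i.cost + 1
  | add e f => e.cost + f.cost + 1
  | sub e f => e.cost + f.cost + 1

/-- The value of an expression. A quotient by zero has the value zero; this gives no additional
power, because a program can compare the divisor with zero. -/
noncomputable def RealExpr.eval (s : RamState) : RealExpr → ℝ
  | const c => (c : ℝ)
  | get a i => s.real a (i.eval s)
  | add e f => e.eval s + f.eval s
  | sub e f => e.eval s - f.eval s
  | mul e f => e.eval s * f.eval s
  | div e f => e.eval s / f.eval s

/-- The time needed to evaluate an expression. -/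
def RealExpr.cost : RealExpr → ℕ
  | const _ => 1
  | get _ i => i.cost + 1
  | add e f => e.cost + f.cost + 1
  | sub e f => e.cost + f.cost + 1
  | mul e f => e.cost + f.cost + 1
  | div e f => e.cost + f.cost + 1

/-- The outcome of a test. -/
def Test.holds (s : RamState) : Test → Prop
  | natLe e f => e.eval s ≤ f.eval s
  | realLe e f => e.eval s ≤ f.eval s
  | not b => ¬ b.holds s
  | and b c => b.holds s ∧ c.holds s

/-- The time needed for a test. -/
def Test.cost : Test → ℕ
  | natLe e f => e.cost + f.cost + 1
  | realLe e f => e.cost + f.cost + 1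
  | not b => b.cost + 1
  | and b c => b.cost + c.cost + 1

/-- Write `x` into cell `i` of the `a`-th array of natural numbers. -/
def RamState.writeNat (s : RamState) (a i x : ℕ) : RamState :=
  { s with nat := Function.update s.nat a (Function.update (s.nat a) i x) }

/-- Write `x` into cell `i` of the `a`-th array of real numbers. -/
noncomputable def RamState.writeReal (s : RamState) (a i : ℕ) (x : ℝ) : RamState :=
  { s with real := Function.update s.real a (Function.update (s.real a) i x) }

/-- `Runs p s t s'`: the program `p`, started in the memory state `s`, terminates after exactly `t`
units of time in the memory state `s'`. -/
inductive Runs : Program → RamState → ℕ → RamState → Prop where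
  | skip (s : RamState) : Runs .skip s 1 s
  | setNat (s : RamState) (a : ℕ) (i e : NatExpr) :
      Runs (.setNat a i e) s (i.cost + e.cost + 1) (s.writeNat a (i.eval s) (e.eval s))
  | setReal (s : RamState) (a : ℕ) (i : NatExpr) (e : RealExpr) :
      Runs (.setReal a i e) s (i.cost + e.cost + 1) (s.writeReal a (i.eval s) (e.eval s))
  | seq {p q : Program} {s s₁ s₂ : RamState} {t₁ t₂ : ℕ}
      (hp : Runs p s t₁ s₁) (hq : Runs q s₁ t₂ s₂) : Runs (.seq p q) s (t₁ + t₂) s₂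
  | branchTrue {b : Test} {p q : Program} {s s₁ : RamState} {t : ℕ}
      (hb : b.holds s) (hp : Runs p s t s₁) : Runs (.branch b p q) s (b.cost + t) s₁
  | branchFalse {b : Test} {p q : Program} {s s₁ : RamState} {t : ℕ}
      (hb : ¬ b.holds s) (hq : Runs q s t s₁) : Runs (.branch b p q) s (b.cost + t) s₁
  | loopDone {b : Test} {p : Program} {s : RamState}
      (hb : ¬ b.holds s) : Runs (.loop b p) s b.cost s
  | loopStep {b : Test} {p : Program} {s s₁ s₂ : RamState} {t₁ t₂ : ℕ}
      (hb : b.holds s) (hp : Runs p s t₁ s₁) (hl : Runs (.loop b p) s₁ t₂ s₂) :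
      Runs (.loop b p) s (b.cost + t₁ + t₂) s₂

/-! ## Input and output -/

/-- The input format: cell `0` of the natural array `0` holds the number `n` of vertices, the real
arrays `0` and `1` hold the two coordinates of the vertices in boundary order, and all other cells
hold zero. -/
noncomputable def RamState.input {n : ℕ} (v : Polygon Plane n) : RamState where
  nat a i := if a = 0 ∧ i = 0 then n else 0
  real a i :=
    if h : i < n then
      if a = 0 then (v ⟨i, h⟩).1 else if a = 1 then (v ⟨i, h⟩).2 else 0
    else 0

/-- The output format for points: cell `0` of the natural array `1` holds their number, the real
arrays `2` and `3` hold their coordinates. -/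
noncomputable def RamState.outputPoints (s : RamState) : Finset Plane :=
  (Finset.range (s.nat 1 0)).image fun j => (s.real 2 j, s.real 3 j)

/-- The output format for polygons: the real arrays `4` and `5` hold the coordinates of their
vertices, one polygon after the other, each in boundary order; the `j`-th polygon occupies the cells
from `s.nat 3 j` up to, but not including, `s.nat 3 (j + 1)`. -/
noncomputable def RamState.outputPolygon (s : RamState) (j : ℕ) :
    Polygon Plane (s.nat 3 (j + 1) - s.nat 3 j) :=
  ⟨fun i => (s.real 4 (s.nat 3 j + i), s.real 5 (s.nat 3 j + i))⟩

/-- The output in `s` is a list of convex polygons (their number is in cell `0` of the natural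
array `2`) and `C` is the set of their regions. -/
def RamState.OutputsConvexPolygons (s : RamState) (C : Finset (Set Plane)) : Prop :=
  (∀ j < s.nat 2 0, (s.outputPolygon j).IsConvex) ∧
    (C : Set (Set Plane)) = {Q | ∃ j < s.nat 2 0, Q = (s.outputPolygon j).hull}

/-! The exterior angles of a counterclockwise simple polygon add up to 2π
(`SimplePeriodic.totalTurn_and_area`). If only three vertices are convex, each of them turning by
less than π, then the directions of the edges are confined: within each of the three reflex chains
later edges are turned clockwise from earlier ones, and every edge of a chain makes a left turn into
every edge of the next chain (`CcwPseudotriangle.pseudoChain`). Once vertices with a straight angle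
are dropped, these strict signs are all that the geometry needs. In particular, the region consists
of the points that are on the left of at least one edge line of each chain
(`PseudoChain.region_eq`).

A line through one convex corner, with a direction between its two edges, cuts the region into two
funnels (`PseudoChain.region_eq_funnels`). Each has one of the other two convex corners as its apex
and two chains that descend from it towards the cut. A left line, a right line and the cut bound a
triangle inside the region (`Funnel.piece_eq_triangle`). A greedy walk goes down both chains. If the
start of the next right edge is beyond the line of the next left edge, it passes only the right
edge; in the symmetric case it passes only the left one; otherwise it passes both. After every step
the triangle of the two lines passed last is taken, and these triangles cover the funnel
(`Funnel.region_eq_iUnion`).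

Each step also pays for one hidden point, in the interior of an edge that it passes. A one-sided
step leaves no choice of the edge, and a two-sided step takes the side of the next one-sided step.
Then every point lies beyond the line of the edge that carries any later point
(`Funnel.modePoint_beyond`), so a segment between the two leaves the region near the later one
(`ThreeChains.not_segment_subset`). The points are therefore hidden in the whole region and not only
in the funnel.

If the walks have N₁ and N₂ steps, the cover has at most N₁ + N₂ triangles and the larger hidden set
has max(N₁, N₂) points, which gives the factor 2. Since a convex piece contains at most one point of
a hidden set (`IsHiddenSet.card_le_of_cover`), both outputs are 2-approximations.

Every step of a walk passes at least one edge, so the walks take linear time; the sides of the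
two-sided steps are found on the way back. The preparation is a fixed number of scans: area,
orientation, a convex vertex, the vertices with a turn, the other two corners, and the edge that
meets the cut. -/

/-! ## Oriented angles between vectors of the plane -/

/-- The cross product of two vectors of the plane. -/
def cross (u v : Plane) : ℝ := u.1 * v.2 - u.2 * v.1

/-- The dot product of two vectors of the plane. -/
def dot (u v : Plane) : ℝ := u.1 * v.1 + u.2 * v.2

theorem orient_eq_cross (a b c : Plane) : orient a b c = cross (b - a) (c - a) := rfl

theorem cross_add_left (u v w : Plane) : cross (u + v) w = cross u w + cross v w := by
  simp only [cross, Prod.fst_add, Prod.snd_add]; ring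

theorem cross_add_right (u v w : Plane) : cross u (v + w) = cross u v + cross u w := by
  simp only [cross, Prod.fst_add, Prod.snd_add]; ring

theorem cross_sub_left (u v w : Plane) : cross (u - v) w = cross u w - cross v w := by
  simp only [cross, Prod.fst_sub, Prod.snd_sub]; ring

theorem cross_sub_right (u v w : Plane) : cross u (v - w) = cross u v - cross u w := by
  simp only [cross, Prod.fst_sub, Prod.snd_sub]; ring

theorem cross_neg_left (u v : Plane) : cross (-u) v = -cross u v := by
  simp only [cross, Prod.fst_neg, Prod.snd_neg]; ring

theorem cross_neg_right (u v : Plane) : cross u (-v) = -cross u v := by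
  simp only [cross, Prod.fst_neg, Prod.snd_neg]; ring

theorem cross_smul_left (r : ℝ) (u v : Plane) : cross (r • u) v = r * cross u v := by
  simp only [cross, Prod.smul_fst, Prod.smul_snd, smul_eq_mul]; ring

theorem cross_smul_right (r : ℝ) (u v : Plane) : cross u (r • v) = r * cross u v := by
  simp only [cross, Prod.smul_fst, Prod.smul_snd, smul_eq_mul]; ring

theorem cross_self_eq_zero (u : Plane) : cross u u = 0 := by simp only [cross]; ring

theorem cross_comm (u v : Plane) : cross u v = -cross v u := by simp only [cross]; ring

theorem cross_zero_right (u : Plane) : cross u 0 = 0 := by simp [cross]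

theorem cross_zero_left (u : Plane) : cross 0 u = 0 := by simp [cross]

theorem cross_sum_right (u : Plane) {ι : Type*} (s : Finset ι) (f : ι → Plane) :
    cross u (∑ i ∈ s, f i) = ∑ i ∈ s, cross u (f i) := by
  classical
  induction s using Finset.induction_on with
  | empty => simp [cross]
  | insert a s ha ih => rw [Finset.sum_insert ha, Finset.sum_insert ha, cross_add_right, ih]

/-- A vector of the plane as a complex number. -/
def toComplex (u : Plane) : ℂ := ⟨u.1, u.2⟩

theorem toComplex_ne_zero {u : Plane} (hu : u ≠ 0) : toComplex u ≠ 0 := by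
  intro h
  apply hu
  have h1 := congrArg Complex.re h
  have h2 := congrArg Complex.im h
  simp only [toComplex, Complex.zero_re, Complex.zero_im] at h1 h2
  exact Prod.ext h1 h2

/-- The oriented angle from `u` to `v`, in `(-π, π]`. -/
noncomputable def ang (u v : Plane) : ℝ :=
  Complex.arg ((starRingEnd ℂ) (toComplex u) * toComplex v)

theorem ang_arg_re (u v : Plane) :
    ((starRingEnd ℂ) (toComplex u) * toComplex v).re = dot u v := by
  simp [toComplex, dot]

theorem ang_arg_im (u v : Plane) :
    ((starRingEnd ℂ) (toComplex u) * toComplex v).im = cross u v := by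
  simp [toComplex, cross]; ring

theorem ang_le_pi (u v : Plane) : ang u v ≤ Real.pi := Complex.arg_le_pi _

theorem neg_pi_lt_ang (u v : Plane) : -Real.pi < ang u v := Complex.neg_pi_lt_arg _

theorem ang_neg_iff {u v : Plane} : ang u v < 0 ↔ cross u v < 0 := by
  rw [ang, Complex.arg_neg_iff, ang_arg_im]

theorem ang_nonneg_iff {u v : Plane} : 0 ≤ ang u v ↔ 0 ≤ cross u v := by
  rw [ang, Complex.arg_nonneg_iff, ang_arg_im]

theorem ang_eq_pi_iff {u v : Plane} : ang u v = Real.pi ↔ dot u v < 0 ∧ cross u v = 0 := by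
  rw [ang, Complex.arg_eq_pi_iff, ang_arg_im, ang_arg_re]

theorem ang_neg_neg (u v : Plane) : ang (-u) (-v) = ang u v := by
  have h : ∀ w : Plane, toComplex (-w) = -toComplex w := fun w => by
    apply Complex.ext <;> simp [toComplex]
  simp only [ang, h, map_neg, neg_mul_neg]

/-- Modulo 2π an oriented angle is a difference of arguments. Identities between real angles are
reduced to this one, after bounds have excluded all but one multiple of 2π. -/
theorem ang_coe {u v : Plane} (hu : u ≠ 0) (hv : v ≠ 0) :
    (ang u v : Real.Angle) = (toComplex v).arg - (toComplex u).arg := by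
  rw [ang, Complex.arg_mul_coe_angle (by simpa using toComplex_ne_zero hu) (toComplex_ne_zero hv),
    Complex.arg_conj_coe_angle]
  abel

theorem dot_ne_zero_left {d u : Plane} (h : 0 < dot d u) : d ≠ 0 := by
  rintro rfl; simp [dot] at h

theorem dot_ne_zero_right {d u : Plane} (h : 0 < dot d u) : u ≠ 0 := by
  rintro rfl; simp [dot] at h

theorem abs_ang_lt {d u : Plane} (h : 0 < dot d u) : |ang d u| < Real.pi / 2 := by
  rw [ang, Complex.abs_arg_lt_pi_div_two_iff, ang_arg_re]
  exact Or.inl h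

theorem ang_coe_unique {x y : ℝ} (h : (x : Real.Angle) = y) (hx : x ∈ Set.Ioc (-Real.pi) Real.pi)
    (hy : y ∈ Set.Ioc (-Real.pi) Real.pi) : x = y := by
  rw [← Real.Angle.toReal_coe_eq_self_iff_mem_Ioc.2 hx, h,
    Real.Angle.toReal_coe_eq_self_iff_mem_Ioc.2 hy]

/-- Measured from `d`, both angles are in (-π/2, π/2), so their difference needs no correction by
2π. Inside an open half plane oriented angles are thus additive. -/
theorem ang_eq_sub {d u v : Plane} (hu : 0 < dot d u) (hv : 0 < dot d v) :
    ang u v = ang d v - ang d u := by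
  have h1 := abs_lt.1 (abs_ang_lt hu)
  have h2 := abs_lt.1 (abs_ang_lt hv)
  apply ang_coe_unique _ ⟨neg_pi_lt_ang _ _, ang_le_pi _ _⟩ ⟨by linarith, by linarith⟩
  rw [Real.Angle.coe_sub, ang_coe (dot_ne_zero_right hu) (dot_ne_zero_right hv),
    ang_coe (dot_ne_zero_left hu) (dot_ne_zero_right hv),
    ang_coe (dot_ne_zero_left hu) (dot_ne_zero_right hu)]
  abel

theorem ang_add_ang {d u v w : Plane} (hu : 0 < dot d u) (hv : 0 < dot d v) (hw : 0 < dot d w) :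
    ang u v + ang v w = ang u w := by
  rw [ang_eq_sub hu hv, ang_eq_sub hv hw, ang_eq_sub hu hw]; ring

theorem dot_add_right (d u v : Plane) : dot d (u + v) = dot d u + dot d v := by
  simp only [dot, Prod.fst_add, Prod.snd_add]; ring

theorem dot_self_pos {w : Plane} (hw : w ≠ 0) : 0 < dot w w := by
  simp only [dot]
  by_contra hn
  have h1 : w.1 * w.1 = 0 := by nlinarith [mul_self_nonneg w.1, mul_self_nonneg w.2]
  have h2 : w.2 * w.2 = 0 := by nlinarith [mul_self_nonneg w.1, mul_self_nonneg w.2]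
  exact hw (Prod.ext (mul_self_eq_zero.1 h1) (mul_self_eq_zero.1 h2))

/-- Two nonzero vectors that are not opposite lie in a common open half plane. -/
theorem exists_dot_pos {u v : Plane} (hu : u ≠ 0) (hv : v ≠ 0) (h : ang u v ≠ Real.pi) :
    ∃ d, 0 < dot d u ∧ 0 < dot d v := by
  have hU := dot_self_pos hu
  have hV := dot_self_pos hv
  set a := Real.sqrt (dot u u) with ha
  set b := Real.sqrt (dot v v) with hb
  have ha0 : 0 < a := Real.sqrt_pos.2 hU
  have hb0 : 0 < b := Real.sqrt_pos.2 hV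
  have ha2 : a * a = dot u u := Real.mul_self_sqrt hU.le
  have hb2 : b * b = dot v v := Real.mul_self_sqrt hV.le
  -- This is strict Cauchy–Schwarz: a dot product equal to minus the product of the lengths belongs
  -- to opposite vectors only.
  have key : 0 < a * b + dot u v := by
    by_contra hn
    have hid : dot u u * dot v v = dot u v ^ 2 + cross u v ^ 2 := by
      simp only [dot, cross]; ring
    have hlt : dot u v < 0 := by nlinarith
    have hne : cross u v ≠ 0 := fun hc => h (ang_eq_pi_iff.2 ⟨hlt, hc⟩)
    have hc : 0 < cross u v ^ 2 := by positivity
    have hle : a * b ≤ -dot u v := by linarith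
    have hab : 0 < a * b := mul_pos ha0 hb0
    have h1 : (a * b) * (a * b) ≤ (-dot u v) * (-dot u v) :=
      mul_le_mul hle hle hab.le (by linarith)
    have h2 : (a * b) * (a * b) = dot u u * dot v v := by rw [← ha2, ← hb2]; ring
    nlinarith
  -- The witness bisects the angle: it is the sum of the two vectors after scaling both to the
  -- length `a * b`.
  refine ⟨b • u + a • v, ?_, ?_⟩
  · have : dot (b • u + a • v) u = b * dot u u + a * dot u v := by
      simp only [dot, Prod.fst_add, Prod.snd_add, Prod.smul_fst, Prod.smul_snd, smul_eq_mul]; ring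
    rw [this, ← ha2]
    nlinarith [mul_pos ha0 key]
  · have : dot (b • u + a • v) v = b * dot u v + a * dot v v := by
      simp only [dot, Prod.fst_add, Prod.snd_add, Prod.smul_fst, Prod.smul_snd, smul_eq_mul]; ring
    rw [this, ← hb2]
    nlinarith [mul_pos hb0 key]

/-- Vectors that are not opposite share an open half plane, which then contains their sum too. -/
theorem ang_add_three {u v : Plane} (hu : u ≠ 0) (hv : v ≠ 0) (h : ang u v ≠ Real.pi) :
    ang u (u + v) + ang (u + v) v = ang u v := by
  obtain ⟨d, h1, h2⟩ := exists_dot_pos hu hv h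
  exact ang_add_ang h1 (by rw [dot_add_right]; linarith) h2

/-- The differences between the points of two disjoint segments lie in an open half plane. -/
theorem exists_dot_pos_of_disjoint {a b c d : Plane} (h : Disjoint (segment ℝ a b) (segment ℝ c d)) :
    ∃ δ : Plane, ∀ x ∈ segment ℝ a b, ∀ y ∈ segment ℝ c d, 0 < dot δ (y - x) := by
  have hcomp : ∀ x y : Plane, IsCompact (segment ℝ x y) := fun x y => by
    rw [segment_eq_image_lineMap]; exact isCompact_Icc.image AffineMap.lineMap_continuous
  obtain ⟨f, s, t, h1, h2, h3⟩ := geometric_hahn_banach_compact_closed (convex_segment a b)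
    (hcomp a b) (convex_segment c d) (hcomp c d).isClosed h
  refine ⟨(f (1, 0), f (0, 1)), fun x hx y hy => ?_⟩
  have hf : ∀ z : Plane, f z = f (1, 0) * z.1 + f (0, 1) * z.2 := by
    intro z
    have : z = z.1 • ((1, 0) : Plane) + z.2 • ((0, 1) : Plane) := by
      ext <;> simp
    conv_lhs => rw [this]
    rw [map_add, map_smul, map_smul, smul_eq_mul, smul_eq_mul]; ring
  have : dot (f (1, 0), f (0, 1)) (y - x) = f y - f x := by
    rw [hf y, hf x]; simp only [dot, Prod.fst_sub, Prod.snd_sub]; ring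
  rw [this]
  linarith [h1 x hx, h3 y hy]

/-- One cell of a discrete homotopy. All four differences lie in one open half plane, so both ways
around the cell from `c - a` to `d - b` turn by the same angle. -/
theorem ang_cell {a b c d : Plane} (h : Disjoint (segment ℝ a b) (segment ℝ c d)) :
    ang (c - a) (d - a) + ang (d - a) (d - b) = ang (c - a) (c - b) + ang (c - b) (d - b) := by
  obtain ⟨δ, hδ⟩ := exists_dot_pos_of_disjoint h
  have ha := left_mem_segment ℝ a b
  have hb := right_mem_segment ℝ a b
  have hc := left_mem_segment ℝ c d
  have hd := right_mem_segment ℝ c d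
  rw [ang_add_ang (hδ a ha c hc) (hδ a ha d hd) (hδ b hb d hd),
    ang_add_ang (hδ a ha c hc) (hδ b hb c hc) (hδ b hb d hd)]

/-! ## Closed simple polygons as periodic sequences -/

/-- The vertices `p 0, …, p (n - 1)`, continued periodically, are those of a simple polygon. -/
structure SimplePeriodic (n : ℕ) (p : ℕ → Plane) : Prop where
  three_le : 3 ≤ n
  periodic : ∀ i, p (i + n) = p i
  inj : ∀ i < n, ∀ j < n, p i = p j → i = j
  meet : ∀ i < n, ∀ j < n, i ≠ j → segment ℝ (p i) (p (i + 1)) ∩ segment ℝ (p j) (p (j + 1)) ⊆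
    {p i, p (i + 1)} ∩ {p j, p (j + 1)}

/-- The edge vector from the `i`-th vertex to the next. -/
def edgeVec (p : ℕ → Plane) (i : ℕ) : Plane := p (i + 1) - p i

/-- The sum of the exterior angles of a closed polygon. -/
noncomputable def totalTurn (n : ℕ) (p : ℕ → Plane) : ℝ :=
  ∑ i ∈ Finset.range n, ang (edgeVec p i) (edgeVec p (i + 1))

/-- Twice the signed area of a closed polygon. -/
def doubleArea (n : ℕ) (p : ℕ → Plane) : ℝ :=
  ∑ i ∈ Finset.range n, cross (p i) (p (i + 1))

namespace SimplePeriodic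

variable {n : ℕ} {p : ℕ → Plane}

theorem mod_eq (h : SimplePeriodic n p) (i : ℕ) : p (i % n) = p i := by
  have := (show Function.Periodic p n from h.periodic).map_mod_nat i
  exact this

theorem ne (h : SimplePeriodic n p) {i j : ℕ} (hij : i % n ≠ j % n) : p i ≠ p j := by
  have hn : 0 < n := by have := h.three_le; omega
  intro he
  rw [← h.mod_eq i, ← h.mod_eq j] at he
  exact hij (h.inj _ (Nat.mod_lt _ hn) _ (Nat.mod_lt _ hn) he)

theorem mod_succ_eq (h : SimplePeriodic n p) (i : ℕ) : p (i % n + 1) = p (i + 1) := by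
  rw [← h.mod_eq (i % n + 1), ← h.mod_eq (i + 1), Nat.mod_add_mod]

theorem meet' (h : SimplePeriodic n p) {i j : ℕ} (hij : i % n ≠ j % n) :
    segment ℝ (p i) (p (i + 1)) ∩ segment ℝ (p j) (p (j + 1)) ⊆
      {p i, p (i + 1)} ∩ {p j, p (j + 1)} := by
  have hn : 0 < n := by have := h.three_le; omega
  have := h.meet _ (Nat.mod_lt i hn) _ (Nat.mod_lt j hn) hij
  rwa [h.mod_eq, h.mod_eq, h.mod_succ_eq, h.mod_succ_eq] at this

theorem mod_ne {i j : ℕ} (hij : i < j) (hj : j < i + n) : i % n ≠ j % n := by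
  intro he
  have : (j - i) % n = 0 := Nat.sub_mod_eq_zero_of_mod_eq he.symm
  have h2 := Nat.mod_eq_of_lt (show j - i < n by omega)
  omega

theorem ne_of_lt (h : SimplePeriodic n p) {i j : ℕ} (hij : i < j) (hj : j < i + n) :
    p i ≠ p j := h.ne (mod_ne hij hj)

theorem disjoint (h : SimplePeriodic n p) {i j : ℕ} (hij : i + 2 ≤ j) (hj : j + 2 ≤ i + n) :
    Disjoint (segment ℝ (p i) (p (i + 1))) (segment ℝ (p j) (p (j + 1))) := by
  rw [Set.disjoint_iff]
  intro x hx
  have hx2 := h.meet' (mod_ne (show i < j by omega) (by omega)) hx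
  simp only [Set.mem_inter_iff, Set.mem_insert_iff, Set.mem_singleton_iff] at hx2
  obtain ⟨h1 | h1, h2 | h2⟩ := hx2
  · exact h.ne_of_lt (show i < j by omega) (by omega) (h1.symm.trans h2)
  · exact h.ne_of_lt (show i < j + 1 by omega) (by omega) (h1.symm.trans h2)
  · exact h.ne_of_lt (show i + 1 < j by omega) (by omega) (h1.symm.trans h2)
  · exact h.ne_of_lt (show i + 1 < j + 1 by omega) (by omega) (h1.symm.trans h2)

theorem edgeVec_ne_zero (h : SimplePeriodic n p) (i : ℕ) : edgeVec p i ≠ 0 := by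
  have := h.three_le
  exact sub_ne_zero.2 (h.ne_of_lt (show i < i + 1 by omega) (by omega)).symm

theorem shift (h : SimplePeriodic n p) (r : ℕ) : SimplePeriodic n (fun i => p (i + r)) where
  three_le := h.three_le
  periodic i := by
    show p (i + n + r) = p (i + r)
    rw [show i + n + r = i + r + n by ring, h.periodic]
  inj i hi j hj hij := by
    by_contra hne
    rcases Nat.lt_or_gt_of_ne hne with hlt | hlt
    · exact h.ne_of_lt (show i + r < j + r by omega) (by omega) hij
    · exact h.ne_of_lt (show j + r < i + r by omega) (by omega) hij.symm
  meet i hi j hj hne := by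
    have hmod : (i + r) % n ≠ (j + r) % n := by
      rcases Nat.lt_or_gt_of_ne hne with hlt | hlt
      · exact mod_ne (by omega) (by omega)
      · exact (mod_ne (by omega) (by omega)).symm
    have := h.meet' hmod
    simpa only [show ∀ k, k + 1 + r = k + r + 1 from fun k => by ring] using this

/-- Consecutive edges are not opposite: they would overlap. -/
theorem ang_ne_pi (h : SimplePeriodic n p) (i : ℕ) :
    ang (edgeVec p i) (edgeVec p (i + 1)) ≠ Real.pi := by
  intro hpi
  have hn := h.three_le
  obtain ⟨hd, hc⟩ := ang_eq_pi_iff.1 hpi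
  set u := edgeVec p i with hu
  set v := edgeVec p (i + 1) with hv
  have huu : 0 < dot u u := dot_self_pos (h.edgeVec_ne_zero i)
  set c := -(dot u v) / dot u u with hcdef
  have hcpos : 0 < c := div_pos (by linarith) huu
  have hvc : v = -(c • u) := by
    have hcu : c * dot u u = -dot u v := by rw [hcdef]; field_simp
    have h0 := huu.ne'
    simp only [dot, cross] at hcu hc h0
    ext
    · simp only [Prod.fst_neg, Prod.smul_fst, smul_eq_mul]
      apply mul_left_cancel₀ h0
      linear_combination u.1 * hcu - u.2 * hc
    · simp only [Prod.snd_neg, Prod.smul_snd, smul_eq_mul]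
      apply mul_left_cancel₀ h0
      linear_combination u.2 * hcu + u.1 * hc
  have hp1 : p (i + 1) = p i + u := by simp [hu, edgeVec]
  have hp2 : p (i + 2) = p i + u - c • u := by
    have : p (i + 2) = p (i + 1) + v := by simp [hv, edgeVec]
    rw [this, hvc, hp1]; abel
  have hmeet := h.meet' (mod_ne (show i < i + 1 by omega) (show i + 1 < i + n by omega))
  -- With opposite directions, either the end of the second edge lies on the first edge, or the
  -- start of the first edge lies on the second; simplicity excludes both.
  rcases le_or_gt c 1 with hc1 | hc1
  · have : p (i + 2) ∈ ({p i, p (i + 1)} : Set Plane) := by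
      apply (hmeet ⟨?_, right_mem_segment ℝ _ _⟩).1
      refine ⟨c, 1 - c, hcpos.le, by linarith, by ring, ?_⟩
      rw [hp1, hp2]; ext <;> simp <;> ring
    rcases this with h1 | h1
    · exact h.ne_of_lt (show i < i + 2 by omega) (by omega) h1.symm
    · exact h.ne_of_lt (show i + 1 < i + 2 by omega) (by omega) (Set.mem_singleton_iff.1 h1).symm
  · have : p i ∈ ({p (i + 1), p (i + 2)} : Set Plane) := by
      apply (hmeet ⟨left_mem_segment ℝ _ _, ?_⟩).2
      refine ⟨1 - 1 / c, 1 / c, ?_, by positivity, by ring, ?_⟩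
      · have : 1 / c ≤ 1 := by rw [div_le_one hcpos]; exact hc1.le
        linarith
      · rw [show i + 1 + 1 = i + 2 by rfl, hp1, hp2]; ext <;> simp <;> field_simp <;> ring
    rcases this with h1 | h1
    · exact h.ne_of_lt (show i < i + 1 by omega) (by omega) h1
    · exact h.ne_of_lt (show i < i + 2 by omega) (by omega) (Set.mem_singleton_iff.1 h1)

end SimplePeriodic

theorem sum_range_periodic_shift {M : Type*} [AddCommGroup M] {n : ℕ} {f : ℕ → M}
    (hf : ∀ i, f (i + n) = f i) (r : ℕ) :
    ∑ i ∈ Finset.range n, f (i + r) = ∑ i ∈ Finset.range n, f i := by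
  induction r with
  | zero => rfl
  | succ r ih =>
    rw [← ih]
    have h1 := Finset.sum_range_succ (fun i => f (i + r)) n
    have h2 := Finset.sum_range_succ' (fun i => f (i + r)) n
    have h3 : f (n + r) = f (0 + r) := by rw [Nat.add_comm n r, hf, zero_add]
    rw [h1, h3] at h2
    have := add_right_cancel h2
    rw [this]
    exact Finset.sum_congr rfl fun i _ => by congr 1; ring

namespace SimplePeriodic

variable {n : ℕ} {p : ℕ → Plane}

theorem totalTurn_shift (h : SimplePeriodic n p) (r : ℕ) :
    totalTurn n (fun i => p (i + r)) = totalTurn n p := by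
  unfold totalTurn edgeVec
  rw [← sum_range_periodic_shift (f := fun i => ang (p (i + 1) - p i) (p (i + 1 + 1) - p (i + 1)))
    (n := n) ?_ r]
  · refine Finset.sum_congr rfl fun i _ => ?_
    simp only [show ∀ k, k + 1 + r = k + r + 1 from fun k => by ring]
  · intro i
    simp only [show i + n + 1 = i + 1 + n by ring, show i + 1 + n + 1 = i + 1 + 1 + n by ring,
      h.periodic]

theorem doubleArea_shift (h : SimplePeriodic n p) (r : ℕ) :
    doubleArea n (fun i => p (i + r)) = doubleArea n p := by
  unfold doubleArea
  rw [← sum_range_periodic_shift (f := fun i => cross (p i) (p (i + 1))) (n := n) ?_ r]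
  · refine Finset.sum_congr rfl fun i _ => ?_
    simp only [show ∀ k, k + 1 + r = k + r + 1 from fun k => by ring]
  · intro i
    simp only [show i + n + 1 = i + 1 + n by ring, h.periodic]

end SimplePeriodic

/-! ### The total turning of a simple polygon, by a discrete form of Hopf's homotopy -/

/-- A column of cells glued together: the contributions of the common sides cancel. -/
theorem ang_column (p : ℕ → Plane) (s c : ℕ) (m : ℕ)
    (h : ∀ i < m, Disjoint (segment ℝ (p (s + i)) (p (s + i + 1))) (segment ℝ (p c) (p (c + 1)))) :
    ang (p c - p s) (p (c + 1) - p s) +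
        ∑ i ∈ Finset.range m, ang (p (c + 1) - p (s + i)) (p (c + 1) - p (s + i + 1)) =
      ∑ i ∈ Finset.range m, ang (p c - p (s + i)) (p c - p (s + i + 1)) +
        ang (p c - p (s + m)) (p (c + 1) - p (s + m)) := by
  induction m with
  | zero => simp
  | succ m ih =>
    rw [Finset.sum_range_succ, Finset.sum_range_succ, ← add_assoc,
      ih fun i hi => h i (by omega)]
    have := ang_cell (h m (by omega))
    rw [← add_assoc s m 1]
    linarith

/-- This is Hopf's proof of the theorem on turning tangents, for the directions `p j - p i` with `i
< j`. The neighbours `(i, i + 1)` carry the exterior angles, and the other two sides of the triangle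
of indices are the fans at `p 0` and at `p (k + 1)`. The cells in between come from disjoint edges;
those next to the diagonal are handled by `ang_add_three`. -/
theorem SimplePeriodic.turn_partial {n : ℕ} {p : ℕ → Plane} (h : SimplePeriodic n p) (k : ℕ)
    (hk : k + 2 ≤ n) :
    ∑ i ∈ Finset.range k, ang (edgeVec p i) (edgeVec p (i + 1)) =
      ∑ j ∈ Finset.range k, ang (p (j + 1) - p 0) (p (j + 2) - p 0) +
        ∑ i ∈ Finset.range k, ang (p (k + 1) - p i) (p (k + 1) - p (i + 1)) := by
  induction k with
  | zero => simp
  | succ k ih =>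
    have hcol := ang_column p 0 (k + 1) k fun i hi => by
      rw [zero_add]; exact h.disjoint (by omega) (by omega)
    have htri := ang_add_three (h.edgeVec_ne_zero k) (h.edgeVec_ne_zero (k + 1)) (h.ang_ne_pi k)
    have hadd : edgeVec p k + edgeVec p (k + 1) = p (k + 2) - p k := by simp [edgeVec]
    rw [hadd] at htri
    rw [Finset.sum_range_succ, ih (by omega), Finset.sum_range_succ, Finset.sum_range_succ]
    simp only [zero_add] at hcol
    simp only [edgeVec] at *
    simp only [show k + 1 + 1 = k + 2 from rfl] at *
    linarith

theorem ang_sum_of_halfplane {d : Plane} {f : ℕ → Plane} (m : ℕ) (h : ∀ i ≤ m, 0 < dot d (f i)) :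
    ∑ i ∈ Finset.range m, ang (f i) (f (i + 1)) = ang (f 0) (f m) := by
  induction m with
  | zero =>
    have := ang_eq_sub (h 0 le_rfl) (h 0 le_rfl)
    simp [this]
  | succ m ih =>
    rw [Finset.sum_range_succ, ih fun i hi => h i (by omega),
      ang_add_ang (h 0 (by omega)) (h m (by omega)) (h (m + 1) le_rfl)]

/-- The sum of the exterior angles of a simple polygon is `2 π` or `-2 π`; which of the two is seen
at any vertex that is the only point of the polygon on a supporting line. -/
theorem SimplePeriodic.totalTurn_of_extreme {n : ℕ} {p : ℕ → Plane} (h : SimplePeriodic n p)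
    {d : Plane} (hd : ∀ i, 0 < i → i < n → 0 < dot d (p i - p 0)) :
    (totalTurn n p = 2 * Real.pi ∧ 0 < cross (edgeVec p (n - 1)) (edgeVec p 0)) ∨
      (totalTurn n p = -(2 * Real.pi) ∧ cross (edgeVec p (n - 1)) (edgeVec p 0) < 0) := by
  have hn := h.three_le
  obtain ⟨m, rfl⟩ : ∃ m, n = m + 3 := ⟨n - 3, by omega⟩
  have hp0 : p (m + 3) = p 0 := by have := h.periodic 0; rwa [zero_add] at this
  have hp1 : p (m + 4) = p 1 := by have := h.periodic 1; rwa [show 1 + (m + 3) = m + 4 by ring] at this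
  have hpart := h.turn_partial (m + 1) (by omega)
  have hcol := ang_column p 1 (m + 2) m fun i hi => h.disjoint (by omega) (by omega)
  have htri := ang_add_three (h.edgeVec_ne_zero (m + 1)) (h.edgeVec_ne_zero (m + 2))
    (h.ang_ne_pi (m + 1))
  have hne := h.ang_ne_pi (m + 2)
  have htri0 := ang_add_three (h.edgeVec_ne_zero (m + 2)) (h.edgeVec_ne_zero (m + 3)) hne
  have hE : edgeVec p (m + 3) = edgeVec p 0 := by simp only [edgeVec, hp0, hp1, zero_add]
  have hβ := ang_sum_of_halfplane (f := fun i => p (i + 1) - p 0) (d := d) (m + 1)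
    fun i hi => hd _ (by omega) (by omega)
  have e1 : edgeVec p (m + 2) = p 0 - p (m + 2) := by simp only [edgeVec, hp0]
  have e2 : edgeVec p 0 = p 1 - p 0 := rfl
  set τ := ang (edgeVec p (m + 2)) (edgeVec p 0) with hτ
  set β := ang (p 1 - p 0) (p (m + 2) - p 0) with hβdef
  -- The fan at `p 0` adds up to the interior angle `β`. Because `p n = p 0`, the closing column
  -- produces the same fan with all vectors reversed, hence another `β`; what remains is the
  -- exterior angle `τ` at `p 0`, twice.
  have htot : totalTurn (m + 3) p = 2 * β + 2 * τ := by
    rw [totalTurn, Finset.sum_range_succ, Finset.sum_range_succ, hpart, hE, ← hτ]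
    rw [hE, e1, e2] at htri0
    have hs1 : ∑ i ∈ Finset.range (m + 1), ang (p (m + 1 + 1) - p i) (p (m + 1 + 1) - p (i + 1)) =
        ∑ i ∈ Finset.range m, ang (p (m + 2) - p (1 + i)) (p (m + 2) - p (1 + i + 1)) +
          ang (p (m + 2) - p 0) (p (m + 2) - p 1) := by
      rw [Finset.sum_range_succ']
      congr 1
      exact Finset.sum_congr rfl fun i _ => by rw [Nat.add_comm i 1]
    have hs2 : ∑ i ∈ Finset.range m, ang (p (m + 2 + 1) - p (1 + i)) (p (m + 2 + 1) - p (1 + i + 1)) =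
        ∑ i ∈ Finset.range m, ang (p (i + 1) - p 0) (p (i + 1 + 1) - p 0) := by
      refine Finset.sum_congr rfl fun i _ => ?_
      rw [show m + 2 + 1 = m + 3 from rfl, hp0, ← ang_neg_neg, neg_sub, neg_sub, Nat.add_comm 1 i]
    have hs3 : ang (p (m + 2 + 1) - p (1 + m)) (p (m + 2 + 1) - p (m + 2)) =
        ang (p (m + 1) - p 0) (p (m + 2) - p 0) := by
      rw [show m + 2 + 1 = m + 3 from rfl, hp0, ← ang_neg_neg, neg_sub, neg_sub, Nat.add_comm 1 m]
    have hs4 : edgeVec p (m + 1) + edgeVec p (m + 2) = p (m + 3) - p (m + 1) := by simp [edgeVec]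
    rw [hs4] at htri
    rw [Finset.sum_range_succ] at hβ
    simp only [show m + 1 + 1 = m + 2 from rfl] at hβ
    have hs5 : ang (p (m + 2) - p 0) (p (m + 2) - p 1) + ang (p (m + 2) - p 1) (p (m + 3) - p 1) = τ := by
      rw [hτ, e1, e2, ← htri0, hp0, ← ang_neg_neg (p 0 - p (m + 2)) _, ← ang_neg_neg _ (p 1 - p 0)]
      congr 2 <;> abel
    rw [hs1]
    rw [hs2] at hcol
    have e3 : edgeVec p (m + 1) = p (m + 2) - p (m + 1) := rfl
    have e4 : edgeVec p (m + 2) = p (m + 3) - p (m + 2) := rfl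
    rw [e3, e4] at htri ⊢
    rw [e4] at e1
    simp only [show m + 2 + 1 = m + 3 from rfl] at *
    rw [Nat.add_comm 1 m] at hcol
    rw [hs3.symm] at hβ
    have hs6 := Finset.sum_range_succ (fun j => ang (p (j + 1) - p 0) (p (j + 2) - p 0)) m
    rw [hs6]
    rw [Nat.add_comm 1 m] at hβ hs3
    simp only [show ∀ j, j + 1 + 1 = j + 2 from fun _ => rfl] at *
    linarith
  -- relation between the exterior and the interior angle at the extreme vertex
  have hu := h.edgeVec_ne_zero (m + 2)
  have hv : edgeVec p 0 ≠ 0 := h.edgeVec_ne_zero 0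
  have hβ' : β = ang (edgeVec p 0) (-edgeVec p (m + 2)) := by rw [hβdef, e1, e2, neg_sub]
  have hv2 := hd 1 (by omega) (by omega)
  have hu2 := hd (m + 2) (by omega) (by omega)
  -- If the two edges at `p 0` were parallel, both neighbours of `p 0` would be on one ray, since
  -- both are strictly on the positive side of `d`. The edges would then be opposite.
  have hcne : cross (edgeVec p (m + 2)) (edgeVec p 0) ≠ 0 := by
    intro hc
    rw [hE] at hne
    have hdn : ¬ dot (edgeVec p (m + 2)) (edgeVec p 0) < 0 := fun hlt => hne (ang_eq_pi_iff.2 ⟨hlt, hc⟩)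
    rw [e1, e2] at hc hdn
    set u := p (m + 2) - p 0
    have hneg : p 0 - p (m + 2) = -u := by simp [u]
    rw [hneg] at hc hdn
    set v := p 1 - p 0
    simp only [cross, dot, Prod.fst_neg, Prod.snd_neg] at hc hdn hu2 hv2
    have hd0 : 0 < d.1 * d.1 + d.2 * d.2 := by
      have := dot_self_pos (dot_ne_zero_left (d := d) (u := u) hu2)
      exact this
    have hab : (d.1 * u.2 - d.2 * u.1) * (d.1 * v.1 + d.2 * v.2) =
        (d.1 * u.1 + d.2 * u.2) * (d.1 * v.2 - d.2 * v.1) := by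
      linear_combination (d.1 * d.1 + d.2 * d.2) * hc
    have hid : (d.1 * d.1 + d.2 * d.2) * (u.1 * v.1 + u.2 * v.2) =
        (d.1 * u.1 + d.2 * u.2) * (d.1 * v.1 + d.2 * v.2) +
          (d.1 * u.2 - d.2 * u.1) * (d.1 * v.2 - d.2 * v.1) := by ring
    set A := d.1 * u.1 + d.2 * u.2
    set B := d.1 * v.1 + d.2 * v.2
    set a := d.1 * u.2 - d.2 * u.1
    set b := d.1 * v.2 - d.2 * v.1
    have hab2 : 0 ≤ (a * b) * B := by
      have : (a * b) * B = A * (b * b) := by linear_combination b * hab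
      rw [this]; exact mul_nonneg hu2.le (mul_self_nonneg b)
    have hab3 : 0 ≤ a * b := nonneg_of_mul_nonneg_left hab2 hv2
    have := mul_pos hu2 hv2
    have h5 : (d.1 * d.1 + d.2 * d.2) * (u.1 * v.1 + u.2 * v.2) ≤ 0 :=
      mul_nonpos_of_nonneg_of_nonpos hd0.le (by linarith)
    linarith
  -- Exterior and interior angle add up to π modulo 2π. They have the same sign, that of the cross
  -- product, and this decides between π and -π.
  have hsum : (((β + τ : ℝ)) : Real.Angle) = (Real.pi : ℝ) := by
    rw [Real.Angle.coe_add, hβ', hτ, ang_coe hv (neg_ne_zero.2 hu), ang_coe hu hv]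
    have : toComplex (-edgeVec p (m + 2)) = -toComplex (edgeVec p (m + 2)) := by
      apply Complex.ext <;> simp [toComplex]
    rw [this, Complex.arg_neg_coe_angle (toComplex_ne_zero hu)]
    abel
  obtain ⟨z, hz⟩ := Real.Angle.angle_eq_iff_two_pi_dvd_sub.1 hsum
  have hβ1 := neg_pi_lt_ang (p 1 - p 0) (p (m + 2) - p 0)
  have hβ2 := ang_le_pi (p 1 - p 0) (p (m + 2) - p 0)
  have hτ1 := neg_pi_lt_ang (edgeVec p (m + 2)) (edgeVec p 0)
  have hτ2 := ang_le_pi (edgeVec p (m + 2)) (edgeVec p 0)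
  have hcβ : cross (p 1 - p 0) (p (m + 2) - p 0) = cross (edgeVec p (m + 2)) (edgeVec p 0) := by
    rw [e1, e2]; simp only [cross, Prod.fst_sub, Prod.snd_sub]; ring
  rw [← hβdef] at hβ1 hβ2
  rw [← hτ] at hτ1 hτ2
  have hpi := Real.pi_pos
  simp only [show m + 3 - 1 = m + 2 from rfl]
  rcases lt_or_gt_of_ne hcne with hc | hc
  · right
    refine ⟨?_, hc⟩
    have a1 : τ < 0 := ang_neg_iff.2 hc
    have a2 : β < 0 := ang_neg_iff.2 (by rw [hcβ]; exact hc)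
    have hz' : z = -1 := by
      have l1 : (z : ℝ) < 0 := by nlinarith
      have l2 : (-2 : ℝ) < z := by nlinarith
      have l1' : z < 0 := by exact_mod_cast l1
      have l2' : -2 < z := by exact_mod_cast l2
      omega
    rw [hz'] at hz; push_cast at hz
    linarith
  · left
    refine ⟨?_, hc⟩
    have a1 : 0 ≤ τ := ang_nonneg_iff.2 hc.le
    have a2 : 0 ≤ β := ang_nonneg_iff.2 (by rw [hcβ]; exact hc.le)
    have hz' : z = 0 := by
      have l1 : (z : ℝ) < 1 := by nlinarith
      have l2 : (-1 : ℝ) < z := by nlinarith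
      have l1' : z < 1 := by exact_mod_cast l1
      have l2' : -1 < z := by exact_mod_cast l2
      omega
    rw [hz'] at hz; push_cast at hz
    linarith

/-! ## The sign of the area -/

theorem simplePeriodic_of_closed {n : ℕ} {q : ℕ → Plane} (hn : 3 ≤ n) (hq : q n = q 0)
    (inj : ∀ i j, i < j → j < n → q i ≠ q j)
    (meet : ∀ i j, i < j → j < n → segment ℝ (q i) (q (i + 1)) ∩ segment ℝ (q j) (q (j + 1)) ⊆
      {q i, q (i + 1)} ∩ {q j, q (j + 1)}) :
    SimplePeriodic n (fun i => q (i % n)) := by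
  have hs : ∀ i < n, q ((i + 1) % n) = q (i + 1) := by
    intro i hi
    rcases Nat.lt_or_ge (i + 1) n with h | h
    · rw [Nat.mod_eq_of_lt h]
    · rw [show i + 1 = n by omega, Nat.mod_self, hq]
  refine ⟨hn, fun i => by simp, ?_, ?_⟩
  · intro i hi j hj hij
    simp only [Nat.mod_eq_of_lt hi, Nat.mod_eq_of_lt hj] at hij
    by_contra hne
    rcases Nat.lt_or_gt_of_ne hne with h | h
    · exact inj i j h hj hij
    · exact inj j i h hi hij.symm
  · intro i hi j hj hne
    simp only [Nat.mod_eq_of_lt hi, Nat.mod_eq_of_lt hj, hs i hi, hs j hj]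
    rcases Nat.lt_or_gt_of_ne hne with h | h
    · exact meet i j h hj
    · rw [Set.inter_comm, Set.inter_comm {q i, _}]
      exact meet j i h hi

theorem doubleArea_closed {n : ℕ} {q : ℕ → Plane} (hq : q n = q 0) :
    doubleArea n (fun i => q (i % n)) = ∑ i ∈ Finset.range n, cross (q i) (q (i + 1)) := by
  refine Finset.sum_congr rfl fun i hi => ?_
  rw [Finset.mem_range] at hi
  simp only [Nat.mod_eq_of_lt hi]
  rcases Nat.lt_or_ge (i + 1) n with h | h
  · rw [Nat.mod_eq_of_lt h]
  · rw [show i + 1 = n by omega, Nat.mod_self, hq]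

/-- The vertices of the part `p 0, …, p k` that a diagonal from `p 0` to `p k` cuts off. -/
def firstPart (p : ℕ → Plane) (k i : ℕ) : Plane := if i ≤ k then p i else p 0

/-- The vertices of the part `p 0, p k, p (k + 1), …` that a diagonal from `p 0` to `p k` cuts
off. -/
def secondPart (p : ℕ → Plane) (k i : ℕ) : Plane := if i = 0 then p 0 else p (i + k - 1)

/-- The segment from `a` to `b` meets the polygon only in common end points. -/
def CleanDiagonal (p : ℕ → Plane) (a b : Plane) : Prop :=
  ∀ j, segment ℝ a b ∩ segment ℝ (p j) (p (j + 1)) ⊆ {a, b} ∩ {p j, p (j + 1)}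

theorem CleanDiagonal.symm {p : ℕ → Plane} {a b : Plane} (h : CleanDiagonal p a b) :
    CleanDiagonal p b a := by
  intro j
  rw [segment_symm, Set.pair_comm b a]
  exact h j

namespace SimplePeriodic

variable {n : ℕ} {p : ℕ → Plane}

theorem p_n (h : SimplePeriodic n p) : p n = p 0 := by
  have := h.periodic 0
  rwa [zero_add] at this

theorem firstPart (h : SimplePeriodic n p) {k : ℕ} (hk : 2 ≤ k) (hkn : k + 2 ≤ n)
    (hd : CleanDiagonal p (p 0) (p k)) :
    SimplePeriodic (k + 1) (fun i => _root_.firstPart p k (i % (k + 1))) := by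
  apply simplePeriodic_of_closed (by omega)
  · simp [_root_.firstPart]
  · intro i j hij hj
    simp only [_root_.firstPart, if_pos (show i ≤ k by omega), if_pos (show j ≤ k by omega)]
    exact h.ne_of_lt hij (by omega)
  · intro i j hij hj
    simp only [_root_.firstPart, if_pos (show i ≤ k by omega), if_pos (show j ≤ k by omega),
      if_pos (show i + 1 ≤ k by omega)]
    rcases Nat.lt_or_ge j k with h1 | h1
    · rw [if_pos (show j + 1 ≤ k by omega)]
      exact h.meet i (by omega) j (by omega) (by omega)
    · rw [if_neg (by omega), show j = k by omega, Set.inter_comm, Set.inter_comm {p i, _}]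
      exact hd.symm i

theorem secondPart (h : SimplePeriodic n p) {k : ℕ} (hk : 2 ≤ k) (hkn : k + 2 ≤ n)
    (hd : CleanDiagonal p (p 0) (p k)) :
    SimplePeriodic (n - k + 1) (fun i => _root_.secondPart p k (i % (n - k + 1))) := by
  have hn : p n = p 0 := h.p_n
  apply simplePeriodic_of_closed (by omega)
  · simp only [_root_.secondPart, if_true]
    rw [if_neg (by omega), show n - k + 1 + k - 1 = n by omega, hn]
  · intro i j hij hj
    simp only [_root_.secondPart, if_neg (show j ≠ 0 by omega)]
    split_ifs with h0
    · exact h.ne_of_lt (by omega) (by omega)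
    · exact h.ne_of_lt (by omega) (by omega)
  · intro i j hij hj
    simp only [_root_.secondPart, if_neg (show j ≠ 0 by omega), if_neg (show j + 1 ≠ 0 by omega),
      if_neg (show i + 1 ≠ 0 by omega)]
    rw [show j + 1 + k - 1 = j + k - 1 + 1 by omega]
    split_ifs with h0
    · rw [show i + 1 + k - 1 = k by omega]
      exact hd _
    · rw [show i + 1 + k - 1 = i + k - 1 + 1 by omega]
      exact h.meet _ (by omega) _ (by omega) (by omega)

/-- The two parts run through the diagonal in opposite directions, so its two terms cancel. -/
theorem doubleArea_split (h : SimplePeriodic n p) {k : ℕ} (hk : 2 ≤ k) (hkn : k + 2 ≤ n) :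
    doubleArea n p = doubleArea (k + 1) (fun i => _root_.firstPart p k (i % (k + 1))) +
      doubleArea (n - k + 1) (fun i => _root_.secondPart p k (i % (n - k + 1))) := by
  have hn : p n = p 0 := h.p_n
  rw [doubleArea_closed, doubleArea_closed]
  · rw [Finset.sum_range_succ, Finset.sum_range_succ']
    have h1 : ∑ i ∈ Finset.range k, cross (_root_.firstPart p k i) (_root_.firstPart p k (i + 1)) =
        ∑ i ∈ Finset.range k, cross (p i) (p (i + 1)) := by
      refine Finset.sum_congr rfl fun i hi => ?_
      rw [Finset.mem_range] at hi
      simp only [_root_.firstPart, if_pos (show i ≤ k by omega), if_pos (show i + 1 ≤ k by omega)]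
    have h2 : ∑ i ∈ Finset.range (n - k),
        cross (_root_.secondPart p k (i + 1)) (_root_.secondPart p k (i + 1 + 1)) =
        ∑ i ∈ Finset.range (n - k), cross (p (k + i)) (p (k + i + 1)) := by
      refine Finset.sum_congr rfl fun i hi => ?_
      simp only [_root_.secondPart, if_neg (show i + 1 ≠ 0 by omega),
        if_neg (show i + 1 + 1 ≠ 0 by omega)]
      rw [show i + 1 + k - 1 = k + i by omega, show i + 1 + 1 + k - 1 = k + i + 1 by omega]
    have h3 : cross (_root_.firstPart p k k) (_root_.firstPart p k (k + 1)) = cross (p k) (p 0) := by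
      simp [_root_.firstPart]
    have h4 : cross (_root_.secondPart p k 0) (_root_.secondPart p k (0 + 1)) =
        -cross (p k) (p 0) := by
      simp only [_root_.secondPart, if_true, if_neg (show 0 + 1 ≠ 0 by omega)]
      rw [show 0 + 1 + k - 1 = k by omega, cross_comm]
    rw [h1, h2, h3, h4, doubleArea]
    have := Finset.sum_range_add (fun i => cross (p i) (p (i + 1))) k (n - k)
    rw [show k + (n - k) = n by omega] at this
    rw [this]; ring
  · simp only [_root_.secondPart, if_true]
    rw [if_neg (by omega), show n - k + 1 + k - 1 = n by omega, hn]
  · simp [_root_.firstPart]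

theorem vertex_on_edge (h : SimplePeriodic n p) {i j : ℕ}
    (hij : p i ∈ segment ℝ (p j) (p (j + 1))) : p i = p j ∨ p i = p (j + 1) := by
  by_cases hm : i % n = j % n
  · left; rw [← h.mod_eq i, hm, h.mod_eq]
  · have := h.meet' hm ⟨left_mem_segment ℝ _ _, hij⟩
    simpa using this.2

end SimplePeriodic

/-! ### Cutting a polygon at a corner: ears and diagonals -/

/-- First affine coordinate of `x` with respect to the origin `o` and the basis `u, v`. -/
noncomputable def coordS (o u v x : Plane) : ℝ := cross (x - o) v / cross u v

/-- Second affine coordinate of `x` with respect to the origin `o` and the basis `u, v`. -/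
noncomputable def coordT (o u v x : Plane) : ℝ := cross u (x - o) / cross u v

theorem coordS_combo (o u v x y : Plane) {a b : ℝ} (hab : a + b = 1) :
    coordS o u v (a • x + b • y) = a * coordS o u v x + b * coordS o u v y := by
  obtain rfl : a = 1 - b := by linarith
  simp only [coordS, cross, Prod.fst_sub, Prod.snd_sub, Prod.fst_add, Prod.snd_add, Prod.smul_fst,
    Prod.smul_snd, smul_eq_mul]
  ring

theorem coordT_combo (o u v x y : Plane) {a b : ℝ} (hab : a + b = 1) :
    coordT o u v (a • x + b • y) = a * coordT o u v x + b * coordT o u v y := by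
  obtain rfl : a = 1 - b := by linarith
  simp only [coordT, cross, Prod.fst_sub, Prod.snd_sub, Prod.fst_add, Prod.snd_add, Prod.smul_fst,
    Prod.smul_snd, smul_eq_mul]
  ring

theorem coord_eq {o u v : Plane} (h : cross u v ≠ 0) (x : Plane) :
    x = o + coordS o u v x • u + coordT o u v x • v := by
  have hS : coordS o u v x * cross u v = cross (x - o) v := div_mul_cancel₀ _ h
  have hT : coordT o u v x * cross u v = cross u (x - o) := div_mul_cancel₀ _ h
  generalize coordS o u v x = s at *
  generalize coordT o u v x = t at *
  ext
  · apply mul_left_cancel₀ h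
    simp only [cross, Prod.fst_sub, Prod.snd_sub, Prod.fst_add, Prod.smul_fst, smul_eq_mul] at *
    linear_combination -u.1 * hS - v.1 * hT
  · apply mul_left_cancel₀ h
    simp only [cross, Prod.fst_sub, Prod.snd_sub, Prod.snd_add, Prod.smul_snd, smul_eq_mul] at *
    linear_combination -u.2 * hS - v.2 * hT

theorem coordS_of_eq {o u v x : Plane} (h : cross u v ≠ 0) {s t : ℝ}
    (hx : x = o + s • u + t • v) : coordS o u v x = s := by
  rw [coordS, div_eq_iff h, hx]
  simp only [cross, Prod.fst_sub, Prod.snd_sub, Prod.fst_add, Prod.snd_add, Prod.smul_fst,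
    Prod.smul_snd, smul_eq_mul]
  ring

theorem coordT_of_eq {o u v x : Plane} (h : cross u v ≠ 0) {s t : ℝ}
    (hx : x = o + s • u + t • v) : coordT o u v x = t := by
  rw [coordT, div_eq_iff h, hx]
  simp only [cross, Prod.fst_sub, Prod.snd_sub, Prod.fst_add, Prod.snd_add, Prod.smul_fst,
    Prod.smul_snd, smul_eq_mul]
  ring

/-- A segment that leaves the cone `s, t ≥ 0` does so through one of its sides. -/
theorem exists_exit {s t s' t' : ℝ} (hs : 0 < s) (ht : 0 < t) (h : s' < 0 ∨ t' < 0) :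
    ∃ μ : ℝ, 0 ≤ μ ∧ μ ≤ 1 ∧ (((1 - μ) * s + μ * s' = 0 ∧ 0 ≤ (1 - μ) * t + μ * t') ∨
      ((1 - μ) * t + μ * t' = 0 ∧ 0 ≤ (1 - μ) * s + μ * s')) := by
  have key : ∀ {s t s' t' : ℝ}, 0 < s → 0 < t → s' < 0 → 0 ≤ s * t' - s' * t →
      ∃ μ : ℝ, 0 ≤ μ ∧ μ ≤ 1 ∧ ((1 - μ) * s + μ * s' = 0 ∧ 0 ≤ (1 - μ) * t + μ * t') := by
    intro s t s' t' hs ht hs' hd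
    have hpos : 0 < s - s' := by linarith
    refine ⟨s / (s - s'), by positivity, (div_le_one hpos).2 (by linarith), ?_, ?_⟩
    · field_simp; ring
    · have : (1 - s / (s - s')) * t + s / (s - s') * t' = (s * t' - s' * t) / (s - s') := by
        field_simp; ring
      rw [this]; positivity
  -- The sign of this determinant tells through which of the two sides the segment leaves.
  by_cases hd : 0 ≤ s * t' - s' * t
  · have hs' : s' < 0 := by
      rcases h with h | h
      · exact h
      · by_contra hn; nlinarith [mul_pos hs (neg_pos.2 h), mul_nonneg (not_lt.1 hn) ht.le]
    obtain ⟨μ, h1, h2, h3⟩ := key hs ht hs' hd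
    exact ⟨μ, h1, h2, Or.inl h3⟩
  · have ht' : t' < 0 := by
      rcases h with h | h
      · by_contra hn; nlinarith [mul_nonneg hs.le (not_lt.1 hn), mul_pos ht (neg_pos.2 h)]
      · exact h
    obtain ⟨μ, h1, h2, h3⟩ := key ht hs ht' (by linarith)
    exact ⟨μ, h1, h2, Or.inr h3⟩

namespace SimplePeriodic

variable {n : ℕ} {p : ℕ → Plane}

/-- An edge that starts inside the corner at `p 1` cannot leave the corner triangle through the
two edges at `p 1`. -/
theorem corner_no_exit (h : SimplePeriodic n p) (hc : cross (p 2 - p 1) (p 0 - p 1) ≠ 0)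
    {S T : Plane → ℝ} (hS : S = coordS (p 1) (p 2 - p 1) (p 0 - p 1))
    (hT : T = coordT (p 1) (p 2 - p 1) (p 0 - p 1)) {j : ℕ} (hj2 : 2 ≤ j) (hjn : j < n)
    {z w : Plane} (hz : z ∈ segment ℝ (p j) (p (j + 1))) (hzj : z ≠ p j) (hzj' : z ≠ p (j + 1))
    (hs : 0 < S z) (ht : 0 < T z) (hst : S z + T z ≤ 1) (hw : w = p j ∨ w = p (j + 1))
    (hle : S w + T w ≤ S z + T z) : 0 ≤ S w ∧ 0 ≤ T w := by
  by_contra hneg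
  have hor : S w < 0 ∨ T w < 0 := by
    by_contra hcon; push Not at hcon; exact hneg hcon
  -- The exit point `y` has coordinate sum at most 1, so it lies on one of the two edges at `p 1`,
  -- and simplicity makes it an end of the edge `j`. It is not `w`, which is outside the cone, and
  -- not the other end, because `z` is strictly between the two ends.
  obtain ⟨μ, hμ0, hμ1, hexit⟩ := exists_exit hs ht hor
  set y : Plane := (1 - μ) • z + μ • w with hy
  have hSy : S y = (1 - μ) * S z + μ * S w := by
    rw [hS]; exact coordS_combo _ _ _ _ _ (by ring)
  have hTy : T y = (1 - μ) * T z + μ * T w := by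
    rw [hT]; exact coordT_combo _ _ _ _ _ (by ring)
  have hyseg : y ∈ segment ℝ z w := ⟨1 - μ, μ, by linarith, hμ0, by ring, rfl⟩
  have hwmem : w ∈ segment ℝ (p j) (p (j + 1)) := by
    rcases hw with rfl | rfl
    · exact left_mem_segment ℝ _ _
    · exact right_mem_segment ℝ _ _
  have hyj : y ∈ segment ℝ (p j) (p (j + 1)) :=
    (convex_segment _ _).segment_subset hz hwmem hyseg
  have hsum : S y + T y ≤ 1 := by
    rw [hSy, hTy]
    nlinarith
  rw [← hSy, ← hTy] at hexit
  have hyeq : y = p 1 + S y • (p 2 - p 1) + T y • (p 0 - p 1) := by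
    rw [hS, hT]; exact coord_eq hc y
  have hyend : y ∈ ({p j, p (j + 1)} : Set Plane) ∧ (S y = 0 ∨ T y = 0) ∧ 0 ≤ S y ∧ 0 ≤ T y := by
    rcases hexit with ⟨h1, h2⟩ | ⟨h1, h2⟩
    · refine ⟨?_, Or.inl h1, h1.ge, h2⟩
      have : y ∈ segment ℝ (p 0) (p (0 + 1)) := by
        refine ⟨T y, 1 - T y, h2, by linarith, by ring, ?_⟩
        conv_rhs => rw [hyeq, h1]
        simp only [zero_add, zero_smul, add_zero]
        module
      exact (h.meet 0 (by omega) j hjn (by omega) ⟨this, hyj⟩).2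
    · refine ⟨?_, Or.inr h1, h2, h1.ge⟩
      have : y ∈ segment ℝ (p 1) (p (1 + 1)) := by
        refine ⟨1 - S y, S y, by linarith, h2, by ring, ?_⟩
        conv_rhs => rw [hyeq, h1]
        simp only [zero_smul, add_zero]
        module
      exact (h.meet 1 (by omega) j hjn (by omega) ⟨this, hyj⟩).2
  obtain ⟨hy1, -, hy3, hy4⟩ := hyend
  -- `y` is an end point of the edge, hence `w` or the other one
  have hyw : y ≠ w := by
    intro he
    rw [he] at hy3 hy4
    rcases hor with h1 | h1 <;> linarith
  have hother : ∀ a b : Plane, z ∈ segment ℝ a b → z ≠ b → z ≠ a → y ∈ segment ℝ z a → y ≠ b := by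
    rintro a b ⟨α, β, hα, hβ, hαβ, rfl⟩ hzb hza ⟨γ, δ, hγ, hδ, hγδ, hyy⟩ hyb
    rw [hyb] at hyy
    have hab : a ≠ b := by
      rintro rfl
      apply hza
      rw [← add_smul, hαβ, one_smul]
    have : (γ * α + δ) • (a - b) = 0 := by
      have e1 : b = (γ * α + δ) • a + (γ * β) • b := by
        conv_lhs => rw [← hyy]
        module
      have e2 : γ * β = 1 - (γ * α + δ) := by
        have : γ * (α + β) + δ = 1 := by rw [hαβ]; linarith
        linarith
      rw [e2] at e1
      have e3 : (γ * α + δ) • (a - b) = ((γ * α + δ) • a + (1 - (γ * α + δ)) • b) - b := by module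
      rw [e3, ← e1, sub_self]
    rcases smul_eq_zero.1 this with h0 | h0
    · have h1 : 0 ≤ γ * α := mul_nonneg hγ hα
      have h2 : δ = 0 := by linarith
      have h3 : γ = 1 := by linarith
      have h4 : α = 0 := by rw [h3, h2] at h0; linarith
      apply hzb
      rw [h4, show β = 1 by linarith]; simp
    · exact hab (sub_eq_zero.1 h0)
  rcases hw with rfl | rfl
  · rcases hy1 with h1 | h1
    · exact hyw h1
    · exact hother _ _ hz hzj' hzj hyseg (Set.mem_singleton_iff.1 h1)
  · rcases hy1 with h1 | h1
    · rw [segment_symm] at hz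
      exact hother _ _ hz hzj hzj' hyseg h1
    · exact hyw (Set.mem_singleton_iff.1 h1)

theorem cleanDiagonal_of_lt (h : SimplePeriodic n p) {a b : Plane}
    (H : ∀ j < n, segment ℝ a b ∩ segment ℝ (p j) (p (j + 1)) ⊆ {a, b} ∩ {p j, p (j + 1)}) :
    CleanDiagonal p a b := by
  intro j
  have hn : 0 < n := by have := h.three_le; omega
  have := H (j % n) (Nat.mod_lt _ hn)
  rwa [h.mod_eq, h.mod_succ_eq] at this

/-- If no other vertex lies in the corner triangle at `p 1`, the corner can be cut off. -/
theorem cleanDiagonal_ear (h : SimplePeriodic n p) (hn : 4 ≤ n)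
    (hc : cross (p 2 - p 1) (p 0 - p 1) ≠ 0)
    {S T : Plane → ℝ} (hS : S = coordS (p 1) (p 2 - p 1) (p 0 - p 1))
    (hT : T = coordT (p 1) (p 2 - p 1) (p 0 - p 1))
    (hempty : ∀ i, 3 ≤ i → i < n → ¬ (0 ≤ S (p i) ∧ 0 ≤ T (p i) ∧ S (p i) + T (p i) ≤ 1)) :
    CleanDiagonal p (p 0) (p 2) := by
  apply h.cleanDiagonal_of_lt
  rintro j hj z ⟨hz, hzj⟩
  have hpn := h.p_n
  by_cases hz0 : z = p 0
  · subst hz0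
    exact ⟨Or.inl rfl, by simpa using h.vertex_on_edge hzj⟩
  by_cases hz2 : z = p 2
  · subst hz2
    exact ⟨Or.inr rfl, by simpa using h.vertex_on_edge hzj⟩
  exfalso
  have hS0 : S (p 0) = 0 := by rw [hS]; exact coordS_of_eq hc (t := 1) (by simp)
  have hT0 : T (p 0) = 1 := by rw [hT]; exact coordT_of_eq hc (s := 0) (by simp)
  have hS2 : S (p 2) = 1 := by rw [hS]; exact coordS_of_eq hc (t := 0) (by simp)
  have hT2 : T (p 2) = 0 := by rw [hT]; exact coordT_of_eq hc (s := 1) (by simp)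
  have hS1 : S (p 1) = 0 := by rw [hS]; exact coordS_of_eq hc (t := 0) (by simp)
  have hT1 : T (p 1) = 0 := by rw [hT]; exact coordT_of_eq hc (s := 0) (by simp)
  have cS : ∀ {a b : ℝ} (x y : Plane), a + b = 1 → S (a • x + b • y) = a * S x + b * S y := by
    intro a b x y hab; rw [hS]; exact coordS_combo _ _ _ _ _ hab
  have cT : ∀ {a b : ℝ} (x y : Plane), a + b = 1 → T (a • x + b • y) = a * T x + b * T y := by
    intro a b x y hab; rw [hT]; exact coordT_combo _ _ _ _ _ hab
  obtain ⟨α, β, hα, hβ, hαβ, hzeq⟩ := hz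
  have hSz : S z = β := by rw [← hzeq, cS _ _ hαβ, hS0, hS2]; ring
  have hTz : T z = α := by rw [← hzeq, cT _ _ hαβ, hT0, hT2]; ring
  have hα0 : 0 < α := by
    refine lt_of_le_of_ne hα fun h0 => hz2 ?_
    rw [← hzeq, ← h0, show β = 1 by linarith]; simp
  have hβ0 : 0 < β := by
    refine lt_of_le_of_ne hβ fun h0 => hz0 ?_
    rw [← hzeq, ← h0, show α = 1 by linarith]; simp
  obtain ⟨γ, δ, hγ, hδ, hγδ, hzeq'⟩ := id hzj
  have hSz' : S z = γ * S (p j) + δ * S (p (j + 1)) := by rw [← hzeq', cS _ _ hγδ]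
  have hTz' : T z = γ * T (p j) + δ * T (p (j + 1)) := by rw [← hzeq', cT _ _ hγδ]
  -- On the edges 0 and 1 one of the coordinates vanishes, while `S z` and `T z` are both positive.
  have hj2 : 2 ≤ j := by
    by_contra hlt
    obtain rfl | rfl : j = 0 ∨ j = 1 := by omega
    · simp only [zero_add] at hSz'; rw [hS0, hS1] at hSz'; linarith
    · rw [hT1, show 1 + 1 = 2 from rfl, hT2] at hTz'; linarith
  -- vertices of the edge with `S + T ≤ 1` are `p 0` or `p 2`
  have hvert : ∀ w, (w = p j ∨ w = p (j + 1)) → S w + T w ≤ 1 → 0 ≤ S w ∧ 0 ≤ T w →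
      w = p 0 ∨ w = p 2 := by
    intro w hw hle ⟨h1, h2⟩
    rcases hw with rfl | rfl
    · by_cases hj' : j = 2
      · exact Or.inr (by rw [hj'])
      · exact absurd ⟨h1, h2, hle⟩ (hempty j (by omega) hj)
    · rcases Nat.lt_or_ge (j + 1) n with hlt | hge
      · exact absurd ⟨h1, h2, hle⟩ (hempty (j + 1) (by omega) hlt)
      · left; rw [show j + 1 = n by omega, hpn]
  have hST02 : ∀ w, w = p 0 ∨ w = p 2 → S w + T w = 1 := by
    rintro w (rfl | rfl)
    · rw [hS0, hT0]; ring
    · rw [hS2, hT2]; ring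
  have hzends : z ≠ p j ∧ z ≠ p (j + 1) := by
    constructor
    · intro he
      rcases hvert z (Or.inl he) (by linarith) ⟨by linarith, by linarith⟩ with h1 | h1
      · exact hz0 h1
      · exact hz2 h1
    · intro he
      rcases hvert z (Or.inr he) (by linarith) ⟨by linarith, by linarith⟩ with h1 | h1
      · exact hz0 h1
      · exact hz2 h1
  have hγ0 : 0 < γ := by
    refine lt_of_le_of_ne hγ fun h0 => hzends.2 ?_
    rw [← hzeq', ← h0, show δ = 1 by linarith]; simp
  have hδ0 : 0 < δ := by
    refine lt_of_le_of_ne hδ fun h0 => hzends.1 ?_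
    rw [← hzeq', ← h0, show γ = 1 by linarith]; simp
  have hstep : ∀ w, (w = p j ∨ w = p (j + 1)) → S w + T w ≤ 1 → w = p 0 ∨ w = p 2 := by
    intro w hw hle
    exact hvert w hw hle (h.corner_no_exit hc hS hT hj2 hj hzj hzends.1 hzends.2 (by linarith)
      (by linarith) (by linarith) hw (by linarith))
  have hsum : γ * (S (p j) + T (p j)) + δ * (S (p (j + 1)) + T (p (j + 1))) = 1 := by
    linarith
  -- The average of the two sums is exactly 1, so one end has sum at most 1. Such an end is `p 0` or
  -- `p 2`, so its sum is 1, and then so is that of the other end. Both ends are thus among `p 0`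
  -- and `p 2`, which are not neighbours when `n ≥ 4`.
  have hboth : S (p j) + T (p j) ≤ 1 ∧ S (p (j + 1)) + T (p (j + 1)) ≤ 1 := by
    rcases le_or_gt (S (p j) + T (p j)) 1 with h1 | h1
    · have h2 := hST02 _ (hstep _ (Or.inl rfl) h1)
      refine ⟨h1, ?_⟩
      rw [h2] at hsum
      have : δ * (S (p (j + 1)) + T (p (j + 1))) = δ * 1 := by linarith
      exact (mul_left_cancel₀ hδ0.ne' this).le
    · have h3 : S (p (j + 1)) + T (p (j + 1)) ≤ 1 := by
        by_contra hcon
        push Not at hcon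
        nlinarith [mul_pos hγ0 (sub_pos.2 h1), mul_pos hδ0 (sub_pos.2 hcon)]
      have h2 := hST02 _ (hstep _ (Or.inr rfl) h3)
      rw [h2] at hsum
      have : γ * (S (p j) + T (p j)) = γ * 1 := by linarith
      exact ⟨(mul_left_cancel₀ hγ0.ne' this).le, h3⟩
  have e1 := hstep _ (Or.inl rfl) hboth.1
  have e2 := hstep _ (Or.inr rfl) hboth.2
  have f1 : j = 2 := by
    by_contra hne
    rcases e1 with e | e
    · exact h.ne_of_lt (show 0 < j by omega) (by omega) e.symm
    · exact h.ne_of_lt (show 2 < j by omega) (by omega) e.symm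
  subst f1
  rcases e2 with e | e
  · exact h.ne_of_lt (show 0 < 3 by omega) (by omega) e.symm
  · exact h.ne_of_lt (show 2 < 3 by omega) (by omega) e.symm

/-- If some vertex lies in the corner triangle at `p 1`, the one closest to `p 1` can be joined to
`p 1`. -/
theorem cleanDiagonal_corner (h : SimplePeriodic n p)
    (hc : cross (p 2 - p 1) (p 0 - p 1) ≠ 0)
    {S T : Plane → ℝ} (hS : S = coordS (p 1) (p 2 - p 1) (p 0 - p 1))
    (hT : T = coordT (p 1) (p 2 - p 1) (p 0 - p 1)) {k : ℕ} (hk3 : 3 ≤ k) (hkn : k < n)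
    (hk : 0 ≤ S (p k) ∧ 0 ≤ T (p k) ∧ S (p k) + T (p k) ≤ 1)
    (hmin : ∀ i, 3 ≤ i → i < n → 0 ≤ S (p i) ∧ 0 ≤ T (p i) ∧ S (p i) + T (p i) ≤ 1 →
      S (p k) + T (p k) ≤ S (p i) + T (p i)) :
    CleanDiagonal p (p 1) (p k) ∧ 0 < S (p k) ∧ 0 < T (p k) := by
  have hpn := h.p_n
  have hS0 : S (p 0) = 0 := by rw [hS]; exact coordS_of_eq hc (t := 1) (by simp)
  have hT0 : T (p 0) = 1 := by rw [hT]; exact coordT_of_eq hc (s := 0) (by simp)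
  have hS2 : S (p 2) = 1 := by rw [hS]; exact coordS_of_eq hc (t := 0) (by simp)
  have hT2 : T (p 2) = 0 := by rw [hT]; exact coordT_of_eq hc (s := 1) (by simp)
  have hS1 : S (p 1) = 0 := by rw [hS]; exact coordS_of_eq hc (t := 0) (by simp)
  have hT1 : T (p 1) = 0 := by rw [hT]; exact coordT_of_eq hc (s := 0) (by simp)
  have cS : ∀ {a b : ℝ} (x y : Plane), a + b = 1 → S (a • x + b • y) = a * S x + b * S y := by
    intro a b x y hab; rw [hS]; exact coordS_combo _ _ _ _ _ hab
  have cT : ∀ {a b : ℝ} (x y : Plane), a + b = 1 → T (a • x + b • y) = a * T x + b * T y := by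
    intro a b x y hab; rw [hT]; exact coordT_combo _ _ _ _ _ hab
  have hkeq : p k = p 1 + S (p k) • (p 2 - p 1) + T (p k) • (p 0 - p 1) := by
    rw [hS, hT]; exact coord_eq hc (p k)
  have hSk : 0 < S (p k) := by
    refine lt_of_le_of_ne hk.1 fun h0 => ?_
    rw [← h0] at hkeq hk
    have : p k ∈ segment ℝ (p 0) (p (0 + 1)) := by
      refine ⟨T (p k), 1 - T (p k), hk.2.1, by linarith, by ring, ?_⟩
      conv_rhs => rw [hkeq]
      simp only [zero_add, zero_smul, add_zero]
      module
    rcases h.vertex_on_edge this with e | e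
    · exact h.ne_of_lt (show 0 < k by omega) (by omega) e.symm
    · exact h.ne_of_lt (show 1 < k by omega) (by omega) e.symm
  have hTk : 0 < T (p k) := by
    refine lt_of_le_of_ne hk.2.1 fun h0 => ?_
    rw [← h0] at hkeq hk
    have : p k ∈ segment ℝ (p 1) (p (1 + 1)) := by
      refine ⟨1 - S (p k), S (p k), by linarith, hk.1, by ring, ?_⟩
      conv_rhs => rw [hkeq]
      simp only [zero_smul, add_zero]
      module
    rcases h.vertex_on_edge this with e | e
    · exact h.ne_of_lt (show 1 < k by omega) (by omega) e.symm
    · exact h.ne_of_lt (show 2 < k by omega) (by omega) e.symm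
  refine ⟨h.cleanDiagonal_of_lt ?_, hSk, hTk⟩
  rintro j hj z ⟨hz, hzj⟩
  by_cases hz1 : z = p 1
  · subst hz1
    exact ⟨Or.inl rfl, by simpa using h.vertex_on_edge hzj⟩
  by_cases hzk : z = p k
  · subst hzk
    exact ⟨Or.inr rfl, by simpa using h.vertex_on_edge hzj⟩
  exfalso
  obtain ⟨α, β, hα, hβ, hαβ, hzeq⟩ := hz
  have hSz : S z = β * S (p k) := by rw [← hzeq, cS _ _ hαβ, hS1]; ring
  have hTz : T z = β * T (p k) := by rw [← hzeq, cT _ _ hαβ, hT1]; ring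
  have hα0 : 0 < α := by
    refine lt_of_le_of_ne hα fun h0 => hzk ?_
    rw [← hzeq, ← h0, show β = 1 by linarith]; simp
  have hβ0 : 0 < β := by
    refine lt_of_le_of_ne hβ fun h0 => hz1 ?_
    rw [← hzeq, ← h0, show α = 1 by linarith]; simp
  have hSz0 : 0 < S z := by rw [hSz]; positivity
  have hTz0 : 0 < T z := by rw [hTz]; positivity
  -- `S + T` measures the distance from `p 1`. An edge through `z` has an end at most as far away as
  -- `z`; this end would stay in the cone and be a vertex closer than the closest one.
  have hlt : S z + T z < S (p k) + T (p k) := by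
    rw [hSz, hTz]; nlinarith
  obtain ⟨γ, δ, hγ, hδ, hγδ, hzeq'⟩ := id hzj
  have hSz' : S z = γ * S (p j) + δ * S (p (j + 1)) := by rw [← hzeq', cS _ _ hγδ]
  have hTz' : T z = γ * T (p j) + δ * T (p (j + 1)) := by rw [← hzeq', cT _ _ hγδ]
  have hj2 : 2 ≤ j := by
    by_contra hlt
    obtain rfl | rfl : j = 0 ∨ j = 1 := by omega
    · simp only [zero_add] at hSz'; rw [hS0, hS1] at hSz'; linarith
    · rw [hT1, show 1 + 1 = 2 from rfl, hT2] at hTz'; linarith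
  have hvert : ∀ w, (w = p j ∨ w = p (j + 1)) → S w + T w < S (p k) + T (p k) →
      0 ≤ S w ∧ 0 ≤ T w → False := by
    intro w hw hle ⟨h1, h2⟩
    rcases hw with rfl | rfl
    · by_cases hj' : j = 2
      · rw [hj', hS2, hT2] at hle; linarith
      · linarith [hmin j (by omega) hj ⟨h1, h2, by linarith⟩]
    · rcases Nat.lt_or_ge (j + 1) n with hlt | hge
      · linarith [hmin (j + 1) (by omega) hlt ⟨h1, h2, by linarith⟩]
      · rw [show j + 1 = n by omega, hpn, hS0, hT0] at hle; linarith
  have hstep : ∀ w, (w = p j ∨ w = p (j + 1)) → S w + T w ≤ S z + T z → False := by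
    intro w hw hle
    refine hvert w hw (by linarith) (h.corner_no_exit hc hS hT hj2 hj hzj
      (fun he => hvert z (Or.inl he) hlt ⟨hSz0.le, hTz0.le⟩)
      (fun he => hvert z (Or.inr he) hlt ⟨hSz0.le, hTz0.le⟩) hSz0 hTz0 (by linarith) hw hle)
  rcases le_or_gt (S (p j) + T (p j)) (S z + T z) with h1 | h1
  · exact hstep _ (Or.inl rfl) h1
  · refine hstep _ (Or.inr rfl) ?_
    by_contra hcon
    push Not at hcon
    have : γ * (S (p j) + T (p j)) + δ * (S (p (j + 1)) + T (p (j + 1))) = S z + T z := by linarith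
    have h3 : (γ + δ) * (S z + T z) = S z + T z := by rw [hγδ, one_mul]
    rcases hγ.eq_or_lt with h0 | h0
    · have : δ = 1 := by linarith
      subst this; nlinarith
    · nlinarith [mul_pos h0 (sub_pos.2 h1), mul_nonneg hδ (sub_pos.2 hcon).le]

end SimplePeriodic

namespace SimplePeriodic

variable {n : ℕ} {p : ℕ → Plane}

/-- A vertex farthest from the origin is strictly extreme. -/
theorem exists_extreme (h : SimplePeriodic n p) :
    ∃ r < n, ∃ d : Plane, ∀ i, p i ≠ p r → 0 < dot d (p i - p r) := by
  have hn : 0 < n := by have := h.three_le; omega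
  obtain ⟨r, hr, hmax⟩ := Finset.exists_max_image (Finset.range n) (fun i => dot (p i) (p i))
    ⟨0, Finset.mem_range.2 hn⟩
  refine ⟨r, Finset.mem_range.1 hr, -p r, fun i hi => ?_⟩
  have h1 : dot (p i) (p i) ≤ dot (p r) (p r) := by
    have := hmax (i % n) (Finset.mem_range.2 (Nat.mod_lt _ hn))
    simpa only [h.mod_eq] using this
  have h2 := dot_self_pos (sub_ne_zero.2 hi)
  simp only [dot, Prod.fst_sub, Prod.snd_sub, Prod.fst_neg, Prod.snd_neg] at *
  nlinarith

theorem totalTurn_of_extreme_one (h : SimplePeriodic n p)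
    {d : Plane} (hd : ∀ i, p i ≠ p 1 → 0 < dot d (p i - p 1)) :
    (totalTurn n p = 2 * Real.pi ∧ 0 < cross (p 2 - p 1) (p 0 - p 1)) ∨
      (totalTurn n p = -(2 * Real.pi) ∧ cross (p 2 - p 1) (p 0 - p 1) < 0) := by
  have hn := h.three_le
  have hs := (h.shift 1).totalTurn_of_extreme (d := d)
    fun i h1 h2 => hd _ (h.ne_of_lt (show 1 < i + 1 by omega) (by omega)).symm
  rw [h.totalTurn_shift] at hs
  have e1 : edgeVec (fun i => p (i + 1)) (n - 1) = p 1 - p 0 := by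
    simp only [edgeVec]
    rw [show n - 1 + 1 = n by omega, h.p_n, show n + 1 = 1 + n by ring, h.periodic]
  have e2 : edgeVec (fun i => p (i + 1)) 0 = p 2 - p 1 := rfl
  have e3 : cross (p 1 - p 0) (p 2 - p 1) = cross (p 2 - p 1) (p 0 - p 1) := by
    simp only [cross, Prod.fst_sub, Prod.snd_sub]; ring
  rwa [e1, e2, e3] at hs

end SimplePeriodic

/-- Three angles that lead around to the first vector add up to zero, unless the vectors wind
around the origin. -/
theorem ang_cycle {u v w : Plane} (hu : u ≠ 0) (hv : v ≠ 0) (hw : w ≠ 0)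
    (h1 : ang u v ≠ Real.pi) (h2 : ang v w ≠ Real.pi) (h3 : ang w u ≠ Real.pi) :
    ang u v + ang v w + ang w u = 0 ∨ (0 < cross u v ∧ 0 < cross v w ∧ 0 < cross w u) ∨
      (cross u v < 0 ∧ cross v w < 0 ∧ cross w u < 0) := by
  have hz : ((ang u v + ang v w + ang w u : ℝ) : Real.Angle) = (0 : ℝ) := by
    rw [Real.Angle.coe_add, Real.Angle.coe_add, ang_coe hu hv, ang_coe hv hw, ang_coe hw hu,
      Real.Angle.coe_zero]
    abel
  obtain ⟨k, hk⟩ := Real.Angle.angle_eq_iff_two_pi_dvd_sub.1 hz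
  have a1 := (ang_le_pi u v).lt_of_ne h1
  have a2 := (ang_le_pi v w).lt_of_ne h2
  have a3 := (ang_le_pi w u).lt_of_ne h3
  have b1 := neg_pi_lt_ang u v
  have b2 := neg_pi_lt_ang v w
  have b3 := neg_pi_lt_ang w u
  have hpi := Real.pi_pos
  have hpos : ∀ {x y : Plane}, 0 < ang x y → ang x y ≠ Real.pi → 0 < cross x y := by
    intro x y hxy hne
    refine lt_of_le_of_ne (ang_nonneg_iff.1 hxy.le) fun h0 => ?_
    have hs : Real.sin (ang x y) = 0 := by
      rw [ang, Complex.sin_arg, ang_arg_im, ← h0, zero_div]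
    have := Real.sin_pos_of_pos_of_lt_pi hxy ((ang_le_pi x y).lt_of_ne hne)
    linarith
  -- The sum is 2πk with each term strictly between -π and π, so for `k ≠ 0` all three terms have
  -- the sign of `k`.
  rcases lt_trichotomy k 0 with hk0 | hk0 | hk0
  · right; right
    have : (k : ℝ) ≤ -1 := by exact_mod_cast (show k ≤ -1 by omega)
    have : ang u v + ang v w + ang w u ≤ -(2 * Real.pi) := by nlinarith
    exact ⟨ang_neg_iff.1 (by linarith), ang_neg_iff.1 (by linarith), ang_neg_iff.1 (by linarith)⟩
  · left; rw [hk0] at hk; simpa using hk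
  · right; left
    have : (1 : ℝ) ≤ k := by exact_mod_cast (show 1 ≤ k by omega)
    have : 2 * Real.pi ≤ ang u v + ang v w + ang w u := by nlinarith
    exact ⟨hpos (by linarith) h1, hpos (by linarith) h2, hpos (by linarith) h3⟩

theorem ang_swap {u v : Plane} (hu : u ≠ 0) (hv : v ≠ 0) (h : ang u v ≠ Real.pi) :
    ang v u = -ang u v := by
  have h1 := (ang_le_pi u v).lt_of_ne h
  apply ang_coe_unique _ ⟨neg_pi_lt_ang _ _, ang_le_pi _ _⟩
    ⟨by linarith, by linarith [neg_pi_lt_ang u v]⟩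
  rw [Real.Angle.coe_neg, ang_coe hu hv, ang_coe hv hu]
  abel

theorem ang_ne_pi_of_cross_ne {u v : Plane} (h : cross u v ≠ 0) : ang u v ≠ Real.pi :=
  fun hp => h (ang_eq_pi_iff.1 hp).2

namespace SimplePeriodic

variable {n : ℕ} {p : ℕ → Plane}

/-- Cutting off an empty corner triangle does not change the total turning. -/
theorem totalTurn_ear (h : SimplePeriodic n p) (hn : 4 ≤ n)
    (hc : cross (p 2 - p 1) (p 0 - p 1) ≠ 0)
    (hempty : ¬ (0 ≤ coordS (p 1) (p 2 - p 1) (p 0 - p 1) (p 3) ∧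
      0 ≤ coordT (p 1) (p 2 - p 1) (p 0 - p 1) (p 3) ∧
      coordS (p 1) (p 2 - p 1) (p 0 - p 1) (p 3) + coordT (p 1) (p 2 - p 1) (p 0 - p 1) (p 3) ≤ 1))
    (hQ : SimplePeriodic (n - 2 + 1) (fun i => _root_.secondPart p 2 (i % (n - 2 + 1))))
    (hP2 : totalTurn n p = 2 * Real.pi ∨ totalTurn n p = -(2 * Real.pi))
    (hQ2 : totalTurn (n - 2 + 1) (fun i => _root_.secondPart p 2 (i % (n - 2 + 1))) = 2 * Real.pi ∨
      totalTurn (n - 2 + 1) (fun i => _root_.secondPart p 2 (i % (n - 2 + 1))) = -(2 * Real.pi)) :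
    totalTurn (n - 2 + 1) (fun i => _root_.secondPart p 2 (i % (n - 2 + 1))) = totalTurn n p := by
  obtain ⟨m, rfl⟩ : ∃ m, n = m + 4 := ⟨n - 4, by omega⟩
  simp only [show m + 4 - 2 + 1 = m + 3 by omega] at *
  set q : ℕ → Plane := fun i => _root_.secondPart p 2 (i % (m + 3)) with hq
  have q0 : q 0 = p 0 := by simp [hq, _root_.secondPart]
  have qi : ∀ i, 0 < i → i < m + 3 → q i = p (i + 1) := by
    intro i h1 h2
    simp only [hq, Nat.mod_eq_of_lt h2, _root_.secondPart, if_neg h1.ne']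
    rfl
  have qn : q (m + 3) = p 0 := by rw [hQ.p_n, q0]
  have qn1 : q (m + 4) = p 2 := by
    have := hQ.periodic 1
    rw [show 1 + (m + 3) = m + 4 by ring] at this
    rw [this, qi 1 (by omega) (by omega)]
  have pn : p (m + 4) = p 0 := h.p_n
  have pn1 : p (m + 5) = p 1 := by
    have := h.periodic 1; rwa [show 1 + (m + 4) = m + 5 by ring] at this
  set g : Plane := p 2 - p 0 with hg
  have E0 : edgeVec q 0 = g := by simp only [edgeVec, q0, zero_add, qi 1 (by omega) (by omega), hg]
  have Ei : ∀ i, 0 < i → i < m + 3 → edgeVec q i = edgeVec p (i + 1) := by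
    intro i h1 h2
    simp only [edgeVec, qi i h1 h2]
    rcases Nat.lt_or_ge (i + 1) (m + 3) with h3 | h3
    · rw [qi _ (by omega) h3]
    · rw [show i + 1 = m + 3 by omega, qn, pn]
  have En : edgeVec q (m + 3) = g := by
    simp only [edgeVec, qn, show m + 3 + 1 = m + 4 from rfl, qn1, hg]
  have Fn : edgeVec p (m + 4) = edgeVec p 0 := by
    simp only [edgeVec, pn, show m + 4 + 1 = m + 5 from rfl, pn1, zero_add]
  have htQ : totalTurn (m + 3) q = ang g (edgeVec p 2) +
      ∑ i ∈ Finset.range (m + 1), ang (edgeVec p (i + 2)) (edgeVec p (i + 3)) +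
        ang (edgeVec p (m + 3)) g := by
    rw [totalTurn, Finset.sum_range_succ, Finset.sum_range_succ', zero_add, E0,
      Ei 1 (by omega) (by omega), show m + 2 + 1 = m + 3 from rfl, En,
      Ei (m + 2) (by omega) (by omega)]
    have : ∑ k ∈ Finset.range (m + 1), ang (edgeVec q (k + 1)) (edgeVec q (k + 1 + 1)) =
        ∑ i ∈ Finset.range (m + 1), ang (edgeVec p (i + 2)) (edgeVec p (i + 3)) := by
      refine Finset.sum_congr rfl fun i hi => ?_
      rw [Finset.mem_range] at hi
      rw [Ei _ (by omega) (by omega), Ei _ (by omega) (by omega)]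
    rw [this]; ring
  have htP : totalTurn (m + 4) p = ang (edgeVec p 0) (edgeVec p 1) + ang (edgeVec p 1) (edgeVec p 2) +
      ∑ i ∈ Finset.range (m + 1), ang (edgeVec p (i + 2)) (edgeVec p (i + 3)) +
        ang (edgeVec p (m + 3)) (edgeVec p 0) := by
    rw [totalTurn, Finset.sum_range_succ, Finset.sum_range_succ', Finset.sum_range_succ',
      show m + 3 + 1 = m + 4 from rfl, Fn]
    simp only [zero_add, show ∀ k, k + 1 + 1 = k + 2 from fun _ => rfl]
    ring
  set e0 := edgeVec p 0 with he0
  set e1 := edgeVec p 1 with he1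
  set e2 := edgeVec p 2 with he2
  have hge : g = e0 + e1 := by simp [hg, he0, he1, edgeVec]
  have he01 : cross e0 e1 = cross (p 2 - p 1) (p 0 - p 1) := by
    simp only [he0, he1, edgeVec, cross, Prod.fst_sub, Prod.snd_sub]; ring
  have hc01 : cross e0 e1 ≠ 0 := by rw [he01]; exact hc
  have hcg1 : cross g e1 = cross e0 e1 := by rw [hge, cross_add_left, cross_self_eq_zero, add_zero]
  have h0 : e0 ≠ 0 := h.edgeVec_ne_zero 0
  have h1 : e1 ≠ 0 := h.edgeVec_ne_zero 1
  have h2 : e2 ≠ 0 := h.edgeVec_ne_zero 2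
  have hg0 : g ≠ 0 := by rw [← E0]; exact hQ.edgeVec_ne_zero 0
  have htri := ang_add_three h0 h1 (ang_ne_pi_of_cross_ne hc01)
  rw [← hge] at htri
  have hg2 : ang g e2 ≠ Real.pi := by
    have := hQ.ang_ne_pi 0
    rwa [E0, Ei 1 (by omega) (by omega)] at this
  have h20 := ang_swap hg0 h2 hg2
  have h2g : ang e2 g ≠ Real.pi := by
    rw [h20]; intro hh; linarith [neg_pi_lt_ang g e2]
  -- The change of the turning at `p 2` vanishes unless `g`, `e1`, `e2` wind around the origin. In
  -- that case `e2` points from `p 2` into the corner triangle.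
  have hb1 : ang g e1 + ang e1 e2 - ang g e2 = 0 := by
    rcases ang_cycle hg0 h1 h2 (ang_ne_pi_of_cross_ne (by rw [hcg1]; exact hc01)) (h.ang_ne_pi 1) h2g
      with hh | hh
    · rw [h20] at hh; linarith
    · exfalso
      obtain ⟨α, β, hα, hβ, h3⟩ : ∃ α β : ℝ, 0 < α ∧ 0 < β ∧ e2 = -(α • g) - β • e1 := by
        have hcne : cross g e1 ≠ 0 := by rw [hcg1]; exact hc01
        refine ⟨cross e1 e2 / cross g e1, cross e2 g / cross g e1, ?_, ?_, ?_⟩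
        · rcases hh with ⟨a, b, c⟩ | ⟨a, b, c⟩
          · exact div_pos b a
          · exact div_pos_of_neg_of_neg b a
        · rcases hh with ⟨a, b, c⟩ | ⟨a, b, c⟩
          · exact div_pos c a
          · exact div_pos_of_neg_of_neg c a
        · ext
          · apply mul_left_cancel₀ hcne
            simp only [Prod.fst_sub, Prod.fst_neg, Prod.smul_fst, smul_eq_mul]
            field_simp
            simp only [cross]; ring
          · apply mul_left_cancel₀ hcne
            simp only [Prod.snd_sub, Prod.snd_neg, Prod.smul_snd, smul_eq_mul]
            field_simp
            simp only [cross]; ring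
      have hp3 : p 3 = p 2 + e2 := by simp [he2, edgeVec]
      -- Either `p 3` is in the corner triangle, or the edge from `p 2` to `p 3` leaves this
      -- triangle through the edge from `p 0` to `p 1`. The second is impossible because these edges
      -- are disjoint.
      rcases le_or_gt (α + β) 1 with hab | hab
      · have e : p 3 = p 1 + (1 - α - β) • (p 2 - p 1) + α • (p 0 - p 1) := by
          rw [hp3, h3, hg, he1, edgeVec]; module
        apply hempty
        rw [coordS_of_eq hc e, coordT_of_eq hc e]
        exact ⟨by linarith, hα.le, by linarith⟩
      · have hd := h.disjoint (show 0 + 2 ≤ 2 by omega) (show 2 + 2 ≤ 0 + (m + 4) by omega)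
        have hab0 : 0 < α + β := by linarith
        refine Set.disjoint_iff.1 hd (show p 2 + (1 / (α + β)) • e2 ∈ _ from ⟨?_, ?_⟩)
        · refine ⟨α / (α + β), β / (α + β), by positivity, by positivity, by field_simp, ?_⟩
          have hx : (p 2 : Plane) = (1 / (α + β) * (α + β)) • p 2 := by
            rw [one_div, inv_mul_cancel₀ hab0.ne', one_smul]
          conv_rhs => rw [hx, h3, hg, he1, edgeVec]
          simp only [zero_add, div_eq_mul_inv, one_mul]
          module
        · refine ⟨1 - 1 / (α + β), 1 / (α + β), ?_, by positivity, by ring, ?_⟩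
          · have : 1 / (α + β) ≤ 1 := by rw [div_le_one hab0]; exact hab.le
            linarith
          · rw [show (2 : ℕ) + 1 = 3 from rfl, hp3]; module
  -- the bracket at `p 0`
  have hlast : edgeVec p (m + 3) ≠ 0 := h.edgeVec_ne_zero _
  have a1 := neg_pi_lt_ang (edgeVec p (m + 3)) e0
  have a2 := ang_le_pi (edgeVec p (m + 3)) e0
  have a3 := neg_pi_lt_ang e0 g
  have a4 := ang_le_pi e0 g
  have a5 := neg_pi_lt_ang (edgeVec p (m + 3)) g
  have a6 := ang_le_pi (edgeVec p (m + 3)) g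
  have hpi := Real.pi_pos
  have hdiff : totalTurn (m + 4) p - totalTurn (m + 3) q =
      ang (edgeVec p (m + 3)) e0 + ang e0 g - ang (edgeVec p (m + 3)) g := by
    rw [htP, htQ]; linarith
  -- Two different values of the total turning would differ by 4π, but three angles account for less
  -- than 3π.
  rcases hP2 with hP2 | hP2 <;> rcases hQ2 with hQ2 | hQ2 <;> rw [hP2, hQ2] at hdiff <;> linarith

theorem doubleArea_firstPart_two (p : ℕ → Plane) :
    doubleArea (2 + 1) (fun i => _root_.firstPart p 2 (i % (2 + 1))) =
      cross (p 2 - p 1) (p 0 - p 1) := by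
  simp [doubleArea, Finset.sum_range_succ, _root_.firstPart, cross]
  ring

end SimplePeriodic

/-- The total turning of a simple polygon is `2 π` or `-2 π` according to the sign of the area. -/
theorem SimplePeriodic.totalTurn_and_area : ∀ (n : ℕ) (p : ℕ → Plane), SimplePeriodic n p →
    (totalTurn n p = 2 * Real.pi ∧ 0 < doubleArea n p) ∨
      (totalTurn n p = -(2 * Real.pi) ∧ doubleArea n p < 0) := by
  intro n
  induction n using Nat.strong_induction_on with
  | _ n ih =>
  intro p₀ h₀
  have hn := h₀.three_le
  obtain ⟨r, hr, d, hd₀⟩ := h₀.exists_extreme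
  -- The shift moves the extreme vertex to index 1, so that its neighbours are `p 0` and `p 2`.
  rw [← h₀.totalTurn_shift (r + n - 1), ← h₀.doubleArea_shift (r + n - 1)]
  have h := h₀.shift (r + n - 1)
  set p : ℕ → Plane := fun i => p₀ (i + (r + n - 1)) with hp
  have hp1 : p 1 = p₀ r := by
    rw [hp]; show p₀ (1 + (r + n - 1)) = _
    rw [show 1 + (r + n - 1) = r + n by omega, h₀.periodic]
  have hd : ∀ i, p i ≠ p 1 → 0 < dot d (p i - p 1) := by
    intro i hi
    rw [hp1] at hi ⊢
    exact hd₀ _ hi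
  clear_value p
  clear hd₀ hp hp1
  have hmain := h.totalTurn_of_extreme_one hd
  have hc : cross (p 2 - p 1) (p 0 - p 1) ≠ 0 := by
    rcases hmain with ⟨_, h1⟩ | ⟨_, h1⟩
    · exact h1.ne'
    · exact h1.ne
  have hpn := h.p_n
  rcases Nat.lt_or_ge n 4 with hn4 | hn4
  · obtain rfl : n = 3 := by omega
    have : doubleArea 3 p = cross (p 2 - p 1) (p 0 - p 1) := by
      simp only [doubleArea, Finset.sum_range_succ, Finset.sum_range_zero, zero_add,
        show 2 + 1 = 3 from rfl, show 1 + 1 = 2 from rfl, hpn, cross, Prod.fst_sub, Prod.snd_sub]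
      ring
    rwa [this]
  set S := coordS (p 1) (p 2 - p 1) (p 0 - p 1) with hS
  set T := coordT (p 1) (p 2 - p 1) (p 0 - p 1) with hT
  classical
  set cand := (Finset.Ico 3 n).filter fun i => 0 ≤ S (p i) ∧ 0 ≤ T (p i) ∧ S (p i) + T (p i) ≤ 1
    with hcand
  rcases cand.eq_empty_or_nonempty with hempty | hne
  · -- an ear
    have hemp : ∀ i, 3 ≤ i → i < n → ¬ (0 ≤ S (p i) ∧ 0 ≤ T (p i) ∧ S (p i) + T (p i) ≤ 1) := by
      intro i h1 h2 h3
      have : i ∈ cand := Finset.mem_filter.2 ⟨Finset.mem_Ico.2 ⟨h1, h2⟩, h3⟩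
      rw [hempty] at this
      simp at this
    have hclean := h.cleanDiagonal_ear hn4 hc hS hT hemp
    have hQ := h.secondPart (k := 2) le_rfl (by omega) hclean
    have ihQ := ih (n - 2 + 1) (by omega) _ hQ
    -- Equal turning means by induction that the area of the rest has the sign of the turning; the
    -- corner triangle that is cut off has the same sign, as it sits at the extreme vertex.
    have heq := h.totalTurn_ear hn4 hc (hemp 3 le_rfl (by omega)) hQ
      (hmain.imp And.left And.left) (ihQ.imp And.left And.left)
    have harea := h.doubleArea_split (k := 2) le_rfl (by omega)
    rw [SimplePeriodic.doubleArea_firstPart_two] at harea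
    rw [heq] at ihQ
    have hpi := Real.pi_pos
    rcases hmain with ⟨a, b⟩ | ⟨a, b⟩ <;> rcases ihQ with ⟨a', b'⟩ | ⟨a', b'⟩
    · left; exact ⟨a, by linarith⟩
    · rw [a] at a'; linarith
    · rw [a] at a'; linarith
    · right; exact ⟨a, by linarith⟩
  · -- a diagonal from the extreme vertex
    obtain ⟨k, hk, hmin⟩ := Finset.exists_min_image cand (fun i => S (p i) + T (p i)) hne
    obtain ⟨hk1, hk2⟩ := Finset.mem_filter.1 hk
    obtain ⟨hk3, hkn⟩ := Finset.mem_Ico.1 hk1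
    obtain ⟨hclean, hSk, hTk⟩ := h.cleanDiagonal_corner hc hS hT hk3 hkn hk2
      fun i h1 h2 h3 => hmin i (Finset.mem_filter.2 ⟨Finset.mem_Ico.2 ⟨h1, h2⟩, h3⟩)
    have hkeq : p k = p 1 + S (p k) • (p 2 - p 1) + T (p k) • (p 0 - p 1) := coord_eq hc (p k)
    rw [← h.totalTurn_shift 1, ← h.doubleArea_shift 1]
    rw [← h.totalTurn_shift 1] at hmain
    have h' := h.shift 1
    obtain ⟨K, rfl⟩ : ∃ K, k = K + 1 := ⟨k - 1, by omega⟩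
    have hplast : p (n - 1 + 1) = p 0 := by rw [show n - 1 + 1 = n by omega, hpn]
    have hne1 : ∀ i, 0 < i → i < n → p (i + 1) ≠ p 1 := fun i h1 h2 =>
      (h.ne_of_lt (show 1 < i + 1 by omega) (by omega)).symm
    set p' : ℕ → Plane := fun i => p (i + 1) with hp'
    have hclean' : CleanDiagonal p' (p' 0) (p' K) := fun j => hclean (j + 1)
    have hQ1 := h'.firstPart (k := K) (by omega) (by omega) hclean'
    have hQ2 := h'.secondPart (k := K) (by omega) (by omega) hclean'
    have harea := h'.doubleArea_split (k := K) (by omega) (by omega)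
    have ih1 := ih (K + 1) (by omega) _ hQ1
    have ih2 := ih (n - K + 1) (by omega) _ hQ2
    -- The vertex `p 1` is extreme in both parts as well. The diagonal starts inside the corner
    -- (`S`, `T` positive), so both parts turn there to the same side as the whole polygon, and by
    -- induction both areas have that sign.
    have hturn1 := hQ1.totalTurn_of_extreme (d := d) (by
      intro i h1 h2
      simp only [Nat.mod_eq_of_lt h2, Nat.zero_mod, _root_.firstPart, if_pos (show i ≤ K by omega)]
      exact hd _ (hne1 i h1 (by omega)))
    have hturn2 := hQ2.totalTurn_of_extreme (d := d) (by
      intro i h1 h2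
      simp only [Nat.mod_eq_of_lt h2, Nat.zero_mod, _root_.secondPart, if_neg h1.ne', if_true]
      exact hd _ (hne1 _ (by omega) (by omega)))
    have c1 : cross (edgeVec (fun i => _root_.firstPart p' K (i % (K + 1))) (K + 1 - 1))
        (edgeVec (fun i => _root_.firstPart p' K (i % (K + 1))) 0) =
        T (p (K + 1)) * cross (p 2 - p 1) (p 0 - p 1) := by
      have e1 : edgeVec (fun i => _root_.firstPart p' K (i % (K + 1))) (K + 1 - 1) =
          p 1 - p (K + 1) := by
        simp [edgeVec, _root_.firstPart, hp']
      have e2 : edgeVec (fun i => _root_.firstPart p' K (i % (K + 1))) 0 = p 2 - p 1 := by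
        simp only [edgeVec, _root_.firstPart, zero_add, Nat.zero_mod, hp', Nat.zero_le, if_true]
        rw [Nat.mod_eq_of_lt (by omega), if_pos (by omega)]
      rw [e1, e2]
      nth_rewrite 1 [hkeq]
      simp only [cross, Prod.fst_sub, Prod.snd_sub, Prod.fst_add, Prod.snd_add, Prod.smul_fst,
        Prod.smul_snd, smul_eq_mul]
      ring
    have c2 : cross (edgeVec (fun i => _root_.secondPart p' K (i % (n - K + 1))) (n - K + 1 - 1))
        (edgeVec (fun i => _root_.secondPart p' K (i % (n - K + 1))) 0) =
        S (p (K + 1)) * cross (p 2 - p 1) (p 0 - p 1) := by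
      have e1 : edgeVec (fun i => _root_.secondPart p' K (i % (n - K + 1))) (n - K + 1 - 1) =
          p 1 - p 0 := by
        simp only [edgeVec, _root_.secondPart, hp']
        rw [show n - K + 1 - 1 = n - K by omega, Nat.mod_self, Nat.mod_eq_of_lt (by omega),
          if_neg (show n - K ≠ 0 by omega), show n - K + K - 1 = n - 1 by omega, hplast]
        simp
      have e2 : edgeVec (fun i => _root_.secondPart p' K (i % (n - K + 1))) 0 = p (K + 1) - p 1 := by
        simp only [edgeVec, _root_.secondPart, zero_add, Nat.zero_mod, hp', if_true]
        rw [Nat.mod_eq_of_lt (by omega), if_neg (by omega), show 1 + K - 1 + 1 = K + 1 by omega]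
      rw [e1, e2]
      nth_rewrite 1 [hkeq]
      simp only [cross, Prod.fst_sub, Prod.snd_sub, Prod.fst_add, Prod.snd_add, Prod.smul_fst,
        Prod.smul_snd, smul_eq_mul]
      ring
    rw [c1] at hturn1
    rw [c2] at hturn2
    have hpi := Real.pi_pos
    have hpos1 : ∀ {x y : ℝ}, 0 < x → 0 < y → ¬ x * y < 0 := fun hx hy => (mul_pos hx hy).le.not_gt
    have hneg1 : ∀ {x y : ℝ}, 0 < x → y < 0 → ¬ 0 < x * y := fun hx hy =>
      (mul_neg_of_pos_of_neg hx hy).le.not_gt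
    rcases hmain with ⟨a, b⟩ | ⟨a, b⟩
    · left
      refine ⟨a, ?_⟩
      rcases hturn1 with ⟨t1, s1⟩ | ⟨t1, s1⟩
      · rcases hturn2 with ⟨t2, s2⟩ | ⟨t2, s2⟩
        · rcases ih1 with ⟨u1, v1⟩ | ⟨u1, v1⟩
          · rcases ih2 with ⟨u2, v2⟩ | ⟨u2, v2⟩
            · linarith
            · linarith
          · linarith
        · exact absurd s2 (hpos1 hSk b)
      · exact absurd s1 (hpos1 hTk b)
    · right
      refine ⟨a, ?_⟩
      rcases hturn1 with ⟨t1, s1⟩ | ⟨t1, s1⟩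
      · exact absurd s1 (hneg1 hTk b)
      · rcases hturn2 with ⟨t2, s2⟩ | ⟨t2, s2⟩
        · exact absurd s2 (hneg1 hSk b)
        · rcases ih1 with ⟨u1, v1⟩ | ⟨u1, v1⟩
          · linarith
          · rcases ih2 with ⟨u2, v2⟩ | ⟨u2, v2⟩
            · linarith
            · linarith

/-! ## The edge directions of a pseudotriangle -/

/-- The accumulated turning angle from the first edge to the `i`-th one. -/
noncomputable def turnAngle (u : ℕ → Plane) (i : ℕ) : ℝ :=
  ∑ k ∈ Finset.range i, ang (edgeVec u k) (edgeVec u (k + 1))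

theorem turnAngle_succ (u : ℕ → Plane) (i : ℕ) :
    turnAngle u (i + 1) = turnAngle u i + ang (edgeVec u i) (edgeVec u (i + 1)) :=
  Finset.sum_range_succ _ _

/-- Accumulated angles are honest real numbers that represent the directions modulo 2π. The mutual
position of any two edges is therefore read off from a sine. -/
theorem exists_cross_eq_sin {u : ℕ → Plane} (hne : ∀ i, edgeVec u i ≠ 0) (i j : ℕ) :
    ∃ r : ℝ, 0 < r ∧ cross (edgeVec u i) (edgeVec u j) =
      r * Real.sin (turnAngle u j - turnAngle u i) := by
  have hcoe : ∀ i, (turnAngle u i : Real.Angle) =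
      (toComplex (edgeVec u i)).arg - (toComplex (edgeVec u 0)).arg := by
    intro i
    induction i with
    | zero => simp [turnAngle]
    | succ i ih => rw [turnAngle_succ, Real.Angle.coe_add, ih, ang_coe (hne _) (hne _)]; abel
  have hang : (ang (edgeVec u i) (edgeVec u j) : Real.Angle) =
      ((turnAngle u j - turnAngle u i : ℝ) : Real.Angle) := by
    rw [Real.Angle.coe_sub, hcoe, hcoe, ang_coe (hne _) (hne _)]; abel
  have hpos : 0 < ‖(starRingEnd ℂ) (toComplex (edgeVec u i)) * toComplex (edgeVec u j)‖ := by
    rw [norm_pos_iff]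
    exact mul_ne_zero (by simpa using toComplex_ne_zero (hne i)) (toComplex_ne_zero (hne j))
  refine ⟨_, hpos, ?_⟩
  rw [← Real.Angle.sin_coe, ← hang, Real.Angle.sin_coe, ang, Complex.sin_arg, ang_arg_im,
    mul_div_cancel₀ _ hpos.ne']

/-- The direction of the edges of a closed polygon with corners `0`, `p`, `q` and `m` (which is the
first one again): all other vertices are reflex, and the total turning is that of a
pseudotriangle. -/
structure PseudoChain (w : ℕ → Plane) (p q m : ℕ) : Prop where
  p_pos : 0 < p
  p_lt_q : p < q
  q_lt_m : q < m
  closed : w m = w 0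
  ab : ∀ i j, i < p → p ≤ j → j < q → 0 < cross (edgeVec w i) (edgeVec w j)
  bc : ∀ i j, p ≤ i → i < q → q ≤ j → j < m → 0 < cross (edgeVec w i) (edgeVec w j)
  ca : ∀ i j, q ≤ i → i < m → j < p → 0 < cross (edgeVec w i) (edgeVec w j)
  aa : ∀ i j, i < j → j < p → cross (edgeVec w i) (edgeVec w j) < 0
  bb : ∀ i j, p ≤ i → i < j → j < q → cross (edgeVec w i) (edgeVec w j) < 0
  cc : ∀ i j, q ≤ i → i < j → j < m → cross (edgeVec w i) (edgeVec w j) < 0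

theorem PseudoChain.congr {w w' : ℕ → Plane} {p q m : ℕ} (h : PseudoChain w p q m)
    (hw : ∀ i ≤ m, w' i = w i) : PseudoChain w' p q m := by
  have hE : ∀ i, i < m → edgeVec w' i = edgeVec w i := fun i hi => by
    rw [edgeVec, edgeVec, hw i hi.le, hw (i + 1) hi]
  have h1 := h.p_pos
  have h2 := h.p_lt_q
  have h3 := h.q_lt_m
  refine ⟨h1, h2, h3, by rw [hw m le_rfl, hw 0 (Nat.zero_le _), h.closed], ?_, ?_, ?_, ?_, ?_, ?_⟩
  · intro i j a b c; rw [hE i (by omega), hE j (by omega)]; exact h.ab i j a b c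
  · intro i j a b c d; rw [hE i (by omega), hE j (by omega)]; exact h.bc i j a b c d
  · intro i j a b c; rw [hE i (by omega), hE j (by omega)]; exact h.ca i j a b c
  · intro i j a b; rw [hE i (by omega), hE j (by omega)]; exact h.aa i j a b
  · intro i j a b c; rw [hE i (by omega), hE j (by omega)]; exact h.bb i j a b c
  · intro i j a b c; rw [hE i (by omega), hE j (by omega)]; exact h.cc i j a b c

/-- The boundary turns (strictly) at the `i`-th vertex. -/
def TurnsAt (n : ℕ) (u : ℕ → Plane) (i : ℕ) : Prop :=
  cross (edgeVec u (i + n - 1)) (edgeVec u i) ≠ 0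

/-- The vertices at which the boundary turns. -/
noncomputable def corners (n : ℕ) (u : ℕ → Plane) (k : ℕ) : Plane := u (Nat.nth (TurnsAt n u) k)

theorem segment_union_of_collinear {a b c : Plane} {t : ℝ} (ht : 0 ≤ t)
    (h : c - b = t • (b - a)) : segment ℝ a b ∪ segment ℝ b c = segment ℝ a c := by
  obtain rfl : c = b + t • (b - a) := by rw [← h]; abel
  have h1 : 0 < 1 + t := by linarith
  rw [segment_eq_image', segment_eq_image', segment_eq_image']
  ext x
  constructor
  · rintro (⟨θ, ⟨h0, h1'⟩, rfl⟩ | ⟨θ, ⟨h0, h1'⟩, rfl⟩)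
    · refine ⟨θ / (1 + t), ⟨by positivity, (div_le_one h1).2 (by linarith)⟩, ?_⟩
      have : θ = θ / (1 + t) * (1 + t) := by field_simp
      conv_rhs => rw [this]
      module
    · refine ⟨(1 + θ * t) / (1 + t), ⟨by positivity, (div_le_one h1).2 (by nlinarith)⟩, ?_⟩
      have : (1 + θ * t) = (1 + θ * t) / (1 + t) * (1 + t) := by field_simp
      have e : b + θ • (b + t • (b - a) - b) = a + (1 + θ * t) • (b - a) := by module
      show _ = b + θ • (b + t • (b - a) - b)
      rw [e]
      conv_rhs => rw [this]
      module
  · rintro ⟨θ, ⟨h0, h1'⟩, rfl⟩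
    rcases le_or_gt (θ * (1 + t)) 1 with hle | hgt
    · left
      exact ⟨θ * (1 + t), ⟨by positivity, hle⟩, by module⟩
    · right
      have ht0 : 0 < t := by
        rcases ht.eq_or_lt with h0 | h0
        · rw [← h0] at hgt; linarith
        · exact h0
      refine ⟨(θ * (1 + t) - 1) / t, ⟨div_nonneg (by linarith) ht, ?_⟩, ?_⟩
      · rw [div_le_one ht0]; nlinarith
      · have : (θ * (1 + t) - 1) / t * t = θ * (1 + t) - 1 := by field_simp
        have e : b + ((θ * (1 + t) - 1) / t) • (b + t • (b - a) - b) =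
            b + ((θ * (1 + t) - 1) / t * t) • (b - a) := by module
        show b + ((θ * (1 + t) - 1) / t) • (b + t • (b - a) - b) = _
        rw [e, this]
        module

/-! ### Turning angles along a counterclockwise pseudotriangle -/

section

variable {n s₁ s₂ : ℕ} {u : ℕ → Plane}

/-- A counterclockwise simple polygon whose convex vertices are `0`, `s₁` and `s₂`. -/
structure CcwPseudotriangle (n s₁ s₂ : ℕ) (u : ℕ → Plane) : Prop where
  simple : SimplePeriodic n u
  area_pos : 0 < doubleArea n u
  s₁_pos : 0 < s₁
  s₁_lt_s₂ : s₁ < s₂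
  s₂_lt : s₂ < n
  convex_iff : ∀ i < n, 0 < cross (edgeVec u (i + n - 1)) (edgeVec u i) ↔ i = 0 ∨ i = s₁ ∨ i = s₂

namespace CcwPseudotriangle

theorem edge_periodic (h : CcwPseudotriangle n s₁ s₂ u) (i : ℕ) :
    edgeVec u (i + n) = edgeVec u i := by
  rw [edgeVec, edgeVec, h.simple.periodic, show i + n + 1 = i + 1 + n by ring, h.simple.periodic]

theorem edge_pred (h : CcwPseudotriangle n s₁ s₂ u) (i : ℕ) :
    edgeVec u (i + 1 + n - 1) = edgeVec u i := by
  rw [show i + 1 + n - 1 = i + n by omega, h.edge_periodic]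

theorem turnAngle_n (h : CcwPseudotriangle n s₁ s₂ u) : turnAngle u n = 2 * Real.pi := by
  rcases SimplePeriodic.totalTurn_and_area n u h.simple with ⟨h1, _⟩ | ⟨_, h2⟩
  · exact h1
  · linarith [h.area_pos]

theorem turnsAt_iff (h : CcwPseudotriangle n s₁ s₂ u) (i : ℕ) :
    TurnsAt n u (i + 1) ↔ cross (edgeVec u i) (edgeVec u (i + 1)) ≠ 0 := by
  rw [TurnsAt, h.edge_pred]

theorem turnsAt_periodic (h : CcwPseudotriangle n s₁ s₂ u) (i : ℕ) :
    TurnsAt n u (i + n) ↔ TurnsAt n u i := by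
  have hn := h.simple.three_le
  rw [TurnsAt, TurnsAt, h.edge_periodic, show i + n + n - 1 = i + n - 1 + n by omega,
    h.edge_periodic]

theorem turnsAt_zero (h : CcwPseudotriangle n s₁ s₂ u) : TurnsAt n u 0 :=
  ((h.convex_iff 0 (by have := h.s₂_lt; omega)).2 (Or.inl rfl)).ne'

theorem turnsAt_s₁ (h : CcwPseudotriangle n s₁ s₂ u) : TurnsAt n u s₁ :=
  ((h.convex_iff s₁ (h.s₁_lt_s₂.trans h.s₂_lt)).2 (Or.inr (Or.inl rfl))).ne'

theorem turnsAt_s₂ (h : CcwPseudotriangle n s₁ s₂ u) : TurnsAt n u s₂ :=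
  ((h.convex_iff s₂ h.s₂_lt).2 (Or.inr (Or.inr rfl))).ne'

theorem turnsAt_n (h : CcwPseudotriangle n s₁ s₂ u) : TurnsAt n u n := by
  have := (h.turnsAt_periodic 0).2 h.turnsAt_zero
  rwa [zero_add] at this

theorem infinite (h : CcwPseudotriangle n s₁ s₂ u) : (Set.ofPred (TurnsAt n u)).Infinite := by
  have hn := h.simple.three_le
  refine Set.infinite_of_injective_forall_mem (f := fun k : ℕ => k * n) ?_ ?_
  · intro a b hab
    exact Nat.eq_of_mul_eq_mul_right (by omega) hab
  · intro k
    show TurnsAt n u (k * n)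
    induction k with
    | zero => rw [zero_mul]; exact h.turnsAt_zero
    | succ k ih => rw [Nat.succ_mul, h.turnsAt_periodic]; exact ih

/-- A zero cross product leaves the angles 0 and π, and π would make the two edges overlap. -/
theorem turn_flat (h : CcwPseudotriangle n s₁ s₂ u) {i : ℕ} (hi : ¬ TurnsAt n u (i + 1)) :
    ang (edgeVec u i) (edgeVec u (i + 1)) = 0 := by
  rw [h.turnsAt_iff, not_not] at hi
  have h1 := ang_nonneg_iff.2 hi.ge
  have h2 : cross (edgeVec u (i + 1)) (edgeVec u i) = 0 := by rw [cross_comm, hi, neg_zero]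
  have h3 := ang_nonneg_iff.2 h2.ge
  rw [ang_swap (h.simple.edgeVec_ne_zero i) (h.simple.edgeVec_ne_zero (i + 1))
    (h.simple.ang_ne_pi i)] at h3
  linarith

theorem turn_convex (h : CcwPseudotriangle n s₁ s₂ u) {i : ℕ}
    (hi : 0 < cross (edgeVec u i) (edgeVec u (i + 1))) :
    0 < ang (edgeVec u i) (edgeVec u (i + 1)) ∧
      ang (edgeVec u i) (edgeVec u (i + 1)) < Real.pi := by
  refine ⟨?_, (ang_le_pi _ _).lt_of_ne (h.simple.ang_ne_pi i)⟩
  have h2 : cross (edgeVec u (i + 1)) (edgeVec u i) < 0 := by rw [cross_comm]; linarith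
  have h3 := ang_neg_iff.2 h2
  rw [ang_swap (h.simple.edgeVec_ne_zero i) (h.simple.edgeVec_ne_zero (i + 1))
    (h.simple.ang_ne_pi i)] at h3
  linarith

theorem turn_reflex (h : CcwPseudotriangle n s₁ s₂ u) {i : ℕ} (hi : i + 1 < n)
    (h1 : i + 1 ≠ s₁) (h2 : i + 1 ≠ s₂) :
    ang (edgeVec u i) (edgeVec u (i + 1)) ≤ 0 ∧
      (TurnsAt n u (i + 1) → ang (edgeVec u i) (edgeVec u (i + 1)) < 0) := by
  have hc : ¬ 0 < cross (edgeVec u i) (edgeVec u (i + 1)) := by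
    intro hc
    rw [← h.edge_pred i, h.convex_iff _ hi] at hc
    omega
  have hlt : TurnsAt n u (i + 1) → ang (edgeVec u i) (edgeVec u (i + 1)) < 0 := by
    intro hcor
    rw [h.turnsAt_iff] at hcor
    exact ang_neg_iff.2 (lt_of_le_of_ne (not_lt.1 hc) hcor)
  refine ⟨?_, hlt⟩
  by_cases hcor : TurnsAt n u (i + 1)
  · exact (hlt hcor).le
  · exact (h.turn_flat hcor).le

theorem turnAngle_antitone (h : CcwPseudotriangle n s₁ s₂ u) {i j : ℕ} (hij : i ≤ j) (hj : j < n)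
    (h1 : ¬ (i < s₁ ∧ s₁ ≤ j)) (h2 : ¬ (i < s₂ ∧ s₂ ≤ j)) : turnAngle u j ≤ turnAngle u i := by
  induction j, hij using Nat.le_induction with
  | base => exact le_rfl
  | succ j hij ih =>
    rw [turnAngle_succ]
    have a := (h.turn_reflex (i := j) hj (by omega) (by omega)).1
    have b := ih (by omega) (by omega) (by omega)
    linarith

theorem turnAngle_strict (h : CcwPseudotriangle n s₁ s₂ u) {i j : ℕ} (hij : i < j) (hj : j < n)
    (h1 : ¬ (i < s₁ ∧ s₁ ≤ j)) (h2 : ¬ (i < s₂ ∧ s₂ ≤ j)) (hc : TurnsAt n u j) :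
    turnAngle u j < turnAngle u i := by
  obtain ⟨j, rfl⟩ : ∃ k, j = k + 1 := ⟨j - 1, by omega⟩
  rw [turnAngle_succ]
  have a := (h.turn_reflex (i := j) hj (by omega) (by omega)).2 hc
  have b := h.turnAngle_antitone (i := i) (j := j) (by omega) (by omega) (by omega) (by omega)
  linarith

theorem turnAngle_const (h : CcwPseudotriangle n s₁ s₂ u) {i j : ℕ} (hij : i ≤ j)
    (hc : ∀ k, i < k → k ≤ j → ¬ TurnsAt n u k) : turnAngle u j = turnAngle u i := by
  induction j, hij using Nat.le_induction with
  | base => rfl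
  | succ j hij ih =>
    rw [turnAngle_succ, h.turn_flat (hc _ (by omega) le_rfl), ih fun k a b => hc k a (by omega),
      add_zero]

theorem turn_bounds (h : CcwPseudotriangle n s₁ s₂ u) :
    (0 < turnAngle u s₁ - turnAngle u (s₁ - 1) ∧
      turnAngle u s₁ - turnAngle u (s₁ - 1) < Real.pi) ∧
    (0 < turnAngle u s₂ - turnAngle u (s₂ - 1) ∧
      turnAngle u s₂ - turnAngle u (s₂ - 1) < Real.pi) ∧
    (0 < 2 * Real.pi - turnAngle u (n - 1) ∧ 2 * Real.pi - turnAngle u (n - 1) < Real.pi) := by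
  have e1 := h.s₁_pos
  have e2 := h.s₁_lt_s₂
  have e3 := h.s₂_lt
  have key : ∀ i, 0 < cross (edgeVec u i) (edgeVec u (i + 1)) →
      0 < turnAngle u (i + 1) - turnAngle u i ∧ turnAngle u (i + 1) - turnAngle u i < Real.pi := by
    intro i hi
    rw [turnAngle_succ, add_sub_cancel_left]
    exact h.turn_convex hi
  refine ⟨?_, ?_, ?_⟩
  · obtain ⟨k, rfl⟩ : ∃ k, s₁ = k + 1 := ⟨s₁ - 1, by omega⟩
    apply key
    rw [← h.edge_pred k]
    exact (h.convex_iff _ (by omega)).2 (Or.inr (Or.inl rfl))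
  · obtain ⟨k, rfl⟩ : ∃ k, s₂ = k + 1 := ⟨s₂ - 1, by omega⟩
    apply key
    rw [← h.edge_pred k]
    exact (h.convex_iff _ (by omega)).2 (Or.inr (Or.inr rfl))
  · rw [← h.turnAngle_n]
    obtain ⟨k, rfl⟩ : ∃ k, n = k + 1 := ⟨n - 1, by omega⟩
    apply key
    have := (h.convex_iff 0 (by omega)).2 (Or.inl rfl)
    rw [← h.edge_periodic 0] at this
    simpa using this

/-- The mutual position of the edge directions. -/
theorem cross_edges (h : CcwPseudotriangle n s₁ s₂ u) :
    (∀ i j, i < s₁ → s₁ ≤ j → j < s₂ → 0 < cross (edgeVec u i) (edgeVec u j)) ∧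
    (∀ i j, s₁ ≤ i → i < s₂ → s₂ ≤ j → j < n → 0 < cross (edgeVec u i) (edgeVec u j)) ∧
    (∀ i j, s₂ ≤ i → i < n → j < s₁ → 0 < cross (edgeVec u i) (edgeVec u j)) ∧
    (∀ i j, i < n → j < n → ((i < s₁ ∧ j < s₁) ∨ (s₁ ≤ i ∧ j < s₂) ∨ s₂ ≤ i) →
      turnAngle u j < turnAngle u i → cross (edgeVec u i) (edgeVec u j) < 0 ∨ j < i) := by
  have e1 := h.s₁_pos
  have e2 := h.s₁_lt_s₂
  have e3 := h.s₂_lt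
  obtain ⟨⟨b1, b2⟩, ⟨b3, b4⟩, b5, b6⟩ := h.turn_bounds
  have h0 : turnAngle u 0 = 0 := by simp [turnAngle]
  -- On each chain the angle decreases weakly. From a chain to the next it rises by at most the jump
  -- at the convex vertex between them, hence by less than π. It rises by more than 0, because the
  -- total is 2π and the other two jumps together are less than 2π.
  have hA : ∀ i, i < s₁ → turnAngle u (s₁ - 1) ≤ turnAngle u i ∧ turnAngle u i ≤ 0 := fun i hi =>
    ⟨h.turnAngle_antitone (by omega) (by omega) (by omega) (by omega),
      h0 ▸ h.turnAngle_antitone (by omega) (by omega) (by omega) (by omega)⟩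
  have hB : ∀ i, s₁ ≤ i → i < s₂ →
      turnAngle u (s₂ - 1) ≤ turnAngle u i ∧ turnAngle u i ≤ turnAngle u s₁ := fun i h1 h2 =>
    ⟨h.turnAngle_antitone (by omega) (by omega) (by omega) (by omega),
      h.turnAngle_antitone (by omega) (by omega) (by omega) (by omega)⟩
  have hC : ∀ i, s₂ ≤ i → i < n →
      turnAngle u (n - 1) ≤ turnAngle u i ∧ turnAngle u i ≤ turnAngle u s₂ := fun i h1 h2 =>
    ⟨h.turnAngle_antitone (by omega) (by omega) (by omega) (by omega),
      h.turnAngle_antitone (by omega) (by omega) (by omega) (by omega)⟩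
  have hA0 := hA 0 e1
  have hB0 := hB s₁ le_rfl e2
  have hC0 := hC s₂ le_rfl e3
  have hne := h.simple.edgeVec_ne_zero
  refine ⟨?_, ?_, ?_, ?_⟩
  · intro i j a b c
    obtain ⟨r, hr, he⟩ := exists_cross_eq_sin hne i j
    rw [he]
    have x := hA i a
    have y := hB j b c
    exact mul_pos hr (Real.sin_pos_of_pos_of_lt_pi (by linarith) (by linarith))
  · intro i j a b c d
    obtain ⟨r, hr, he⟩ := exists_cross_eq_sin hne i j
    rw [he]
    have x := hB i a b
    have y := hC j c d
    exact mul_pos hr (Real.sin_pos_of_pos_of_lt_pi (by linarith) (by linarith))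
  · intro i j a b c
    obtain ⟨r, hr, he⟩ := exists_cross_eq_sin hne i j
    rw [he]
    have x := hC i a b
    have y := hA j c
    refine mul_pos hr ?_
    -- Going on from the last chain to the first, the accumulated angle restarts one full turn
    -- lower.
    rw [← Real.sin_add_two_pi]
    exact Real.sin_pos_of_pos_of_lt_pi (by linarith) (by linarith)
  · intro i j hi hj hcase hlt
    rcases Nat.lt_or_ge j i with hji | hij
    · exact Or.inr hji
    left
    obtain ⟨r, hr, he⟩ := exists_cross_eq_sin hne i j
    rw [he]
    refine mul_neg_of_pos_of_neg hr (Real.sin_neg_of_neg_of_neg_pi_lt (by linarith) ?_)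
    rcases hcase with ⟨x, y⟩ | ⟨x, y⟩ | x
    · have := hA i x; have := hA j y; linarith
    · have := hB i x (by omega); have := hB j (by omega) y; linarith
    · have := hC i x hi; have := hC j (by omega) hj; linarith

end CcwPseudotriangle

end

/-! ### Dropping the vertices with a straight angle -/

theorem cross_sum_left (u : Plane) {ι : Type*} (s : Finset ι) (f : ι → Plane) :
    cross (∑ i ∈ s, f i) u = ∑ i ∈ s, cross (f i) u := by
  rw [cross_comm, cross_sum_right, ← Finset.sum_neg_distrib]
  exact Finset.sum_congr rfl fun i _ => (cross_comm _ _).symm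

theorem exists_smul_of_ang_eq_zero {u v : Plane} (hu : u ≠ 0) (h : ang u v = 0) :
    ∃ t : ℝ, 0 ≤ t ∧ v = t • u := by
  have huu := dot_self_pos hu
  obtain ⟨h1, h2⟩ := Complex.arg_eq_zero_iff.1 h
  rw [ang_arg_re] at h1
  rw [ang_arg_im] at h2
  refine ⟨dot u v / dot u u, div_nonneg h1 huu.le, ?_⟩
  have ht : dot u v / dot u u * dot u u = dot u v := div_mul_cancel₀ _ huu.ne'
  have h0 := huu.ne'
  generalize dot u v / dot u u = t at ht
  simp only [dot, cross] at *
  ext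
  · apply mul_left_cancel₀ h0
    simp only [Prod.smul_fst, smul_eq_mul]
    linear_combination -u.1 * ht - u.2 * h2
  · apply mul_left_cancel₀ h0
    simp only [Prod.smul_snd, smul_eq_mul]
    linear_combination -u.2 * ht + u.1 * h2

namespace CcwPseudotriangle

variable {n s₁ s₂ : ℕ} {u : ℕ → Plane}

theorem nth_turns (h : CcwPseudotriangle n s₁ s₂ u) (k : ℕ) :
    TurnsAt n u (Nat.nth (TurnsAt n u) k) := Nat.nth_mem_of_infinite h.infinite k

theorem nth_lt (h : CcwPseudotriangle n s₁ s₂ u) {i j : ℕ} (hij : i < j) :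
    Nat.nth (TurnsAt n u) i < Nat.nth (TurnsAt n u) j := Nat.nth_strictMono h.infinite hij

theorem nth_le (h : CcwPseudotriangle n s₁ s₂ u) {i j : ℕ} (hij : i ≤ j) :
    Nat.nth (TurnsAt n u) i ≤ Nat.nth (TurnsAt n u) j :=
  (Nat.nth_strictMono h.infinite).monotone hij

theorem flat_between (k : ℕ) {i : ℕ} (h1 : Nat.nth (TurnsAt n u) k < i)
    (h2 : i < Nat.nth (TurnsAt n u) (k + 1)) : ¬ TurnsAt n u i :=
  fun hi => (Nat.le_nth_of_lt_nth_succ h2 hi).not_gt h1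

theorem edgeVec_corners (h : CcwPseudotriangle n s₁ s₂ u) (k : ℕ) :
    edgeVec (corners n u) k =
      ∑ i ∈ Finset.Ico (Nat.nth (TurnsAt n u) k) (Nat.nth (TurnsAt n u) (k + 1)), edgeVec u i := by
  rw [edgeVec, corners, corners]
  exact (Finset.sum_Ico_sub u (h.nth_le (Nat.le_succ k))).symm

/-- An edge between consecutive corners is a sum of original edges, so by bilinearity a sign that
holds for all pairs of original edges passes to it. -/
theorem cross_corners (h : CcwPseudotriangle n s₁ s₂ u) (k l : ℕ) :
    cross (edgeVec (corners n u) k) (edgeVec (corners n u) l) =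
      ∑ i ∈ Finset.Ico (Nat.nth (TurnsAt n u) k) (Nat.nth (TurnsAt n u) (k + 1)),
        ∑ j ∈ Finset.Ico (Nat.nth (TurnsAt n u) l) (Nat.nth (TurnsAt n u) (l + 1)),
          cross (edgeVec u i) (edgeVec u j) := by
  rw [h.edgeVec_corners, h.edgeVec_corners, cross_sum_left]
  exact Finset.sum_congr rfl fun i _ => cross_sum_right _ _ _

theorem cross_corners_pos (h : CcwPseudotriangle n s₁ s₂ u) {k l : ℕ}
    (H : ∀ i j, Nat.nth (TurnsAt n u) k ≤ i → i < Nat.nth (TurnsAt n u) (k + 1) →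
      Nat.nth (TurnsAt n u) l ≤ j → j < Nat.nth (TurnsAt n u) (l + 1) →
      0 < cross (edgeVec u i) (edgeVec u j)) :
    0 < cross (edgeVec (corners n u) k) (edgeVec (corners n u) l) := by
  rw [h.cross_corners]
  refine Finset.sum_pos (fun i hi => Finset.sum_pos (fun j hj => ?_) ?_) ?_
  · rw [Finset.mem_Ico] at hi hj
    exact H i j hi.1 hi.2 hj.1 hj.2
  · exact Finset.nonempty_Ico.2 (h.nth_lt (Nat.lt_succ_self l))
  · exact Finset.nonempty_Ico.2 (h.nth_lt (Nat.lt_succ_self k))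

theorem cross_corners_neg (h : CcwPseudotriangle n s₁ s₂ u) {k l : ℕ}
    (H : ∀ i j, Nat.nth (TurnsAt n u) k ≤ i → i < Nat.nth (TurnsAt n u) (k + 1) →
      Nat.nth (TurnsAt n u) l ≤ j → j < Nat.nth (TurnsAt n u) (l + 1) →
      cross (edgeVec u i) (edgeVec u j) < 0) :
    cross (edgeVec (corners n u) k) (edgeVec (corners n u) l) < 0 := by
  rw [h.cross_corners]
  refine Finset.sum_neg (fun i hi => Finset.sum_neg (fun j hj => ?_) ?_) ?_
  · rw [Finset.mem_Ico] at hi hj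
    exact H i j hi.1 hi.2 hj.1 hj.2
  · exact Finset.nonempty_Ico.2 (h.nth_lt (Nat.lt_succ_self l))
  · exact Finset.nonempty_Ico.2 (h.nth_lt (Nat.lt_succ_self k))

open Classical in
/-- The vertices at which the boundary of a pseudotriangle turns satisfy the direction
conditions. -/
theorem pseudoChain (h : CcwPseudotriangle n s₁ s₂ u) :
    PseudoChain (corners n u) (Nat.count (TurnsAt n u) s₁) (Nat.count (TurnsAt n u) s₂)
      (Nat.count (TurnsAt n u) n) := by
  have e1 := h.s₁_pos
  have e2 := h.s₁_lt_s₂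
  have e3 := h.s₂_lt
  have n0 : Nat.nth (TurnsAt n u) 0 = 0 := Nat.nth_zero_of_zero h.turnsAt_zero
  have n1 : Nat.nth (TurnsAt n u) (Nat.count (TurnsAt n u) s₁) = s₁ := Nat.nth_count h.turnsAt_s₁
  have n2 : Nat.nth (TurnsAt n u) (Nat.count (TurnsAt n u) s₂) = s₂ := Nat.nth_count h.turnsAt_s₂
  have n3 : Nat.nth (TurnsAt n u) (Nat.count (TurnsAt n u) n) = n := Nat.nth_count h.turnsAt_n
  have c1 : 0 < Nat.count (TurnsAt n u) s₁ := by
    have := Nat.count_strict_mono h.turnsAt_zero e1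
    omega
  have c2 := Nat.count_strict_mono h.turnsAt_s₁ e2
  have c3 := Nat.count_strict_mono h.turnsAt_s₂ e3
  set p := Nat.count (TurnsAt n u) s₁
  set q := Nat.count (TurnsAt n u) s₂
  set m := Nat.count (TurnsAt n u) n
  obtain ⟨x1, x2, x3, x4⟩ := h.cross_edges
  have lo : ∀ {a b i : ℕ}, a ≤ b → Nat.nth (TurnsAt n u) b ≤ i → Nat.nth (TurnsAt n u) a ≤ i :=
    fun hab hi => (h.nth_le hab).trans hi
  have hi : ∀ {a b i : ℕ}, a < b → i < Nat.nth (TurnsAt n u) (a + 1) → i < Nat.nth (TurnsAt n u) b :=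
    fun hab hi => hi.trans_le (h.nth_le hab)
  have neg : ∀ i j, i < j → j < m → ((i < p ∧ j < p) ∨ (p ≤ i ∧ j < q) ∨ q ≤ i) →
      cross (edgeVec (corners n u) i) (edgeVec (corners n u) j) < 0 := by
    intro i j hij hjm hcase
    refine h.cross_corners_neg fun a b ha1 ha2 hb1 hb2 => ?_
    have hbn : b < n := n3 ▸ hi hjm hb2
    have hab : a < Nat.nth (TurnsAt n u) j := hi hij ha2
    have hjn : Nat.nth (TurnsAt n u) j < n := by omega
    have hc : (a < s₁ ∧ b < s₁) ∨ (s₁ ≤ a ∧ b < s₂) ∨ s₂ ≤ a := by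
      rcases hcase with ⟨y1, y2⟩ | ⟨y1, y2⟩ | y1
      · exact Or.inl ⟨n1 ▸ hi y1 ha2, n1 ▸ hi y2 hb2⟩
      · exact Or.inr (Or.inl ⟨n1 ▸ lo y1 ha1, n2 ▸ hi y2 hb2⟩)
      · exact Or.inr (Or.inr (n2 ▸ lo y1 ha1))
    -- The straight vertices after the `j`-th corner leave the angle unchanged, and at the corner
    -- itself it drops strictly. This is what makes the inequalities within a chain strict.
    have hconst : turnAngle u b = turnAngle u (Nat.nth (TurnsAt n u) j) :=
      h.turnAngle_const hb1 fun k k1 k2 => flat_between j k1 (by omega)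
    have hstrict := h.turnAngle_strict hab hjn (by omega) (by omega) (h.nth_turns j)
    rcases x4 a b (by omega) hbn hc (by rw [hconst]; exact hstrict) with y | y
    · exact y
    · omega
  refine ⟨c1, c2, c3, ?_, ?_, ?_, ?_, ?_, ?_, ?_⟩
  · rw [corners, corners, n3, n0, h.simple.p_n]
  · intro i j a b c
    refine h.cross_corners_pos fun i' j' y1 y2 y3 y4 => x1 i' j' ?_ ?_ ?_
    · exact n1 ▸ hi a y2
    · exact n1 ▸ lo b y3
    · exact n2 ▸ hi c y4
  · intro i j a b c d
    refine h.cross_corners_pos fun i' j' y1 y2 y3 y4 => x2 i' j' ?_ ?_ ?_ ?_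
    · exact n1 ▸ lo a y1
    · exact n2 ▸ hi b y2
    · exact n2 ▸ lo c y3
    · exact n3 ▸ hi d y4
  · intro i j a b c
    refine h.cross_corners_pos fun i' j' y1 y2 y3 y4 => x3 i' j' ?_ ?_ ?_
    · exact n2 ▸ lo a y1
    · exact n3 ▸ hi b y2
    · exact n1 ▸ hi c y4
  · exact fun i j a b => neg i j a (by omega) (Or.inl ⟨by omega, b⟩)
  · exact fun i j a b c => neg i j b (by omega) (Or.inr (Or.inl ⟨a, c⟩))
  · exact fun i j a b c => neg i j b c (Or.inr (Or.inr a))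

theorem segment_flat (h : CcwPseudotriangle n s₁ s₂ u) {a b : ℕ} (hab : a < b)
    (hflat : ∀ k, a < k → k < b → ¬ TurnsAt n u k) :
    ⋃ i ∈ Set.Ico a b, segment ℝ (u i) (u (i + 1)) = segment ℝ (u a) (u b) ∧
      ∃ T : ℝ, 0 < T ∧ u b - u a = T • edgeVec u a ∧
        ∃ t : ℝ, 0 ≤ t ∧ edgeVec u (b - 1) = t • edgeVec u a := by
  induction b, hab using Nat.le_induction with
  | base =>
    refine ⟨?_, 1, one_pos, by rw [one_smul]; rfl, 1, zero_le_one, by simp⟩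
    have : Set.Ico a a.succ = {a} := by ext x; simp only [Set.mem_Ico, Set.mem_singleton_iff]; omega
    rw [this]; simp
  | succ b hb ih =>
    have hb : a < b := hb
    obtain ⟨ih1, T, hT, hT2, t, ht, ht2⟩ := ih fun k k1 k2 => hflat k k1 (by omega)
    obtain ⟨c, rfl⟩ : ∃ c, b = c + 1 := ⟨b - 1, by omega⟩
    simp only [Nat.add_sub_cancel] at ht2 ⊢
    obtain ⟨r, hr, hr2⟩ := exists_smul_of_ang_eq_zero (h.simple.edgeVec_ne_zero c)
      (h.turn_flat (hflat (c + 1) (by omega) (by omega)))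
    have e : edgeVec u (c + 1) = (r * t) • edgeVec u a := by rw [hr2, ht2, smul_smul]
    have e' : u (c + 1 + 1) - u (c + 1) = (r * t / T) • (u (c + 1) - u a) := by
      rw [hT2, smul_smul, div_mul_cancel₀ _ hT.ne', ← e]; rfl
    refine ⟨?_, T + r * t, by positivity, ?_, r * t, by positivity, e⟩
    · rw [← segment_union_of_collinear (by positivity) e', ← ih1]
      have : Set.Ico a (c + 1 + 1) = Set.Ico a (c + 1) ∪ {c + 1} := by
        ext x; simp only [Set.mem_Ico, Set.mem_union, Set.mem_singleton_iff]; omega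
      rw [this, Set.biUnion_union, Set.biUnion_singleton]
    · rw [add_smul, ← hT2, ← e, edgeVec]; abel

open Classical in
/-- Vertices with a straight angle do not change the boundary. -/
theorem boundary_corners (h : CcwPseudotriangle n s₁ s₂ u) :
    ⋃ i ∈ Set.Iio n, segment ℝ (u i) (u (i + 1)) =
      ⋃ k ∈ Set.Iio (Nat.count (TurnsAt n u) n),
        segment ℝ (corners n u k) (corners n u (k + 1)) := by
  have n3 : Nat.nth (TurnsAt n u) (Nat.count (TurnsAt n u) n) = n := Nat.nth_count h.turnsAt_n
  have key : ∀ k, ⋃ i ∈ Set.Iio (Nat.nth (TurnsAt n u) k), segment ℝ (u i) (u (i + 1)) =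
      ⋃ j ∈ Set.Iio k, segment ℝ (corners n u j) (corners n u (j + 1)) := by
    intro k
    induction k with
    | zero => simp [Nat.nth_zero_of_zero h.turnsAt_zero]
    | succ k ih =>
      have hlt := h.nth_lt (Nat.lt_succ_self k)
      have s1 : Set.Iio (Nat.nth (TurnsAt n u) (k + 1)) = Set.Iio (Nat.nth (TurnsAt n u) k) ∪
          Set.Ico (Nat.nth (TurnsAt n u) k) (Nat.nth (TurnsAt n u) (k + 1)) :=
        (Set.Iio_union_Ico_eq_Iio hlt.le).symm
      have s2 : Set.Iio (k + 1) = Set.Iio k ∪ {k} := by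
        ext x; simp only [Set.mem_Iio, Set.mem_union, Set.mem_singleton_iff]; omega
      rw [s1, s2, Set.biUnion_union, Set.biUnion_union, ih, Set.biUnion_singleton,
        (h.segment_flat hlt fun i h1 h2 => flat_between k h1 h2).1]
      rfl
  rw [← key, n3]

end CcwPseudotriangle

/-! ## The region of a pseudotriangle -/

/-- The position of `x` relative to the line through the `i`-th edge: positive on the left. -/
def side (w : ℕ → Plane) (i : ℕ) (x : Plane) : ℝ := cross (edgeVec w i) (x - w i)

/-- The points that are on the left of some edge of the chain from `a` to `b`. -/
def chainSide (w : ℕ → Plane) (a b : ℕ) : Set Plane :=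
  {x | ∃ i, a ≤ i ∧ i < b ∧ 0 ≤ side w i x}

/-- The points that are on the left of some edge of each of the three chains. -/
def chainRegion (w : ℕ → Plane) (p q m : ℕ) : Set Plane :=
  chainSide w 0 p ∩ chainSide w p q ∩ chainSide w q m

/-- The union of the edges of a closed chain. -/
def chainBoundary (w : ℕ → Plane) (m : ℕ) : Set Plane :=
  ⋃ k ∈ Set.Iio m, segment ℝ (w k) (w (k + 1))

theorem side_combo (w : ℕ → Plane) (i : ℕ) (x y : Plane) {a b : ℝ} (hab : a + b = 1) :
    side w i (a • x + b • y) = a * side w i x + b * side w i y := by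
  obtain rfl : a = 1 - b := by linarith
  simp only [side, cross, Prod.fst_sub, Prod.snd_sub, Prod.fst_add, Prod.snd_add, Prod.smul_fst,
    Prod.smul_snd, smul_eq_mul]
  ring

theorem side_add (w : ℕ → Plane) (i : ℕ) (x d : Plane) :
    side w i (x + d) = side w i x + cross (edgeVec w i) d := by
  rw [side, side, ← cross_add_right]; congr 1; abel

theorem side_self (w : ℕ → Plane) (i : ℕ) : side w i (w i) = 0 := by
  rw [side, sub_self, cross_zero_right]

theorem side_next (w : ℕ → Plane) (i : ℕ) : side w i (w (i + 1)) = 0 := cross_self_eq_zero _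

theorem side_eq_next (w : ℕ → Plane) (i : ℕ) (x : Plane) :
    side w i x = cross (edgeVec w i) (x - w (i + 1)) := by
  rw [side, show x - w i = (x - w (i + 1)) + edgeVec w i by rw [edgeVec]; abel, cross_add_right,
    cross_self_eq_zero, add_zero]

theorem continuous_side (w : ℕ → Plane) (i : ℕ) : Continuous (side w i) := by
  unfold side cross
  fun_prop

theorem sub_eq_sum_edgeVec (w : ℕ → Plane) {a b : ℕ} (h : a ≤ b) :
    w b - w a = ∑ k ∈ Finset.Ico a b, edgeVec w k := (Finset.sum_Ico_sub w h).symm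

/-- Three chains of edges that are joined cyclically, with the directions of a pseudotriangle. -/
structure ThreeChains (w : ℕ → Plane) (a b a' b' a'' b'' : ℕ) : Prop where
  lt₁ : a < b
  lt₂ : a' < b'
  lt₃ : a'' < b''
  join₁ : w b = w a'
  join₂ : w b' = w a''
  join₃ : w b'' = w a
  pos₁ : ∀ i j, a ≤ i → i < b → a' ≤ j → j < b' → 0 < cross (edgeVec w i) (edgeVec w j)
  pos₂ : ∀ i j, a' ≤ i → i < b' → a'' ≤ j → j < b'' → 0 < cross (edgeVec w i) (edgeVec w j)
  pos₃ : ∀ i j, a'' ≤ i → i < b'' → a ≤ j → j < b → 0 < cross (edgeVec w i) (edgeVec w j)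
  neg₁ : ∀ i j, a ≤ i → i < j → j < b → cross (edgeVec w i) (edgeVec w j) < 0
  neg₂ : ∀ i j, a' ≤ i → i < j → j < b' → cross (edgeVec w i) (edgeVec w j) < 0
  neg₃ : ∀ i j, a'' ≤ i → i < j → j < b'' → cross (edgeVec w i) (edgeVec w j) < 0

namespace ThreeChains

variable {w : ℕ → Plane} {a b a' b' a'' b'' : ℕ}

/-- Everything is proved for the first chain and transferred to the other two by this cyclic
symmetry. -/
theorem rotate (h : ThreeChains w a b a' b' a'' b'') : ThreeChains w a' b' a'' b'' a b :=
  ⟨h.lt₂, h.lt₃, h.lt₁, h.join₂, h.join₃, h.join₁, h.pos₂, h.pos₃, h.pos₁, h.neg₂, h.neg₃, h.neg₁⟩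

/-- The end of the chain is not on the left of any of its edges. -/
theorem side_end (h : ThreeChains w a b a' b' a'' b'') {i : ℕ} (h1 : a ≤ i) (h2 : i < b) :
    side w i (w b) ≤ 0 := by
  rw [side_eq_next, sub_eq_sum_edgeVec w (show i + 1 ≤ b by omega), cross_sum_right]
  refine Finset.sum_nonpos fun k hk => ?_
  rw [Finset.mem_Ico] at hk
  exact (h.neg₁ i k h1 (by omega) hk.2).le

/-- The start of the chain is not on the left of any of its edges. -/
theorem side_start (h : ThreeChains w a b a' b' a'' b'') {i : ℕ} (h1 : a ≤ i) (h2 : i < b) :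
    side w i (w a) ≤ 0 := by
  rw [side, ← neg_sub, sub_eq_sum_edgeVec w h1, cross_neg_right, neg_nonpos, cross_sum_right]
  refine Finset.sum_nonneg fun k hk => ?_
  rw [Finset.mem_Ico] at hk
  rw [cross_comm, neg_nonneg]
  exact (h.neg₁ k i hk.1 hk.2 h2).le

/-- The vertices of a chain are on the left of all edges of the next chain at its start. -/
theorem side_next_chain (h : ThreeChains w a b a' b' a'' b'') {k : ℕ} (h1 : a ≤ k) (h2 : k ≤ b) :
    0 ≤ side w a' (w k) := by
  rw [side, ← h.join₁, ← neg_sub, sub_eq_sum_edgeVec w h2, cross_neg_right, cross_sum_right,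
    ← Finset.sum_neg_distrib]
  refine Finset.sum_nonneg fun j hj => ?_
  rw [Finset.mem_Ico] at hj
  rw [← cross_comm]
  exact (h.pos₁ j a' (by omega) hj.2 le_rfl h.lt₂).le

/-- The vertices of a chain are on the left of the last edge of the previous chain. -/
theorem side_prev_chain (h : ThreeChains w a b a' b' a'' b'') {k : ℕ} (h1 : a ≤ k) (h2 : k ≤ b) :
    0 ≤ side w (b'' - 1) (w k) := by
  have h3 := h.lt₃
  rw [side_eq_next, show b'' - 1 + 1 = b'' by omega, h.join₃, sub_eq_sum_edgeVec w h1,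
    cross_sum_right]
  refine Finset.sum_nonneg fun j hj => ?_
  rw [Finset.mem_Ico] at hj
  exact (h.pos₃ _ j (by omega) (by omega) hj.1 (by omega)).le

theorem edge_subset (h : ThreeChains w a b a' b' a'' b'') {i : ℕ} (h1 : a ≤ i) (h2 : i < b) :
    segment ℝ (w i) (w (i + 1)) ⊆ chainSide w a b ∩ chainSide w a' b' ∩ chainSide w a'' b'' := by
  have h3 := h.lt₃
  rintro x ⟨α, β, hα, hβ, hαβ, rfl⟩
  refine ⟨⟨⟨i, h1, h2, ?_⟩, ⟨a', le_rfl, h.lt₂, ?_⟩⟩, ⟨b'' - 1, by omega, by omega, ?_⟩⟩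
  · rw [side_combo _ _ _ _ hαβ, side_self, side_next]; simp
  · rw [side_combo _ _ _ _ hαβ]
    have := h.side_next_chain h1 h2.le
    have := h.side_next_chain (k := i + 1) (by omega) h2
    positivity
  · rw [side_combo _ _ _ _ hαβ]
    have := h.side_prev_chain h1 h2.le
    have := h.side_prev_chain (k := i + 1) (by omega) h2
    positivity

theorem exists_smul_of_side_eq_zero {w : ℕ → Plane} {i : ℕ} (hne : edgeVec w i ≠ 0) {x : Plane}
    (h : side w i x = 0) : ∃ t : ℝ, x = w i + t • edgeVec w i := by
  have hd := dot_self_pos hne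
  refine ⟨dot (edgeVec w i) (x - w i) / dot (edgeVec w i) (edgeVec w i), ?_⟩
  have ht := div_mul_cancel₀ (dot (edgeVec w i) (x - w i)) hd.ne'
  generalize dot (edgeVec w i) (x - w i) / dot (edgeVec w i) (edgeVec w i) = t at *
  have h0 := hd.ne'
  simp only [side] at h
  generalize edgeVec w i = e at *
  generalize w i = y at *
  simp only [dot, cross, Prod.fst_sub, Prod.snd_sub] at *
  ext
  · apply mul_left_cancel₀ h0
    simp only [Prod.fst_add, Prod.smul_fst, smul_eq_mul]
    linear_combination -e.1 * ht - e.2 * h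
  · apply mul_left_cancel₀ h0
    simp only [Prod.snd_add, Prod.smul_snd, smul_eq_mul]
    linear_combination -e.2 * ht + e.1 * h

theorem edge_ne_zero (h : ThreeChains w a b a' b' a'' b'') {i : ℕ} (h1 : a ≤ i) (h2 : i < b) :
    edgeVec w i ≠ 0 := by
  intro h0
  have := h.pos₁ i a' h1 h2 le_rfl h.lt₂
  rw [h0, cross_zero_left] at this
  exact lt_irrefl _ this

/-- A point of the region that is not on the boundary is strictly on the left of some edge of each
chain. -/
theorem exists_side_pos (h : ThreeChains w a b a' b' a'' b'') {x : Plane}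
    (hx : x ∈ chainSide w a b ∩ chainSide w a' b' ∩ chainSide w a'' b'')
    (hbd : ∀ i, a ≤ i → i < b → x ∉ segment ℝ (w i) (w (i + 1))) :
    ∃ i, a ≤ i ∧ i < b ∧ 0 < side w i x := by
  by_contra hcon
  push Not at hcon
  obtain ⟨⟨⟨k, k1, k2, hk⟩, ⟨j, j1, j2, hj⟩⟩, ⟨l, l1, l2, hl⟩⟩ := hx
  -- The point lies on the line of the edge `k`. Beyond an inner vertex of the chain it would be
  -- strictly on the left of the neighbouring edge. Beyond an end of the chain it would be strictly
  -- on the right of the edge `l` or `j` that has it on the left. On the edge itself it would be a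
  -- boundary point.
  obtain ⟨t, ht⟩ := exists_smul_of_side_eq_zero (h.edge_ne_zero k1 k2) (le_antisymm (hcon k k1 k2) hk)
  have ht' : x = w (k + 1) + (t - 1) • edgeVec w k := by
    rw [ht]; simp only [edgeVec]; module
  rcases lt_or_ge t 0 with ht0 | ht0
  · rcases k1.eq_or_lt with rfl | hak
    · have := h.rotate.rotate.side_end l1 l2
      have hs : side w l x = side w l (w b'') + t * cross (edgeVec w l) (edgeVec w a) := by
        rw [ht, h.join₃, side_add, cross_smul_right]
      nlinarith [h.pos₃ l a l1 l2 le_rfl k2]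
    · have hs : side w (k - 1) x = t * cross (edgeVec w (k - 1)) (edgeVec w k) := by
        rw [ht, side_add, cross_smul_right]
        have := side_next w (k - 1)
        rw [show k - 1 + 1 = k by omega] at this
        rw [this, zero_add]
      nlinarith [h.neg₁ (k - 1) k (by omega) (by omega) k2, hcon (k - 1) (by omega) (by omega)]
  · rcases le_or_gt t 1 with ht1 | ht1
    · refine hbd k k1 k2 ⟨1 - t, t, by linarith, ht0, by ring, ?_⟩
      rw [ht]; simp only [edgeVec]; module
    · rcases Nat.lt_or_ge (k + 1) b with hkb | hkb
      · have hs : side w (k + 1) x = (t - 1) * cross (edgeVec w (k + 1)) (edgeVec w k) := by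
          rw [ht', side_add, cross_smul_right, side_self, zero_add]
        rw [cross_comm] at hs
        nlinarith [h.neg₁ k (k + 1) k1 (by omega) hkb, hcon (k + 1) (by omega) hkb]
      · obtain rfl : b = k + 1 := by omega
        have := h.rotate.side_start j1 j2
        have hs : side w j x = side w j (w a') + (t - 1) * cross (edgeVec w j) (edgeVec w k) := by
          rw [ht', h.join₁, side_add, cross_smul_right]
        rw [cross_comm] at hs
        nlinarith [h.pos₁ k j k1 k2 j1 j2]

/-- From a point on the right of all edges of a chain one can escape to infinity. -/
theorem exists_ray (h : ThreeChains w a b a' b' a'' b'') {x : Plane} (hx : x ∉ chainSide w a b) :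
    ∃ d : Plane, d ≠ 0 ∧ ∀ t : ℝ, 0 ≤ t → x + t • d ∉ chainSide w a b := by
  -- All edges of the chain turn left into the first edge of the next chain, so moving against that
  -- edge decreases all the functions `side w i` of the chain at once.
  refine ⟨-edgeVec w a', neg_ne_zero.2 (h.rotate.edge_ne_zero le_rfl h.lt₂), fun t ht => ?_⟩
  rintro ⟨i, i1, i2, hi⟩
  apply hx
  refine ⟨i, i1, i2, ?_⟩
  rw [side_add, cross_smul_right, cross_neg_right] at hi
  nlinarith [h.pos₁ i a' i1 i2 le_rfl h.lt₂]

end ThreeChains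

/-- Three half planes whose normals positively span the plane have a bounded intersection. -/
theorem isBounded_three_halfplanes {u v w : Plane} (huv : 0 < cross u v) (hvw : 0 < cross v w)
    (hwu : 0 < cross w u) (α β γ : ℝ) :
    Bornology.IsBounded {x : Plane | α ≤ cross u x ∧ β ≤ cross v x ∧ γ ≤ cross w x} := by
  set M := -(cross w u * β + cross u v * γ) / cross v w with hM
  set N := -(cross v w * α + cross u v * γ) / cross w u with hN
  have hcomp : IsCompact ((fun z : ℝ × ℝ => (1 / cross u v) • (z.1 • v - z.2 • u)) ''
      (Set.Icc α M ×ˢ Set.Icc β N)) := by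
    refine (isCompact_Icc.prod isCompact_Icc).image ?_
    fun_prop
  refine hcomp.isBounded.subset ?_
  rintro x ⟨h1, h2, h3⟩
  -- A linear relation with positive coefficients: lower bounds for all three forms give an upper
  -- bound for each of them.
  have hid : cross v w * cross u x + cross w u * cross v x + cross u v * cross w x = 0 := by
    simp only [cross]; ring
  refine ⟨(cross u x, cross v x), ⟨⟨h1, ?_⟩, ⟨h2, ?_⟩⟩, ?_⟩
  · rw [hM, le_div_iff₀ hvw]
    nlinarith [mul_le_mul_of_nonneg_left h2 hwu.le, mul_le_mul_of_nonneg_left h3 huv.le]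
  · rw [hN, le_div_iff₀ hwu]
    nlinarith [mul_le_mul_of_nonneg_left h1 hvw.le, mul_le_mul_of_nonneg_left h3 huv.le]
  · have h0 := huv.ne'
    ext
    · simp only [Prod.smul_fst, Prod.fst_sub, smul_eq_mul]
      field_simp
      simp only [cross]; ring
    · simp only [Prod.smul_snd, Prod.snd_sub, smul_eq_mul]
      field_simp
      simp only [cross]; ring

theorem isClosed_chainSide (w : ℕ → Plane) (a b : ℕ) : IsClosed (chainSide w a b) := by
  have : chainSide w a b = ⋃ i ∈ Set.Ico a b, {x | 0 ≤ side w i x} := by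
    ext x; simp [chainSide, and_assoc]
  rw [this]
  exact (Set.finite_Ico a b).isClosed_biUnion fun i _ =>
    isClosed_le continuous_const (continuous_side w i)

theorem isOpen_side_pos (w : ℕ → Plane) (a b : ℕ) :
    IsOpen {x | ∃ i, a ≤ i ∧ i < b ∧ 0 < side w i x} := by
  have : {x | ∃ i, a ≤ i ∧ i < b ∧ 0 < side w i x} = ⋃ i ∈ Set.Ico a b, {x | 0 < side w i x} := by
    ext x; simp [and_assoc]
  rw [this]
  exact isOpen_biUnion fun i _ => isOpen_lt continuous_const (continuous_side w i)

namespace PseudoChain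

variable {w : ℕ → Plane} {p q m : ℕ}

theorem threeChains (h : PseudoChain w p q m) : ThreeChains w 0 p p q q m :=
  ⟨h.p_pos, h.p_lt_q, h.q_lt_m, rfl, rfl, h.closed, fun i j _ => h.ab i j, h.bc,
    fun i j a b _ => h.ca i j a b, fun i j _ => h.aa i j, h.bb, h.cc⟩

theorem boundary_subset (h : PseudoChain w p q m) : chainBoundary w m ⊆ chainRegion w p q m := by
  intro x hx
  simp only [chainBoundary, Set.mem_iUnion, Set.mem_Iio] at hx
  obtain ⟨k, hk, hx⟩ := hx
  rcases Nat.lt_or_ge k p with h1 | h1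
  · exact h.threeChains.edge_subset (Nat.zero_le _) h1 hx
  · rcases Nat.lt_or_ge k q with h2 | h2
    · obtain ⟨⟨x1, x2⟩, x3⟩ := h.threeChains.rotate.edge_subset h1 h2 hx
      exact ⟨⟨x3, x1⟩, x2⟩
    · obtain ⟨⟨x1, x2⟩, x3⟩ := h.threeChains.rotate.rotate.edge_subset h2 hk hx
      exact ⟨⟨x2, x3⟩, x1⟩

theorem isBounded_region (h : PseudoChain w p q m) : Bornology.IsBounded (chainRegion w p q m) := by
  have hsub : chainRegion w p q m ⊆ ⋃ i ∈ Set.Iio p, ⋃ j ∈ Set.Ico p q, ⋃ k ∈ Set.Ico q m,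
      {x | 0 ≤ side w i x ∧ 0 ≤ side w j x ∧ 0 ≤ side w k x} := by
    rintro x ⟨⟨⟨i, _, i2, hi⟩, ⟨j, j1, j2, hj⟩⟩, ⟨k, k1, k2, hk⟩⟩
    simp only [Set.mem_iUnion]
    exact ⟨i, i2, j, ⟨j1, j2⟩, k, ⟨k1, k2⟩, hi, hj, hk⟩
  refine Bornology.IsBounded.subset ?_ hsub
  refine (Bornology.isBounded_biUnion (Set.finite_Iio p)).2 fun i hi => ?_
  refine (Bornology.isBounded_biUnion (Set.finite_Ico p q)).2 fun j hj => ?_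
  refine (Bornology.isBounded_biUnion (Set.finite_Ico q m)).2 fun k hk => ?_
  refine (isBounded_three_halfplanes (h.ab i j hi hj.1 hj.2) (h.bc j k hj.1 hj.2 hk.1 hk.2)
    (h.ca k i hk.1 hk.2 hi) (cross (edgeVec w i) (w i)) (cross (edgeVec w j) (w j))
    (cross (edgeVec w k) (w k))).subset ?_
  rintro x ⟨h1, h2, h3⟩
  simp only [side, cross_sub_right] at h1 h2 h3
  exact ⟨by linarith, by linarith, by linarith⟩

theorem exists_escape (h : PseudoChain w p q m) {x : Plane} (hx : x ∉ chainRegion w p q m) :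
    ∃ d : Plane, d ≠ 0 ∧ ∀ t : ℝ, 0 ≤ t → x + t • d ∉ chainRegion w p q m := by
  by_cases h1 : x ∈ chainSide w 0 p
  · by_cases h2 : x ∈ chainSide w p q
    · have h3 : x ∉ chainSide w q m := fun h3 => hx ⟨⟨h1, h2⟩, h3⟩
      obtain ⟨d, hd, hr⟩ := h.threeChains.rotate.rotate.exists_ray h3
      exact ⟨d, hd, fun t ht hmem => hr t ht hmem.2⟩
    · obtain ⟨d, hd, hr⟩ := h.threeChains.rotate.exists_ray h2
      exact ⟨d, hd, fun t ht hmem => hr t ht hmem.1.2⟩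
  · obtain ⟨d, hd, hr⟩ := h.threeChains.exists_ray h1
    exact ⟨d, hd, fun t ht hmem => hr t ht hmem.1.1⟩

/-- The closed region bounded by the chains. -/
theorem region_eq (h : PseudoChain w p q m) :
    chainBoundary w m ∪ {x | x ∉ chainBoundary w m ∧
      Bornology.IsBounded (connectedComponentIn (chainBoundary w m)ᶜ x)} = chainRegion w p q m := by
  set B := chainBoundary w m with hB
  set R := chainRegion w p q m with hR
  have hBR : B ⊆ R := h.boundary_subset
  have hclosed : IsClosed R :=
    ((isClosed_chainSide w 0 p).inter (isClosed_chainSide w p q)).inter (isClosed_chainSide w q m)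
  set U : Set Plane := {x | ∃ i, 0 ≤ i ∧ i < p ∧ 0 < side w i x} ∩
    {x | ∃ i, p ≤ i ∧ i < q ∧ 0 < side w i x} ∩ {x | ∃ i, q ≤ i ∧ i < m ∧ 0 < side w i x} with hU
  have hUopen : IsOpen U :=
    ((isOpen_side_pos w 0 p).inter (isOpen_side_pos w p q)).inter (isOpen_side_pos w q m)
  have hUR : U ⊆ R := by
    rintro x ⟨⟨⟨i, i1, i2, hi⟩, ⟨j, j1, j2, hj⟩⟩, ⟨k, k1, k2, hk⟩⟩
    exact ⟨⟨⟨i, i1, i2, hi.le⟩, ⟨j, j1, j2, hj.le⟩⟩, ⟨k, k1, k2, hk.le⟩⟩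
  -- Off the boundary, the closed set `R` coincides with the open set `U`. A component of the
  -- complement of the boundary that meets `R` therefore stays in `R`, which is bounded.
  have hRU : ∀ x ∈ R, x ∉ B → x ∈ U := by
    intro x hx hxB
    have hbd : ∀ i, i < m → x ∉ segment ℝ (w i) (w (i + 1)) := fun i hi hmem =>
      hxB (Set.mem_biUnion (show i ∈ Set.Iio m from hi) hmem)
    have h2 := h.p_lt_q
    have h3 := h.q_lt_m
    refine ⟨⟨?_, ?_⟩, ?_⟩
    · exact h.threeChains.exists_side_pos hx fun i _ hi => hbd i (by omega)
    · exact h.threeChains.rotate.exists_side_pos ⟨⟨hx.1.2, hx.2⟩, hx.1.1⟩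
        fun i _ hi => hbd i (by omega)
    · exact h.threeChains.rotate.rotate.exists_side_pos ⟨⟨hx.2, hx.1.1⟩, hx.1.2⟩
        fun i _ hi => hbd i (by omega)
  apply Set.Subset.antisymm
  · rintro x (hx | ⟨hxB, hbdd⟩)
    · exact hBR hx
    · by_contra hxR
      -- The ray avoids `R` and hence the boundary, so the component of `x` would be unbounded.
      obtain ⟨d, hd, hray⟩ := h.exists_escape hxR
      set ray : Set Plane := (fun t : ℝ => x + t • d) '' Set.Ici 0 with hraydef
      have hconn : IsPreconnected ray :=
        isPreconnected_Ici.image _ (by fun_prop)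
      have hsub : ray ⊆ connectedComponentIn Bᶜ x := by
        refine hconn.subset_connectedComponentIn ⟨0, Set.self_mem_Ici, by simp⟩ ?_
        rintro _ ⟨t, ht, rfl⟩ hmem
        exact hray t ht (hBR hmem)
      obtain ⟨C, hC⟩ := isBounded_iff_forall_norm_le.1 (hbdd.subset hsub)
      have hdn : 0 < ‖d‖ := norm_pos_iff.2 hd
      have hC0 : 0 ≤ C := (norm_nonneg _).trans (hC x ⟨0, Set.self_mem_Ici, by simp⟩)
      have hT : 0 ≤ (C + ‖x‖ + 1) / ‖d‖ := by positivity
      have h1 := hC _ ⟨(C + ‖x‖ + 1) / ‖d‖, hT, rfl⟩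
      have h2 : ‖((C + ‖x‖ + 1) / ‖d‖) • d‖ = C + ‖x‖ + 1 := by
        rw [norm_smul, Real.norm_of_nonneg hT, div_mul_cancel₀ _ hdn.ne']
      have h3 := norm_sub_le (x + ((C + ‖x‖ + 1) / ‖d‖) • d) x
      rw [add_sub_cancel_left, h2] at h3
      linarith
  · intro x hx
    by_cases hxB : x ∈ B
    · exact Or.inl hxB
    · refine Or.inr ⟨hxB, ?_⟩
      refine h.isBounded_region.subset (Set.Subset.trans ?_ hUR)
      have hmem : x ∈ connectedComponentIn Bᶜ x := mem_connectedComponentIn hxB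
      refine isPreconnected_connectedComponentIn.subset_left_of_subset_union hUopen
        hclosed.isOpen_compl ?_ ?_ ⟨x, hmem, hRU x hx hxB⟩
      · exact Set.disjoint_left.2 fun y hy hy' => hy' (hUR hy)
      · intro y hy
        by_cases hyR : y ∈ R
        · exact Or.inl (hRU y hyR (connectedComponentIn_subset _ _ hy))
        · exact Or.inr hyR

end PseudoChain

/-! ## Funnels -/

/-- The position of `x` relative to the `i`-th line of the left chain of a funnel: it is nonnegative
on the side of the interior. -/
def leftSide (L : ℕ → Plane) (i : ℕ) (x : Plane) : ℝ := cross (edgeVec L i) (x - L i)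

/-- The position of `x` relative to the `j`-th line of the right chain of a funnel: it is
nonnegative on the side of the interior. -/
def rightSide (R : ℕ → Plane) (j : ℕ) (x : Plane) : ℝ := -cross (edgeVec R j) (x - R j)

/-- The height of `x` above the line through `A` with direction `D`. -/
def height (A D x : Plane) : ℝ := cross D (x - A)

theorem leftSide_combo (L : ℕ → Plane) (i : ℕ) (x d : Plane) :
    leftSide L i (x + d) = leftSide L i x + cross (edgeVec L i) d := side_add L i x d

theorem rightSide_combo (R : ℕ → Plane) (j : ℕ) (x d : Plane) :
    rightSide R j (x + d) = rightSide R j x - cross (edgeVec R j) d := by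
  have := side_add R j x d
  simp only [side] at this
  rw [rightSide, rightSide, this]; ring

theorem height_add (A D x d : Plane) : height A D (x + d) = height A D x + cross D d := by
  rw [height, height, ← cross_add_right]; congr 1; abel

/-- A funnel: two chains of edges that go down from a common apex, both bent away from each other,
and the line through `A` with direction `D` below them. -/
structure Funnel (L R : ℕ → Plane) (nl nr : ℕ) (A D : Plane) : Prop where
  nl_pos : 0 < nl
  nr_pos : 0 < nr
  apex : L 0 = R 0
  lr : ∀ i j, i < nl → j < nr → 0 < cross (edgeVec L i) (edgeVec R j)
  ll : ∀ i k, i < k → k < nl → cross (edgeVec L i) (edgeVec L k) < 0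
  rr : ∀ j k, j < k → k < nr → 0 < cross (edgeVec R j) (edgeVec R k)
  lD : ∀ i, i < nl → 0 < cross (edgeVec L i) D
  rD : ∀ j, j < nr → 0 < cross (edgeVec R j) D
  hL : ∀ i, i < nl → 0 ≤ height A D (L i)
  hR : ∀ j, j < nr → 0 ≤ height A D (R j)
  h_apex : 0 < height A D (L 0)

/-- Reflection in the vertical axis. -/
def mirror (x : Plane) : Plane := (-x.1, x.2)

theorem mirror_sub (x y : Plane) : mirror x - mirror y = mirror (x - y) := by
  ext <;> simp [mirror]; ring

theorem mirror_add (x y : Plane) : mirror x + mirror y = mirror (x + y) := by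
  ext <;> simp [mirror]; ring

theorem mirror_smul (r : ℝ) (x : Plane) : r • mirror x = mirror (r • x) := by
  ext <;> simp [mirror]

theorem mirror_mirror (x : Plane) : mirror (mirror x) = x := by ext <;> simp [mirror]

theorem mirror_inj {x y : Plane} (h : mirror x = mirror y) : x = y := by
  rw [← mirror_mirror x, h, mirror_mirror]

theorem cross_mirror (x y : Plane) : cross (mirror x) (mirror y) = -cross x y := by
  simp [cross, mirror]; ring

theorem edgeVec_mirror (L : ℕ → Plane) (i : ℕ) :
    edgeVec (fun k => mirror (L k)) i = mirror (edgeVec L i) := mirror_sub _ _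

theorem leftSide_mirror (L : ℕ → Plane) (i : ℕ) (x : Plane) :
    leftSide (fun k => mirror (L k)) i (mirror x) = rightSide L i x := by
  rw [leftSide, rightSide, edgeVec_mirror, mirror_sub, cross_mirror]

theorem rightSide_mirror (L : ℕ → Plane) (i : ℕ) (x : Plane) :
    rightSide (fun k => mirror (L k)) i (mirror x) = leftSide L i x := by
  rw [leftSide, rightSide, edgeVec_mirror, mirror_sub, cross_mirror, neg_neg]

theorem height_mirror (A D x : Plane) :
    height (mirror A) (-mirror D) (mirror x) = height A D x := by
  rw [height, height, mirror_sub, cross_neg_left, cross_mirror, neg_neg]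

namespace Funnel

variable {L R : ℕ → Plane} {nl nr : ℕ} {A D : Plane}

/-- Reflection exchanges the two chains; changing the sign of the direction as well preserves
heights. Statements about one chain are carried over to the other in this way. -/
theorem mirror (h : Funnel L R nl nr A D) :
    Funnel (fun k => mirror (R k)) (fun k => mirror (L k)) nr nl (mirror A) (-mirror D) where
  nl_pos := h.nr_pos
  nr_pos := h.nl_pos
  apex := by rw [h.apex]
  lr i j hi hj := by
    rw [edgeVec_mirror, edgeVec_mirror, cross_mirror, ← cross_comm]; exact h.lr j i hj hi
  ll i k hik hk := by
    rw [edgeVec_mirror, edgeVec_mirror, cross_mirror, neg_lt_zero]; exact h.rr i k hik hk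
  rr i k hik hk := by
    rw [edgeVec_mirror, edgeVec_mirror, cross_mirror, neg_pos]; exact h.ll i k hik hk
  lD i hi := by rw [edgeVec_mirror, cross_neg_right, cross_mirror, neg_neg]; exact h.rD i hi
  rD i hi := by rw [edgeVec_mirror, cross_neg_right, cross_mirror, neg_neg]; exact h.lD i hi
  hL i hi := by rw [height_mirror]; exact h.hR i hi
  hR i hi := by rw [height_mirror]; exact h.hL i hi
  h_apex := by rw [height_mirror, ← h.apex]; exact h.h_apex

/-- Cramer's rule: the signs of two cross products tell in which of the four sectors between the
lines along `u` and `v` the vector `d` lies. -/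
theorem wedge {u v d : Plane} (huv : 0 < cross u v) :
    d = (cross d v / cross u v) • u + (cross u d / cross u v) • v := by
  have h0 := huv.ne'
  ext
  · simp only [Prod.fst_add, Prod.smul_fst, smul_eq_mul]
    field_simp
    simp only [cross]; ring
  · simp only [Prod.snd_add, Prod.smul_snd, smul_eq_mul]
    field_simp
    simp only [cross]; ring

theorem rightSide_eq_next (R : ℕ → Plane) (j : ℕ) (x : Plane) :
    rightSide R j x = -cross (edgeVec R j) (x - R (j + 1)) := by
  have := side_eq_next R j x
  rw [side] at this
  rw [rightSide, this]

/-- A point beyond the `j`-th line of the right chain, but not beyond the next one, lies below their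
common vertex. -/
theorem right_lower (h : Funnel L R nl nr A D) {j : ℕ} (hj : j + 1 < nr) {x : Plane}
    (h1 : rightSide R j x < 0) (h2 : 0 ≤ rightSide R (j + 1) x) :
    ∃ s t : ℝ, 0 ≤ s ∧ 0 < t ∧ x = R (j + 1) + (s • edgeVec R j + t • edgeVec R (j + 1)) := by
  have hrr := h.rr j (j + 1) (by omega) hj
  rw [rightSide_eq_next] at h1
  rw [rightSide] at h2
  refine ⟨_, _, ?_, ?_, by rw [← wedge (d := x - R (j + 1)) hrr]; abel⟩
  · refine div_nonneg ?_ hrr.le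
    rw [cross_comm]; exact h2
  · exact div_pos (by linarith) hrr

/-- A point beyond a line of the right chain, but not beyond the previous one, lies above their
common vertex. -/
theorem right_upper (h : Funnel L R nl nr A D) {j : ℕ} (hj : j + 1 < nr) {x : Plane}
    (h1 : 0 ≤ rightSide R j x) (h2 : rightSide R (j + 1) x < 0) :
    height A D (R (j + 1)) < height A D x := by
  have hrr := h.rr j (j + 1) (by omega) hj
  rw [rightSide_eq_next] at h1
  rw [rightSide] at h2
  have e := wedge (d := x - R (j + 1)) hrr
  have h3 : x = R (j + 1) + (x - R (j + 1)) := by abel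
  rw [h3, height_add, e, cross_add_right, cross_smul_right, cross_smul_right]
  have a1 : cross (x - R (j + 1)) (edgeVec R (j + 1)) / cross (edgeVec R j) (edgeVec R (j + 1)) < 0 := by
    refine div_neg_of_neg_of_pos ?_ hrr
    rw [cross_comm]; exact h2
  have a2 : cross (edgeVec R j) (x - R (j + 1)) / cross (edgeVec R j) (edgeVec R (j + 1)) ≤ 0 :=
    div_nonpos_of_nonpos_of_nonneg (by linarith) hrr.le
  have d1 := h.rD j (by omega)
  have d2 := h.rD (j + 1) hj
  rw [cross_comm] at d1 d2
  nlinarith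

theorem height_R_le (h : Funnel L R nl nr A D) {j k : ℕ} (hjk : j ≤ k) (hk : k ≤ nr) :
    height A D (R k) ≤ height A D (R j) := by
  induction k, hjk using Nat.le_induction with
  | base => exact le_rfl
  | succ k hjk ih =>
    have d := h.rD k (by omega)
    have e : R (k + 1) = R k + edgeVec R k := by simp [edgeVec]
    rw [e, height_add, cross_comm]
    linarith [ih (by omega)]

theorem height_L_le (h : Funnel L R nl nr A D) {j k : ℕ} (hjk : j ≤ k) (hk : k ≤ nl) :
    height A D (L k) ≤ height A D (L j) := by
  have := h.mirror.height_R_le hjk hk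
  rwa [height_mirror, height_mirror] at this

theorem right_lower_height (h : Funnel L R nl nr A D) {j : ℕ} (hj : j + 1 < nr) {x : Plane}
    (h1 : rightSide R j x < 0) (h2 : 0 ≤ rightSide R (j + 1) x) :
    height A D x ≤ height A D (R (j + 1)) := by
  obtain ⟨s, t, hs, ht, rfl⟩ := h.right_lower hj h1 h2
  have d1 := h.rD j (by omega)
  have d2 := h.rD (j + 1) hj
  rw [cross_comm] at d1 d2
  rw [height_add, cross_add_right, cross_smul_right, cross_smul_right]
  nlinarith

theorem left_lower (h : Funnel L R nl nr A D) {i : ℕ} (hi : i + 1 < nl) {x : Plane}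
    (h1 : leftSide L i x < 0) (h2 : 0 ≤ leftSide L (i + 1) x) :
    ∃ s t : ℝ, 0 ≤ s ∧ 0 < t ∧ x = L (i + 1) + (s • edgeVec L i + t • edgeVec L (i + 1)) := by
  obtain ⟨s, t, hs, ht, e⟩ := h.mirror.right_lower hi (x := _root_.mirror x)
    (by rwa [rightSide_mirror]) (by rwa [rightSide_mirror])
  refine ⟨s, t, hs, ht, mirror_inj ?_⟩
  rw [e, edgeVec_mirror, edgeVec_mirror, mirror_smul, mirror_smul, mirror_add, mirror_add]

theorem left_upper (h : Funnel L R nl nr A D) {i : ℕ} (hi : i + 1 < nl) {x : Plane}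
    (h1 : 0 ≤ leftSide L i x) (h2 : leftSide L (i + 1) x < 0) :
    height A D (L (i + 1)) < height A D x := by
  have := h.mirror.right_upper hi (x := _root_.mirror x)
    (by rwa [rightSide_mirror]) (by rwa [rightSide_mirror])
  rwa [height_mirror, height_mirror] at this

/-- Every right edge leads towards the inner side of every left line, so a visible vertex of the
right chain stays visible further down. -/
theorem leftSide_R_succ (h : Funnel L R nl nr A D) {i j : ℕ} (hi : i < nl) (hj : j < nr)
    (h0 : 0 ≤ leftSide L i (R j)) : 0 ≤ leftSide L i (R (j + 1)) := by
  have e : R (j + 1) = R j + edgeVec R j := by simp [edgeVec]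
  rw [e, leftSide_combo]
  linarith [h.lr i j hi hj]

theorem rightSide_L_succ (h : Funnel L R nl nr A D) {i j : ℕ} (hi : i < nl) (hj : j < nr)
    (h0 : 0 ≤ rightSide R j (L i)) : 0 ≤ rightSide R j (L (i + 1)) := by
  have e : L (i + 1) = L i + edgeVec L i := by simp [edgeVec]
  rw [e, rightSide_combo, cross_comm]
  linarith [h.lr i j hi hj]

/-- Two tangents that start at mutually visible vertices cannot both pass below the other one. -/
theorem not_both_hidden (h : Funnel L R nl nr A D) {a b : ℕ} (ha : a + 1 < nl) (hb : b + 1 < nr)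
    (h1 : 0 ≤ rightSide R b (L (a + 1))) (h2 : 0 ≤ leftSide L a (R (b + 1)))
    (h3 : leftSide L (a + 1) (R (b + 1)) < 0) : 0 ≤ rightSide R (b + 1) (L (a + 1)) := by
  by_contra hcon
  push Not at hcon
  -- Each of the two failures places one of the vertices `L (a + 1)`, `R (b + 1)` strictly above the
  -- other.
  have x1 := h.right_upper hb h1 hcon
  have x2 := h.left_upper ha h2 h3
  linarith

end Funnel

/-! ### The greedy walk down a funnel -/

/-- What the greedy walk does at the state `(a, b)`, in which `a` left and `b` right edges have been
passed: `1` if it passes the next right edge, `2` if it passes the next left edge, `0` if it passes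
both, because these two edges see each other completely. -/
noncomputable def greedyKind (L R : ℕ → Plane) (nl nr a b : ℕ) : ℕ :=
  open Classical in
  if nl ≤ a then 1 else if nr ≤ b then 2 else if leftSide L a (R b) < 0 then 1 else
    if rightSide R b (L a) < 0 then 2 else 0

/-- The states of the greedy walk. -/
noncomputable def greedyWalk (L R : ℕ → Plane) (nl nr : ℕ) : ℕ → ℕ × ℕ
  | 0 => (0, 0)
  | t + 1 =>
    let c := greedyWalk L R nl nr t
    let k := greedyKind L R nl nr c.1 c.2
    (if k = 1 then c.1 else c.1 + 1, if k = 2 then c.2 else c.2 + 1)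

/-- The state of the greedy walk after `N` steps is the first in which all edges are passed. -/
structure GreedyEnd (L R : ℕ → Plane) (nl nr N : ℕ) : Prop where
  last : greedyWalk L R nl nr N = (nl, nr)
  not_last : ∀ t < N, greedyWalk L R nl nr t ≠ (nl, nr)

namespace Funnel

variable {L R : ℕ → Plane} {nl nr : ℕ} {A D : Plane}

theorem greedyKind_cases (L R : ℕ → Plane) (nl nr a b : ℕ) :
    (nl ≤ a ∧ greedyKind L R nl nr a b = 1) ∨
    (a < nl ∧ nr ≤ b ∧ greedyKind L R nl nr a b = 2) ∨
    (a < nl ∧ b < nr ∧ leftSide L a (R b) < 0 ∧ greedyKind L R nl nr a b = 1) ∨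
    (a < nl ∧ b < nr ∧ 0 ≤ leftSide L a (R b) ∧ rightSide R b (L a) < 0 ∧
      greedyKind L R nl nr a b = 2) ∨
    (a < nl ∧ b < nr ∧ 0 ≤ leftSide L a (R b) ∧ 0 ≤ rightSide R b (L a) ∧
      greedyKind L R nl nr a b = 0) := by
  unfold greedyKind
  split_ifs with h1 h2 h3 h4
  · exact Or.inl ⟨h1, rfl⟩
  · exact Or.inr (Or.inl ⟨not_le.1 h1, h2, rfl⟩)
  · exact Or.inr (Or.inr (Or.inl ⟨not_le.1 h1, not_le.1 h2, h3, rfl⟩))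
  · exact Or.inr (Or.inr (Or.inr (Or.inl ⟨not_le.1 h1, not_le.1 h2, not_lt.1 h3, h4, rfl⟩)))
  · exact Or.inr (Or.inr (Or.inr (Or.inr
      ⟨not_le.1 h1, not_le.1 h2, not_lt.1 h3, not_lt.1 h4, rfl⟩)))

/-- What is known about the states of the greedy walk after the first step. -/
structure WalkInv (L R : ℕ → Plane) (nl nr a b : ℕ) : Prop where
  a_pos : 0 < a
  b_pos : 0 < b
  a_le : a ≤ nl
  b_le : b ≤ nr
  left : a < nl → 0 ≤ rightSide R (b - 1) (L a)
  right : b < nr → 0 ≤ leftSide L (a - 1) (R b)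

/-- One step of the greedy walk: the new state, and why the newly passed edges see the other current
edge. -/
theorem walk_step (h : Funnel L R nl nr A D) {a b : ℕ} (hinv : (a = 0 ∧ b = 0) ∨ WalkInv L R nl nr a b)
    (hne : (a, b) ≠ (nl, nr)) {k a' b' : ℕ} (hk : greedyKind L R nl nr a b = k)
    (ha' : a' = if k = 1 then a else a + 1) (hb' : b' = if k = 2 then b else b + 1) :
    WalkInv L R nl nr a' b' ∧ (k ≠ 2 → 0 ≤ leftSide L (a' - 1) (R b)) ∧
      (k ≠ 1 → 0 ≤ rightSide R (b' - 1) (L a)) := by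
  rcases hinv with ⟨rfl, rfl⟩ | hinv
  · have hl := h.nl_pos
    have hr := h.nr_pos
    -- Both chains start at the apex, where the two tests yield 0, so the first step always passes
    -- both edges.
    have z1 : leftSide L 0 (R 0) = 0 := by rw [leftSide, h.apex, sub_self, cross_zero_right]
    have z2 : rightSide R 0 (L 0) = 0 := by rw [rightSide, h.apex, sub_self, cross_zero_right, neg_zero]
    rcases greedyKind_cases L R nl nr 0 0 with c | c | c | c | c
    · omega
    · omega
    · exact absurd c.2.2.1 (by rw [z1]; exact lt_irrefl _)
    · exact absurd c.2.2.2.1 (by rw [z2]; exact lt_irrefl _)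
    · obtain ⟨-, -, -, -, c⟩ := c
      obtain rfl : k = 0 := hk ▸ c
      simp only [zero_add] at ha' hb'
      rw [if_neg (by omega)] at ha' hb'
      subst ha' hb'
      exact ⟨⟨one_pos, one_pos, hl, hr, fun _ => h.rightSide_L_succ hl hr z2.ge,
        fun _ => h.leftSide_R_succ hl hr z1.ge⟩, fun _ => z1.ge, fun _ => z2.ge⟩
  · obtain ⟨p1, p2, p3, p4, p5, p6⟩ := hinv
    obtain ⟨a, rfl⟩ : ∃ x, a = x + 1 := ⟨a - 1, by omega⟩
    obtain ⟨b, rfl⟩ : ∃ x, b = x + 1 := ⟨b - 1, by omega⟩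
    simp only [Nat.add_sub_cancel] at p5 p6
    rcases greedyKind_cases L R nl nr (a + 1) (b + 1) with c | c | c | c | c
    · obtain ⟨c1, c2⟩ := c
      obtain rfl : k = 1 := hk ▸ c2
      have hb : b + 1 < nr := by
        rcases p4.lt_or_eq with x | x
        · exact x
        · exact absurd (Prod.ext (le_antisymm p3 c1) x) hne
      simp only [if_true, if_neg (show (1 : ℕ) ≠ 2 by omega)] at ha' hb'
      subst ha' hb'
      refine ⟨⟨p1, by omega, p3, hb, fun x => by omega, fun x => ?_⟩, fun _ => p6 hb,
        fun x => absurd rfl x⟩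
      exact h.leftSide_R_succ (by omega) hb (p6 hb)
    · obtain ⟨c0, c1, c2⟩ := c
      obtain rfl : k = 2 := hk ▸ c2
      simp only [if_true, if_neg (show (2 : ℕ) ≠ 1 by omega)] at ha' hb'
      subst ha' hb'
      refine ⟨⟨by omega, p2, c0, p4, fun x => ?_, fun x => by omega⟩, fun x => absurd rfl x,
        fun _ => p5 c0⟩
      exact h.rightSide_L_succ c0 (by omega) (p5 c0)
    · obtain ⟨ca, cb, c1, c2⟩ := c
      obtain rfl : k = 1 := hk ▸ c2
      simp only [if_true, if_neg (show (1 : ℕ) ≠ 2 by omega)] at ha' hb'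
      subst ha' hb'
      refine ⟨⟨p1, by omega, p3, cb, fun x => ?_, fun x => ?_⟩, fun _ => p6 cb,
        fun x => absurd rfl x⟩
      · exact h.not_both_hidden ca cb (p5 ca) (p6 cb) c1
      · exact h.leftSide_R_succ (by omega) cb (p6 cb)
    · obtain ⟨ca, cb, c0, c1, c2⟩ := c
      obtain rfl : k = 2 := hk ▸ c2
      simp only [if_true, if_neg (show (2 : ℕ) ≠ 1 by omega)] at ha' hb'
      subst ha' hb'
      refine ⟨⟨by omega, p2, ca, p4, fun x => ?_, fun x => c0⟩, fun x => absurd rfl x,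
        fun _ => p5 ca⟩
      exact h.rightSide_L_succ ca (by omega) (p5 ca)
    · obtain ⟨ca, cb, c0, c1, c2⟩ := c
      obtain rfl : k = 0 := hk ▸ c2
      simp only [if_neg (show (0 : ℕ) ≠ 2 by omega), if_neg (show (0 : ℕ) ≠ 1 by omega)] at ha' hb'
      subst ha' hb'
      exact ⟨⟨by omega, by omega, ca, cb, fun x => h.rightSide_L_succ ca cb c1,
        fun x => h.leftSide_R_succ ca cb c0⟩, fun _ => c0, fun _ => c1⟩

theorem walk_inv (h : Funnel L R nl nr A D) {N : ℕ} (hN : GreedyEnd L R nl nr N) {t : ℕ}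
    (ht : t ≤ N) : (t = 0 ∧ greedyWalk L R nl nr t = (0, 0)) ∨
      (0 < t ∧ WalkInv L R nl nr (greedyWalk L R nl nr t).1 (greedyWalk L R nl nr t).2) := by
  induction t with
  | zero => exact Or.inl ⟨rfl, rfl⟩
  | succ t ih =>
    right
    refine ⟨Nat.succ_pos _, ?_⟩
    refine (h.walk_step (a := (greedyWalk L R nl nr t).1) (b := (greedyWalk L R nl nr t).2) ?_
      (hN.not_last t ht) rfl rfl rfl).1
    rcases ih (by omega) with ⟨_, e⟩ | ⟨_, e⟩
    · left; rw [e]; exact ⟨rfl, rfl⟩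
    · exact Or.inr e

theorem walk_facts (h : Funnel L R nl nr A D) {N : ℕ} (hN : GreedyEnd L R nl nr N) {t : ℕ}
    (ht : t < N) {a b a' b' k : ℕ} (e : greedyWalk L R nl nr t = (a, b))
    (hk : greedyKind L R nl nr a b = k) (e' : greedyWalk L R nl nr (t + 1) = (a', b')) :
    a' = (if k = 1 then a else a + 1) ∧ b' = (if k = 2 then b else b + 1) ∧
    WalkInv L R nl nr a' b' ∧ (k ≠ 2 → 0 ≤ leftSide L (a' - 1) (R b)) ∧
      (k ≠ 1 → 0 ≤ rightSide R (b' - 1) (L a)) := by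
  have e2 : a' = (if k = 1 then a else a + 1) ∧ b' = (if k = 2 then b else b + 1) := by
    rw [greedyWalk, e] at e'
    simp only [hk] at e'
    exact ⟨(Prod.mk.inj e').1.symm, (Prod.mk.inj e').2.symm⟩
  refine ⟨e2.1, e2.2, h.walk_step (a := a) (b := b) ?_ (e ▸ hN.not_last t ht) hk e2.1 e2.2⟩
  rcases h.walk_inv hN ht.le with ⟨_, x⟩ | ⟨_, x⟩
  · left; rw [e] at x; exact Prod.mk.inj x
  · right; rwa [e] at x

/-- The part of the funnel that is on the inner side of the `i`-th left and the `j`-th right line. -/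
def _root_.funnelPiece (L R : ℕ → Plane) (A D : Plane) (i j : ℕ) : Set Plane :=
  {x | 0 ≤ height A D x ∧ 0 ≤ leftSide L i x ∧ 0 ≤ rightSide R j x}

/-- The region of a funnel. -/
def _root_.funnelRegion (L R : ℕ → Plane) (nl nr : ℕ) (A D : Plane) : Set Plane :=
  {x | 0 ≤ height A D x ∧ (∃ i < nl, 0 ≤ leftSide L i x) ∧ ∃ j < nr, 0 ≤ rightSide R j x}

/-- The pieces at the states of the greedy walk cover the funnel. -/
theorem region_eq_iUnion (h : Funnel L R nl nr A D) {N : ℕ} (hN : GreedyEnd L R nl nr N) :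
    funnelRegion L R nl nr A D = ⋃ t ∈ Set.Ioc 0 N,
      funnelPiece L R A D ((greedyWalk L R nl nr t).1 - 1) ((greedyWalk L R nl nr t).2 - 1) := by
  classical
  apply Set.Subset.antisymm
  · rintro x ⟨hx, hl, hr⟩
    -- Take the first left line `i₀` and the first right line `j₀` that have `x` on the inner side.
    -- The triangle at the first state that has passed both of them contains `x`.
    obtain ⟨i1, i2⟩ := Nat.find_spec hl
    obtain ⟨j1, j2⟩ := Nat.find_spec hr
    have imin : ∀ i, i < Nat.find hl → i < nl → leftSide L i x < 0 := fun i hi hi' => by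
      by_contra hc
      exact Nat.find_min hl hi ⟨hi', not_lt.1 hc⟩
    have jmin : ∀ j, j < Nat.find hr → j < nr → rightSide R j x < 0 := fun j hj hj' => by
      by_contra hc
      exact Nat.find_min hr hj ⟨hj', not_lt.1 hc⟩
    generalize Nat.find hl = i₀ at *
    generalize Nat.find hr = j₀ at *
    have hex : ∃ t, t ≤ N ∧ i₀ < (greedyWalk L R nl nr t).1 ∧ j₀ < (greedyWalk L R nl nr t).2 :=
      ⟨N, le_rfl, by rw [hN.last]; exact ⟨i1, j1⟩⟩
    obtain ⟨tN, ta, tb⟩ := Nat.find_spec hex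
    have tmin : ∀ t, t < Nat.find hex →
        ¬ (i₀ < (greedyWalk L R nl nr t).1 ∧ j₀ < (greedyWalk L R nl nr t).2) := fun t ht hc =>
      Nat.find_min hex ht ⟨by omega, hc.1, hc.2⟩
    generalize Nat.find hex = t₁ at *
    rcases t₁ with _ | t
    · rw [greedyWalk] at ta; omega
    have hnot := tmin t (by omega)
    rcases e : greedyWalk L R nl nr t with ⟨a, b⟩
    rcases e' : greedyWalk L R nl nr (t + 1) with ⟨a', b'⟩
    rw [e] at hnot
    rw [e'] at ta tb
    simp only at hnot ta tb
    simp only [Set.mem_iUnion]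
    refine ⟨t + 1, ⟨by omega, tN⟩, ?_⟩
    rw [e']
    obtain ⟨g1, g2, g3, g4, g5⟩ := h.walk_facts hN (by omega) e rfl e'
    generalize greedyKind L R nl nr a b = k at *
    have hab : (a = 0 ∧ b = 0) ∨ (0 < a ∧ 0 < b) := by
      rcases h.walk_inv hN (t := t) (by omega) with ⟨_, y⟩ | ⟨_, y⟩
      · left; rw [e] at y; exact Prod.mk.inj y
      · right; rw [e] at y; exact ⟨y.a_pos, y.b_pos⟩
    have hale := g3.a_le
    have hble := g3.b_le
    refine ⟨hx, ?_, ?_⟩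
    · by_cases ha : a ≤ i₀
      · have : a' - 1 = i₀ := by split_ifs at g1 <;> omega
        simp only [this]; exact i2
      · have hb : b ≤ j₀ := by by_contra hc; exact hnot ⟨by omega, by omega⟩
        have hk2 : k ≠ 2 := by rintro rfl; rw [if_pos rfl] at g2; omega
        rw [if_neg hk2] at g2
        obtain rfl : b = j₀ := by omega
        obtain ⟨j, rfl⟩ : ∃ j, b = j + 1 := ⟨b - 1, by omega⟩
        -- The right edge `j₀` is passed only now, so its start is on the inner side of the left
        -- line `a' - 1`. The point `x` is reached from that start along nonnegative multiples of
        -- two right edges, which lead further inwards.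
        obtain ⟨s, r, hs, hr', ex⟩ := h.right_lower j1 (jmin j (by omega) (by omega)) j2
        have := g4 hk2
        rw [ex, leftSide_combo, cross_add_right, cross_smul_right, cross_smul_right]
        have p1 := h.lr (a' - 1) j (by omega) (by omega)
        have p2 := h.lr (a' - 1) (j + 1) (by omega) j1
        positivity
    · by_cases hb : b ≤ j₀
      · have : b' - 1 = j₀ := by split_ifs at g2 <;> omega
        simp only [this]; exact j2
      · have ha : a ≤ i₀ := by by_contra hc; exact hnot ⟨by omega, by omega⟩
        have hk1 : k ≠ 1 := by rintro rfl; rw [if_pos rfl] at g1; omega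
        rw [if_neg hk1] at g1
        obtain rfl : a = i₀ := by omega
        obtain ⟨i, rfl⟩ : ∃ i, a = i + 1 := ⟨a - 1, by omega⟩
        obtain ⟨s, r, hs, hr', ex⟩ := h.left_lower i1 (imin i (by omega) (by omega)) i2
        have := g5 hk1
        rw [ex, rightSide_combo, cross_add_right, cross_smul_right, cross_smul_right,
          cross_comm _ (edgeVec L i), cross_comm _ (edgeVec L (i + 1))]
        have p1 := h.lr i (b' - 1) (by omega) (by omega)
        have p2 := h.lr (i + 1) (b' - 1) i1 (by omega)
        nlinarith [mul_nonneg hs p1.le, mul_pos hr' p2]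
  · intro x hx
    simp only [Set.mem_iUnion] at hx
    obtain ⟨t, ⟨t1, t2⟩, hx1, hx2, hx3⟩ := hx
    rcases h.walk_inv hN t2 with ⟨y, _⟩ | ⟨_, y⟩
    · omega
    · have := y.a_pos
      have := y.b_pos
      have := y.a_le
      have := y.b_le
      exact ⟨hx1, ⟨_, by omega, hx2⟩, ⟨_, by omega, hx3⟩⟩

end Funnel

/-! ## Triangles -/

/-- The position on the line through `A` with direction `D` of its common point with the line
through `p` with direction `d`. -/
noncomputable def baseCoord (A D p d : Plane) : ℝ := cross (p - A) d / cross D d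

/-- The common point of the line through `A` with direction `D` and the line through `p` with
direction `d`. -/
noncomputable def lineMeet (A D p d : Plane) : Plane := A + baseCoord A D p d • D

theorem cross_lineMeet {A D p d : Plane} (h : cross D d ≠ 0) : cross d (lineMeet A D p d - p) = 0 := by
  have : lineMeet A D p d - p = -(p - A) + baseCoord A D p d • D := by rw [lineMeet]; abel
  rw [this, cross_add_right, cross_smul_right, cross_neg_right, baseCoord, cross_comm d (p - A),
    cross_comm d D]
  field_simp
  ring

theorem convexHull_triangle {a b c : Plane} (h : 0 < orient a b c) :
    convexHull ℝ {a, b, c} = {x | 0 ≤ orient a b x ∧ 0 ≤ orient b c x ∧ 0 ≤ orient c a x} := by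
  apply Set.Subset.antisymm
  · have hb : 0 < orient b c a := by simp only [orient] at h ⊢; linarith
    have hc : 0 < orient c a b := by simp only [orient] at h ⊢; linarith
    refine convexHull_min ?_ ?_
    · rintro x (rfl | rfl | rfl)
      · refine ⟨?_, hb.le, ?_⟩ <;> simp [orient, mul_comm]
      · refine ⟨?_, ?_, hc.le⟩ <;> simp [orient, mul_comm]
      · refine ⟨h.le, ?_, ?_⟩ <;> simp [orient, mul_comm]
    · have hconv : ∀ u v : Plane, Convex ℝ {x | 0 ≤ orient u v x} := by
        intro u v x hx y hy s t hs ht hst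
        have e : orient u v (s • x + t • y) = s * orient u v x + t * orient u v y := by
          obtain rfl : s = 1 - t := by linarith
          simp only [orient, Prod.fst_add, Prod.snd_add, Prod.smul_fst, Prod.smul_snd, smul_eq_mul]
          ring
        simp only [Set.mem_ofPred_eq] at hx hy ⊢
        rw [e]; positivity
      exact (hconv a b).inter ((hconv b c).inter (hconv c a))
  · rintro x ⟨h1, h2, h3⟩
    have h0 := h.ne'
    have hx : x = (orient b c x / orient a b c) • a + ((orient c a x / orient a b c) • b +
        (orient a b x / orient a b c) • c) := by
      ext
      · simp only [Prod.fst_add, Prod.smul_fst, smul_eq_mul]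
        field_simp
        simp only [orient]; ring
      · simp only [Prod.snd_add, Prod.smul_snd, smul_eq_mul]
        field_simp
        simp only [orient]; ring
    have hs : orient b c x / orient a b c + orient c a x / orient a b c +
        orient a b x / orient a b c = 1 := by
      field_simp
      simp only [orient]; ring
    have hsum := (convex_convexHull ℝ ({a, b, c} : Set Plane)).sum_mem (t := Finset.univ)
      (w := ![orient b c x / orient a b c, orient c a x / orient a b c, orient a b x / orient a b c])
      (z := ![a, b, c]) ?_ ?_ ?_
    · rw [hx]
      simpa [Fin.sum_univ_three, add_assoc] using hsum
    · intro i _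
      fin_cases i <;> simp <;> positivity
    · simpa [Fin.sum_univ_three] using hs
    · intro i _
      apply subset_convexHull
      fin_cases i <;> simp

theorem Polygon.isConvex_of_three {k : ℕ} (w : Polygon Plane k) (hk : k = 3) {a b c : Plane}
    (hw : ∀ i : Fin k, w i = if i.1 = 0 then a else if i.1 = 1 then b else c)
    (h : 0 < orient a b c) : w.IsConvex ∧ w.hull = convexHull ℝ {a, b, c} := by
  subst hk
  have h0 : w 0 = a := hw 0
  have h1 : w 1 = b := hw 1
  have h2 : w 2 = c := hw 2
  have hb : 0 < orient b c a := by simp only [orient] at h ⊢; linarith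
  have hc : 0 < orient c a b := by simp only [orient] at h ⊢; linarith
  have r0 : finRotate 3 0 = 1 := rfl
  have r1 : finRotate 3 1 = 2 := rfl
  have r2 : finRotate 3 2 = 0 := rfl
  refine ⟨⟨le_rfl, Or.inl fun i j => ?_⟩, ?_⟩
  · fin_cases i <;> fin_cases j <;> intro e1 e2 <;>
      simp [r0, r1, r2, h0, h1, h2] at e1 e2 ⊢ <;> assumption
  · rw [Polygon.hull]
    congr 1
    ext x
    simp only [Set.mem_range, Set.mem_insert_iff, Set.mem_singleton_iff]
    constructor
    · rintro ⟨i, rfl⟩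
      fin_cases i
      · exact Or.inl h0
      · exact Or.inr (Or.inl h1)
      · exact Or.inr (Or.inr h2)
    · rintro (rfl | rfl | rfl)
      · exact ⟨0, h0⟩
      · exact ⟨1, h1⟩
      · exact ⟨2, h2⟩

theorem baseCoord_mirror (A D p d : Plane) :
    baseCoord (mirror A) (-mirror D) (mirror p) (mirror d) = -baseCoord A D p d := by
  rw [baseCoord, baseCoord, mirror_sub, cross_mirror, cross_neg_left, cross_mirror, neg_neg, neg_div]

namespace Funnel

variable {L R : ℕ → Plane} {nl nr : ℕ} {A D : Plane}

/-- If the line through `p` is turned, its common point with the base line moves. -/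
theorem baseCoord_sub {A D p d e : Plane} (hd : cross D d ≠ 0) (he : cross D e ≠ 0) :
    baseCoord A D p d - baseCoord A D p e =
      -(height A D p * cross d e) / (cross D d * cross D e) := by
  rw [baseCoord, baseCoord, height, div_sub_div _ _ hd he]
  congr 1
  simp only [cross]; ring

/-- Both lines pass through `L (i + 1)`, which is not below the base line, and the second one is
turned clockwise, so its foot does not lie further along `D`. -/
theorem baseCoord_L_succ (h : Funnel L R nl nr A D) {i : ℕ} (hi : i + 1 < nl) :
    baseCoord A D (L (i + 1)) (edgeVec L (i + 1)) ≤ baseCoord A D (L i) (edgeVec L i) := by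
  have d1 := h.lD i (by omega)
  have d2 := h.lD (i + 1) hi
  rw [cross_comm] at d1 d2
  have e1 : baseCoord A D (L i) (edgeVec L i) = baseCoord A D (L (i + 1)) (edgeVec L i) := by
    rw [baseCoord, baseCoord, show L (i + 1) - A = (L i - A) + edgeVec L i by rw [edgeVec]; abel,
      cross_add_left, cross_self_eq_zero, add_zero]
  rw [e1, ← sub_nonneg, baseCoord_sub (by linarith) (by linarith)]
  have := h.hL (i + 1) hi
  have := h.ll i (i + 1) (by omega) hi
  refine div_nonneg ?_ ?_ <;> nlinarith

theorem baseCoord_L_le (h : Funnel L R nl nr A D) {i : ℕ} (hi : i < nl) :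
    baseCoord A D (L i) (edgeVec L i) ≤ baseCoord A D (L 0) (edgeVec L 0) := by
  induction i with
  | zero => exact le_rfl
  | succ i ih => exact (h.baseCoord_L_succ hi).trans (ih (by omega))

theorem baseCoord_le_R (h : Funnel L R nl nr A D) {j : ℕ} (hj : j < nr) :
    baseCoord A D (R 0) (edgeVec R 0) ≤ baseCoord A D (R j) (edgeVec R j) := by
  have := h.mirror.baseCoord_L_le hj
  rw [edgeVec_mirror, edgeVec_mirror, baseCoord_mirror, baseCoord_mirror] at this
  linarith

/-- The feet of all lines are compared with those of the two lines through the apex, which is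
strictly above the base line; these two are in the right order. So the base side of every piece is
nondegenerate. -/
theorem baseCoord_lt (h : Funnel L R nl nr A D) {i j : ℕ} (hi : i < nl) (hj : j < nr) :
    baseCoord A D (L i) (edgeVec L i) < baseCoord A D (R j) (edgeVec R j) := by
  refine (h.baseCoord_L_le hi).trans_lt (lt_of_lt_of_le ?_ (h.baseCoord_le_R hj))
  have d1 := h.lD 0 h.nl_pos
  have d2 := h.rD 0 h.nr_pos
  rw [cross_comm] at d1 d2
  have d3 := h.lr 0 0 h.nl_pos h.nr_pos
  have d4 := h.h_apex
  rw [← h.apex, ← sub_neg, baseCoord_sub (by linarith) (by linarith)]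
  have d5 : 0 < cross D (edgeVec L 0) * cross D (edgeVec R 0) := by nlinarith
  exact div_neg_of_neg_of_pos (by nlinarith) d5

/-- The corners of the pieces of a funnel form triangles. -/
theorem piece_eq_triangle (h : Funnel L R nl nr A D) {i j : ℕ} (hi : i < nl) (hj : j < nr)
    {X Y Z : Plane} (hX : X = lineMeet A D (L i) (edgeVec L i))
    (hY : Y = lineMeet A D (R j) (edgeVec R j))
    (hZ : Z = lineMeet (L i) (edgeVec L i) (R j) (edgeVec R j)) :
    0 < orient X Y Z ∧ funnelPiece L R A D i j = convexHull ℝ {X, Y, Z} := by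
  have hlD := h.lD i hi
  have hrD := h.rD j hj
  have hlr := h.lr i j hi hj
  have hlD' := cross_comm (edgeVec L i) D
  have hrD' := cross_comm (edgeVec R j) D
  have hlr' := cross_comm (edgeVec L i) (edgeVec R j)
  have cX : cross (edgeVec L i) (X - L i) = 0 := hX ▸ cross_lineMeet (by linarith)
  have cY : cross (edgeVec R j) (Y - R j) = 0 := hY ▸ cross_lineMeet (by linarith)
  have cZ : cross (edgeVec R j) (Z - R j) = 0 := hZ ▸ cross_lineMeet (by linarith)
  have cZ' : Z - L i = baseCoord (L i) (edgeVec L i) (R j) (edgeVec R j) • edgeVec L i := by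
    rw [hZ, lineMeet]; abel
  have hXY : Y - X = (baseCoord A D (R j) (edgeVec R j) - baseCoord A D (L i) (edgeVec L i)) • D := by
    rw [hX, hY, lineMeet, lineMeet, sub_smul]; abel
  have hκ := sub_pos.2 (h.baseCoord_lt hi hj)
  generalize baseCoord A D (R j) (edgeVec R j) - baseCoord A D (L i) (edgeVec L i) = κ at *
  generalize baseCoord (L i) (edgeVec L i) (R j) (edgeVec R j) = ζ at *
  have hA : cross D (X - A) = 0 := by
    rw [hX, lineMeet, add_sub_cancel_left, cross_smul_right, cross_self_eq_zero, mul_zero]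
  have cXZ : cross (edgeVec L i) (X - Z) = 0 := by
    rw [show X - Z = (X - L i) - (Z - L i) by abel, cross_sub_right, cX, cZ', cross_smul_right,
      cross_self_eq_zero, mul_zero, sub_zero]
  have cYZ : cross (edgeVec R j) (Z - Y) = 0 := by
    rw [show Z - Y = (Z - R j) - (Y - R j) by abel, cross_sub_right, cY, cZ, sub_zero]
  have wXZ := wedge (d := X - Z) hlr
  have wYZ := wedge (d := Z - Y) hlr
  rw [cXZ, zero_div, zero_smul, add_zero] at wXZ
  rw [cross_comm, cYZ, neg_zero, zero_div, zero_smul, zero_add] at wYZ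
  set σ := cross (X - Z) (edgeVec R j) / cross (edgeVec L i) (edgeVec R j) with hσ
  set τ := cross (edgeVec L i) (Z - Y) / cross (edgeVec L i) (edgeVec R j) with hτ
  have hsum : (X - Z) + (Z - Y) = -(κ • D) := by rw [← hXY]; abel
  rw [wXZ, wYZ] at hsum
  have hσ0 : 0 < σ := by
    have := congrArg (fun v => cross v (edgeVec R j)) hsum
    simp only [cross_add_left, cross_smul_left, cross_neg_left, cross_self_eq_zero] at this
    by_contra hc
    nlinarith
  have hτ0 : τ < 0 := by
    have := congrArg (fun v => cross (edgeVec L i) v) hsum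
    simp only [cross_add_right, cross_smul_right, cross_neg_right, cross_self_eq_zero] at this
    by_contra hc
    nlinarith
  -- The orientations with respect to the three sides are positive multiples, by `κ`, `-τ` and `σ`,
  -- of the three forms that define the piece.
  have o1 : ∀ x, orient X Y x = κ * height A D x := by
    intro x
    rw [orient_eq_cross, hXY, cross_smul_left, height,
      show x - A = (x - X) + (X - A) by abel, cross_add_right, hA, add_zero]
  have o2 : ∀ x, orient Y Z x = -τ * rightSide R j x := by
    intro x
    rw [orient_eq_cross, wYZ, cross_smul_left, rightSide,
      show x - R j = (x - Y) + (Y - R j) by abel, cross_add_right, cY]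
    ring
  have o3 : ∀ x, orient Z X x = σ * leftSide L i x := by
    intro x
    rw [orient_eq_cross, wXZ, cross_smul_left, leftSide,
      show x - L i = (x - Z) + (Z - L i) by abel, cross_add_right, cZ', cross_smul_right,
      cross_self_eq_zero]
    ring
  have hpos : 0 < orient X Y Z := by
    have hhZ : height A D Z = σ * cross (edgeVec L i) D := by
      have : Z - A = (X - A) - (X - Z) := by abel
      rw [height, this, cross_sub_right, hA, wXZ, cross_smul_right, cross_comm D]; ring
    rw [o1, hhZ]; positivity
  refine ⟨hpos, ?_⟩
  rw [convexHull_triangle hpos]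
  ext x
  simp only [funnelPiece, Set.mem_ofPred_eq, o1, o2, o3]
  rw [mul_nonneg_iff_of_pos_left hκ, mul_nonneg_iff_of_pos_left hσ0,
    mul_nonneg_iff_of_pos_left (neg_pos.2 hτ0)]
  tauto

end Funnel

/-! ## Hidden points on the chains of a funnel -/

/-- A choice of modes and parameters that makes the points on the edges that are passed by the
greedy walk invisible from each other. In mode `2` the point is on the left edge. -/
structure HiddenChoice (L R : ℕ → Plane) (nl nr N : ℕ) (M : ℕ → ℕ) (s : ℕ → ℝ) : Prop where
  mode : ∀ t < N, ∀ a b, greedyWalk L R nl nr t = (a, b) →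
    M t = if greedyKind L R nl nr a b = 0 then M (t + 1) else greedyKind L R nl nr a b
  pos : ∀ t < N, 0 < s t
  lt_one : ∀ t < N, s t < 1
  left : ∀ t < N, ∀ a b, greedyWalk L R nl nr t = (a, b) → greedyKind L R nl nr a b = 1 → a < nl →
    leftSide L a (R b + s t • edgeVec R b) < 0
  right : ∀ t < N, ∀ a b, greedyWalk L R nl nr t = (a, b) → greedyKind L R nl nr a b = 2 → b < nr →
    rightSide R b (L a + s t • edgeVec L a) < 0

/-- The point on the `a`-th left edge (in mode `2`) or on the `b`-th right edge. -/
noncomputable def modePoint (L R : ℕ → Plane) (M : ℕ) (s : ℝ) (a b : ℕ) : Plane :=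
  if M = 2 then L a + s • edgeVec L a else R b + s • edgeVec R b

theorem edge_convex_combo (L : ℕ → Plane) (i : ℕ) (s : ℝ) :
    L i + s • edgeVec L i = (1 - s) • L i + s • L (i + 1) := by
  rw [edgeVec, smul_sub, sub_smul, one_smul]; abel

namespace Funnel

variable {L R : ℕ → Plane} {nl nr : ℕ} {A D : Plane}

theorem walk_mono (L R : ℕ → Plane) (nl nr : ℕ) {t t' : ℕ} (h : t ≤ t') :
    (greedyWalk L R nl nr t).1 ≤ (greedyWalk L R nl nr t').1 ∧
      (greedyWalk L R nl nr t).2 ≤ (greedyWalk L R nl nr t').2 := by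
  induction t', h using Nat.le_induction with
  | base => exact ⟨le_rfl, le_rfl⟩
  | succ k _ ih =>
    rw [greedyWalk]
    refine ⟨ih.1.trans ?_, ih.2.trans ?_⟩ <;> dsimp only <;> split_ifs <;> omega

theorem leftSide_R_mono (h : Funnel L R nl nr A D) {i j k : ℕ} (hi : i < nl) (hjk : j ≤ k)
    (hk : k ≤ nr) : leftSide L i (R j) ≤ leftSide L i (R k) := by
  induction k, hjk using Nat.le_induction with
  | base => exact le_rfl
  | succ k _ ih =>
    have e : R (k + 1) = R k + edgeVec R k := by simp [edgeVec]
    rw [e, leftSide_combo]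
    linarith [ih (by omega), h.lr i k hi (by omega)]

/-- A point beyond a line of the left chain and above the upper vertex of its edge is beyond all
lower lines. -/
theorem leftSide_neg_of_height (h : Funnel L R nl nr A D) {a : ℕ} {x : Plane}
    (hx : leftSide L a x < 0) (hh : height A D (L a) < height A D x) {i : ℕ} (hai : a ≤ i)
    (hi : i < nl) : leftSide L i x < 0 := by
  induction i, hai using Nat.le_induction with
  | base => exact hx
  | succ i hai ih =>
    by_contra hc
    -- A point beyond line `i` but not beyond line `i + 1` lies in the wedge below `L (i + 1)`,
    -- whereas `x` is above `L a`.
    have h1 := h.mirror.right_lower_height (j := i) hi (x := _root_.mirror x)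
      (by rw [rightSide_mirror]; exact ih (by omega)) (by rw [rightSide_mirror]; exact not_lt.1 hc)
    rw [height_mirror, height_mirror] at h1
    have := h.height_L_le (show a ≤ i + 1 by omega) hi.le
    linarith

/-- A point of a right edge that is passed at or before a step in which the next left edge hides the
next right edge is beyond all remaining lines of the left chain. -/
theorem leftSide_neg_of_passed (h : Funnel L R nl nr A D) {a b j : ℕ} (ha : a + 1 < nl)
    (hb : b < nr) {s : ℝ} (hs0 : 0 < s) (hs1 : s < 1)
    (h1 : 0 ≤ leftSide L a (R b)) (h2 : leftSide L (a + 1) (R b) < 0)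
    (hj : j < b ∨ j = b ∧ leftSide L (a + 1) (R b + s • edgeVec R b) < 0) {i : ℕ} (hai : a + 1 ≤ i)
    (hi : i < nl) : leftSide L i (R j + s • edgeVec R j) < 0 := by
  rcases hj with hj | ⟨rfl, hj⟩
  -- Higher points of the right chain are even further beyond the line `a + 1` than `R b`. They are
  -- also above `R b`, which is above `L (a + 1)`.
  · refine h.leftSide_neg_of_height ?_ ?_ hai hi
    · have e : leftSide L (a + 1) (R (j + 1)) ≤ leftSide L (a + 1) (R b) :=
        h.leftSide_R_mono ha hj hb.le
      have e2 : R (j + 1) = R j + edgeVec R j := by simp [edgeVec]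
      have := h.lr (a + 1) j ha (by omega)
      rw [e2, leftSide_combo] at e
      rw [leftSide_combo, cross_smul_right]
      nlinarith
    · have e1 := h.left_upper ha h1 h2
      have e3 := h.height_R_le (show j + 1 ≤ b by omega) hb.le
      have e2 : R (j + 1) = R j + edgeVec R j := by simp [edgeVec]
      have := h.rD j (by omega)
      rw [e2, height_add, cross_comm] at e3
      rw [height_add, cross_smul_right, cross_comm]
      nlinarith
  -- This point is below `R b`. It is still on the inner side of the line `a` and, by the choice of
  -- its parameter, beyond the line `a + 1`, hence above `L (a + 1)`.
  · refine h.leftSide_neg_of_height hj ?_ hai hi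
    refine h.left_upper ha ?_ hj
    rw [leftSide_combo, cross_smul_right]
    have := h.lr a j (by omega) hb
    positivity

theorem rightSide_neg_of_passed (h : Funnel L R nl nr A D) {a b j : ℕ} (hb : b + 1 < nr)
    (ha : a < nl) {s : ℝ} (hs0 : 0 < s) (hs1 : s < 1)
    (h1 : 0 ≤ rightSide R b (L a)) (h2 : rightSide R (b + 1) (L a) < 0)
    (hj : j < a ∨ j = a ∧ rightSide R (b + 1) (L a + s • edgeVec L a) < 0) {i : ℕ}
    (hbi : b + 1 ≤ i) (hi : i < nr) : rightSide R i (L j + s • edgeVec L j) < 0 := by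
  have e : ∀ j, _root_.mirror (L j) + s • _root_.mirror (edgeVec L j) =
      _root_.mirror (L j + s • edgeVec L j) := fun j => by rw [mirror_smul, mirror_add]
  have := h.mirror.leftSide_neg_of_passed (a := b) (b := a) (j := j) (i := i) hb ha hs0 hs1
    (by rwa [leftSide_mirror]) (by rwa [leftSide_mirror])
    (by rwa [edgeVec_mirror, e, leftSide_mirror]) hbi hi
  rwa [edgeVec_mirror, e, leftSide_mirror] at this

/-- Interior points of an edge of the left chain are beyond the lines of the lower edges. -/
theorem leftSide_neg_of_lt (h : Funnel L R nl nr A D) {i j : ℕ} (hij : i < j) (hj : j < nl) {s : ℝ}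
    (hs1 : s < 1) : leftSide L j (L i + s • edgeVec L i) < 0 := by
  have e : L i + s • edgeVec L i - L j =
      -((1 - s) • edgeVec L i + ∑ k ∈ Finset.Ico (i + 1) j, edgeVec L k) := by
    rw [← sub_eq_sum_edgeVec L hij, sub_smul, one_smul]
    simp only [edgeVec]
    abel
  rw [leftSide, e, cross_neg_right, cross_add_right, cross_smul_right, cross_sum_right, neg_lt_zero]
  refine add_pos_of_pos_of_nonneg (mul_pos (by linarith) ?_) (Finset.sum_nonneg fun k hk => ?_)
  · rw [cross_comm, neg_pos]; exact h.ll i j hij hj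
  · rw [Finset.mem_Ico] at hk
    rw [cross_comm, neg_nonneg]; exact (h.ll k j hk.2 hj).le

theorem rightSide_neg_of_lt (h : Funnel L R nl nr A D) {i j : ℕ} (hij : i < j) (hj : j < nr) {s : ℝ}
    (hs1 : s < 1) : rightSide R j (R i + s • edgeVec R i) < 0 := by
  have := h.mirror.leftSide_neg_of_lt hij hj hs1
  rwa [edgeVec_mirror, mirror_smul, mirror_add, leftSide_mirror] at this

/-- If the modes of two steps are different, then the first one comes from a step in between. -/
theorem exists_kind_eq {N : ℕ} {M : ℕ → ℕ} {s : ℕ → ℝ} (hM : HiddenChoice L R nl nr N M s)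
    {t₁ t₂ : ℕ} (h12 : t₁ < t₂) (h2 : t₂ < N) (hne : M t₁ ≠ M t₂) :
    ∃ t, t₁ ≤ t ∧ t < t₂ ∧ ∃ a b, greedyWalk L R nl nr t = (a, b) ∧
      greedyKind L R nl nr a b = M t₁ ∧ M t₁ ≠ 0 := by
  obtain ⟨d, hd⟩ : ∃ d, t₂ = t₁ + 1 + d := ⟨t₂ - t₁ - 1, by omega⟩
  induction d generalizing t₁ with
  | zero =>
    rcases e : greedyWalk L R nl nr t₁ with ⟨a, b⟩
    have := hM.mode t₁ (by omega) a b e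
    split_ifs at this with h0
    · rw [hd] at hne; exact absurd this hne
    · exact ⟨t₁, le_rfl, h12, a, b, e, this.symm, this ▸ h0⟩
  | succ d ih =>
    rcases e : greedyWalk L R nl nr t₁ with ⟨a, b⟩
    have := hM.mode t₁ (by omega) a b e
    split_ifs at this with h0
    · obtain ⟨t, q1, q2, q3⟩ := ih (t₁ := t₁ + 1) (by omega) (by rwa [← this]) (by omega)
      exact ⟨t, by omega, q2, by rwa [this]⟩
    · exact ⟨t₁, le_rfl, h12, a, b, e, this.symm, this ▸ h0⟩

/-- The edges that carry the chosen points exist. -/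
theorem modePoint_valid (h : Funnel L R nl nr A D) {N : ℕ} (hN : GreedyEnd L R nl nr N)
    {M : ℕ → ℕ} {s : ℕ → ℝ} (hM : HiddenChoice L R nl nr N M s) {t : ℕ} (ht : t < N) {a b : ℕ}
    (e : greedyWalk L R nl nr t = (a, b)) :
    (M t = 2 → a < nl ∧ (greedyWalk L R nl nr (t + 1)).1 = a + 1) ∧
      (M t ≠ 2 → b < nr ∧ (greedyWalk L R nl nr (t + 1)).2 = b + 1) := by
  rcases e' : greedyWalk L R nl nr (t + 1) with ⟨a', b'⟩
  obtain ⟨g1, g2, g3, -⟩ := h.walk_facts hN ht e rfl e'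
  have hm := hM.mode t ht a b e
  have := g3.a_le
  have := g3.b_le
  refine ⟨fun h2 => ?_, fun h2 => ?_⟩
  · have : greedyKind L R nl nr a b ≠ 1 := fun h1 => by
      rw [if_neg (by omega)] at hm; omega
    rw [if_neg this] at g1
    exact ⟨by omega, g1⟩
  · have : greedyKind L R nl nr a b ≠ 2 := fun h1 => by
      rw [if_neg (by omega)] at hm; omega
    rw [if_neg this] at g2
    exact ⟨by omega, g2⟩

/-- The chosen points are beyond the lines of the edges that carry later chosen points. -/
theorem modePoint_beyond (h : Funnel L R nl nr A D) {N : ℕ} (hN : GreedyEnd L R nl nr N)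
    {M : ℕ → ℕ} {s : ℕ → ℝ} (hM : HiddenChoice L R nl nr N M s) {t₁ t₂ : ℕ} (h12 : t₁ < t₂)
    (h2 : t₂ < N) {a₁ b₁ a₂ b₂ : ℕ} (e₁ : greedyWalk L R nl nr t₁ = (a₁, b₁))
    (e₂ : greedyWalk L R nl nr t₂ = (a₂, b₂)) :
    (M t₂ = 2 → leftSide L a₂ (modePoint L R (M t₁) (s t₁) a₁ b₁) < 0) ∧
      (M t₂ ≠ 2 → rightSide R b₂ (modePoint L R (M t₁) (s t₁) a₁ b₁) < 0) := by
  have h1 : t₁ < N := by omega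
  have v₁ := h.modePoint_valid hN hM h1 e₁
  have v₂ := h.modePoint_valid hN hM h2 e₂
  have mono := walk_mono L R nl nr (show t₁ + 1 ≤ t₂ by omega)
  rw [e₂] at mono
  have s0 := hM.pos t₁ h1
  have s1 := hM.lt_one t₁ h1
  refine ⟨fun m2 => ?_, fun m2 => ?_⟩
  · by_cases m1 : M t₁ = 2
    · rw [modePoint, if_pos m1]
      have := (v₁.1 m1).2
      exact h.leftSide_neg_of_lt (by omega) (v₂.1 m2).1 s1
    · rw [modePoint, if_neg m1]
      -- The first point got its side from a one-sided step `t` before `t₂`. At that step the start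
      -- of the next right edge is beyond the next left line, and then all points chosen on the
      -- right up to `t` are beyond all left lines that are still to come.
      obtain ⟨t, x1, x2, a, b, e, x3, x4⟩ := exists_kind_eq hM h12 h2 (by omega)
      have mono1 := walk_mono L R nl nr x1
      have mono2 := walk_mono L R nl nr x2.le
      rw [e₁, e] at mono1
      rw [e₂, e] at mono2
      simp only at mono1 mono2
      have ha2 := (v₂.1 m2).1
      have inv := h.walk_inv hN (t := t) (by omega)
      rw [e] at inv
      have hk1 : greedyKind L R nl nr a b = 1 ∧ a < nl ∧ b < nr ∧ leftSide L a (R b) < 0 := by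
        rcases greedyKind_cases L R nl nr a b with c | c | c | c | c
        · omega
        · omega
        · exact ⟨c.2.2.2, c.1, c.2.1, c.2.2.1⟩
        · omega
        · omega
      obtain ⟨hk1, ha, hb, hab⟩ := hk1
      rcases inv with ⟨rfl, inv⟩ | ⟨_, inv⟩
      · obtain ⟨rfl, rfl⟩ := Prod.mk.inj inv
        rw [leftSide, h.apex, sub_self, cross_zero_right] at hab
        exact absurd hab (lt_irrefl _)
      · obtain ⟨a, rfl⟩ : ∃ a', a = a' + 1 := ⟨a - 1, by have := inv.a_pos; omega⟩
        refine h.leftSide_neg_of_passed ha hb s0 s1 (inv.right hb) hab ?_ mono2.1 ha2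
        rcases x1.lt_or_eq with x1 | rfl
        · left
          have mono3 := walk_mono L R nl nr (show t₁ + 1 ≤ t from x1)
          rw [e] at mono3
          have := (v₁.2 m1).2
          omega
        · right
          rw [e] at e₁
          obtain ⟨rfl, rfl⟩ := Prod.mk.inj e₁
          exact ⟨rfl, hM.left t₁ h1 _ _ e hk1 ha⟩
  · by_cases m1 : M t₁ = 2
    · rw [modePoint, if_pos m1]
      obtain ⟨t, x1, x2, a, b, e, x3, x4⟩ := exists_kind_eq hM h12 h2 (by omega)
      have mono1 := walk_mono L R nl nr x1
      have mono2 := walk_mono L R nl nr x2.le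
      rw [e₁, e] at mono1
      rw [e₂, e] at mono2
      simp only at mono1 mono2
      have hb2 := (v₂.2 m2).1
      have inv := h.walk_inv hN (t := t) (by omega)
      rw [e] at inv
      have hk1 : greedyKind L R nl nr a b = 2 ∧ a < nl ∧ b < nr ∧ rightSide R b (L a) < 0 := by
        rcases greedyKind_cases L R nl nr a b with c | c | c | c | c
        · omega
        · omega
        · omega
        · exact ⟨c.2.2.2.2, c.1, c.2.1, c.2.2.2.1⟩
        · omega
      obtain ⟨hk1, ha, hb, hab⟩ := hk1
      rcases inv with ⟨rfl, inv⟩ | ⟨_, inv⟩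
      · obtain ⟨rfl, rfl⟩ := Prod.mk.inj inv
        rw [rightSide, h.apex, sub_self, cross_zero_right, neg_zero] at hab
        exact absurd hab (lt_irrefl _)
      · obtain ⟨b, rfl⟩ : ∃ b', b = b' + 1 := ⟨b - 1, by have := inv.b_pos; omega⟩
        refine h.rightSide_neg_of_passed hb ha s0 s1 (inv.left ha) hab ?_ mono2.2 hb2
        rcases x1.lt_or_eq with x1 | rfl
        · left
          have mono3 := walk_mono L R nl nr (show t₁ + 1 ≤ t from x1)
          rw [e] at mono3
          have := (v₁.1 m1).2
          omega
        · right
          rw [e] at e₁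
          obtain ⟨rfl, rfl⟩ := Prod.mk.inj e₁
          exact ⟨rfl, hM.right t₁ h1 _ _ e hk1 hb⟩
    · rw [modePoint, if_neg m1]
      have := (v₁.2 m1).2
      exact h.rightSide_neg_of_lt (by omega) (v₂.2 m2).1 s1

end Funnel

/-! ### Invisibility in the whole region -/

namespace ThreeChains

variable {w : ℕ → Plane} {a b a' b' a'' b'' : ℕ}

/-- Interior points of an edge of a chain are strictly outside the lines of the other edges. -/
theorem side_neg_of_ne (h : ThreeChains w a b a' b' a'' b'') {i j : ℕ} (hi : a ≤ i) (hi' : i < b)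
    (hj : a ≤ j) (hj' : j < b) (hij : i ≠ j) {s : ℝ} (s0 : 0 < s) (s1 : s < 1) :
    side w j (w i + s • edgeVec w i) < 0 := by
  rcases lt_or_gt_of_ne hij with hlt | hlt
  · have e : w i + s • edgeVec w i - w j =
        -((1 - s) • edgeVec w i + ∑ k ∈ Finset.Ico (i + 1) j, edgeVec w k) := by
      rw [← sub_eq_sum_edgeVec w hlt, sub_smul, one_smul]
      simp only [edgeVec]
      abel
    rw [side, e, cross_neg_right, cross_add_right, cross_smul_right, cross_sum_right, neg_lt_zero]
    refine add_pos_of_pos_of_nonneg (mul_pos (by linarith) ?_) (Finset.sum_nonneg fun k hk => ?_)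
    · rw [cross_comm, neg_pos]; exact h.neg₁ i j hi hlt hj'
    · rw [Finset.mem_Ico] at hk
      rw [cross_comm, neg_nonneg]; exact (h.neg₁ k j (by omega) hk.2 hj').le
  · have e : w i + s • edgeVec w i - w (j + 1) =
        s • edgeVec w i + ∑ k ∈ Finset.Ico (j + 1) i, edgeVec w k := by
      rw [← sub_eq_sum_edgeVec w hlt]
      abel
    rw [side_eq_next, e, cross_add_right, cross_smul_right, cross_sum_right]
    refine add_neg_of_neg_of_nonpos (mul_neg_of_pos_of_neg s0 (h.neg₁ j i hj hlt hi'))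
      (Finset.sum_nonpos fun k hk => ?_)
    rw [Finset.mem_Ico] at hk
    exact (h.neg₁ j k hj (by omega) (by omega)).le

/-- An interior point of an edge does not see the points beyond the line of this edge. -/
theorem not_segment_subset (h : ThreeChains w a b a' b' a'' b'') {i : ℕ} (hi : a ≤ i) (hi' : i < b)
    {s : ℝ} (s0 : 0 < s) (s1 : s < 1) {x : Plane} (hx : side w i x < 0) :
    ¬ segment ℝ x (w i + s • edgeVec w i) ⊆ chainSide w a b := by
  intro hsub
  -- Near its end on the edge `i`, the segment is beyond the line `i` because it starts beyond it.
  -- It is beyond the other lines of the chain by continuity, since the end point is strictly beyond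
  -- them. So there it leaves the set of points on the left of some edge of the chain.
  have hev : ∀ j ∈ Finset.Ico a b, ∀ᶠ ε : ℝ in nhdsWithin 0 (Set.Ioi 0),
      side w j (ε • x + (1 - ε) • (w i + s • edgeVec w i)) < 0 := by
    intro j hj
    rw [Finset.mem_Ico] at hj
    by_cases hij : i = j
    · subst hij
      filter_upwards [self_mem_nhdsWithin] with ε hε
      have hε : 0 < ε := hε
      rw [side_combo _ _ _ _ (by ring), side_add, side_self, cross_smul_right, cross_self_eq_zero]
      nlinarith
    · have hc : Continuous fun ε : ℝ => side w j (ε • x + (1 - ε) • (w i + s • edgeVec w i)) :=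
        (continuous_side w j).comp (by fun_prop)
      have h0 : side w j ((0 : ℝ) • x + (1 - (0 : ℝ)) • (w i + s • edgeVec w i)) < 0 := by
        rw [zero_smul, zero_add, sub_zero, one_smul]
        exact h.side_neg_of_ne hi hi' hj.1 hj.2 hij s0 s1
      exact (hc.continuousAt.eventually_lt continuousAt_const h0).filter_mono nhdsWithin_le_nhds
  have hall := (Finset.eventually_all (Finset.Ico a b)).2 hev
  have hle : ∀ᶠ ε : ℝ in nhdsWithin 0 (Set.Ioi 0), ε < 1 :=
    (eventually_lt_nhds one_pos).filter_mono nhdsWithin_le_nhds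
  obtain ⟨ε, e1, e2, e3⟩ := (hall.and (hle.and self_mem_nhdsWithin)).exists
  have e3 : 0 < ε := e3
  obtain ⟨j, j1, j2, j3⟩ := hsub ⟨ε, 1 - ε, e3.le, by linarith, by ring, rfl⟩
  exact absurd (e1 j (Finset.mem_Ico.2 ⟨j1, j2⟩)) (not_lt.2 j3)

end ThreeChains

/-! ## Funnels in a pseudotriangle -/

/-- The vertices after the corner `c`. -/
def chainAfter (w : ℕ → Plane) (c : ℕ) : ℕ → Plane := fun i => w (c + i)

/-- The vertices before the corner `c`, listed backwards. -/
def chainBefore (w : ℕ → Plane) (c : ℕ) : ℕ → Plane := fun j => w (c - j)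

theorem edgeVec_chainAfter (w : ℕ → Plane) (c i : ℕ) :
    edgeVec (chainAfter w c) i = edgeVec w (c + i) := rfl

theorem edgeVec_chainBefore (w : ℕ → Plane) {c j : ℕ} (h : j < c) :
    edgeVec (chainBefore w c) j = -edgeVec w (c - 1 - j) := by
  rw [edgeVec, edgeVec, chainBefore, chainBefore, show c - 1 - j + 1 = c - j by omega,
    show c - (j + 1) = c - 1 - j by omega, neg_sub]

theorem leftSide_chainAfter (w : ℕ → Plane) (c i : ℕ) (x : Plane) :
    leftSide (chainAfter w c) i x = side w (c + i) x := rfl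

theorem rightSide_chainBefore (w : ℕ → Plane) {c j : ℕ} (h : j < c) (x : Plane) :
    rightSide (chainBefore w c) j x = side w (c - 1 - j) x := by
  rw [rightSide, edgeVec_chainBefore w h, side_eq_next, cross_neg_left, neg_neg, chainBefore,
    show c - 1 - j + 1 = c - j by omega]

theorem chainBefore_point (w : ℕ → Plane) {c j : ℕ} (h : j < c) (s : ℝ) :
    chainBefore w c j + s • edgeVec (chainBefore w c) j =
      w (c - 1 - j) + (1 - s) • edgeVec w (c - 1 - j) := by
  rw [edgeVec_chainBefore w h, chainBefore, edgeVec, show c - 1 - j + 1 = c - j by omega, sub_smul,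
    one_smul, smul_neg]
  abel

/-- The points of a set that are chosen along the greedy walk. -/
noncomputable def walkPoint (L R : ℕ → Plane) (nl nr : ℕ) (M : ℕ → ℕ) (s : ℕ → ℝ) (t : ℕ) : Plane :=
  modePoint L R (M t) (s t) (greedyWalk L R nl nr t).1 (greedyWalk L R nl nr t).2

namespace ThreeChains

variable {w : ℕ → Plane} {a c b a'' b'' : ℕ}

/-- The points that are chosen along the greedy walk are hidden from each other. -/
theorem isHiddenSet_walk (h : ThreeChains w a c c b a'' b'') {P : Set Plane}
    (hP : P = chainSide w a c ∩ chainSide w c b ∩ chainSide w a'' b'')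
    {nl nr : ℕ} {A D : Plane} (hf : Funnel (chainAfter w c) (chainBefore w c) nl nr A D)
    (hnl : nl ≤ b - c) (hnr : nr ≤ c - a) {N : ℕ}
    (hN : GreedyEnd (chainAfter w c) (chainBefore w c) nl nr N) {M : ℕ → ℕ} {s : ℕ → ℝ}
    (hM : HiddenChoice (chainAfter w c) (chainBefore w c) nl nr N M s) :
    IsHiddenSet P ((Finset.range N).image
        (walkPoint (chainAfter w c) (chainBefore w c) nl nr M s)) ∧
      ((Finset.range N).image (walkPoint (chainAfter w c) (chainBefore w c) nl nr M s)).card = N := by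
  set q := walkPoint (chainAfter w c) (chainBefore w c) nl nr M s with hq
  -- It suffices to leave the side of a single chain, the one that carries the later point; that the
  -- earlier point is beyond its line is `modePoint_beyond`.
  have key : ∀ t₁ t₂, t₁ < t₂ → t₂ < N → ¬ segment ℝ (q t₁) (q t₂) ⊆ P := by
    intro t₁ t₂ h12 h2 hsub
    obtain ⟨b1, b2⟩ := hf.modePoint_beyond hN hM h12 h2 (a₁ := _) (b₁ := _) (a₂ := _) (b₂ := _) rfl rfl
    obtain ⟨v1, v2⟩ := hf.modePoint_valid hN hM h2 (a := _) (b := _) rfl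
    have s0 := hM.pos t₂ h2
    have s1 := hM.lt_one t₂ h2
    by_cases m2 : M t₂ = 2
    · have b1 := b1 m2
      have v1 := (v1 m2).1
      have e : q t₂ = w (c + (greedyWalk (chainAfter w c) (chainBefore w c) nl nr t₂).1) +
          s t₂ • edgeVec w (c + (greedyWalk (chainAfter w c) (chainBefore w c) nl nr t₂).1) := by
        rw [hq, walkPoint, modePoint, if_pos m2, edgeVec_chainAfter, chainAfter]
      rw [leftSide_chainAfter] at b1
      rw [e] at hsub
      exact h.rotate.not_segment_subset (Nat.le_add_right _ _) (by omega) s0 s1 b1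
        (fun x hx => by have := hsub hx; rw [hP] at this; exact this.1.2)
    · have b2 := b2 m2
      have v2 := (v2 m2).1
      rw [rightSide_chainBefore w (by omega)] at b2
      have e : q t₂ = w (c - 1 - (greedyWalk (chainAfter w c) (chainBefore w c) nl nr t₂).2) +
          (1 - s t₂) • edgeVec w (c - 1 - (greedyWalk (chainAfter w c) (chainBefore w c) nl nr t₂).2) := by
        rw [hq, walkPoint, modePoint, if_neg m2, chainBefore_point w (by omega)]
      rw [e] at hsub
      -- The right chain of the funnel lists the vertices backwards, so in the original direction of
      -- the edge the parameter is `1 - s`.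
      exact h.not_segment_subset (s := 1 - s t₂) (by omega) (by omega) (by linarith) (by linarith) b2
        (fun x hx => by have := hsub hx; rw [hP] at this; exact this.1.1)
  have hmem : ∀ t < N, q t ∈ P := by
    intro t ht
    obtain ⟨v1, v2⟩ := hf.modePoint_valid hN hM ht (a := _) (b := _) rfl
    have s0 := hM.pos t ht
    have s1 := hM.lt_one t ht
    rw [hP]
    by_cases m2 : M t = 2
    · have v1 := (v1 m2).1
      have hsub := h.rotate.edge_subset
        (i := c + (greedyWalk (chainAfter w c) (chainBefore w c) nl nr t).1) (by omega) (by omega)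
      have hseg : q t ∈ segment ℝ (w (c + (greedyWalk (chainAfter w c) (chainBefore w c) nl nr t).1))
          (w (c + (greedyWalk (chainAfter w c) (chainBefore w c) nl nr t).1 + 1)) := by
        refine ⟨1 - s t, s t, by linarith, by linarith, by ring, ?_⟩
        rw [hq, walkPoint, modePoint, if_pos m2, edge_convex_combo]; rfl
      obtain ⟨⟨x1, x2⟩, x3⟩ := hsub hseg
      exact ⟨⟨x3, x1⟩, x2⟩
    · have v2 := (v2 m2).1
      refine h.edge_subset
        (i := c - 1 - (greedyWalk (chainAfter w c) (chainBefore w c) nl nr t).2) (by omega) (by omega) ?_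
      refine ⟨s t, 1 - s t, by linarith, by linarith, by ring, ?_⟩
      rw [hq, walkPoint, modePoint, if_neg m2, chainBefore_point w (by omega), edge_convex_combo,
        sub_sub_cancel]
  -- Equal points would see each other along a trivial segment, so the `N` points are distinct.
  have hinj : Set.InjOn q (Finset.range N : Set ℕ) := by
    intro t₁ h1 t₂ h2 he
    rw [Finset.mem_coe, Finset.mem_range] at h1 h2
    by_contra hne
    rcases lt_or_gt_of_ne hne with hlt | hlt
    · refine key t₁ t₂ hlt h2 ?_
      rw [he, segment_same, Set.singleton_subset_iff]
      exact hmem t₂ h2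
    · refine key t₂ t₁ hlt h1 ?_
      rw [he, segment_same, Set.singleton_subset_iff]
      exact hmem t₂ h2
  refine ⟨⟨?_, ?_⟩, ?_⟩
  · intro x hx
    obtain ⟨t, ht, rfl⟩ := Finset.mem_image.1 hx
    exact hmem t (Finset.mem_range.1 ht)
  · intro x hx y hy hxy
    obtain ⟨t₁, h1, rfl⟩ := Finset.mem_image.1 hx
    obtain ⟨t₂, h2, rfl⟩ := Finset.mem_image.1 hy
    rw [Finset.mem_range] at h1 h2
    have hne : t₁ ≠ t₂ := by rintro rfl; exact hxy rfl
    rcases lt_or_gt_of_ne hne with hlt | hlt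
    · exact key t₁ t₂ hlt h2
    · rw [Sees, segment_symm]
      exact key t₂ t₁ hlt h1
  · rw [Finset.card_image_of_injOn hinj, Finset.card_range]

end ThreeChains

/-! ### Cutting a pseudotriangle into two funnels -/

/-- The direction of the cut at the first corner. -/
def cutDir (w : ℕ → Plane) (m : ℕ) : Plane := edgeVec w 0 - edgeVec w (m - 1)

/-- The edge from `k` to `k + 1` is the first edge of the opposite chain that reaches the cut. -/
structure CutEdge (w : ℕ → Plane) (p q m k : ℕ) : Prop where
  p_le : p ≤ k
  lt_q : k < q
  reach : 0 ≤ height (w 0) (cutDir w m) (w (k + 1))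
  first : ∀ i, p ≤ i → i < k → height (w 0) (cutDir w m) (w (i + 1)) < 0

namespace PseudoChain

variable {w : ℕ → Plane} {p q m k : ℕ}

/-- The cut direction is the sum of the first edge and the reversed last edge, so it points into the
first corner. The opposite chain crosses it from right to left, the two chains at the corner cross
it the other way, and so the height over the cut is monotone on each chain. -/
theorem cutDir_pos (h : PseudoChain w p q m) {j : ℕ} (h1 : p ≤ j) (h2 : j < q) :
    0 < cross (cutDir w m) (edgeVec w j) := by
  have := h.p_pos
  have := h.q_lt_m
  have a1 := h.ab 0 j (by omega) h1 h2
  have a2 := h.bc j (m - 1) h1 h2 (by omega) (by omega)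
  rw [cutDir, cross_sub_left, cross_comm (edgeVec w (m - 1))]
  linarith

theorem cutDir_neg_a (h : PseudoChain w p q m) {j : ℕ} (h1 : j < p) :
    cross (cutDir w m) (edgeVec w j) < 0 := by
  have := h.p_pos
  have := h.q_lt_m
  have a1 := h.ca (m - 1) j (by omega) (by omega) h1
  have a2 : cross (edgeVec w 0) (edgeVec w j) ≤ 0 := by
    rcases Nat.eq_zero_or_pos j with rfl | hj
    · rw [cross_self_eq_zero]
    · exact (h.aa 0 j hj h1).le
  rw [cutDir, cross_sub_left]
  linarith

theorem cutDir_neg_c (h : PseudoChain w p q m) {j : ℕ} (h1 : q ≤ j) (h2 : j < m) :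
    cross (cutDir w m) (edgeVec w j) < 0 := by
  have := h.p_pos
  have a1 := h.ca j 0 h1 h2 (by omega)
  have a2 : 0 ≤ cross (edgeVec w (m - 1)) (edgeVec w j) := by
    rcases (show j ≤ m - 1 by omega).eq_or_lt with rfl | hj
    · rw [cross_self_eq_zero]
    · have := h.cc j (m - 1) h1 hj (by omega)
      rw [cross_comm]; linarith
  rw [cutDir, cross_sub_left, cross_comm (edgeVec w 0)]
  linarith

theorem height_succ (w : ℕ → Plane) (A D : Plane) (i : ℕ) :
    height A D (w (i + 1)) = height A D (w i) + cross D (edgeVec w i) := by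
  rw [← height_add]; simp [edgeVec]

theorem height_a (h : PseudoChain w p q m) {j : ℕ} (h0 : 0 < j) (h1 : j ≤ p) :
    height (w 0) (cutDir w m) (w j) < 0 := by
  induction j, h0 using Nat.le_induction with
  | base =>
    rw [height_succ, height, sub_self, cross_zero_right, zero_add]
    exact h.cutDir_neg_a h1
  | succ j _ ih =>
    rw [height_succ]
    linarith [ih (by omega), h.cutDir_neg_a (show j < p by omega)]

theorem height_c (h : PseudoChain w p q m) {j : ℕ} (h0 : q ≤ j) (h1 : j < m) :
    0 < height (w 0) (cutDir w m) (w j) := by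
  obtain ⟨d, hd⟩ : ∃ d, m = j + 1 + d := ⟨m - j - 1, by omega⟩
  have hs := height_succ w (w 0) (cutDir w m) j
  have hc := h.cutDir_neg_c h0 h1
  induction d generalizing j with
  | zero =>
    have : height (w 0) (cutDir w m) (w (j + 1)) = 0 := by
      rw [show j + 1 = m by omega, h.closed, height, sub_self, cross_zero_right]
    linarith
  | succ d ih =>
    have := ih (j := j + 1) (by omega) (by omega) (by omega)
      (height_succ w (w 0) (cutDir w m) (j + 1)) (h.cutDir_neg_c (by omega) (by omega))
    linarith

theorem height_b_mono (h : PseudoChain w p q m) {i j : ℕ} (h0 : p ≤ i) (hij : i ≤ j) (h1 : j ≤ q) :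
    height (w 0) (cutDir w m) (w i) ≤ height (w 0) (cutDir w m) (w j) := by
  induction j, hij using Nat.le_induction with
  | base => exact le_rfl
  | succ j hij ih =>
    rw [height_succ]
    linarith [ih (by omega), h.cutDir_pos (show p ≤ j by omega) (show j < q by omega)]

/-- There is an edge that reaches the cut. -/
theorem exists_reach (h : PseudoChain w p q m) :
    ∃ k, p ≤ k ∧ k < q ∧ 0 ≤ height (w 0) (cutDir w m) (w (k + 1)) := by
  have := h.p_lt_q
  refine ⟨q - 1, by omega, by omega, ?_⟩
  rw [show q - 1 + 1 = q by omega]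
  exact (h.height_c le_rfl h.q_lt_m).le

theorem height_b_neg (h : PseudoChain w p q m) (hk : CutEdge w p q m k) {i : ℕ} (h0 : p ≤ i)
    (h1 : i ≤ k) : height (w 0) (cutDir w m) (w i) < 0 := by
  rcases h0.eq_or_lt with rfl | h0
  · exact h.height_a h.p_pos le_rfl
  · have := hk.first (i - 1) (by omega) (by omega)
    rwa [show i - 1 + 1 = i by omega] at this

/-- The funnel at the second corner. -/
theorem funnel₁ (h : PseudoChain w p q m) (hk : CutEdge w p q m k) :
    Funnel (chainAfter w p) (chainBefore w p) (k + 1 - p) p (w 0) (-cutDir w m) := by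
  have h1 := hk.p_le
  have h2 := hk.lt_q
  -- This funnel is on the negative side of the cut, which is therefore taken in the reversed
  -- direction.
  have hh : ∀ x, height (w 0) (-cutDir w m) x = -height (w 0) (cutDir w m) x := fun x => by
    rw [height, height, cross_neg_left]
  refine ⟨by omega, h.p_pos, rfl, ?_, ?_, ?_, ?_, ?_, ?_, ?_, ?_⟩
  · intro i j hi hj
    rw [edgeVec_chainAfter, edgeVec_chainBefore w hj, cross_neg_right, ← cross_comm]
    exact h.ab _ _ (by omega) (by omega) (by omega)
  · intro i j hij hj
    rw [edgeVec_chainAfter, edgeVec_chainAfter]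
    exact h.bb _ _ (by omega) (by omega) (by omega)
  · intro i j hij hj
    rw [edgeVec_chainBefore w hj, edgeVec_chainBefore w (by omega), cross_neg_right, cross_neg_left,
      neg_neg, cross_comm, neg_pos]
    exact h.aa _ _ (by omega) (by omega)
  · intro i hi
    rw [edgeVec_chainAfter, cross_neg_right, ← cross_comm]
    exact h.cutDir_pos (by omega) (by omega)
  · intro j hj
    rw [edgeVec_chainBefore w hj, cross_neg_right, cross_neg_left, neg_neg, cross_comm, neg_pos]
    exact h.cutDir_neg_a (by omega)
  · intro i hi
    rw [hh, chainAfter, neg_nonneg]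
    exact (h.height_b_neg hk (by omega) (by omega)).le
  · intro j hj
    rw [hh, chainBefore, neg_nonneg]
    exact (h.height_a (by omega) (by omega)).le
  · rw [hh, chainAfter, neg_pos]
    exact h.height_a (by have := h.p_pos; omega) (by omega)

/-- The funnel at the third corner. -/
theorem funnel₂ (h : PseudoChain w p q m) (hk : CutEdge w p q m k) :
    Funnel (chainAfter w q) (chainBefore w q) (m - q) (q - k) (w 0) (cutDir w m) := by
  have h0 := h.q_lt_m
  have h1 := hk.p_le
  have h2 := hk.lt_q
  -- The edge `k`, which reaches the cut, belongs to both funnels: it is the last right edge of this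
  -- one.
  refine ⟨by omega, by omega, rfl, ?_, ?_, ?_, ?_, ?_, ?_, ?_, ?_⟩
  · intro i j hi hj
    rw [edgeVec_chainAfter, edgeVec_chainBefore w (by omega), cross_neg_right, ← cross_comm]
    exact h.bc _ _ (by omega) (by omega) (by omega) (by omega)
  · intro i j hij hj
    rw [edgeVec_chainAfter, edgeVec_chainAfter]
    exact h.cc _ _ (by omega) (by omega) (by omega)
  · intro i j hij hj
    rw [edgeVec_chainBefore w (by omega), edgeVec_chainBefore w (by omega), cross_neg_right,
      cross_neg_left, neg_neg, cross_comm, neg_pos]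
    exact h.bb _ _ (by omega) (by omega) (by omega)
  · intro i hi
    rw [edgeVec_chainAfter, cross_comm, neg_pos]
    exact h.cutDir_neg_c (by omega) (by omega)
  · intro j hj
    rw [edgeVec_chainBefore w (by omega), cross_neg_left, ← cross_comm]
    exact h.cutDir_pos (by omega) (by omega)
  · intro i hi
    exact (h.height_c (by omega) (by omega)).le
  · intro j hj
    exact hk.reach.trans (h.height_b_mono (by omega) (by omega) (by omega))
  · exact h.height_c (by omega) (by omega)

theorem height_cutDir_eq (h : PseudoChain w p q m) (x : Plane) :
    height (w 0) (cutDir w m) x = side w 0 x - side w (m - 1) x := by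
  have := h.q_lt_m
  rw [height, cutDir, cross_sub_left, side, side_eq_next, show m - 1 + 1 = m by omega, h.closed]

/-- A point beyond both edges at the first corner is beyond all edges of the two chains. -/
theorem side_neg_of_corner (h : PseudoChain w p q m) {x : Plane} (h0 : side w 0 x < 0)
    (h1 : side w (m - 1) x < 0) {i : ℕ} (hi : i < p ∨ (q ≤ i ∧ i < m)) : side w i x < 0 := by
  have hp := h.p_pos
  have hq := h.q_lt_m
  have hE : 0 < cross (edgeVec w (m - 1)) (edgeVec w 0) := h.ca (m - 1) 0 (by omega) (by omega) hp
  -- In the basis of the last and the first edge, the coordinates of `x - w 0` are positive and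
  -- negative, respectively: `x` is in the sector opposite to the corner. Both summands decrease the
  -- position relative to each edge of the two chains.
  have e := Funnel.wedge (d := x - w 0) hE
  rw [side_eq_next, show m - 1 + 1 = m by omega, h.closed] at h1
  rw [side] at h0
  have hs : 0 < cross (x - w 0) (edgeVec w 0) / cross (edgeVec w (m - 1)) (edgeVec w 0) :=
    div_pos (by rw [cross_comm]; linarith) hE
  have ht : cross (edgeVec w (m - 1)) (x - w 0) / cross (edgeVec w (m - 1)) (edgeVec w 0) < 0 :=
    div_neg_of_neg_of_pos h1 hE
  have hx : x = w 0 + (x - w 0) := by abel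
  rw [hx, side_add, e, cross_add_right, cross_smul_right, cross_smul_right]
  rcases hi with hi | ⟨hi, hi'⟩
  · have c0 := h.threeChains.side_start (Nat.zero_le i) hi
    have c1 := h.ca (m - 1) i (by omega) (by omega) hi
    have c2 : 0 ≤ cross (edgeVec w i) (edgeVec w 0) := by
      rcases Nat.eq_zero_or_pos i with rfl | hj
      · rw [cross_self_eq_zero]
      · rw [cross_comm, neg_nonneg]; exact (h.aa 0 i hj hi).le
    rw [cross_comm] at c1
    nlinarith
  · have c0 := h.threeChains.rotate.rotate.side_end hi hi'
    have c1 := h.ca i 0 hi hi' hp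
    have c2 : cross (edgeVec w i) (edgeVec w (m - 1)) ≤ 0 := by
      rcases (show i ≤ m - 1 by omega).eq_or_lt with rfl | hj
      · rw [cross_self_eq_zero]
      · exact (h.cc i (m - 1) hi hj (by omega)).le
    rw [h.closed] at c0
    nlinarith

/-- The cut divides the region into the regions of the two funnels. -/
theorem region_eq_funnels (h : PseudoChain w p q m) (hk : CutEdge w p q m k) :
    chainRegion w p q m =
      funnelRegion (chainAfter w p) (chainBefore w p) (k + 1 - p) p (w 0) (-cutDir w m) ∪
      funnelRegion (chainAfter w q) (chainBefore w q) (m - q) (q - k) (w 0) (cutDir w m) := by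
  have h0 := h.p_pos
  have h1 := hk.p_le
  have h2 := hk.lt_q
  have h3 := h.q_lt_m
  have hh : ∀ x, height (w 0) (-cutDir w m) x = -height (w 0) (cutDir w m) x := fun x => by
    rw [height, height, cross_neg_left]
  -- Coordinates of `x` about the vertex `w (i + 1)` with respect to its two edges: their signs are
  -- those of `side w (i + 1) x` and `-side w i x`, and they control the height over the cut.
  have wedge' : ∀ i, p ≤ i → i + 1 < q → ∀ x, ∃ s t : ℝ,
      s * -cross (edgeVec w i) (edgeVec w (i + 1)) = side w (i + 1) x ∧
      t * -cross (edgeVec w i) (edgeVec w (i + 1)) = -side w i x ∧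
      height (w 0) (cutDir w m) x = height (w 0) (cutDir w m) (w (i + 1)) +
        (s * cross (cutDir w m) (edgeVec w i) + t * cross (cutDir w m) (edgeVec w (i + 1))) := by
    intro i i1 i2 x
    have hE : 0 < cross (edgeVec w (i + 1)) (edgeVec w i) := by
      rw [cross_comm, neg_pos]; exact h.bb i (i + 1) i1 (by omega) i2
    have e := Funnel.wedge (d := x - w (i + 1)) hE
    refine ⟨cross (edgeVec w (i + 1)) (x - w (i + 1)) / cross (edgeVec w (i + 1)) (edgeVec w i),
      cross (x - w (i + 1)) (edgeVec w i) / cross (edgeVec w (i + 1)) (edgeVec w i), ?_, ?_, ?_⟩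
    · rw [← cross_comm, div_mul_cancel₀ _ hE.ne', side]
    · rw [← cross_comm, div_mul_cancel₀ _ hE.ne', side_eq_next, ← cross_comm]
    · have hx : x = w (i + 1) + (x - w (i + 1)) := by abel
      conv_lhs => rw [hx, height_add, e, cross_add_right, cross_smul_right, cross_smul_right]
      ring
  apply Set.Subset.antisymm
  · rintro x ⟨⟨⟨i, _, i2, hi⟩, ⟨j, j1, j2, hj⟩⟩, ⟨l, l1, l2, hl⟩⟩
    rcases le_total (height (w 0) (cutDir w m) x) 0 with hx | hx
    · left
      refine ⟨by rw [hh]; linarith, ?_, ⟨p - 1 - i, by omega, ?_⟩⟩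
      · by_contra hcon
        push Not at hcon
        -- Changing from beyond edge `i` to not beyond edge `i + 1` would put `x` ahead of `w (i +
        -- 1)` along the two edges, hence strictly above the cut.
        have hall : ∀ i, k ≤ i → i < q → side w i x < 0 := by
          intro i hki
          induction i, hki using Nat.le_induction with
          | base =>
            intro _
            have := hcon (k - p) (by omega)
            rwa [leftSide_chainAfter, show p + (k - p) = k by omega] at this
          | succ i hki ih =>
            intro hi2
            by_contra hc
            obtain ⟨s, t, e1, e2, e3⟩ := wedge' i (by omega) hi2 x
            have b1 := h.bb i (i + 1) (by omega) (by omega) hi2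
            have b2 := h.cutDir_pos (show p ≤ i by omega) (show i < q by omega)
            have b3 := h.cutDir_pos (show p ≤ i + 1 by omega) hi2
            have b4 := hk.reach.trans (h.height_b_mono (i := k + 1) (j := i + 1) (by omega) (by omega) hi2.le)
            have b5 := ih (by omega)
            have s0 : 0 ≤ s := by by_contra hs; nlinarith
            have t0 : 0 < t := by by_contra ht; nlinarith
            nlinarith [mul_pos t0 b3, mul_nonneg s0 b2.le]
        rcases Nat.lt_or_ge j k with hjk | hjk
        · have := hcon (j - p) (by omega)
          rw [leftSide_chainAfter, show p + (j - p) = j by omega] at this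
          linarith
        · linarith [hall j hjk j2]
      · rw [rightSide_chainBefore w (by omega), show p - 1 - (p - 1 - i) = i by omega]
        exact hi
    · right
      refine ⟨hx, ⟨l - q, by omega, ?_⟩, ?_⟩
      · rw [leftSide_chainAfter, show q + (l - q) = l by omega]; exact hl
      · suffices hs : ∃ i, k ≤ i ∧ i < q ∧ 0 ≤ side w i x by
          obtain ⟨i, i1, i2, i3⟩ := hs
          refine ⟨q - 1 - i, by omega, ?_⟩
          rwa [rightSide_chainBefore w (by omega), show q - 1 - (q - 1 - i) = i by omega]
        rcases Nat.lt_or_ge j k with hjk | hjk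
        · have hall : ∀ i, j ≤ i → i ≤ k → 0 ≤ side w i x := by
            intro i hji
            induction i, hji using Nat.le_induction with
            | base => exact fun _ => hj
            | succ i hji ih =>
              intro hik
              by_contra hc
              obtain ⟨s, t, e1, e2, e3⟩ := wedge' i (by omega) (by omega) x
              have b1 := h.bb i (i + 1) (by omega) (by omega) (by omega)
              have b2 := h.cutDir_pos (show p ≤ i by omega) (show i < q by omega)
              have b3 := h.cutDir_pos (show p ≤ i + 1 by omega) (show i + 1 < q by omega)
              have b4 := h.height_b_neg hk (i := i + 1) (by omega) hik
              have b5 := ih (by omega)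
              have s0 : s < 0 := by by_contra hs; nlinarith
              have t0 : t ≤ 0 := by by_contra ht; nlinarith
              nlinarith [mul_pos_of_neg_of_neg s0 (neg_lt_zero.2 b2),
                mul_nonneg_of_nonpos_of_nonpos t0 (neg_nonpos.2 b3.le)]
          exact ⟨k, le_rfl, h2, hall k hjk.le le_rfl⟩
        · exact ⟨j, hjk, j2, hj⟩
  · rintro x (⟨hx, ⟨i, i1, hi⟩, ⟨j, j1, hj⟩⟩ | ⟨hx, ⟨i, i1, hi⟩, ⟨j, j1, hj⟩⟩)
    · rw [leftSide_chainAfter] at hi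
      rw [rightSide_chainBefore w (by omega)] at hj
      refine ⟨⟨⟨_, Nat.zero_le _, by omega, hj⟩, ⟨_, by omega, by omega, hi⟩⟩,
        ⟨m - 1, by omega, by omega, ?_⟩⟩
      -- On this side of the cut `side w 0 x ≤ side w (m - 1) x`. Beyond the last edge, `x` would be
      -- beyond both edges of the first corner and so beyond the whole first chain.
      by_contra hc
      push Not at hc
      rw [hh, h.height_cutDir_eq] at hx
      have := h.side_neg_of_corner (by linarith) hc (i := p - 1 - j) (Or.inl (by omega))
      linarith
    · rw [leftSide_chainAfter] at hi
      rw [rightSide_chainBefore w (by omega)] at hj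
      refine ⟨⟨⟨0, le_rfl, h0, ?_⟩, ⟨_, by omega, by omega, hj⟩⟩, ⟨_, by omega, by omega, hi⟩⟩
      by_contra hc
      push Not at hc
      rw [h.height_cutDir_eq] at hx
      have := h.side_neg_of_corner hc (by linarith) (i := q + i) (Or.inr ⟨by omega, by omega⟩)
      linarith

end PseudoChain

/-! ### Hidden sets and convex covers -/

/-- Two points in the same piece of the cover see each other by convexity, so choosing for each
hidden point a piece that contains it is injective. -/
theorem IsHiddenSet.card_le_of_cover {P : Set Plane} {H : Finset Plane} {C : Finset (Set Plane)}
    (hH : IsHiddenSet P H) (hC : IsConvexCover P C) : H.card ≤ C.card := by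
  classical
  have hex : ∀ x ∈ H, ∃ Q ∈ C, x ∈ Q := by
    intro x hx
    have hxP := hH.1 x hx
    rw [← hC.2] at hxP
    obtain ⟨Q, hQ, hxQ⟩ := hxP
    exact ⟨Q, hQ, hxQ⟩
  choose! f hf1 hf2 using hex
  refine Finset.card_le_card_of_injOn f hf1 ?_
  intro x hx y hy he
  by_contra hne
  refine hH.2 x hx y hy hne ?_
  obtain ⟨k, v, _, hv⟩ := hC.1 (f x) (hf1 x hx)
  have hconv : Convex ℝ (f x) := by rw [hv]; exact convex_convexHull _ _
  have hsub : f x ⊆ P := by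
    rw [← hC.2]; exact Set.subset_sUnion_of_mem (hf1 x hx)
  have hy' : y ∈ f x := by rw [he]; exact hf2 y hy
  exact (hconv.segment_subset (hf2 x hx) hy').trans hsub

/-! ## From polygons to periodic sequences -/

/-- The turn of a periodic sequence at its `i`-th vertex. -/
def turn (n : ℕ) (p : ℕ → Plane) (i : ℕ) : ℝ := cross (edgeVec p (i + n - 1)) (edgeVec p i)

theorem turn_of_pos {n : ℕ} {p : ℕ → Plane} (hp : ∀ i, p (i + n) = p i) {i : ℕ} (hi : 0 < i) :
    turn n p i = cross (edgeVec p (i - 1)) (edgeVec p i) := by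
  rw [turn, show i + n - 1 = i - 1 + n by omega]
  congr 1
  rw [edgeVec, edgeVec, hp, show i - 1 + n + 1 = i - 1 + 1 + n by ring, hp]

theorem turn_periodic {n : ℕ} {p : ℕ → Plane} (hn : 0 < n) (hp : ∀ i, p (i + n) = p i) (i : ℕ) :
    turn n p (i + n) = turn n p i := by
  have he : ∀ i, edgeVec p (i + n) = edgeVec p i := fun i => by
    rw [edgeVec, edgeVec, hp, show i + n + 1 = i + 1 + n by ring, hp]
  rw [turn, turn, he, show i + n + n - 1 = i + n - 1 + n by omega, he]

theorem turn_shift {n : ℕ} {p : ℕ → Plane} (hn : 0 < n) (f i : ℕ) :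
    turn n (fun k => p (k + f)) i = turn n p (i + f) := by
  rw [turn, turn]
  simp only [edgeVec]
  rw [show i + n - 1 + 1 + f = i + f + n - 1 + 1 by omega, show i + n - 1 + f = i + f + n - 1 by omega,
    show i + 1 + f = i + f + 1 by omega]

open Classical in
/-- A simple polygon, traversed counterclockwise, with exactly three convex vertices. -/
structure ThreeConvex (n : ℕ) (p : ℕ → Plane) : Prop where
  simple : SimplePeriodic n p
  area_pos : 0 < doubleArea n p
  count : Nat.count (fun i => 0 < turn n p i) n = 3

namespace ThreeConvex

variable {n : ℕ} {p : ℕ → Plane}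

open Classical in
theorem card_Ico (h : ThreeConvex n p) (f : ℕ) :
    ((Finset.Ico f (f + n)).filter fun i => 0 < turn n p i).card = 3 := by
  rw [← h.count]
  refine Nat.filter_Ico_card_eq_of_periodic f n _ fun i => ?_
  rw [turn_periodic (by have := h.simple.three_le; omega) h.simple.periodic]

theorem exists_convex (h : ThreeConvex n p) : ∃ f, 0 < f ∧ f ≤ n ∧ 0 < turn n p f := by
  classical
  have := h.card_Ico 1
  obtain ⟨f, hf⟩ := Finset.card_pos.1 (by rw [this]; norm_num)
  rw [Finset.mem_filter, Finset.mem_Ico] at hf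
  exact ⟨f, hf.1.1, by omega, hf.2⟩

/-- Started at a convex vertex, the polygon is a pseudotriangle in standard position. -/
theorem ccwPseudotriangle (h : ThreeConvex n p) {f : ℕ} (hf : 0 < turn n p f) :
    ∃ s₁ s₂, CcwPseudotriangle n s₁ s₂ (fun i => p (i + f)) := by
  classical
  have hn := h.simple.three_le
  have hc := h.card_Ico f
  set T := (Finset.Ico f (f + n)).filter fun i => 0 < turn n p i with hT
  have hfT : f ∈ T := by
    rw [hT, Finset.mem_filter, Finset.mem_Ico]; exact ⟨⟨le_rfl, by omega⟩, hf⟩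
  have hc2 : (T.erase f).card = 2 := by rw [Finset.card_erase_of_mem hfT, hc]
  obtain ⟨x, y, hxy, hTe⟩ := Finset.card_eq_two.1 hc2
  wlog hlt : x < y generalizing x y
  · exact this y x hxy.symm (by rw [hTe, Finset.pair_comm]) (by omega)
  have hx : x ∈ T.erase f := by rw [hTe]; simp
  have hy : y ∈ T.erase f := by rw [hTe]; simp
  rw [Finset.mem_erase, hT, Finset.mem_filter, Finset.mem_Ico] at hx hy
  refine ⟨x - f, y - f, h.simple.shift f, ?_, by omega, by omega, by omega, ?_⟩
  · rw [h.simple.doubleArea_shift]; exact h.area_pos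
  · intro i hi
    show 0 < turn n (fun k => p (k + f)) i ↔ _
    rw [turn_shift (by omega)]
    have hmem : 0 < turn n p (i + f) ↔ i + f ∈ T := by
      rw [hT, Finset.mem_filter, Finset.mem_Ico]
      exact ⟨fun hh => ⟨⟨by omega, by omega⟩, hh⟩, fun hh => hh.2⟩
    rw [hmem, ← Finset.insert_erase hfT, hTe]
    simp only [Finset.mem_insert, Finset.mem_singleton]
    omega

end ThreeConvex

theorem iUnion_Iio_periodic {α : Type*} {n : ℕ} (hn : 0 < n) {g : ℕ → Set α}
    (hg : ∀ i, g (i + n) = g i) : ⋃ k ∈ Set.Iio n, g k = ⋃ k, g k := by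
  apply Set.Subset.antisymm
  · exact Set.iUnion₂_subset fun k _ => Set.subset_iUnion g k
  · refine Set.iUnion_subset fun k => ?_
    have : g (k % n) = g k := (show Function.Periodic g n from hg).map_mod_nat k
    rw [← this]
    exact Set.subset_iUnion₂ (s := fun k (_ : k ∈ Set.Iio n) => g k) (k % n) (Nat.mod_lt _ hn)

theorem SimplePeriodic.chainBoundary_shift {n : ℕ} {p : ℕ → Plane} (h : SimplePeriodic n p) (f : ℕ) :
    chainBoundary (fun i => p (i + f)) n = chainBoundary p n := by
  have hn : 0 < n := by have := h.three_le; omega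
  have hg : ∀ i, segment ℝ (p (i + n)) (p (i + n + 1)) = segment ℝ (p i) (p (i + 1)) := fun i => by
    rw [h.periodic, show i + n + 1 = i + 1 + n by ring, h.periodic]
  rw [chainBoundary, chainBoundary, iUnion_Iio_periodic (g := fun i => segment ℝ (p i) (p (i + 1))) hn hg,
    iUnion_Iio_periodic (g := fun i => segment ℝ (p (i + f)) (p (i + 1 + f))) hn fun i => by
      rw [show i + n + f = i + f + n by ring, h.periodic, show i + n + 1 + f = i + 1 + f + n by ring,
        h.periodic]]
  apply Set.Subset.antisymm
  · refine Set.iUnion_subset fun k => ?_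
    rw [show k + 1 + f = k + f + 1 by ring]
    exact Set.subset_iUnion (fun i => segment ℝ (p i) (p (i + 1))) (k + f)
  · refine Set.iUnion_subset fun k => ?_
    have hp : ∀ i r, p (i + n * r) = p i := by
      intro i r
      induction r with
      | zero => simp
      | succ r ih => rw [Nat.mul_succ, ← add_assoc, h.periodic, ih]
    have hfn : f ≤ n * f := Nat.le_mul_of_pos_left f hn
    rw [← hp k f, ← hp (k + 1) f, show k + n * f = k + (n * f - f) + f by omega,
      show k + 1 + n * f = k + (n * f - f) + 1 + f by omega]
    exact Set.subset_iUnion (fun i => segment ℝ (p (i + f)) (p (i + 1 + f))) _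

/-! ### Reversing the direction -/

/-- A closed polygon, traversed in the other direction. -/
def reverseSeq (n : ℕ) (p : ℕ → Plane) (i : ℕ) : Plane := p (n - i % n)

section Reverse

variable {n : ℕ} {p : ℕ → Plane}

theorem reverseSeq_of_le (h : SimplePeriodic n p) {i : ℕ} (hi : i ≤ n) :
    reverseSeq n p i = p (n - i) := by
  rcases hi.lt_or_eq with hi | rfl
  · rw [reverseSeq, Nat.mod_eq_of_lt hi]
  · rw [reverseSeq, Nat.mod_self, Nat.sub_zero, Nat.sub_self, h.p_n]

theorem SimplePeriodic.reverse (h : SimplePeriodic n p) : SimplePeriodic n (reverseSeq n p) := by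
  have h3 := h.three_le
  refine simplePeriodic_of_closed (q := fun i => p (n - i)) h3 (by simp [h.p_n]) ?_ ?_
  · intro i j hij hj
    exact (h.ne_of_lt (show n - j < n - i by omega) (by omega)).symm
  · intro i j hij hj
    have := h.meet (n - (i + 1)) (by omega) (n - (j + 1)) (by omega) (by omega)
    rw [show n - (i + 1) + 1 = n - i by omega, show n - (j + 1) + 1 = n - j by omega] at this
    rw [segment_symm ℝ (p (n - i)), segment_symm ℝ (p (n - j)), Set.pair_comm (p (n - i)),
      Set.pair_comm (p (n - j))]
    exact this

theorem doubleArea_reverse (h : SimplePeriodic n p) :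
    doubleArea n (reverseSeq n p) = -doubleArea n p := by
  have : doubleArea n (reverseSeq n p) = _ :=
    doubleArea_closed (q := fun i => p (n - i)) (by simp [h.p_n])
  rw [this, doubleArea, ← Finset.sum_range_reflect, ← Finset.sum_neg_distrib]
  refine Finset.sum_congr rfl fun i hi => ?_
  rw [Finset.mem_range] at hi
  rw [show n - (n - 1 - i) = i + 1 by omega, show n - (n - 1 - i + 1) = i by omega, cross_comm]

/-- Reversal negates both edges at a vertex and exchanges them, so every turn changes its sign, just
as the area does. Convexity of a vertex, the sign of their product, is unaffected. -/
theorem turn_reverse (h : SimplePeriodic n p) {i : ℕ} (hi : i < n) :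
    turn n (reverseSeq n p) i = -turn n p (n - i) := by
  have h3 := h.three_le
  have he : ∀ i < n, edgeVec (reverseSeq n p) i = -edgeVec p (n - i - 1) := fun i hi => by
    rw [edgeVec, edgeVec, reverseSeq_of_le h hi, reverseSeq_of_le h hi.le,
      show n - i - 1 + 1 = n - i by omega, show n - (i + 1) = n - i - 1 by omega, neg_sub]
  have he' : edgeVec (reverseSeq n p) (i + n - 1) = -edgeVec p (n - i) := by
    rcases Nat.eq_zero_or_pos i with rfl | h0
    · rw [show 0 + n - 1 = n - 1 by omega, he (n - 1) (by omega), show n - (n - 1) - 1 = 0 by omega,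
        Nat.sub_zero, edgeVec, edgeVec, add_comm n 1, h.periodic, h.p_n]
    · have hr := h.reverse.periodic
      have : edgeVec (reverseSeq n p) (i + n - 1) = edgeVec (reverseSeq n p) (i - 1) := by
        rw [edgeVec, edgeVec, show i + n - 1 + 1 = i - 1 + 1 + n by omega,
          show i + n - 1 = i - 1 + n by omega, hr, hr]
      rw [this, he _ (by omega), show n - (i - 1) - 1 = n - i by omega]
  rw [turn, he', he i hi, turn_of_pos h.periodic (by omega), cross_neg_left, cross_neg_right,
    neg_neg, ← cross_comm]

theorem chainBoundary_reverse (h : SimplePeriodic n p) :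
    chainBoundary (reverseSeq n p) n = chainBoundary p n := by
  ext x
  simp only [chainBoundary, Set.mem_iUnion, Set.mem_Iio, exists_prop]
  constructor
  · rintro ⟨i, hi, hx⟩
    rw [reverseSeq_of_le h hi.le, reverseSeq_of_le h hi, segment_symm] at hx
    refine ⟨n - (i + 1), by omega, ?_⟩
    rwa [show n - (i + 1) + 1 = n - i by omega]
  · rintro ⟨i, hi, hx⟩
    refine ⟨n - 1 - i, by omega, ?_⟩
    rw [reverseSeq_of_le h (by omega), reverseSeq_of_le h (by omega), segment_symm]
    rwa [show n - (n - 1 - i + 1) = i by omega, show n - (n - 1 - i) = i + 1 by omega]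

end Reverse

/-! ### The vertices of a polygon as a periodic sequence -/

namespace Polygon

variable {n : ℕ}

/-- The vertices of a polygon, repeated periodically. -/
def seq (v : Polygon Plane n) (i : ℕ) : Plane :=
  if h : 0 < n then v ⟨i % n, Nat.mod_lt _ h⟩ else 0

theorem seq_val (v : Polygon Plane n) (i : Fin n) : v.seq i = v i := by
  rw [seq, dif_pos i.pos]
  congr 1
  exact Fin.ext (Nat.mod_eq_of_lt i.2)

theorem seq_periodic (v : Polygon Plane n) (i : ℕ) : v.seq (i + n) = v.seq i := by
  simp only [seq, Nat.add_mod_right]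

theorem val_finRotate (i : Fin n) : (finRotate n i : ℕ) = (i + 1) % n := by
  obtain ⟨k, rfl⟩ : ∃ k, n = k + 1 := ⟨n - 1, by have := i.2; omega⟩
  rw [coe_finRotate]
  split_ifs with h
  · rw [h, Fin.val_last, Nat.mod_self]
  · rw [Nat.mod_eq_of_lt]
    have := Fin.val_lt_last h
    omega

theorem seq_mod (v : Polygon Plane n) (i : ℕ) : v.seq (i % n) = v.seq i := by
  simp only [seq, Nat.mod_mod]

theorem apply_finRotate (v : Polygon Plane n) (i : Fin n) : v (finRotate n i) = v.seq (i + 1) := by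
  rw [← seq_val, val_finRotate, seq_mod]

theorem apply_finRotate_symm (v : Polygon Plane n) (i : Fin n) :
    v ((finRotate n).symm i) = v.seq (i + n - 1) := by
  have hn := i.pos
  have h := val_finRotate ((finRotate n).symm i)
  rw [Equiv.apply_symm_apply] at h
  rw [← seq_val]
  have hlt := ((finRotate n).symm i).2
  generalize (((finRotate n).symm i : Fin n) : ℕ) = j at *
  rcases Nat.lt_or_ge (j + 1) n with h1 | h1
  · rw [Nat.mod_eq_of_lt h1] at h
    rw [h, show j + 1 + n - 1 = j + n by omega, seq_periodic]
  · rw [show j + 1 = n by omega, Nat.mod_self] at h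
    rw [h, show 0 + n - 1 = j by omega]

theorem edgeSet_eq (v : Polygon Plane n) (i : Fin n) :
    v.edgeSet ℝ i = segment ℝ (v.seq i) (v.seq (i + 1)) := by
  rw [← apply_finRotate, seq_val, edgeSet, affineSegment_eq_segment]

theorem boundary_eq (v : Polygon Plane n) : v.boundary ℝ = chainBoundary v.seq n := by
  ext x
  simp only [boundary, chainBoundary, Set.mem_iUnion, Set.mem_Iio, exists_prop]
  constructor
  · rintro ⟨i, hi⟩
    exact ⟨i, i.2, by rwa [← edgeSet_eq]⟩
  · rintro ⟨i, hi, hx⟩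
    exact ⟨⟨i, hi⟩, by rwa [edgeSet_eq]⟩

theorem IsSimple.simplePeriodic {v : Polygon Plane n} (h : v.IsSimple) :
    SimplePeriodic n v.seq where
  three_le := h.1
  periodic := v.seq_periodic
  inj i hi j hj hij := by
    have := h.2.1 (show v.vertices ⟨i, hi⟩ = v.vertices ⟨j, hj⟩ from ?_)
    · exact congrArg Fin.val this
    · exact (v.seq_val ⟨i, hi⟩).symm.trans (hij.trans (v.seq_val ⟨j, hj⟩))
  meet i hi j hj hij := by
    have := h.2.2 ⟨i, hi⟩ ⟨j, hj⟩ (fun e => hij (congrArg Fin.val e))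
    rw [edgeSet_eq, edgeSet_eq, apply_finRotate, apply_finRotate, ← seq_val, ← seq_val] at this
    exact this

theorem signedArea_eq (v : Polygon Plane n) : v.signedArea = doubleArea n v.seq / 2 := by
  rw [signedArea, doubleArea, ← Fin.sum_univ_eq_sum_range fun i => cross (v.seq i) (v.seq (i + 1))]
  congr 1
  refine Finset.sum_congr rfl fun i _ => ?_
  rw [apply_finRotate, seq_val, cross]
  ring

theorem isConvexVertex_iff (v : Polygon Plane n) (i : Fin n) :
    v.IsConvexVertex i ↔ 0 < doubleArea n v.seq * turn n v.seq i := by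
  have hn := i.pos
  have e : orient (v ((finRotate n).symm i)) (v i) (v (finRotate n i)) = turn n v.seq i := by
    rw [apply_finRotate_symm, apply_finRotate, ← seq_val, orient_eq_cross, turn, edgeVec, edgeVec,
      show (i : ℕ) + n - 1 + 1 = i + n by omega, seq_periodic,
      show v.seq (i + 1) - v.seq (i + n - 1) =
        (v.seq i - v.seq (i + n - 1)) + (v.seq (i + 1) - v.seq i) by abel, cross_add_right,
      cross_self_eq_zero, zero_add]
  rw [IsConvexVertex, e, signedArea_eq]
  constructor <;> intro h <;> linarith

open Classical in
theorem IsPseudotriangle.count {v : Polygon Plane n} (h : v.IsPseudotriangle) :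
    Nat.count (fun i => 0 < doubleArea n v.seq * turn n v.seq i) n = 3 := by
  rw [← h.2, Nat.count_eq_card_filter_range, ← Set.ncard_coe_finset]
  symm
  refine Set.ncard_congr (fun i _ => (i : ℕ)) ?_ ?_ ?_
  · intro i hi
    simp only [Finset.coe_filter, Finset.mem_range]
    exact ⟨i.2, (isConvexVertex_iff v i).1 hi⟩
  · intro i j _ _ hij
    exact Fin.ext hij
  · intro i hi
    simp only [Finset.coe_filter, Finset.mem_range] at hi
    exact ⟨⟨i, hi.1⟩, (isConvexVertex_iff v ⟨i, hi.1⟩).2 hi.2, rfl⟩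

/-- The vertices of a polygon in counterclockwise order. -/
noncomputable def ccwSeq (v : Polygon Plane n) : ℕ → Plane :=
  open Classical in if 0 < doubleArea n v.seq then v.seq else reverseSeq n v.seq

theorem IsPseudotriangle.threeConvex {v : Polygon Plane n} (h : v.IsPseudotriangle) :
    ThreeConvex n v.ccwSeq := by
  classical
  have hs := h.1.simplePeriodic
  have hn := hs.three_le
  have hcount := h.count
  by_cases hA : 0 < doubleArea n v.seq
  · rw [ccwSeq, if_pos hA]
    refine ⟨hs, hA, ?_⟩
    rw [← hcount]
    congr 1
    funext i
    rw [eq_iff_iff, mul_pos_iff_of_pos_left hA]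
  · rw [ccwSeq, if_neg hA]
    -- Area zero has to be excluded; this is where the theorem on the total turning is used for the
    -- orientation.
    have hA' : doubleArea n v.seq < 0 := by
      rcases hs.totalTurn_and_area with a | a
      · exact absurd a.2 hA
      · exact a.2
    refine ⟨hs.reverse, by rw [doubleArea_reverse hs]; linarith, ?_⟩
    have hQ : ∀ i, 0 < doubleArea n v.seq * turn n v.seq i ↔ 0 < -turn n v.seq i := fun i => by
      constructor <;> intro hh <;> nlinarith
    simp only [hQ] at hcount
    -- The map `i ↦ n - i` sends 0, …, n - 1 to n, …, 1, so the convex vertices are counted over the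
    -- period that starts at 1.
    rw [← hcount, ← Nat.filter_Ico_card_eq_of_periodic 1 n (fun i => 0 < -turn n v.seq i) fun i => by
      simp only [turn_periodic (by omega) hs.periodic], Nat.count_eq_card_filter_range]
    refine Finset.card_bij (fun i _ => n - i) ?_ ?_ ?_
    · intro i hi
      rw [Finset.mem_filter, Finset.mem_range] at hi
      rw [Finset.mem_filter, Finset.mem_Ico, ← turn_reverse hs hi.1]
      exact ⟨⟨by omega, by omega⟩, hi.2⟩
    · intro i hi j hj hij
      rw [Finset.mem_filter, Finset.mem_range] at hi hj
      omega
    · intro j hj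
      rw [Finset.mem_filter, Finset.mem_Ico] at hj
      refine ⟨n - j, ?_, by omega⟩
      rw [Finset.mem_filter, Finset.mem_range, turn_reverse hs (by omega),
        show n - (n - j) = j by omega]
      exact ⟨by omega, hj.2⟩

theorem IsPseudotriangle.boundary_ccwSeq {v : Polygon Plane n} (h : v.IsPseudotriangle) :
    v.boundary ℝ = chainBoundary v.ccwSeq n := by
  rw [boundary_eq, ccwSeq]
  split_ifs
  · rfl
  · rw [chainBoundary_reverse h.1.simplePeriodic]

open Classical in
/-- From a convex vertex on, the vertices at which the boundary turns form a pseudotriangle chain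
with the given region. -/
theorem IsPseudotriangle.exists_pseudoChain {v : Polygon Plane n} (h : v.IsPseudotriangle) {f : ℕ}
    (hf : 0 < turn n v.ccwSeq f) :
    ∃ p q, PseudoChain (corners n fun i => v.ccwSeq (i + f)) p q
        (Nat.count (TurnsAt n fun i => v.ccwSeq (i + f)) n) ∧
      v.region = chainRegion (corners n fun i => v.ccwSeq (i + f)) p q
        (Nat.count (TurnsAt n fun i => v.ccwSeq (i + f)) n) := by
  obtain ⟨s₁, s₂, hc⟩ := h.threeConvex.ccwPseudotriangle hf
  refine ⟨_, _, hc.pseudoChain, ?_⟩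
  have hb : v.boundary ℝ = chainBoundary (corners n fun i => v.ccwSeq (i + f))
      (Nat.count (TurnsAt n fun i => v.ccwSeq (i + f)) n) := by
    rw [h.boundary_ccwSeq, ← h.threeConvex.simple.chainBoundary_shift f]
    exact hc.boundary_corners
  rw [region, hb]
  exact hc.pseudoChain.region_eq

end Polygon

/-! ## Parameters and modes of the hidden points -/

/-- A parameter at which an affine function with the value `f₀ < 0` at `0` and `f₁` at `1` is still
negative. -/
noncomputable def smallParam (f₀ f₁ : ℝ) : ℝ := (0 - f₀) / (2 * ((0 - f₀) + 1 + f₁ * f₁))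

/-- Only field operations are needed: the factor that multiplies `f₀` in the value at this parameter
is positive because `f₁` is dominated by `1 + f₁ * f₁`. -/
theorem smallParam_spec {f₀ f₁ : ℝ} (h : f₀ < 0) :
    0 < smallParam f₀ f₁ ∧ smallParam f₀ f₁ < 1 ∧ f₀ + smallParam f₀ f₁ * (f₁ - f₀) < 0 := by
  have hd : 0 < 2 * ((0 - f₀) + 1 + f₁ * f₁) := by nlinarith [mul_self_nonneg f₁]
  refine ⟨div_pos (by linarith) hd, ?_, ?_⟩
  · rw [smallParam, div_lt_one hd]
    nlinarith [mul_self_nonneg f₁]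
  · have e : f₀ + smallParam f₀ f₁ * (f₁ - f₀) =
        f₀ * ((0 - f₀) + 2 + 2 * (f₁ * f₁) - f₁) / (2 * ((0 - f₀) + 1 + f₁ * f₁)) := by
      rw [smallParam, eq_div_iff hd.ne', add_mul, mul_right_comm, div_mul_cancel₀ _ hd.ne']
      ring
    rw [e]
    exact div_neg_of_neg_of_pos (mul_neg_of_neg_of_pos h (by nlinarith [sq_nonneg (f₁ - 1)])) hd

/-- The parameter of the points on the edges that are passed by the greedy walk at `(a, b)`. -/
noncomputable def greedyParam (L R : ℕ → Plane) (nl nr a b : ℕ) : ℝ :=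
  open Classical in
  if nl ≤ a then 1 / 2 else if nr ≤ b then 1 / 2 else
    if leftSide L a (R b) < 0 then smallParam (leftSide L a (R b)) (leftSide L a (R (b + 1))) else
      if rightSide R b (L a) < 0 then
        smallParam (rightSide R b (L a)) (rightSide R b (L (a + 1))) else 1 / 2

/-- The kind of the `t`-th step of the greedy walk. -/
noncomputable def stepKind (L R : ℕ → Plane) (nl nr t : ℕ) : ℕ :=
  greedyKind L R nl nr (greedyWalk L R nl nr t).1 (greedyWalk L R nl nr t).2

/-- The parameter of the `t`-th step of the greedy walk. -/
noncomputable def stepParam (L R : ℕ → Plane) (nl nr t : ℕ) : ℝ :=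
  greedyParam L R nl nr (greedyWalk L R nl nr t).1 (greedyWalk L R nl nr t).2

/-- The last nonzero value before the last `d` of the first `N` values of `κ`. -/
def modeRev (κ : ℕ → ℕ) (N : ℕ) : ℕ → ℕ
  | 0 => 1
  | d + 1 => if κ (N - (d + 1)) = 0 then modeRev κ N d else κ (N - (d + 1))

/-- The first nonzero value of `κ` from `t` on, if there is one before `N`. -/
def modeAt (κ : ℕ → ℕ) (N t : ℕ) : ℕ := modeRev κ N (N - t)

/-- When only two-sided steps remain, both sides would do; 1 is the value with which the program
starts its way back. -/
theorem modeAt_self (κ : ℕ → ℕ) (N : ℕ) : modeAt κ N N = 1 := by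
  rw [modeAt, Nat.sub_self, modeRev]

theorem modeAt_of_lt (κ : ℕ → ℕ) {N t : ℕ} (h : t < N) :
    modeAt κ N t = if κ t = 0 then modeAt κ N (t + 1) else κ t := by
  rw [modeAt, show N - t = N - (t + 1) + 1 by omega, modeRev,
    show N - (N - (t + 1) + 1) = t by omega, modeAt]

/-- A one-sided step is taken because the start of an edge is beyond the next opposite line. Along
that edge the position relative to this line is affine, so `smallParam` supplies an interior point
that is still beyond it. -/
theorem hiddenChoice_greedy (L R : ℕ → Plane) (nl nr N : ℕ) :
    HiddenChoice L R nl nr N (modeAt (stepKind L R nl nr) N) (stepParam L R nl nr) := by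
  have key : ∀ a b, 0 < greedyParam L R nl nr a b ∧ greedyParam L R nl nr a b < 1 := by
    intro a b
    unfold greedyParam
    split_ifs with h1 h2 h3 h4
    · norm_num
    · norm_num
    · exact ⟨(smallParam_spec h3).1, (smallParam_spec h3).2.1⟩
    · exact ⟨(smallParam_spec h4).1, (smallParam_spec h4).2.1⟩
    · norm_num
  have hsucc : ∀ (p : ℕ → Plane) i, p (i + 1) = p i + edgeVec p i := fun p i => by simp [edgeVec]
  refine ⟨?_, fun t _ => (key _ _).1, fun t _ => (key _ _).2, ?_, ?_⟩
  · intro t ht a b e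
    rw [modeAt_of_lt _ ht, stepKind, e]
  · intro t _ a b e hk ha
    rw [stepParam, e]
    rcases Funnel.greedyKind_cases L R nl nr a b with c | c | c | c | c
    · omega
    · omega
    · obtain ⟨c1, c2, c3, -⟩ := c
      have hs := (smallParam_spec (f₁ := leftSide L a (R (b + 1))) c3).2.2
      rw [greedyParam, if_neg (by omega), if_neg (by omega), if_pos c3]
      rw [leftSide_combo, cross_smul_right]
      have e1 : leftSide L a (R (b + 1)) = leftSide L a (R b) + cross (edgeVec L a) (edgeVec R b) := by
        rw [hsucc R b, leftSide_combo]
      rw [show cross (edgeVec L a) (edgeVec R b) =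
        leftSide L a (R (b + 1)) - leftSide L a (R b) by rw [e1]; ring]
      exact hs
    · omega
    · omega
  · intro t _ a b e hk hb
    rw [stepParam, e]
    rcases Funnel.greedyKind_cases L R nl nr a b with c | c | c | c | c
    · omega
    · omega
    · omega
    · obtain ⟨c1, c2, c0, c3, -⟩ := c
      have hs := (smallParam_spec (f₁ := rightSide R b (L (a + 1))) c3).2.2
      rw [greedyParam, if_neg (by omega), if_neg (by omega), if_neg (not_lt.2 c0), if_pos c3]
      rw [rightSide_combo, cross_smul_right]
      have e1 : rightSide R b (L (a + 1)) = rightSide R b (L a) - cross (edgeVec R b) (edgeVec L a) := by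
        rw [hsucc L a, rightSide_combo]
      have e2 : cross (edgeVec R b) (edgeVec L a) =
        rightSide R b (L a) - rightSide R b (L (a + 1)) := by rw [e1]; ring
      rw [e2]
      linarith
    · omega

/-! ## Reasoning about programs -/

namespace Program

/-- Programs without loops. -/
def loopFree : Program → Bool
  | skip => true
  | setNat _ _ _ => true
  | setReal _ _ _ => true
  | seq p q => p.loopFree && q.loopFree
  | branch _ p q => p.loopFree && q.loopFree
  | loop _ _ => false

/-- The final state of a program without loops. -/
noncomputable def exec : Program → RamState → RamState
  | skip, s => s
  | setNat a i e, s => s.writeNat a (i.eval s) (e.eval s)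
  | setReal a i e, s => s.writeReal a (i.eval s) (e.eval s)
  | seq p q, s => q.exec (p.exec s)
  | branch b p q, s => open Classical in if b.holds s then p.exec s else q.exec s
  | loop _ _, s => s

/-- An upper bound for the running time of a program without loops. -/
def maxCost : Program → ℕ
  | skip => 1
  | setNat _ i e => i.cost + e.cost + 1
  | setReal _ i e => i.cost + e.cost + 1
  | seq p q => p.maxCost + q.maxCost
  | branch b p q => b.cost + (p.maxCost + q.maxCost)
  | loop _ _ => 0

/-- The program writes into the `a`-th array of natural numbers. -/
def writesNat (a : ℕ) : Program → Bool
  | skip => false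
  | setNat c _ _ => c == a
  | setReal _ _ _ => false
  | seq p q => p.writesNat a || q.writesNat a
  | branch _ p q => p.writesNat a || q.writesNat a
  | loop _ p => p.writesNat a

/-- The program writes into the `a`-th array of real numbers. -/
def writesReal (a : ℕ) : Program → Bool
  | skip => false
  | setNat _ _ _ => false
  | setReal c _ _ => c == a
  | seq p q => p.writesReal a || q.writesReal a
  | branch _ p q => p.writesReal a || q.writesReal a
  | loop _ p => p.writesReal a

/-- `s'` agrees with `s` in all arrays that are not written by `p`. -/
structure Frame (p : Program) (s s' : RamState) : Prop where
  nat : ∀ a, p.writesNat a = false → s'.nat a = s.nat a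
  real : ∀ a, p.writesReal a = false → s'.real a = s.real a

theorem Frame.refl (p : Program) (s : RamState) : Frame p s s := ⟨fun _ _ => rfl, fun _ _ => rfl⟩

theorem Frame.trans {p : Program} {s s₁ s₂ : RamState} (h : Frame p s s₁) (h' : Frame p s₁ s₂) :
    Frame p s s₂ :=
  ⟨fun a ha => (h'.nat a ha).trans (h.nat a ha), fun a ha => (h'.real a ha).trans (h.real a ha)⟩

end Program

open Program

/-- Which arrays a program writes can be computed from its text. Facts about all other arrays are
carried through programs by `rfl`. -/
theorem Runs.frame {p : Program} {s s' : RamState} {t : ℕ} (h : Runs p s t s') : Frame p s s' := by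
  induction h with
  | skip s => exact Frame.refl _ _
  | setNat s a i e =>
    refine ⟨fun b hb => ?_, fun b _ => rfl⟩
    rw [writesNat, beq_eq_false_iff_ne] at hb
    exact Function.update_of_ne hb.symm _ _
  | setReal s a i e =>
    refine ⟨fun b _ => rfl, fun b hb => ?_⟩
    rw [writesReal, beq_eq_false_iff_ne] at hb
    exact Function.update_of_ne hb.symm _ _
  | seq _ _ ih₁ ih₂ =>
    refine ⟨fun a ha => ?_, fun a ha => ?_⟩
    · rw [writesNat, Bool.or_eq_false_iff] at ha
      exact (ih₂.nat a ha.2).trans (ih₁.nat a ha.1)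
    · rw [writesReal, Bool.or_eq_false_iff] at ha
      exact (ih₂.real a ha.2).trans (ih₁.real a ha.1)
  | branchTrue _ _ ih =>
    refine ⟨fun a ha => ?_, fun a ha => ?_⟩
    · rw [writesNat, Bool.or_eq_false_iff] at ha
      exact ih.nat a ha.1
    · rw [writesReal, Bool.or_eq_false_iff] at ha
      exact ih.real a ha.1
  | branchFalse _ _ ih =>
    refine ⟨fun a ha => ?_, fun a ha => ?_⟩
    · rw [writesNat, Bool.or_eq_false_iff] at ha
      exact ih.nat a ha.2
    · rw [writesReal, Bool.or_eq_false_iff] at ha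
      exact ih.real a ha.2
  | loopDone _ => exact Frame.refl _ _
  | loopStep _ _ _ ih₁ ih₂ =>
    refine ⟨fun a ha => ?_, fun a ha => ?_⟩
    · exact (ih₂.nat a ha).trans (ih₁.nat a ha)
    · exact (ih₂.real a ha).trans (ih₁.real a ha)

/-- Loop-free programs are treated by computing their final state. Loops enter only with loop-free
bodies, through `runs_loop` and an invariant. -/
theorem runs_exec {p : Program} (hp : p.loopFree = true) (s : RamState) :
    ∃ t ≤ p.maxCost, Runs p s t (p.exec s) := by
  induction p generalizing s with
  | skip => exact ⟨1, le_rfl, .skip s⟩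
  | setNat a i e => exact ⟨_, le_rfl, .setNat s a i e⟩
  | setReal a i e => exact ⟨_, le_rfl, .setReal s a i e⟩
  | seq p q ihp ihq =>
    rw [loopFree, Bool.and_eq_true] at hp
    obtain ⟨t₁, h₁, r₁⟩ := ihp hp.1 s
    obtain ⟨t₂, h₂, r₂⟩ := ihq hp.2 (p.exec s)
    exact ⟨t₁ + t₂, Nat.add_le_add h₁ h₂, .seq r₁ r₂⟩
  | branch b p q ihp ihq =>
    rw [loopFree, Bool.and_eq_true] at hp
    rw [exec, maxCost]
    split_ifs with hb
    · obtain ⟨t₁, h₁, r₁⟩ := ihp hp.1 s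
      exact ⟨b.cost + t₁, by omega, .branchTrue hb r₁⟩
    · obtain ⟨t₁, h₁, r₁⟩ := ihq hp.2 s
      exact ⟨b.cost + t₁, by omega, .branchFalse hb r₁⟩
  | loop b p => cases hp

theorem exec_frame {p : Program} (hp : p.loopFree = true) (s : RamState) : Frame p s (p.exec s) := by
  obtain ⟨t, _, r⟩ := runs_exec hp s
  exact r.frame

/-- A loop with an invariant and a decreasing measure. -/
theorem runs_loop {b : Test} {p : Program} (hp : p.loopFree = true) {s : RamState}
    (I : RamState → Prop) (μ : RamState → ℕ) (h0 : I s)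
    (hstep : ∀ s', Frame p s s' → I s' → b.holds s' → I (p.exec s') ∧ μ (p.exec s') < μ s') :
    ∃ t s', t ≤ (b.cost + p.maxCost) * (μ s + 1) ∧ Runs (.loop b p) s t s' ∧ I s' ∧ ¬ b.holds s' := by
  have key : ∀ k s₁, μ s₁ = k → Frame p s s₁ → I s₁ → ∃ t s', t ≤ (b.cost + p.maxCost) * (k + 1) ∧
      Runs (.loop b p) s₁ t s' ∧ I s' ∧ ¬ b.holds s' := by
    intro k
    induction k using Nat.strong_induction_on with
    | _ k ih =>
      intro s₁ hk hf hI
      by_cases hb : b.holds s₁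
      · obtain ⟨h1, h2⟩ := hstep s₁ hf hI hb
        obtain ⟨t₁, ht₁, r₁⟩ := runs_exec hp s₁
        obtain ⟨t₂, s', ht₂, r₂, q₁, q₂⟩ := ih _ (hk ▸ h2) _ rfl (hf.trans r₁.frame) h1
        refine ⟨b.cost + t₁ + t₂, s', ?_, .loopStep hb r₁ r₂, q₁, q₂⟩
        have : (b.cost + p.maxCost) * (μ (p.exec s₁) + 1) ≤ (b.cost + p.maxCost) * k :=
          Nat.mul_le_mul_left _ (by omega)
        rw [Nat.mul_succ]
        omega
      · refine ⟨b.cost, s₁, ?_, .loopDone hb, hI, hb⟩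
        rw [Nat.mul_succ]
        omega
  exact key _ s rfl (Frame.refl _ _) h0

/-! ### Memory access -/

namespace RamState

@[simp] theorem writeNat_nat (s : RamState) (a i x b j : ℕ) :
    (s.writeNat a i x).nat b j = if b = a ∧ j = i then x else s.nat b j := by
  rw [writeNat]
  by_cases h : b = a
  · subst h
    simp [Function.update_apply]
  · simp [h]

@[simp] theorem writeNat_real (s : RamState) (a i x : ℕ) : (s.writeNat a i x).real = s.real := rfl

@[simp] theorem writeReal_nat (s : RamState) (a i : ℕ) (x : ℝ) : (s.writeReal a i x).nat = s.nat := rfl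

@[simp] theorem writeReal_real (s : RamState) (a i : ℕ) (x : ℝ) (b j : ℕ) :
    (s.writeReal a i x).real b j = if b = a ∧ j = i then x else s.real b j := by
  rw [writeReal]
  by_cases h : b = a
  · subst h
    simp [Function.update_apply]
  · simp [h]

/-- The points whose coordinates are in the real arrays `a` and `b`. -/
def pt (s : RamState) (a b i : ℕ) : Plane := (s.real a i, s.real b i)

end RamState

/-- Register `a`: cell `0` of the `a`-th array of natural numbers. -/
def NatExpr.reg (a : ℕ) : NatExpr := .get a (.const 0)

@[simp] theorem NatExpr.eval_reg (s : RamState) (a : ℕ) : (NatExpr.reg a).eval s = s.nat a 0 := rfl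

@[simp] theorem NatExpr.eval_const (s : RamState) (c : ℕ) : (NatExpr.const c).eval s = c := rfl

@[simp] theorem NatExpr.eval_get (s : RamState) (a : ℕ) (i : NatExpr) :
    (NatExpr.get a i).eval s = s.nat a (i.eval s) := rfl

@[simp] theorem NatExpr.eval_add (s : RamState) (e f : NatExpr) :
    (NatExpr.add e f).eval s = e.eval s + f.eval s := rfl

@[simp] theorem NatExpr.eval_sub (s : RamState) (e f : NatExpr) :
    (NatExpr.sub e f).eval s = e.eval s - f.eval s := rfl

theorem NatExpr.eval_congr {s s' : RamState} (h : s.nat = s'.nat) (e : NatExpr) :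
    e.eval s = e.eval s' := by
  induction e with
  | const c => rfl
  | get a i ih => simp only [eval_get, ih, h]
  | add e f ih₁ ih₂ => simp only [eval_add, ih₁, ih₂]
  | sub e f ih₁ ih₂ => simp only [eval_sub, ih₁, ih₂]

@[simp] theorem NatExpr.eval_writeReal (s : RamState) (a i : ℕ) (x : ℝ) (e : NatExpr) :
    e.eval (s.writeReal a i x) = e.eval s :=
  NatExpr.eval_congr (s := s.writeReal a i x) (s' := s) rfl e

namespace RealExpr

/-- The expression reads the `a`-th array of real numbers. -/
def reads (a : ℕ) : RealExpr → Bool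
  | const _ => false
  | get b _ => b == a
  | add e f => e.reads a || f.reads a
  | sub e f => e.reads a || f.reads a
  | mul e f => e.reads a || f.reads a
  | div e f => e.reads a || f.reads a

theorem eval_writeReal {a : ℕ} {e : RealExpr} (h : e.reads a = false) (s : RamState) (i : ℕ) (x : ℝ) :
    e.eval (s.writeReal a i x) = e.eval s := by
  induction e with
  | const c => rfl
  | get b j =>
    rw [reads, beq_eq_false_iff_ne] at h
    simp [eval, h]
  | add e f ih₁ ih₂ | sub e f ih₁ ih₂ | mul e f ih₁ ih₂ | div e f ih₁ ih₂ =>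
    rw [reads, Bool.or_eq_false_iff] at h
    rw [eval, eval, ih₁ h.1, ih₂ h.2]

end RealExpr

/-- A pair of expressions for the coordinates of a point. -/
structure PointExpr where
  fst : RealExpr
  snd : RealExpr

namespace PointExpr

/-- The value of a pair of expressions. -/
noncomputable def eval (s : RamState) (p : PointExpr) : Plane := (p.fst.eval s, p.snd.eval s)

/-- The point in the cells `i` of two arrays. -/
def get (a b : ℕ) (i : NatExpr) : PointExpr := ⟨.get a i, .get b i⟩

/-- The sum of two points. -/
def add (p q : PointExpr) : PointExpr := ⟨.add p.fst q.fst, .add p.snd q.snd⟩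

/-- The difference of two points. -/
def sub (p q : PointExpr) : PointExpr := ⟨.sub p.fst q.fst, .sub p.snd q.snd⟩

/-- A multiple of a point. -/
def smul (r : RealExpr) (p : PointExpr) : PointExpr := ⟨.mul r p.fst, .mul r p.snd⟩

/-- The cross product. -/
def cross (p q : PointExpr) : RealExpr := .sub (.mul p.fst q.snd) (.mul p.snd q.fst)

/-- The common point of two lines. -/
def lineMeet (A D p d : PointExpr) : PointExpr :=
  .add A (.smul (.div (PointExpr.cross (.sub p A) d) (PointExpr.cross D d)) D)

@[simp] theorem eval_get (s : RamState) (a b : ℕ) (i : NatExpr) :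
    (get a b i).eval s = s.pt a b (i.eval s) := rfl

@[simp] theorem eval_add (s : RamState) (p q : PointExpr) :
    (add p q).eval s = p.eval s + q.eval s := rfl

@[simp] theorem eval_sub (s : RamState) (p q : PointExpr) :
    (sub p q).eval s = p.eval s - q.eval s := rfl

@[simp] theorem eval_smul (s : RamState) (r : RealExpr) (p : PointExpr) :
    (smul r p).eval s = r.eval s • p.eval s := rfl

@[simp] theorem eval_cross (s : RamState) (p q : PointExpr) :
    (cross p q).eval s = _root_.cross (p.eval s) (q.eval s) := rfl

@[simp] theorem eval_lineMeet (s : RamState) (A D p d : PointExpr) :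
    (lineMeet A D p d).eval s = _root_.lineMeet (A.eval s) (D.eval s) (p.eval s) (d.eval s) := rfl

end PointExpr

/-- Write a point into the cells `i` of two arrays. -/
def Program.setPoint (a b : ℕ) (i : NatExpr) (p : PointExpr) : Program :=
  .seq (.setReal a i p.fst) (.setReal b i p.snd)

/-- The first coordinate is written before the second one is evaluated; the hypothesis keeps this
from changing the second. -/
theorem exec_setPoint {a b : ℕ} {i : NatExpr} {p : PointExpr} (h : p.snd.reads a = false)
    (s : RamState) : (setPoint a b i p).exec s =
      (s.writeReal a (i.eval s) (p.eval s).1).writeReal b (i.eval s) (p.eval s).2 := by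
  rw [setPoint, exec, exec, exec, NatExpr.eval_writeReal, RealExpr.eval_writeReal h]
  rfl

/-- The program `p` started in `s` stops within time `c` in a state with the property `Q`. -/
def RunsWithin (p : Program) (s : RamState) (c : ℕ) (Q : RamState → Prop) : Prop :=
  ∃ t s', t ≤ c ∧ Runs p s t s' ∧ Q s'

theorem RunsWithin.seq {p q : Program} {s : RamState} {c₁ c₂ : ℕ} {Q₁ Q₂ : RamState → Prop}
    (h₁ : RunsWithin p s c₁ Q₁) (h₂ : ∀ s', Frame p s s' → Q₁ s' → RunsWithin q s' c₂ Q₂) :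
    RunsWithin (.seq p q) s (c₁ + c₂) Q₂ := by
  obtain ⟨t₁, s₁, a₁, a₂, a₃⟩ := h₁
  obtain ⟨t₂, s₂, b₁, b₂, b₃⟩ := h₂ s₁ a₂.frame a₃
  exact ⟨t₁ + t₂, s₂, Nat.add_le_add a₁ b₁, .seq a₂ b₂, b₃⟩

theorem RunsWithin.of_exec {p : Program} (hp : p.loopFree = true) {s : RamState}
    {Q : RamState → Prop} (h : Q (p.exec s)) : RunsWithin p s p.maxCost Q := by
  obtain ⟨t, ht, r⟩ := runs_exec hp s
  exact ⟨t, _, ht, r, h⟩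

theorem RunsWithin.mono {p : Program} {s : RamState} {c c' : ℕ} {Q Q' : RamState → Prop}
    (h : RunsWithin p s c Q) (hc : c ≤ c') (hQ : ∀ s', Frame p s s' → Q s' → Q' s') :
    RunsWithin p s c' Q' := by
  obtain ⟨t, s', h₁, h₂, h₃⟩ := h
  exact ⟨t, s', h₁.trans hc, h₂, hQ s' h₂.frame h₃⟩

/-- Search for the first number from a register on at which a test fails. -/
def Program.search (a : ℕ) (b : Test) : Program :=
  .loop b (.setNat a (.const 0) (.add (.reg a) (.const 1)))

theorem writeNat_writeNat (s : RamState) (a i x y : ℕ) :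
    (s.writeNat a i x).writeNat a i y = s.writeNat a i y := by
  simp [RamState.writeNat]

theorem writeNat_self (s : RamState) (a i : ℕ) : s.writeNat a i (s.nat a i) = s := by
  simp [RamState.writeNat]

theorem runs_search {a : ℕ} {b : Test} {s : RamState} {f : ℕ} (hle : s.nat a 0 ≤ f)
    (h1 : ∀ g, s.nat a 0 ≤ g → g < f → b.holds (s.writeNat a 0 g))
    (h2 : ¬ b.holds (s.writeNat a 0 f)) :
    RunsWithin (search a b) s ((b.cost + 6) * (f + 1)) (fun s' => s' = s.writeNat a 0 f) := by
  obtain ⟨t, s', r1, r2, ⟨g, g1, g2, rfl⟩, r4⟩ := runs_loop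
    (p := .setNat a (.const 0) (.add (.reg a) (.const 1))) (b := b) rfl
    (fun s' => ∃ g, s.nat a 0 ≤ g ∧ g ≤ f ∧ s' = s.writeNat a 0 g) (fun s' => f - s'.nat a 0)
    (s := s) ⟨_, le_rfl, hle, (writeNat_self s a 0).symm⟩ (by
      rintro _ _ ⟨g, g1, g2, rfl⟩ hb
      have hne : g ≠ f := by rintro rfl; exact h2 hb
      refine ⟨⟨g + 1, by omega, by omega, ?_⟩, ?_⟩
      · simp [exec, writeNat_writeNat]
      · simp [exec]
        omega)
  have : g = f := by
    by_contra hne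
    exact r4 (h1 g g1 (by omega))
  subst this
  refine ⟨t, _, r1.trans (Nat.mul_le_mul ?_ (by omega)), r2, rfl⟩
  simp [maxCost, NatExpr.cost, NatExpr.reg]

/-! ## The program for a funnel -/

namespace Funnel

variable {L R : ℕ → Plane} {nl nr : ℕ} {A D : Plane}

/-- The greedy walk reaches the end of both chains. -/
theorem exists_greedyEnd (h : Funnel L R nl nr A D) :
    ∃ N, N ≤ nl + nr ∧ GreedyEnd L R nl nr N := by
  classical
  -- Each step passes at least one edge, so `a + b` grows at least as fast as `t`, but it never
  -- exceeds `nl + nr`.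
  have key : ∀ t, (∀ t' < t, greedyWalk L R nl nr t' ≠ (nl, nr)) →
      (((greedyWalk L R nl nr t).1 = 0 ∧ (greedyWalk L R nl nr t).2 = 0) ∨
        WalkInv L R nl nr (greedyWalk L R nl nr t).1 (greedyWalk L R nl nr t).2) ∧
      t ≤ (greedyWalk L R nl nr t).1 + (greedyWalk L R nl nr t).2 := by
    intro t
    induction t with
    | zero => exact fun _ => ⟨Or.inl ⟨rfl, rfl⟩, Nat.zero_le _⟩
    | succ t ih =>
      intro hne
      obtain ⟨h1, h2⟩ := ih fun t' ht' => hne t' (by omega)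
      refine ⟨Or.inr (h.walk_step h1 (hne t (by omega)) rfl rfl rfl).1, ?_⟩
      rw [greedyWalk]
      dsimp only
      split_ifs <;> omega
  have hex : ∃ t, greedyWalk L R nl nr t = (nl, nr) := by
    by_contra hcon
    push Not at hcon
    obtain ⟨h1, h2⟩ := key (nl + nr + 1) fun t' _ => hcon t'
    rcases h1 with h1 | h1
    · omega
    · have := h1.a_le
      have := h1.b_le
      omega
  refine ⟨Nat.find hex, ?_, Nat.find_spec hex, fun t ht => Nat.find_min hex ht⟩
  have := (key (Nat.find hex) fun t ht => Nat.find_min hex ht).2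
  rwa [Nat.find_spec hex] at this

end Funnel

/-- The pieces at the states of the greedy walk. -/
def walkPieces (L R : ℕ → Plane) (nl nr : ℕ) (A D : Plane) (N : ℕ) : Set (Set Plane) :=
  {Q | ∃ t, 0 < t ∧ t ≤ N ∧ Q = funnelPiece L R A D ((greedyWalk L R nl nr t).1 - 1)
    ((greedyWalk L R nl nr t).2 - 1)}

/-- The output arrays hold triangles, and `S` is the set of their regions. -/
structure StoredTriangles (s : RamState) (S : Set (Set Plane)) : Prop where
  start : ∀ j ≤ s.nat 2 0, s.nat 3 j = 3 * j
  pos : ∀ j < s.nat 2 0, 0 < orient (s.pt 4 5 (3 * j)) (s.pt 4 5 (3 * j + 1)) (s.pt 4 5 (3 * j + 2))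
  eq : S = {Q | ∃ j < s.nat 2 0, Q =
    convexHull ℝ {s.pt 4 5 (3 * j), s.pt 4 5 (3 * j + 1), s.pt 4 5 (3 * j + 2)}}

@[simp] theorem RamState.pt_writeNat (s : RamState) (a i x b c : ℕ) :
    (s.writeNat a i x).pt b c = s.pt b c := rfl

theorem RamState.pt_writeReal (s : RamState) {a b c d : ℕ} (h : a ≠ b) (i : ℕ) (x y : ℝ)
    (hc : c ≠ a ∧ c ≠ b) (hd : d ≠ a ∧ d ≠ b) :
    ((s.writeReal a i x).writeReal b i y).pt a b =
      (fun j => if j = i then (x, y) else s.pt a b j) ∧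
    ((s.writeReal a i x).writeReal b i y).pt c d = s.pt c d := by
  refine ⟨funext fun j => ?_, funext fun j => ?_⟩
  · by_cases hj : j = i <;> simp [pt, h, hj]
  · simp [pt, hc.1, hc.2, hd.1, hd.2]

theorem pt_setPoint {a b : ℕ} {i : NatExpr} {p : PointExpr} (h : p.snd.reads a = false) (hab : a ≠ b)
    (s : RamState) (j : ℕ) : ((setPoint a b i p).exec s).pt a b j =
      if j = i.eval s then p.eval s else s.pt a b j := by
  rw [exec_setPoint h]
  -- The number `a + b + 1` merely stands for some array different from `a` and `b`.
  exact congrFun (s.pt_writeReal hab _ _ _ (c := a + b + 1) (d := a + b + 1)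
    ⟨by omega, by omega⟩ ⟨by omega, by omega⟩).1 j

theorem nat_setPoint {a b : ℕ} {i : NatExpr} {p : PointExpr} (s : RamState) :
    ((setPoint a b i p).exec s).nat = s.nat := rfl

theorem Program.Frame.pt {p : Program} {s s' : RamState} (h : Frame p s s') (a b : ℕ)
    (ha : p.writesReal a = false) (hb : p.writesReal b = false) : s'.pt a b = s.pt a b := by
  funext i
  rw [RamState.pt, RamState.pt, h.real a ha, h.real b hb]

/-- Equality of natural numbers. -/
def Test.natEq (e f : NatExpr) : Test := .and (.natLe e f) (.natLe f e)

@[simp] theorem Test.holds_natEq (s : RamState) (e f : NatExpr) :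
    (Test.natEq e f).holds s ↔ e.eval s = f.eval s :=
  ⟨fun h => le_antisymm h.1 h.2, fun h => ⟨h.le, h.ge⟩⟩

/-- Strict comparison with zero. -/
def Test.neg (e : RealExpr) : Test := .not (.realLe (.const 0) e)

@[simp] theorem Test.holds_neg (s : RamState) (e : RealExpr) : (Test.neg e).holds s ↔ e.eval s < 0 := by
  simp [Test.neg, Test.holds, RealExpr.eval]

@[simp] theorem Test.holds_natLe (s : RamState) (e f : NatExpr) :
    (Test.natLe e f).holds s ↔ e.eval s ≤ f.eval s := Iff.rfl

namespace FunnelProgram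

/-- A vertex of the chain. -/
def vertex (e : NatExpr) : PointExpr := .get 8 9 e

/-- A vertex of the left chain of the funnel. -/
def left (i : NatExpr) : PointExpr := vertex (.add (.reg 20) i)

/-- A vertex of the right chain of the funnel. -/
def right (j : NatExpr) : PointExpr := vertex (.sub (.reg 20) j)

/-- An edge of the left chain. -/
def leftEdge (i : NatExpr) : PointExpr := .sub (left (.add i (.const 1))) (left i)

/-- An edge of the right chain. -/
def rightEdge (j : NatExpr) : PointExpr := .sub (right (.add j (.const 1))) (right j)

/-- The position relative to a line of the left chain. -/
def leftPos (i : NatExpr) (x : PointExpr) : RealExpr := PointExpr.cross (leftEdge i) (.sub x (left i))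

/-- The position relative to a line of the right chain. -/
def rightPos (j : NatExpr) (x : PointExpr) : RealExpr :=
  .sub (.const 0) (PointExpr.cross (rightEdge j) (.sub x (right j)))

/-- The left chain in the memory. -/
def leftChain (s : RamState) : ℕ → Plane := chainAfter (s.pt 8 9) (s.nat 20 0)

/-- The right chain in the memory. -/
def rightChain (s : RamState) : ℕ → Plane := chainBefore (s.pt 8 9) (s.nat 20 0)

@[simp] theorem eval_left (s : RamState) (i : NatExpr) :
    (left i).eval s = leftChain s (i.eval s) := rfl

@[simp] theorem eval_right (s : RamState) (i : NatExpr) :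
    (right i).eval s = rightChain s (i.eval s) := rfl

@[simp] theorem eval_leftEdge (s : RamState) (i : NatExpr) :
    (leftEdge i).eval s = edgeVec (leftChain s) (i.eval s) := rfl

@[simp] theorem eval_rightEdge (s : RamState) (i : NatExpr) :
    (rightEdge i).eval s = edgeVec (rightChain s) (i.eval s) := rfl

@[simp] theorem eval_leftPos (s : RamState) (i : NatExpr) (x : PointExpr) :
    (leftPos i x).eval s = leftSide (leftChain s) (i.eval s) (x.eval s) := rfl

@[simp] theorem eval_rightPos (s : RamState) (i : NatExpr) (x : PointExpr) :
    (rightPos i x).eval s = rightSide (rightChain s) (i.eval s) (x.eval s) := by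
  simp [rightPos, RealExpr.eval, rightSide]

/-- A parameter at which an affine function is still negative. -/
def param (e₀ e₁ : RealExpr) : RealExpr :=
  .div (.sub (.const 0) e₀)
    (.mul (.const 2) (.add (.add (.sub (.const 0) e₀) (.const 1)) (.mul e₁ e₁)))

@[simp] theorem eval_param (s : RamState) (e₀ e₁ : RealExpr) :
    (param e₀ e₁).eval s = smallParam (e₀.eval s) (e₁.eval s) := by
  simp [param, RealExpr.eval, smallParam]

/-- Set the kind and the parameter of a step. -/
def setKind (k : ℕ) (e : RealExpr) : Program :=
  .seq (.setNat 26 (.const 0) (.const k)) (.setReal 15 (.const 0) e)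

theorem exec_setKind (s : RamState) (k : ℕ) (e : RealExpr) (r : ℝ)
    (h : e.eval (s.writeNat 26 0 k) = r) :
    ((setKind k e).exec s).nat 26 0 = k ∧ ((setKind k e).exec s).real 15 0 = r := by
  simp [setKind, exec, h]

/-- Determine the kind and the parameter of the next step. -/
def chooseStep : Program :=
  .branch (.natLe (.reg 21) (.reg 23)) (setKind 1 (.const (1 / 2))) <|
  .branch (.natLe (.reg 22) (.reg 24)) (setKind 2 (.const (1 / 2))) <|
  .branch (.neg (leftPos (.reg 23) (right (.reg 24))))
    (setKind 1 (param (leftPos (.reg 23) (right (.reg 24)))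
      (leftPos (.reg 23) (right (.add (.reg 24) (.const 1)))))) <|
  .branch (.neg (rightPos (.reg 24) (left (.reg 23))))
    (setKind 2 (param (rightPos (.reg 24) (left (.reg 23)))
      (rightPos (.reg 24) (left (.add (.reg 23) (.const 1))))))
    (setKind 0 (.const (1 / 2)))

/-- Register 20 holds the index of the apex, 21 and 22 the lengths of the two chains, 23 and 24 the
state of the walk. The kind of the step is left in register 26 and its parameter in cell 0 of the
real array 15. -/
theorem exec_chooseStep (s : RamState) :
    (chooseStep.exec s).nat 26 0 = greedyKind (leftChain s) (rightChain s) (s.nat 21 0) (s.nat 22 0)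
      (s.nat 23 0) (s.nat 24 0) ∧
    (chooseStep.exec s).real 15 0 = greedyParam (leftChain s) (rightChain s) (s.nat 21 0)
      (s.nat 22 0) (s.nat 23 0) (s.nat 24 0) := by
  have hl : ∀ k, leftChain (s.writeNat 26 0 k) = leftChain s := fun k => by simp [leftChain]
  have hr : ∀ k, rightChain (s.writeNat 26 0 k) = rightChain s := fun k => by simp [rightChain]
  simp only [chooseStep, exec, greedyKind, greedyParam, Test.holds_natLe, Test.holds_neg,
    eval_leftPos, eval_rightPos, eval_left, eval_right, NatExpr.eval_reg]
  split_ifs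
  all_goals
    apply exec_setKind
    simp [RealExpr.eval, hl, hr]

/-- Store the kind of a step and the points on the next edges. -/
def storePoints : Program :=
  .seq (.setNat 27 (.reg 25) (.reg 26)) <|
  .seq (.setPoint 16 17 (.reg 25)
    (.add (left (.reg 23)) (.smul (.get 15 (.const 0)) (leftEdge (.reg 23)))))
  (.setPoint 18 19 (.reg 25)
    (.add (right (.reg 24)) (.smul (.get 15 (.const 0)) (rightEdge (.reg 24)))))

/-- Both candidates, on the left edge and on the right edge, are kept: which of them a two-sided
step uses depends on later steps. A candidate for an edge that does not exist is never used
(`Funnel.modePoint_valid`). -/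
theorem exec_storePoints (s : RamState) :
    (∀ j, (storePoints.exec s).nat 27 j = if j = s.nat 25 0 then s.nat 26 0 else s.nat 27 j) ∧
    (∀ j, (storePoints.exec s).pt 16 17 j = if j = s.nat 25 0 then
      leftChain s (s.nat 23 0) + s.real 15 0 • edgeVec (leftChain s) (s.nat 23 0) else s.pt 16 17 j) ∧
    (∀ j, (storePoints.exec s).pt 18 19 j = if j = s.nat 25 0 then
      rightChain s (s.nat 24 0) + s.real 15 0 • edgeVec (rightChain s) (s.nat 24 0)
      else s.pt 18 19 j) := by
  set s₁ := s.writeNat 27 (s.nat 25 0) (s.nat 26 0) with hs₁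
  set s₂ := (setPoint 16 17 (.reg 25)
    (.add (left (.reg 23)) (.smul (.get 15 (.const 0)) (leftEdge (.reg 23))))).exec s₁ with hs₂
  have f₂ : Frame _ s₁ s₂ := exec_frame rfl s₁
  have e : storePoints.exec s = (setPoint 18 19 (.reg 25)
    (.add (right (.reg 24)) (.smul (.get 15 (.const 0)) (rightEdge (.reg 24))))).exec s₂ := rfl
  have f₃ : Frame _ s₂ (storePoints.exec s) := e ▸ exec_frame rfl s₂
  refine ⟨fun j => ?_, fun j => ?_, fun j => ?_⟩
  · rw [f₃.nat 27 rfl, f₂.nat 27 rfl]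
    simp [hs₁]
  · rw [f₃.pt 16 17 rfl rfl, hs₂, pt_setPoint rfl (by norm_num)]
    simp [hs₁, leftChain, RealExpr.eval]
  · rw [e, pt_setPoint rfl (by norm_num)]
    have h8 := f₂.pt 8 9 rfl rfl
    have h18 := f₂.pt 18 19 rfl rfl
    have h15 := f₂.real 15 rfl
    have hn : s₂.nat = s₁.nat := rfl
    simp [RealExpr.eval, rightChain, h8, h18, h15, hn, hs₁]

/-- Advance the state of the walk. -/
def advance : Program :=
  .seq (.branch (.natEq (.reg 26) (.const 1)) .skip (.setNat 23 (.const 0) (.add (.reg 23) (.const 1))))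
  (.branch (.natEq (.reg 26) (.const 2)) .skip (.setNat 24 (.const 0) (.add (.reg 24) (.const 1))))

theorem exec_advance (s : RamState) :
    (advance.exec s).nat 23 0 = (if s.nat 26 0 = 1 then s.nat 23 0 else s.nat 23 0 + 1) ∧
    (advance.exec s).nat 24 0 = (if s.nat 26 0 = 2 then s.nat 24 0 else s.nat 24 0 + 1) := by
  by_cases h1 : s.nat 26 0 = 1
  · simp [advance, exec, h1]
  · by_cases h2 : s.nat 26 0 = 2 <;> simp [advance, exec, h1, h2]

/-- The edge of the left chain that was passed last. -/
def curLeft : NatExpr := .sub (.reg 23) (.const 1)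

/-- The edge of the right chain that was passed last. -/
def curRight : NatExpr := .sub (.reg 24) (.const 1)

/-- The place of the next output vertices. -/
def outCell (e : ℕ) : NatExpr := .add (.get 3 (.reg 2)) (.const e)

/-- The common point of the base line with a line of the left chain. -/
def leftFoot : PointExpr :=
  .lineMeet (vertex (.const 0)) (.get 13 14 (.const 0)) (left curLeft) (leftEdge curLeft)

/-- The common point of the base line with a line of the right chain. -/
def rightFoot : PointExpr :=
  .lineMeet (vertex (.const 0)) (.get 13 14 (.const 0)) (right curRight) (rightEdge curRight)

/-- The common point of the current lines of the two chains. -/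
def summit : PointExpr :=
  .lineMeet (left curLeft) (leftEdge curLeft) (right curRight) (rightEdge curRight)

/-- Output the triangle of the current state of the walk. -/
def outputTriangle : Program :=
  .seq (.setPoint 4 5 (outCell 0) leftFoot) <|
  .seq (.setPoint 4 5 (outCell 1) rightFoot) <|
  .seq (.setPoint 4 5 (outCell 2) summit) <|
  .seq (.setNat 3 (.add (.reg 2) (.const 1)) (.add (.get 3 (.reg 2)) (.const 3)))
  (.setNat 2 (.const 0) (.add (.reg 2) (.const 1)))

theorem exec_outputTriangle (s : RamState) {L R : ℕ → Plane} {i j : ℕ} (hL : L = leftChain s)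
    (hR : R = rightChain s) (hi : i = s.nat 23 0 - 1) (hj : j = s.nat 24 0 - 1) :
    (outputTriangle.exec s).nat 2 0 = s.nat 2 0 + 1 ∧
    (∀ e, (outputTriangle.exec s).nat 3 e =
      if e = s.nat 2 0 + 1 then s.nat 3 (s.nat 2 0) + 3 else s.nat 3 e) ∧
    (∀ e, (outputTriangle.exec s).pt 4 5 e =
      if e = s.nat 3 (s.nat 2 0) + 2 then lineMeet (L i) (edgeVec L i) (R j) (edgeVec R j) else
      if e = s.nat 3 (s.nat 2 0) + 1 then
        lineMeet (s.pt 8 9 0) (s.pt 13 14 0) (R j) (edgeVec R j) else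
      if e = s.nat 3 (s.nat 2 0) then lineMeet (s.pt 8 9 0) (s.pt 13 14 0) (L i) (edgeVec L i)
      else s.pt 4 5 e) := by
  subst hL hR hi hj
  set s₁ := (Program.setPoint 4 5 (outCell 0) leftFoot).exec s with hs₁
  set s₂ := (Program.setPoint 4 5 (outCell 1) rightFoot).exec s₁ with hs₂
  set s₃ := (Program.setPoint 4 5 (outCell 2) summit).exec s₂ with hs₃
  have f₁ : Frame _ s s₁ := exec_frame rfl s
  have f₂ : Frame _ s₁ s₂ := exec_frame rfl s₁
  have n₁ : s₁.nat = s.nat := rfl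
  have n₂ : s₂.nat = s.nat := rfl
  have n₃ : s₃.nat = s.nat := rfl
  have e : outputTriangle.exec s = (s₃.writeNat 3 (s.nat 2 0 + 1) (s.nat 3 (s.nat 2 0) + 3)).writeNat 2 0
      (s.nat 2 0 + 1) := by
    rw [outputTriangle, exec, exec, exec, exec, exec, exec, ← hs₁, ← hs₂, ← hs₃]
    simp [n₃]
  have w₁ := f₁.pt 8 9 rfl rfl
  have w₂ := (f₂.pt 8 9 rfl rfl).trans w₁
  have d₁ := f₁.pt 13 14 rfl rfl
  rw [e]
  refine ⟨by simp, fun e => by simp [n₃], fun e => ?_⟩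
  rw [RamState.pt_writeNat, RamState.pt_writeNat, hs₃, pt_setPoint rfl (by norm_num), hs₂,
    pt_setPoint rfl (by norm_num), ← hs₂, hs₁, pt_setPoint rfl (by norm_num), ← hs₁]
  simp [outCell, leftFoot, rightFoot, summit, vertex, n₁, n₂, curLeft, curRight, leftChain,
    rightChain, w₁, w₂, d₁]

/-- One step of the walk. -/
def step : Program :=
  .seq chooseStep <| .seq storePoints <| .seq advance <| .seq outputTriangle
    (.setNat 25 (.const 0) (.add (.reg 25) (.const 1)))

/-- Not all edges are passed. -/
def notDone : Test := .not (.and (.natLe (.reg 21) (.reg 23)) (.natLe (.reg 22) (.reg 24)))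

/-- The invariant of the walk. -/
structure WalkState (L R : ℕ → Plane) (nl nr : ℕ) (A D : Plane) (N : ℕ) (S : Set (Set Plane))
    (s : RamState) : Prop where
  le : s.nat 25 0 ≤ N
  left : s.nat 23 0 = (greedyWalk L R nl nr (s.nat 25 0)).1
  right : s.nat 24 0 = (greedyWalk L R nl nr (s.nat 25 0)).2
  kind : ∀ t < s.nat 25 0, s.nat 27 t = stepKind L R nl nr t
  leftPoint : ∀ t < s.nat 25 0, s.pt 16 17 t =
    modePoint L R 2 (stepParam L R nl nr t) (greedyWalk L R nl nr t).1 (greedyWalk L R nl nr t).2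
  rightPoint : ∀ t < s.nat 25 0, s.pt 18 19 t =
    modePoint L R 1 (stepParam L R nl nr t) (greedyWalk L R nl nr t).1 (greedyWalk L R nl nr t).2
  stored : StoredTriangles s (S ∪ walkPieces L R nl nr A D (s.nat 25 0))

/-- The parameters of a funnel in the memory. -/
structure Params (w : ℕ → Plane) (c nl nr : ℕ) (D : Plane) (s : RamState) : Prop where
  vertices : s.pt 8 9 = w
  corner : s.nat 20 0 = c
  left : s.nat 21 0 = nl
  right : s.nat 22 0 = nr
  dir : s.pt 13 14 0 = D

theorem Params.of_frame {w : ℕ → Plane} {c nl nr : ℕ} {D : Plane} {s s' : RamState} {p : Program}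
    (h : Params w c nl nr D s) (hf : Frame p s s')
    (hp : (p.writesReal 8 || p.writesReal 9 || p.writesReal 13 || p.writesReal 14 ||
      p.writesNat 20 || p.writesNat 21 || p.writesNat 22) = false) : Params w c nl nr D s' := by
  simp only [Bool.or_eq_false_iff] at hp
  obtain ⟨⟨⟨⟨⟨⟨h8, h9⟩, h13⟩, h14⟩, h20⟩, h21⟩, h22⟩ := hp
  refine ⟨?_, ?_, ?_, ?_, ?_⟩
  · rw [hf.pt 8 9 h8 h9, h.vertices]
  · rw [hf.nat 20 h20, h.corner]
  · rw [hf.nat 21 h21, h.left]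
  · rw [hf.nat 22 h22, h.right]
  · rw [hf.pt 13 14 h13 h14, h.dir]

section

variable {w : ℕ → Plane} {c nl nr : ℕ} {D : Plane} {N : ℕ} {S : Set (Set Plane)}

theorem _root_.StoredTriangles.insert_step {L R : ℕ → Plane} {i j : ℕ} {A : Plane} {s s' : RamState}
    (hs : StoredTriangles s S) (hf : Funnel L R nl nr A D) (hi : i < nl) (hj : j < nr)
    (h2 : s'.nat 2 0 = s.nat 2 0 + 1)
    (h3 : ∀ e, s'.nat 3 e = if e = s.nat 2 0 + 1 then s.nat 3 (s.nat 2 0) + 3 else s.nat 3 e)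
    (h4 : ∀ e, s'.pt 4 5 e =
      if e = s.nat 3 (s.nat 2 0) + 2 then lineMeet (L i) (edgeVec L i) (R j) (edgeVec R j) else
      if e = s.nat 3 (s.nat 2 0) + 1 then lineMeet A D (R j) (edgeVec R j) else
      if e = s.nat 3 (s.nat 2 0) then lineMeet A D (L i) (edgeVec L i) else s.pt 4 5 e) :
    StoredTriangles s' (S ∪ {funnelPiece L R A D i j}) := by
  obtain ⟨hst, hpos, heq⟩ := hs
  have e0 := hst _ le_rfl
  rw [e0] at h3 h4
  generalize s.nat 2 0 = J at *
  have old : ∀ e < 3 * J, s'.pt 4 5 e = s.pt 4 5 e := fun e he => by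
    rw [h4, if_neg (by omega), if_neg (by omega), if_neg (by omega)]
  have c0 : s'.pt 4 5 (3 * J) = lineMeet A D (L i) (edgeVec L i) := by
    rw [h4, if_neg (by omega), if_neg (by omega), if_pos rfl]
  have c1 : s'.pt 4 5 (3 * J + 1) = lineMeet A D (R j) (edgeVec R j) := by
    rw [h4, if_neg (by omega), if_pos rfl]
  have c2 : s'.pt 4 5 (3 * J + 2) = lineMeet (L i) (edgeVec L i) (R j) (edgeVec R j) := by
    rw [h4, if_pos rfl]
  obtain ⟨t1, t2⟩ := hf.piece_eq_triangle hi hj c0 c1 c2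
  refine ⟨?_, ?_, ?_⟩
  · intro e he
    rw [h3]
    split_ifs with h
    · omega
    · exact hst e (by omega)
  · intro e he
    rcases Nat.lt_or_ge e J with h | h
    · rw [old _ (by omega), old _ (by omega), old _ (by omega)]
      exact hpos e h
    · obtain rfl : e = J := by omega
      exact t1
  · rw [t2, heq]
    ext Q
    simp only [Set.mem_union, Set.mem_ofPred_eq, Set.mem_singleton_iff]
    constructor
    · rintro (⟨e, he, rfl⟩ | rfl)
      · refine ⟨e, by omega, ?_⟩
        rw [old _ (by omega), old _ (by omega), old _ (by omega)]
      · exact ⟨J, by omega, rfl⟩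
    · rintro ⟨e, he, rfl⟩
      rcases Nat.lt_or_ge e J with h | h
      · refine Or.inl ⟨e, h, ?_⟩
        rw [old _ (by omega), old _ (by omega), old _ (by omega)]
      · obtain rfl : e = J := by omega
        exact Or.inr rfl

theorem _root_.StoredTriangles.congr {s s' : RamState} (hs : StoredTriangles s S) (h2 : s'.nat 2 = s.nat 2)
    (h3 : s'.nat 3 = s.nat 3) (h4 : s'.pt 4 5 = s.pt 4 5) : StoredTriangles s' S := by
  refine ⟨?_, ?_, ?_⟩
  · rw [h2, h3]; exact hs.start
  · rw [h2, h4]; exact hs.pos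
  · rw [h2, h4]; exact hs.eq

theorem walkPieces_succ (L R : ℕ → Plane) (nl nr : ℕ) (A D : Plane) (t : ℕ) :
    walkPieces L R nl nr A D (t + 1) = walkPieces L R nl nr A D t ∪
      {funnelPiece L R A D ((greedyWalk L R nl nr (t + 1)).1 - 1)
        ((greedyWalk L R nl nr (t + 1)).2 - 1)} := by
  ext Q
  simp only [walkPieces, Set.mem_union, Set.mem_ofPred_eq, Set.mem_singleton_iff]
  constructor
  · rintro ⟨i, h0, h1, rfl⟩
    rcases Nat.lt_or_ge i (t + 1) with h | h
    · exact Or.inl ⟨i, h0, by omega, rfl⟩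
    · obtain rfl : i = t + 1 := by omega
      exact Or.inr rfl
  · rintro (⟨i, h0, h1, rfl⟩ | rfl)
    · exact ⟨i, h0, by omega, rfl⟩
    · exact ⟨t + 1, by omega, le_rfl, rfl⟩

theorem exec_step (hf : Funnel (chainAfter w c) (chainBefore w c) nl nr (w 0) D)
    (hN : GreedyEnd (chainAfter w c) (chainBefore w c) nl nr N) {s : RamState}
    (hp : Params w c nl nr D s)
    (hs : WalkState (chainAfter w c) (chainBefore w c) nl nr (w 0) D N S s)
    (hlt : s.nat 25 0 < N) :
    WalkState (chainAfter w c) (chainBefore w c) nl nr (w 0) D N S (step.exec s) ∧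
      (step.exec s).nat 25 0 = s.nat 25 0 + 1 := by
  set s₁ := chooseStep.exec s with hs₁
  set s₂ := storePoints.exec s₁ with hs₂
  set s₃ := advance.exec s₂ with hs₃
  set s₄ := outputTriangle.exec s₃ with hs₄
  have e : step.exec s = s₄.writeNat 25 0 (s₄.nat 25 0 + 1) := rfl
  have f₁ : Frame _ s s₁ := exec_frame rfl s
  have f₂ : Frame _ s₁ s₂ := exec_frame rfl s₁
  have f₃ : Frame _ s₂ s₃ := exec_frame rfl s₂
  have f₄ : Frame _ s₃ s₄ := exec_frame rfl s₃
  have p₁ := hp.of_frame f₁ rfl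
  have p₃ := (p₁.of_frame f₂ rfl).of_frame f₃ rfl
  have hL : ∀ {s}, Params w c nl nr D s → leftChain s = chainAfter w c := fun h => by
    rw [leftChain, h.vertices, h.corner]
  have hR : ∀ {s}, Params w c nl nr D s → rightChain s = chainBefore w c := fun h => by
    rw [rightChain, h.vertices, h.corner]
  obtain ⟨k1, k2⟩ := exec_chooseStep s
  obtain ⟨q1, q2, q3⟩ := exec_storePoints s₁
  obtain ⟨a1, a2⟩ := exec_advance s₂
  rw [← hs₁, hL hp, hR hp, hp.left, hp.right, hs.left, hs.right] at k1 k2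
  rw [← hs₂, f₁.nat 25 rfl, k1, f₁.nat 27 rfl] at q1
  rw [← hs₂, f₁.nat 25 rfl, k2, hL p₁, f₁.nat 23 rfl, hs.left, f₁.pt 16 17 rfl rfl] at q2
  rw [← hs₂, f₁.nat 25 rfl, k2, hR p₁, f₁.nat 24 rfl, hs.right, f₁.pt 18 19 rfl rfl] at q3
  rw [← hs₃, f₂.nat 26 rfl, k1, f₂.nat 23 rfl, f₁.nat 23 rfl, hs.left] at a1
  rw [← hs₃, f₂.nat 26 rfl, k1, f₂.nat 24 rfl, f₁.nat 24 rfl, hs.right] at a2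
  have w1 : s₃.nat 23 0 = (greedyWalk (chainAfter w c) (chainBefore w c) nl nr (s.nat 25 0 + 1)).1 := by
    rw [a1, greedyWalk]
  have w2 : s₃.nat 24 0 = (greedyWalk (chainAfter w c) (chainBefore w c) nl nr (s.nat 25 0 + 1)).2 := by
    rw [a2, greedyWalk]
  have t₄ : s₄.nat 25 0 = s.nat 25 0 := by
    rw [f₄.nat 25 rfl, f₃.nat 25 rfl, f₂.nat 25 rfl, f₁.nat 25 rfl]
  have et : (step.exec s).nat 25 0 = s.nat 25 0 + 1 := by rw [e]; simp [t₄]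
  refine ⟨⟨by omega, ?_, ?_, ?_, ?_, ?_, ?_⟩, et⟩
  · rw [et, ← w1, e]; simp [f₄.nat 23 rfl]
  · rw [et, ← w2, e]; simp [f₄.nat 24 rfl]
  · intro t ht
    rw [et] at ht
    have : (step.exec s).nat 27 t = s₂.nat 27 t := by
      rw [e]; simp [f₄.nat 27 rfl, f₃.nat 27 rfl]
    rw [this, q1]
    split_ifs with h
    · rw [h]; rfl
    · exact hs.kind t (by omega)
  · intro t ht
    rw [et] at ht
    rw [e, RamState.pt_writeNat, f₄.pt 16 17 rfl rfl, f₃.pt 16 17 rfl rfl, q2]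
    split_ifs with h
    · rw [h, modePoint, if_pos rfl, stepParam]
    · exact hs.leftPoint t (by omega)
  · intro t ht
    rw [et] at ht
    rw [e, RamState.pt_writeNat, f₄.pt 18 19 rfl rfl, f₃.pt 18 19 rfl rfl, q3]
    split_ifs with h
    · rw [h, modePoint, if_neg (by norm_num), stepParam]
    · exact hs.rightPoint t (by omega)
  · have hst : StoredTriangles s₃ (S ∪ walkPieces (chainAfter w c) (chainBefore w c) nl nr (w 0) D
        (s.nat 25 0)) := by
      refine hs.stored.congr ?_ ?_ ?_
      · rw [f₃.nat 2 rfl, f₂.nat 2 rfl, f₁.nat 2 rfl]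
      · rw [f₃.nat 3 rfl, f₂.nat 3 rfl, f₁.nat 3 rfl]
      · rw [f₃.pt 4 5 rfl rfl, f₂.pt 4 5 rfl rfl, f₁.pt 4 5 rfl rfl]
    rw [et, walkPieces_succ, ← Set.union_assoc]
    -- The triangle is put out after the state has advanced. Both counters are then positive, so
    -- subtracting 1 does not truncate.
    obtain ⟨o1, o2, o3⟩ := exec_outputTriangle s₃ (hL p₃).symm (hR p₃).symm rfl rfl
    rw [← hs₄] at o1 o2 o3
    rw [p₃.vertices, p₃.dir] at o3
    rcases hf.walk_inv hN (t := s.nat 25 0 + 1) hlt with ⟨h0, -⟩ | ⟨-, h0⟩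
    · omega
    · have := h0.a_pos
      have := h0.b_pos
      have := h0.a_le
      have := h0.b_le
      rw [← w1, ← w2] at *
      refine (hst.insert_step hf (by omega) (by omega) o1 o2 o3).congr ?_ ?_ ?_
      · funext j; rw [e]; simp
      · funext j; rw [e]; simp
      · rw [e, RamState.pt_writeNat]

/-! ### The way back: resolving the two-sided steps -/

/-- Go back along the walk and output the hidden points. -/
def backStep : Program :=
  .seq (.setNat 25 (.const 0) (.sub (.reg 25) (.const 1))) <|
  .seq (.branch (.natEq (.get 27 (.reg 25)) (.const 0)) .skip
    (.setNat 32 (.const 0) (.get 27 (.reg 25))))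
  (.branch (.natEq (.reg 32) (.const 2)) (.setPoint 2 3 (.reg 25) (.get 16 17 (.reg 25)))
    (.setPoint 2 3 (.reg 25) (.get 18 19 (.reg 25))))

/-- Register 32 carries the last nonzero kind met on the way back, which is the recursion
`modeAt_of_lt` for the modes. -/
theorem exec_backStep (s : RamState) {k : ℕ}
    (hk : k = if s.nat 27 (s.nat 25 0 - 1) = 0 then s.nat 32 0 else s.nat 27 (s.nat 25 0 - 1)) :
    (backStep.exec s).nat 25 0 = s.nat 25 0 - 1 ∧ (backStep.exec s).nat 32 0 = k ∧
    ∀ j, (backStep.exec s).pt 2 3 j = if j = s.nat 25 0 - 1 then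
      (if k = 2 then s.pt 16 17 j else s.pt 18 19 j) else s.pt 2 3 j := by
  set s₁ := s.writeNat 25 0 (s.nat 25 0 - 1) with hs₁
  set s₂ := (Program.branch (.natEq (.get 27 (.reg 25)) (.const 0)) .skip
    (.setNat 32 (.const 0) (.get 27 (.reg 25)))).exec s₁ with hs₂
  have e : backStep.exec s = (Program.branch (.natEq (.reg 32) (.const 2))
    (.setPoint 2 3 (.reg 25) (.get 16 17 (.reg 25)))
    (.setPoint 2 3 (.reg 25) (.get 18 19 (.reg 25)))).exec s₂ := rfl
  have f₂ : Frame _ s₁ s₂ := exec_frame rfl s₁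
  have f₃ : Frame _ s₂ (backStep.exec s) := e ▸ exec_frame rfl s₂
  have h32 : s₂.nat 32 0 = k := by
    rw [hk, hs₂, exec]
    simp only [Test.holds_natEq, NatExpr.eval_get, NatExpr.eval_reg, NatExpr.eval_const]
    split_ifs <;> simp_all [exec]
  have h25 : s₂.nat 25 0 = s.nat 25 0 - 1 := by
    rw [f₂.nat 25 rfl, hs₁]; simp
  refine ⟨?_, ?_, fun j => ?_⟩
  · rw [f₃.nat 25 rfl, h25]
  · rw [f₃.nat 32 rfl, h32]
  · rw [e, exec]
    simp only [Test.holds_natEq, NatExpr.eval_reg, NatExpr.eval_const, h32]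
    have h16 : s₂.pt 16 17 = s.pt 16 17 := (f₂.pt 16 17 rfl rfl).trans rfl
    have h18 : s₂.pt 18 19 = s.pt 18 19 := (f₂.pt 18 19 rfl rfl).trans rfl
    have h2 : s₂.pt 2 3 = s.pt 2 3 := (f₂.pt 2 3 rfl rfl).trans rfl
    split_ifs <;> rw [pt_setPoint rfl (by norm_num)] <;> simp_all

/-- Start the walk. -/
def startWalk : Program :=
  .seq (.setNat 23 (.const 0) (.const 0)) <| .seq (.setNat 24 (.const 0) (.const 0))
    (.setNat 25 (.const 0) (.const 0))

/-- Output the length of the walk and turn around. -/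
def turnAround : Program :=
  .seq (.setNat 1 (.const 0) (.reg 25)) (.setNat 32 (.const 0) (.const 1))

/-- The program for a funnel. -/
def main : Program :=
  .seq startWalk <| .seq (.loop notDone step) <| .seq turnAround (.loop (.natLe (.const 1) (.reg 25)) backStep)

/-- The result of the program for a funnel. -/
structure Result (w : ℕ → Plane) (c nl nr : ℕ) (D : Plane) (N : ℕ) (S : Set (Set Plane))
    (s : RamState) : Prop where
  count : s.nat 1 0 = N
  points : ∀ t < N, s.pt 2 3 t = walkPoint (chainAfter w c) (chainBefore w c) nl nr
    (modeAt (stepKind (chainAfter w c) (chainBefore w c) nl nr) N)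
    (stepParam (chainAfter w c) (chainBefore w c) nl nr) t
  stored : StoredTriangles s (S ∪ walkPieces (chainAfter w c) (chainBefore w c) nl nr (w 0) D N)

theorem runs_walk (hf : Funnel (chainAfter w c) (chainBefore w c) nl nr (w 0) D)
    (hN : GreedyEnd (chainAfter w c) (chainBefore w c) nl nr N) {s : RamState}
    (hp : Params w c nl nr D s)
    (hs : WalkState (chainAfter w c) (chainBefore w c) nl nr (w 0) D N S s) :
    RunsWithin (.loop notDone step) s ((notDone.cost + step.maxCost) * (N + 1)) fun s' =>
      WalkState (chainAfter w c) (chainBefore w c) nl nr (w 0) D N S s' ∧ s'.nat 25 0 = N := by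
  -- The test only checks that the counters have reached the lengths of the chains. The walk never
  -- exceeds these lengths, so failure of the test means the final state.
  have key : ∀ s', Params w c nl nr D s' →
      WalkState (chainAfter w c) (chainBefore w c) nl nr (w 0) D N S s' →
      (notDone.holds s' ↔ s'.nat 25 0 < N) := by
    intro s' hp' h'
    have h1 : notDone.holds s' ↔ ¬ (nl ≤ s'.nat 23 0 ∧ nr ≤ s'.nat 24 0) := by
      rw [← hp'.left, ← hp'.right]; rfl
    rw [h1, h'.left, h'.right]
    constructor
    · intro h2
      refine lt_of_le_of_ne h'.le fun h3 => h2 ?_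
      rw [h3, hN.last]
      exact ⟨le_rfl, le_rfl⟩
    · intro h2 h3
      refine hN.not_last _ h2 ?_
      rcases hf.walk_inv hN h'.le with ⟨-, h0⟩ | ⟨-, h0⟩
      · rw [h0] at h3
        have := hf.nl_pos
        simp only at h3
        omega
      · exact Prod.ext (le_antisymm h0.a_le h3.1) (le_antisymm h0.b_le h3.2)
  obtain ⟨t, s', r1, r2, r3, r4⟩ := runs_loop (b := notDone) (p := step) rfl
    (fun s' => WalkState (chainAfter w c) (chainBefore w c) nl nr (w 0) D N S s')
    (fun s' => N - s'.nat 25 0) hs (fun s' hfr h' hb => by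
      have hp' := hp.of_frame hfr rfl
      have hlt := (key s' hp' h').1 hb
      obtain ⟨x1, x2⟩ := exec_step hf hN hp' h' hlt
      exact ⟨x1, by rw [x2]; omega⟩)
  refine ⟨t, s', r1.trans (Nat.mul_le_mul_left _ (by omega)), r2, r3, ?_⟩
  have := r3.le
  rw [key s' (hp.of_frame (p := .loop notDone step) r2.frame rfl) r3] at r4
  omega

theorem runs_back (κ : ℕ → ℕ) (P Q : ℕ → Plane) {s : RamState} (hs : s.nat 25 0 = N)
    (h32 : s.nat 32 0 = 1) (hκ : ∀ t < N, s.nat 27 t = κ t) (hP : ∀ t < N, s.pt 16 17 t = P t)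
    (hQ : ∀ t < N, s.pt 18 19 t = Q t) :
    RunsWithin (.loop (.natLe (.const 1) (.reg 25)) backStep) s
      (((Test.natLe (.const 1) (.reg 25)).cost + backStep.maxCost) * (N + 1)) fun s' =>
      ∀ t < N, s'.pt 2 3 t = if modeAt κ N t = 2 then P t else Q t := by
  obtain ⟨t, s', r1, r2, r3, r4⟩ := runs_loop (b := .natLe (.const 1) (.reg 25)) (p := backStep) rfl
    (fun s' => s'.nat 25 0 ≤ N ∧ s'.nat 32 0 = modeAt κ N (s'.nat 25 0) ∧
      ∀ t < N, s'.nat 25 0 ≤ t → s'.pt 2 3 t = if modeAt κ N t = 2 then P t else Q t)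
    (fun s' => s'.nat 25 0) (s := s)
    ⟨hs.le, by rw [h32, hs, modeAt_self], fun t ht ht' => by omega⟩ (by
      rintro s' hfr ⟨i1, i2, i3⟩ hb
      have hb : 1 ≤ s'.nat 25 0 := hb
      obtain ⟨T, hT⟩ : ∃ T, s'.nat 25 0 = T + 1 := ⟨s'.nat 25 0 - 1, by omega⟩
      obtain ⟨x1, x2, x3⟩ := exec_backStep s' (k := modeAt κ N T) (by
        rw [modeAt_of_lt κ (by omega : T < N), i2, hT, Nat.add_sub_cancel, hfr.nat 27 rfl,
          hκ T (by omega)])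
      rw [hT, Nat.add_sub_cancel] at x1 x3
      refine ⟨⟨by omega, by rw [x1, x2], fun t ht ht' => ?_⟩, by omega⟩
      rw [x3]
      by_cases h1 : t = T
      · subst h1
        rw [if_pos rfl, hfr.pt 16 17 rfl rfl, hfr.pt 18 19 rfl rfl, hP t ht, hQ t ht]
      · rw [if_neg h1, i3 t ht (by omega)])
  refine ⟨t, s', r1.trans (by rw [hs]), r2, fun t ht => r3.2.2 t ht ?_⟩
  have : ¬ 1 ≤ s'.nat 25 0 := r4
  omega

end

/-- The time of the program for a funnel, for each step. -/
def cost : ℕ := main.maxCost + (notDone.cost + step.maxCost) +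
  ((Test.natLe (.const 1) (.reg 25)).cost + backStep.maxCost)

/-- The triangles are appended to those already stored for `S`, while the hidden points are written
from cell 0 on. A second run thus extends the cover and replaces the hidden set. -/
theorem runs_main {w : ℕ → Plane} {c nl nr : ℕ} {D : Plane} {N : ℕ} {S : Set (Set Plane)}
    (hf : Funnel (chainAfter w c) (chainBefore w c) nl nr (w 0) D)
    (hN : GreedyEnd (chainAfter w c) (chainBefore w c) nl nr N) {s : RamState}
    (hp : Params w c nl nr D s) (hs : StoredTriangles s S) :
    RunsWithin main s (cost * (N + 1)) (Result w c nl nr D N S) := by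
  set L := chainAfter w c with hL
  set R := chainBefore w c with hR
  have b₁ : RunsWithin startWalk s startWalk.maxCost
      (fun s' => Params w c nl nr D s' ∧ WalkState L R nl nr (w 0) D N S s') := by
    refine .of_exec rfl ⟨hp.of_frame (exec_frame rfl s) rfl, ?_⟩
    have h0 : walkPieces L R nl nr (w 0) D 0 = ∅ :=
      Set.eq_empty_of_forall_notMem fun Q hQ => by
        obtain ⟨t, h1, h2, -⟩ := hQ
        omega
    refine ⟨?_, ?_, ?_, ?_, ?_, ?_, ?_⟩
    · simp [startWalk, exec]
    · simp [startWalk, exec, greedyWalk]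
    · simp [startWalk, exec, greedyWalk]
    · simp [startWalk, exec]
    · simp [startWalk, exec]
    · simp [startWalk, exec]
    · have : (startWalk.exec s).nat 25 0 = 0 := by simp [startWalk, exec]
      rw [this, h0, Set.union_empty]
      have f := exec_frame (p := startWalk) rfl s
      exact hs.congr (f.nat 2 rfl) (f.nat 3 rfl) (f.pt 4 5 rfl rfl)
  have b₃ : ∀ s₂, WalkState L R nl nr (w 0) D N S s₂ ∧ s₂.nat 25 0 = N →
      RunsWithin turnAround s₂ turnAround.maxCost
      (fun s' => (WalkState L R nl nr (w 0) D N S s' ∧ s'.nat 25 0 = N) ∧ s'.nat 1 0 = N ∧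
        s'.nat 32 0 = 1) := by
    intro s₂ h₂
    refine .of_exec rfl ⟨⟨?_, ?_⟩, ?_, ?_⟩
    · obtain ⟨⟨i1, i2, i3, i4, i5, i6, i7⟩, -⟩ := h₂
      have f := exec_frame (p := turnAround) rfl s₂
      refine ⟨?_, ?_, ?_, ?_, ?_, ?_, ?_⟩
      · rwa [f.nat 25 rfl]
      · rwa [f.nat 23 rfl, f.nat 25 rfl]
      · rwa [f.nat 24 rfl, f.nat 25 rfl]
      · rwa [f.nat 25 rfl, f.nat 27 rfl]
      · rwa [f.nat 25 rfl, f.pt 16 17 rfl rfl]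
      · rwa [f.nat 25 rfl, f.pt 18 19 rfl rfl]
      · rw [f.nat 25 rfl]
        exact i7.congr (f.nat 2 rfl) (f.nat 3 rfl) (f.pt 4 5 rfl rfl)
    · simp [turnAround, exec, h₂.2]
    · simp [turnAround, exec, h₂.2]
    · simp [turnAround, exec]
  have b₄ : ∀ s₃, ((WalkState L R nl nr (w 0) D N S s₃ ∧ s₃.nat 25 0 = N) ∧ s₃.nat 1 0 = N ∧
      s₃.nat 32 0 = 1) → RunsWithin (.loop (.natLe (.const 1) (.reg 25)) backStep) s₃
        (((Test.natLe (.const 1) (.reg 25)).cost + backStep.maxCost) * (N + 1))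
      (Result w c nl nr D N S) := by
    rintro s₃ ⟨⟨h1, h2⟩, h3, h4⟩
    refine (runs_back (stepKind L R nl nr)
      (fun t => modePoint L R 2 (stepParam L R nl nr t) (greedyWalk L R nl nr t).1
        (greedyWalk L R nl nr t).2)
      (fun t => modePoint L R 1 (stepParam L R nl nr t) (greedyWalk L R nl nr t).1
        (greedyWalk L R nl nr t).2) h2 h4 (fun t ht => h1.kind t (by omega))
      (fun t ht => h1.leftPoint t (by omega)) (fun t ht => h1.rightPoint t (by omega))).mono le_rfl
      fun s' f h => ⟨?_, ?_, ?_⟩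
    · rw [f.nat 1 rfl, h3]
    · intro t ht
      rw [h t ht, walkPoint]
      split_ifs with h5
      · rw [h5]
      · rw [modePoint, if_neg (by norm_num), modePoint, if_neg h5]
    · have := h1.stored
      rw [h2] at this
      exact this.congr (f.nat 2 rfl) (f.nat 3 rfl) (f.pt 4 5 rfl rfl)
  refine (b₁.seq fun s₁ _ h₁ => (runs_walk hf hN h₁.1 h₁.2).seq fun s₂ _ h₂ =>
    (b₃ s₂ h₂).seq fun s₃ _ h₃ => b₄ s₃ h₃).mono ?_ fun _ _ h => h
  have h0 : cost * (N + 1) = main.maxCost * (N + 1) + (notDone.cost + step.maxCost) * (N + 1) +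
      ((Test.natLe (.const 1) (.reg 25)).cost + backStep.maxCost) * (N + 1) := by
    rw [cost, add_mul, add_mul]
  rw [h0]
  have h1 : main.maxCost ≤ main.maxCost * (N + 1) := Nat.le_mul_of_pos_right _ (Nat.succ_pos N)
  have h2 : startWalk.maxCost + turnAround.maxCost ≤ main.maxCost := by
    rw [main, maxCost, maxCost, maxCost]
    omega
  omega

end FunnelProgram

/-! ## The preparation: the corners of the pseudotriangle -/

theorem RunsWithin.branch {b : Test} {p q : Program} {s : RamState} {c : ℕ} {Q : RamState → Prop}
    (h₁ : b.holds s → RunsWithin p s c Q) (h₂ : ¬ b.holds s → RunsWithin q s c Q) :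
    RunsWithin (.branch b p q) s (b.cost + c) Q := by
  by_cases hb : b.holds s
  · obtain ⟨t, s', r1, r2, r3⟩ := h₁ hb
    exact ⟨_, s', Nat.add_le_add_left r1 _, .branchTrue hb r2, r3⟩
  · obtain ⟨t, s', r1, r2, r3⟩ := h₂ hb
    exact ⟨_, s', Nat.add_le_add_left r1 _, .branchFalse hb r2, r3⟩

/-- Repeat a program for all values of register `10` that are smaller than register `b`. -/
def Program.repeatFor (b : ℕ) (p : Program) : Program :=
  .seq (.setNat 10 (.const 0) (.const 0)) <|
    .loop (.natLe (.add (.reg 10) (.const 1)) (.reg b))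
      (.seq p (.setNat 10 (.const 0) (.add (.reg 10) (.const 1))))

/-- The invariant has to survive changes of register 10, the loop counter. Of the 17 units per
round, 14 suffice for the test and the increment, and 3 cover the initialisation. -/
theorem runs_repeatFor {b : ℕ} {p : Program} (hp : p.loopFree = true)
    (hw : (p.writesNat 10 || p.writesNat b) = false) (hb : b ≠ 10) {s : RamState} {n : ℕ}
    (hn : s.nat b 0 = n) (I : ℕ → RamState → Prop)
    (hI : ∀ i s' x, I i s' → I i (s'.writeNat 10 0 x)) (h0 : I 0 s)
    (hstep : ∀ i < n, ∀ s', Frame (repeatFor b p) s s' → s'.nat 10 0 = i → I i s' →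
      I (i + 1) (p.exec s')) :
    RunsWithin (repeatFor b p) s ((p.maxCost + 17) * (n + 1)) (I n) := by
  rw [Bool.or_eq_false_iff] at hw
  have hnb : ∀ s', Frame (repeatFor b p) s s' → s'.nat b 0 = n := fun s' hf => by
    rw [hf.nat b, hn]
    simp [repeatFor, writesNat, hw.2, hb.symm]
  obtain ⟨t, s', r1, r2, r3, r4⟩ := runs_loop (b := .natLe (.add (.reg 10) (.const 1)) (.reg b))
    (p := .seq p (.setNat 10 (.const 0) (.add (.reg 10) (.const 1))))
    (by rw [loopFree, hp]; rfl) (s := s.writeNat 10 0 0)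
    (fun s' => Frame (repeatFor b p) s s' ∧ s'.nat 10 0 ≤ n ∧ I (s'.nat 10 0) s')
    (fun s' => n - s'.nat 10 0)
    ⟨(Frame.mk (fun a ha => by
        simp only [repeatFor, writesNat, Bool.or_eq_false_iff, beq_eq_false_iff_ne] at ha
        funext j
        simp [Ne.symm ha.1]) (fun a _ => rfl)), by simp, by simpa using hI 0 s 0 h0⟩ (by
      rintro s' - ⟨hf, hle, hi⟩ hlt
      have hlt : s'.nat 10 0 + 1 ≤ s'.nat b 0 := hlt
      rw [hnb s' hf] at hlt
      have f := exec_frame hp s'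
      have h10 : (p.exec s').nat 10 0 = s'.nat 10 0 := by rw [f.nat 10 hw.1]
      have hi' := hstep _ (by omega) s' hf rfl hi
      have e : (Program.seq p (.setNat 10 (.const 0) (.add (.reg 10) (.const 1)))).exec s' =
          (p.exec s').writeNat 10 0 (s'.nat 10 0 + 1) := by
        rw [exec, exec, NatExpr.eval_add, NatExpr.eval_reg, h10]; rfl
      rw [e]
      refine ⟨⟨⟨fun a ha => ?_, fun a ha => ?_⟩, ?_, ?_⟩, ?_⟩
      · rw [← hf.nat a ha]
        simp only [repeatFor, writesNat, Bool.or_eq_false_iff, beq_eq_false_iff_ne] at ha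
        funext j
        simp [Ne.symm ha.1, f.nat a ha.2.1]
      · rw [← hf.real a ha]
        simp only [repeatFor, writesReal, Bool.or_eq_false_iff] at ha
        rw [RamState.writeNat_real, f.real a ha.2.1]
      · simp; omega
      · simpa using hI _ _ _ hi'
      · simp; omega)
  refine ⟨3 + t, s', ?_, .seq (.setNat s 10 (.const 0) (.const 0)) r2, ?_⟩
  · have h1 : (Test.natLe (.add (.reg 10) (.const 1)) (.reg b)).cost +
        (Program.seq p (.setNat 10 (.const 0) (.add (.reg 10) (.const 1)))).maxCost ≤ p.maxCost + 14 := by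
      simp [maxCost, Test.cost, NatExpr.cost, NatExpr.reg]
      omega
    have h2 := Nat.mul_le_mul h1 (show n - (s.writeNat 10 0 0).nat 10 0 + 1 ≤ n + 1 by omega)
    have h3 : (p.maxCost + 17) * (n + 1) = (p.maxCost + 14) * (n + 1) + 3 * (n + 1) := by ring
    omega
  · have : s'.nat 10 0 = n := by
      have h5 : ¬ s'.nat 10 0 + 1 ≤ s'.nat b 0 := r4
      rw [hnb s' r3.1] at h5
      omega
    rw [← this]
    exact r3.2.2

theorem runs_searchFrom {a : ℕ} {e : NatExpr} {b : Test} {s : RamState} {x f : ℕ}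
    (he : e.eval s = x) (hle : x ≤ f) (h1 : ∀ g, x ≤ g → g < f → b.holds (s.writeNat a 0 g))
    (h2 : ¬ b.holds (s.writeNat a 0 f)) :
    RunsWithin (.seq (.setNat a (.const 0) e) (search a b)) s
      (e.cost + 2 + (b.cost + 6) * (f + 1)) (fun s' => s' = s.writeNat a 0 f) := by
  refine (RunsWithin.seq (c₁ := (Program.setNat a (.const 0) e).maxCost)
    (Q₁ := fun s' => s' = s.writeNat a 0 x) (Q₂ := fun s' => s' = s.writeNat a 0 f)
    (.of_exec rfl (by simp [exec, he])) ?_).mono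
    (Nat.add_le_add_right (by simp only [maxCost, NatExpr.cost]; omega) _) fun _ _ h => h
  rintro _ - rfl
  have := runs_search (a := a) (b := b) (s := s.writeNat a 0 x) (f := f) (by simpa using hle)
    (fun g hg hg' => by rw [writeNat_writeNat]; exact h1 g (by simpa using hg) hg')
    (by rwa [writeNat_writeNat])
  rwa [writeNat_writeNat] at this

namespace Preparation

/-- Repeat the first vertex after the last one. -/
def closeUp : Program := .setPoint 0 1 (.reg 0) (.get 0 1 (.const 0))

/-- Add a term to the area. -/
def addArea : Program :=
  .setReal 10 (.const 0) (.add (.get 10 (.const 0))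
    (PointExpr.cross (.get 0 1 (.reg 10)) (.get 0 1 (.add (.reg 10) (.const 1)))))

/-- Compute the area. -/
def area : Program := repeatFor 0 addArea

/-- Copy the vertex with the number in register `11` three times. -/
def copyVertex : Program :=
  .seq (.setPoint 6 7 (.reg 10) (.get 0 1 (.reg 11))) <|
  .seq (.setPoint 6 7 (.add (.reg 10) (.reg 0)) (.get 0 1 (.reg 11)))
  (.setPoint 6 7 (.add (.reg 10) (.add (.reg 0) (.reg 0))) (.get 0 1 (.reg 11)))

/-- Copy the next vertex in counterclockwise order. -/
def copyNext : Program :=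
  .seq (.branch (.realLe (.get 10 (.const 0)) (.const 0))
    (.setNat 11 (.const 0) (.sub (.reg 0) (.reg 10))) (.setNat 11 (.const 0) (.reg 10))) copyVertex

/-- List the vertices counterclockwise, three times. -/
def orientVertices : Program := repeatFor 0 copyNext

/-- The edge after a vertex. -/
def edge (a b : ℕ) (e : NatExpr) : PointExpr := .sub (.get a b (.add e (.const 1))) (.get a b e)

/-- The turn at a vertex. -/
def turnAt (a b : ℕ) (e : NatExpr) : RealExpr :=
  PointExpr.cross (edge a b (.sub e (.const 1))) (edge a b e)

@[simp] theorem eval_edge (s : RamState) (a b : ℕ) (e : NatExpr) :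
    (edge a b e).eval s = edgeVec (s.pt a b) (e.eval s) := rfl

@[simp] theorem eval_turnAt (s : RamState) (a b : ℕ) (e : NatExpr) : (turnAt a b e).eval s =
    cross (edgeVec (s.pt a b) (e.eval s - 1)) (edgeVec (s.pt a b) (e.eval s)) := rfl

/-- The turn at a vertex is not to the left. -/
def notLeft (a b : ℕ) (e : NatExpr) : Test := .realLe (turnAt a b e) (.const 0)

@[simp] theorem holds_notLeft (s : RamState) (a b : ℕ) (e : NatExpr) : (notLeft a b e).holds s ↔
    cross (edgeVec (s.pt a b) (e.eval s - 1)) (edgeVec (s.pt a b) (e.eval s)) ≤ 0 := by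
  simp [notLeft, Test.holds, RealExpr.eval]

/-- There is no turn at a vertex. -/
def straight (a b : ℕ) (e : NatExpr) : Test :=
  .and (.realLe (turnAt a b e) (.const 0)) (.realLe (.const 0) (turnAt a b e))

@[simp] theorem holds_straight (s : RamState) (a b : ℕ) (e : NatExpr) : (straight a b e).holds s ↔
    cross (edgeVec (s.pt a b) (e.eval s - 1)) (edgeVec (s.pt a b) (e.eval s)) = 0 := by
  simp [straight, Test.holds, RealExpr.eval, le_antisymm_iff]

/-- Find a convex vertex. -/
def findStart : Program :=
  .seq (.setNat 12 (.const 0) (.const 1)) (search 12 (notLeft 6 7 (.reg 12)))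

/-- Copy a vertex unless there is no turn. -/
def copyCorner : Program :=
  .seq (.setNat 11 (.const 0) (.add (.reg 10) (.reg 12))) <|
  .branch (straight 6 7 (.reg 11)) .skip <|
  .seq (.setPoint 8 9 (.reg 13) (.get 6 7 (.reg 11)))
    (.setNat 13 (.const 0) (.add (.reg 13) (.const 1)))

/-- List the vertices at which the boundary turns. -/
def listCorners : Program :=
  .seq (.seq (.setNat 17 (.const 0) (.add (.reg 0) (.const 1))) (.setNat 13 (.const 0) (.const 0))) <|
  .seq (repeatFor 17 copyCorner) (.setNat 13 (.const 0) (.sub (.reg 13) (.const 1)))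

/-- Find the second corner. -/
def findSecond : Program :=
  .seq (.setNat 14 (.const 0) (.const 1)) (search 14 (notLeft 8 9 (.reg 14)))

/-- Find the third corner. -/
def findThird : Program :=
  .seq (.setNat 15 (.const 0) (.add (.reg 14) (.const 1))) (search 15 (notLeft 8 9 (.reg 15)))

/-- The cut has not yet been reached. -/
def belowCut : Test :=
  .neg (PointExpr.cross (.get 11 12 (.const 0))
    (.sub (.get 8 9 (.add (.reg 16) (.const 1))) (.get 8 9 (.const 0))))

/-- Find the edge that reaches the cut. -/
def findCut : Program :=
  .seq (.setPoint 11 12 (.const 0)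
    (.sub (edge 8 9 (.const 0)) (edge 8 9 (.sub (.reg 13) (.const 1))))) <|
  .seq (.setNat 16 (.const 0) (.reg 14)) (search 16 belowCut)

section

variable {n : ℕ} {v : Polygon Plane n} {s : RamState}

theorem runs_closeUp (hn : 0 < n) : RunsWithin closeUp (RamState.input v) closeUp.maxCost fun s' =>
    s'.nat = (RamState.input v).nat ∧ s'.real 10 0 = 0 ∧ ∀ i ≤ n, s'.pt 0 1 i = v.seq i := by
  refine .of_exec rfl ⟨rfl, ?_, fun i hi => ?_⟩
  · rw [(exec_frame (p := closeUp) rfl _).real 10 rfl]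
    simp [RamState.input]
  · have hv : ∀ i < n, (RamState.input v).pt 0 1 i = v.seq i := fun i hi => by
      have := v.seq_val ⟨i, hi⟩
      rw [this]
      simp [RamState.pt, RamState.input, hi]
    have h0 : (RamState.input v).nat 0 0 = n := by simp [RamState.input]
    rw [closeUp, pt_setPoint rfl (by norm_num)]
    simp only [NatExpr.eval_reg, h0, PointExpr.eval_get, NatExpr.eval_const]
    split_ifs with h
    · rw [hv 0 hn, h, show v.seq n = v.seq 0 by rw [← v.seq_periodic 0, zero_add]]
    · exact hv i (by omega)

theorem runs_area (hn : s.nat 0 0 = n) (h10 : s.real 10 0 = 0) (hs : ∀ i ≤ n, s.pt 0 1 i = v.seq i) :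
    RunsWithin area s ((addArea.maxCost + 17) * (n + 1)) fun s' =>
      s'.real 10 0 = doubleArea n v.seq := by
  refine runs_repeatFor rfl rfl (by norm_num) hn
    (fun i s' => s'.real 10 0 = ∑ j ∈ Finset.range i, cross (v.seq j) (v.seq (j + 1)))
    (fun i s' x h => h) (by simpa using h10) ?_
  intro i hi s' hf h' hI
  have e : (addArea.exec s').real 10 0 =
      s'.real 10 0 + cross (s'.pt 0 1 (s'.nat 10 0)) (s'.pt 0 1 (s'.nat 10 0 + 1)) := by
    simp [addArea, exec, RealExpr.eval]
  rw [e, hI, h', hf.pt 0 1 rfl rfl, hs i hi.le, hs (i + 1) hi, Finset.sum_range_succ]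

theorem exec_copyVertex (s : RamState) (j : ℕ) : (copyVertex.exec s).pt 6 7 j =
    if j = s.nat 10 0 + (s.nat 0 0 + s.nat 0 0) ∨ j = s.nat 10 0 + s.nat 0 0 ∨ j = s.nat 10 0 then
      s.pt 0 1 (s.nat 11 0) else s.pt 6 7 j := by
  set s₁ := (setPoint 6 7 (.reg 10) (.get 0 1 (.reg 11))).exec s with hs₁
  set s₂ := (setPoint 6 7 (.add (.reg 10) (.reg 0)) (.get 0 1 (.reg 11))).exec s₁ with hs₂
  have e : copyVertex.exec s =
    (setPoint 6 7 (.add (.reg 10) (.add (.reg 0) (.reg 0))) (.get 0 1 (.reg 11))).exec s₂ := rfl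
  have f₁ : Frame _ s s₁ := exec_frame rfl s
  have f₂ : Frame _ s₁ s₂ := exec_frame rfl s₁
  have n₁ : s₁.nat = s.nat := rfl
  have n₂ : s₂.nat = s.nat := rfl
  rw [e, pt_setPoint rfl (by norm_num), hs₂, pt_setPoint rfl (by norm_num), ← hs₂, hs₁,
    pt_setPoint rfl (by norm_num), ← hs₁]
  simp only [NatExpr.eval_add, NatExpr.eval_reg, PointExpr.eval_get, n₁, n₂, f₂.pt 0 1 rfl rfl,
    f₁.pt 0 1 rfl rfl]
  by_cases h1 : j = s.nat 10 0 + (s.nat 0 0 + s.nat 0 0)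
  · simp [h1]
  · by_cases h2 : j = s.nat 10 0 + s.nat 0 0
    · simp [h2]
    · simp only [h1, h2, false_or, if_false]
      congr

theorem exec_copyNext (s : RamState) (j : ℕ) : (copyNext.exec s).pt 6 7 j =
    if j = s.nat 10 0 + (s.nat 0 0 + s.nat 0 0) ∨ j = s.nat 10 0 + s.nat 0 0 ∨ j = s.nat 10 0 then
      s.pt 0 1 (if s.real 10 0 ≤ 0 then s.nat 0 0 - s.nat 10 0 else s.nat 10 0)
    else s.pt 6 7 j := by
  by_cases h : s.real 10 0 ≤ 0
  · have e : copyNext.exec s = copyVertex.exec (s.writeNat 11 0 (s.nat 0 0 - s.nat 10 0)) := by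
      simp [copyNext, exec, Test.holds, RealExpr.eval, h]
    rw [e, exec_copyVertex]
    simp [h]
  · have e : copyNext.exec s = copyVertex.exec (s.writeNat 11 0 (s.nat 10 0)) := by
      simp [copyNext, exec, Test.holds, RealExpr.eval, h]
    rw [e, exec_copyVertex]
    simp [h]

/-- The later scan starts at a vertex `f ≤ n` and reads up to index `2 * n + 1`. With three copies
of the vertices no reduction modulo `n` is needed. -/
theorem runs_orientVertices (hv : SimplePeriodic n v.seq) (hn : s.nat 0 0 = n)
    (h10 : s.real 10 0 = doubleArea n v.seq) (hs : ∀ i ≤ n, s.pt 0 1 i = v.seq i) :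
    RunsWithin orientVertices s ((copyNext.maxCost + 17) * (n + 1)) fun s' =>
      ∀ i < 3 * n, s'.pt 6 7 i = v.ccwSeq i := by
  have hccw : ∀ i < n, v.ccwSeq i = v.seq (if doubleArea n v.seq ≤ 0 then n - i else i) := by
    intro i hi
    by_cases hA : doubleArea n v.seq ≤ 0
    · rw [if_pos hA, Polygon.ccwSeq, if_neg (not_lt.2 hA), reverseSeq_of_le hv hi.le]
    · rw [if_neg hA, Polygon.ccwSeq, if_pos (not_le.1 hA)]
  have hper : ∀ i, v.ccwSeq (i + n) = v.ccwSeq i := by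
    rw [Polygon.ccwSeq]
    split_ifs
    · exact v.seq_periodic
    · exact hv.reverse.periodic
  refine (runs_repeatFor rfl rfl (by norm_num) hn (fun i s' => ∀ j < i,
    s'.pt 6 7 j = v.ccwSeq j ∧ s'.pt 6 7 (j + n) = v.ccwSeq j ∧
      s'.pt 6 7 (j + (n + n)) = v.ccwSeq j) (fun i s' x h => h) (fun j hj => by omega) ?_).mono
    le_rfl fun s' _ h i hi => ?_
  · intro i hi s' hf h' hI j hj
    have key : s'.pt 0 1 (if s'.real 10 0 ≤ 0 then s'.nat 0 0 - s'.nat 10 0 else s'.nat 10 0) =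
        v.ccwSeq i := by
      rw [hccw i hi, hf.pt 0 1 rfl rfl, hf.real 10 rfl, h10, hf.nat 0 rfl, hn, h']
      exact hs _ (by split_ifs <;> omega)
    have e := exec_copyNext s'
    rw [key, h', hf.nat 0 rfl, hn] at e
    rcases (show j ≤ i by omega).eq_or_lt with rfl | hlt
    · refine ⟨?_, ?_, ?_⟩ <;> rw [e, if_pos (by omega)]
    · rw [e, e, e, if_neg (by omega), if_neg (by omega), if_neg (by omega)]
      exact hI j hlt
  · rcases Nat.lt_or_ge i n with h1 | h1
    · exact (h i h1).1
    · rcases Nat.lt_or_ge i (n + n) with h2 | h2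
      · have := (h (i - n) (by omega)).2.1
        rwa [← hper, show i - n + n = i by omega] at this
      · have := (h (i - (n + n)) (by omega)).2.2
        rwa [← hper, ← hper, show i - (n + n) + n + n = i by omega,
          show i - (n + n) + (n + n) = i by omega] at this

theorem _root_.edgeVec_congr {p q : ℕ → Plane} {i : ℕ} (h0 : p i = q i) (h1 : p (i + 1) = q (i + 1)) :
    edgeVec p i = edgeVec q i := by rw [edgeVec, edgeVec, h0, h1]

/-- The search covers the vertices 1, …, n instead of 0, …, n - 1, because the turn at a vertex is
computed from the preceding index. -/
theorem runs_findStart (hv : v.IsPseudotriangle) (hs : ∀ i < 3 * n, s.pt 6 7 i = v.ccwSeq i) :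
    RunsWithin findStart s (3 + ((notLeft 6 7 (.reg 12)).cost + 6) * (n + 1)) fun s' =>
      0 < s'.nat 12 0 ∧ s'.nat 12 0 ≤ n ∧ 0 < turn n v.ccwSeq (s'.nat 12 0) := by
  classical
  have hn := hv.1.1
  have hT := hv.threeConvex
  have hex := hT.exists_convex
  obtain ⟨f1, f2, f3⟩ := Nat.find_spec hex
  have hmin : ∀ g, 0 < g → g < Nat.find hex → turn n v.ccwSeq g ≤ 0 := fun g hg hg' => by
    by_contra hc
    exact Nat.find_min hex hg' ⟨hg, by omega, not_le.1 hc⟩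
  generalize Nat.find hex = f at *
  have hturn : ∀ g, 0 < g → g ≤ n →
      cross (edgeVec (s.pt 6 7) (g - 1)) (edgeVec (s.pt 6 7) g) = turn n v.ccwSeq g := by
    intro g hg hgn
    rw [turn_of_pos hT.simple.periodic hg, edgeVec_congr (hs _ (by omega)) (hs _ (by omega)),
      edgeVec_congr (i := g) (hs _ (by omega)) (hs _ (by omega))]
  refine (runs_searchFrom (x := 1) (f := f) rfl f1 ?_ ?_).mono ?_ ?_
  · intro g hg hg'
    simp only [holds_notLeft, NatExpr.eval_reg, RamState.pt_writeNat, RamState.writeNat_nat,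
      and_self, if_true]
    rw [hturn g (by omega) (by omega)]
    exact hmin g (by omega) hg'
  · simp only [holds_notLeft, NatExpr.eval_reg, RamState.pt_writeNat, RamState.writeNat_nat,
      and_self, if_true]
    rw [hturn f f1 f2, not_le]
    exact f3
  · exact Nat.add_le_add le_rfl (Nat.mul_le_mul_left _ (by omega))
  · rintro s' - rfl
    simp [f1, f2, f3]

theorem exec_copyCorner (s : RamState) {i : ℕ} (hi : i = s.nat 10 0 + s.nat 12 0) :
    (cross (edgeVec (s.pt 6 7) (i - 1)) (edgeVec (s.pt 6 7) i) = 0 ∧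
      (copyCorner.exec s).nat 13 0 = s.nat 13 0 ∧ (copyCorner.exec s).pt 8 9 = s.pt 8 9) ∨
    (cross (edgeVec (s.pt 6 7) (i - 1)) (edgeVec (s.pt 6 7) i) ≠ 0 ∧
      (copyCorner.exec s).nat 13 0 = s.nat 13 0 + 1 ∧ ∀ j, (copyCorner.exec s).pt 8 9 j =
        if j = s.nat 13 0 then s.pt 6 7 i else s.pt 8 9 j) := by
  subst hi
  by_cases h : cross (edgeVec (s.pt 6 7) (s.nat 10 0 + s.nat 12 0 - 1))
      (edgeVec (s.pt 6 7) (s.nat 10 0 + s.nat 12 0)) = 0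
  · have e : copyCorner.exec s = s.writeNat 11 0 (s.nat 10 0 + s.nat 12 0) := by
      simp [copyCorner, exec, h]
    left
    rw [e]
    exact ⟨h, by simp, rfl⟩
  · have e : copyCorner.exec s = (Program.seq (.setPoint 8 9 (.reg 13) (.get 6 7 (.reg 11)))
        (.setNat 13 (.const 0) (.add (.reg 13) (.const 1)))).exec
        (s.writeNat 11 0 (s.nat 10 0 + s.nat 12 0)) := by
      rw [copyCorner, exec, exec]
      simp [exec, h]
    right
    rw [e, exec]
    refine ⟨h, by simp [exec, nat_setPoint], fun j => ?_⟩
    rw [exec, RamState.pt_writeNat, pt_setPoint rfl (by norm_num)]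
    simp

-- The scan covers `n + 1` vertices, so the starting corner is listed a second time, which closes
-- the chain. The final decrement turns the number of listed points into the index of this last
-- copy.
open Classical in
theorem runs_listCorners (hv : v.IsPseudotriangle) (hs : ∀ i < 3 * n, s.pt 6 7 i = v.ccwSeq i)
    (hn : s.nat 0 0 = n) {f : ℕ} (h12 : s.nat 12 0 = f) (f1 : 0 < f) (f2 : f ≤ n)
    (f3 : 0 < turn n v.ccwSeq f) :
    RunsWithin listCorners s (listCorners.maxCost + 14 + (copyCorner.maxCost + 17) * (n + 2)) fun s' =>
      s'.nat 13 0 = Nat.count (TurnsAt n fun i => v.ccwSeq (i + f)) n ∧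
      ∀ k ≤ s'.nat 13 0, s'.pt 8 9 k = corners n (fun i => v.ccwSeq (i + f)) k := by
  have h3 := hv.1.1
  have hT := hv.threeConvex
  obtain ⟨s₁, s₂, hc⟩ := hT.ccwPseudotriangle f3
  have hturn : ∀ i ≤ n, cross (edgeVec (s.pt 6 7) (i + f - 1)) (edgeVec (s.pt 6 7) (i + f)) =
      turn n (fun i => v.ccwSeq (i + f)) i := by
    intro i hi
    rw [turn_shift (by omega), turn_of_pos hT.simple.periodic (by omega),
      edgeVec_congr (hs _ (by omega)) (hs _ (by omega)),
      edgeVec_congr (i := i + f) (hs _ (by omega)) (hs _ (by omega))]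
  have hTn := hc.turnsAt_n
  set u := fun i => v.ccwSeq (i + f) with hu
  have b₁ : RunsWithin (.seq (.setNat 17 (.const 0) (.add (.reg 0) (.const 1)))
      (.setNat 13 (.const 0) (.const 0))) s
      (Program.seq (.setNat 17 (.const 0) (.add (.reg 0) (.const 1)))
        (.setNat 13 (.const 0) (.const 0))).maxCost
      (fun s' => s'.nat 17 0 = n + 1 ∧ s'.nat 13 0 = 0) :=
    .of_exec rfl ⟨by simp [exec, hn], by simp [exec]⟩
  have b₂ : ∀ s₁, Frame (.seq (.setNat 17 (.const 0) (.add (.reg 0) (.const 1)))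
      (.setNat 13 (.const 0) (.const 0))) s s₁ → s₁.nat 17 0 = n + 1 ∧ s₁.nat 13 0 = 0 →
      RunsWithin (repeatFor 17 copyCorner) s₁ ((copyCorner.maxCost + 17) * (n + 2)) fun s' =>
        s'.nat 13 0 = Nat.count (TurnsAt n u) (n + 1) ∧
          ∀ k < Nat.count (TurnsAt n u) (n + 1), s'.pt 8 9 k = corners n u k := by
    intro s₁ hf₁ h₁
    refine runs_repeatFor rfl rfl (by norm_num) h₁.1 (fun i s' =>
      s'.nat 13 0 = Nat.count (TurnsAt n u) i ∧
          ∀ k < Nat.count (TurnsAt n u) i, s'.pt 8 9 k = corners n u k)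
      (fun i s' x h => ⟨by simpa using h.1, h.2⟩) ⟨by simp [h₁.2], by simp⟩ ?_
    intro i hi s' hf h' hI
    have e12 : s'.nat 12 0 = f := by rw [hf.nat 12 rfl, hf₁.nat 12 rfl, h12]
    have e67 : s'.pt 6 7 = s.pt 6 7 := by rw [hf.pt 6 7 rfl rfl, hf₁.pt 6 7 rfl rfl]
    have hex := exec_copyCorner s' (i := i + f) (by rw [h', e12])
    rw [e67, hturn i (by omega)] at hex
    rcases hex with ⟨x1, x2, x3⟩ | ⟨x1, x2, x3⟩
    · have hnot : ¬ TurnsAt n u i := fun h => h x1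
      rw [Nat.count_succ_eq_count hnot, x2, x3]
      exact hI
    · have hyes : TurnsAt n u i := x1
      rw [Nat.count_succ, if_pos hyes, x2, hI.1]
      refine ⟨rfl, fun k hk => ?_⟩
      rw [x3, hI.1]
      split_ifs with hk'
      · rw [hk', corners, Nat.nth_count hyes, hs _ (by omega)]
      · exact hI.2 k (by omega)
  have hcount : Nat.count (TurnsAt n u) (n + 1) = Nat.count (TurnsAt n u) n + 1 := by
    rw [Nat.count_succ, if_pos hTn]
  refine (b₁.seq fun s₁ hf₁ h₁ => (b₂ s₁ hf₁ h₁).seq (Q₂ := fun s' =>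
      s'.nat 13 0 = Nat.count (TurnsAt n u) n ∧
      ∀ k ≤ s'.nat 13 0, s'.pt 8 9 k = corners n u k)
      (c₂ := (Program.setNat 13 (.const 0) (.sub (.reg 13) (.const 1))).maxCost) fun s₂ _ h₂ =>
    .of_exec rfl ?_).mono ?_ fun _ _ h => h
  · have e : ((Program.setNat 13 (.const 0) (.sub (.reg 13) (.const 1))).exec s₂).nat 13 0 =
        Nat.count (TurnsAt n u) n := by
      simp [exec, h₂.1, hcount]
    rw [e]
    refine ⟨rfl, fun k hk => ?_⟩
    exact h₂.2 k (by omega)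
  · simp only [listCorners, maxCost]
    omega

end

end Preparation

theorem chainRegion_congr {w w' : ℕ → Plane} {p q m : ℕ} (hp : p ≤ q) (hq : q ≤ m)
    (h : ∀ i ≤ m, w' i = w i) : chainRegion w' p q m = chainRegion w p q m := by
  have key : ∀ a b, b ≤ m → chainSide w' a b = chainSide w a b := fun a b hb => by
    ext x
    simp only [chainSide, Set.mem_ofPred_eq]
    refine exists_congr fun i => and_congr_right fun _ => and_congr_right fun hi => ?_
    rw [side, side, edgeVec_congr (h i (by omega)) (h (i + 1) (by omega)), h i (by omega)]
  rw [chainRegion, chainRegion, key _ _ (hp.trans hq), key _ _ hq, key _ _ le_rfl]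

theorem PseudoChain.exists_cutEdge {w : ℕ → Plane} {p q m : ℕ} (h : PseudoChain w p q m) :
    ∃ k, CutEdge w p q m k := by
  classical
  obtain ⟨h1, h2, h3⟩ := Nat.find_spec h.exists_reach
  refine ⟨_, h1, h2, h3, fun i hi hi' => not_le.1 fun hc => Nat.find_min h.exists_reach hi' ?_⟩
  exact ⟨hi, by omega, hc⟩

/-! ### Finding the other two corners and the cut -/

namespace Preparation

variable {n : ℕ} {v : Polygon Plane n} {s : RamState} {w : ℕ → Plane} {p q m k : ℕ}

/-- Inside the first chain all turns are to the right (`aa`) and at its end the turn is to the left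
(`ab`), so the second corner is the first left turn after the start. The third corner is found in
the same way. -/
theorem runs_findSecond (h : PseudoChain w p q m) (hw : s.pt 8 9 = w) :
    RunsWithin findSecond s (3 + ((notLeft 8 9 (.reg 14)).cost + 6) * (m + 1))
      fun s' => s'.nat 14 0 = p := by
  have h1 := h.p_pos
  have h2 := h.p_lt_q
  have h3 := h.q_lt_m
  refine (runs_searchFrom (x := 1) (f := p) rfl h1 ?_ ?_).mono ?_ ?_
  · intro g hg hg'
    simp only [holds_notLeft, NatExpr.eval_reg, RamState.pt_writeNat, RamState.writeNat_nat,
      and_self, if_true, hw]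
    exact (h.aa _ _ (by omega) hg').le
  · simp only [holds_notLeft, NatExpr.eval_reg, RamState.pt_writeNat, RamState.writeNat_nat,
      and_self, if_true, hw, not_le]
    exact h.ab _ _ (by omega) le_rfl h2
  · exact Nat.add_le_add le_rfl (Nat.mul_le_mul_left _ (by omega))
  · rintro s' - rfl
    simp

theorem runs_findThird (h : PseudoChain w p q m) (hw : s.pt 8 9 = w) (hp : s.nat 14 0 = p) :
    RunsWithin findThird s (6 + ((notLeft 8 9 (.reg 15)).cost + 6) * (m + 1))
      fun s' => s'.nat 15 0 = q := by
  have h2 := h.p_lt_q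
  have h3 := h.q_lt_m
  refine (runs_searchFrom (x := p + 1) (f := q) (by simp [hp]) h2 ?_ ?_).mono ?_ ?_
  · intro g hg hg'
    simp only [holds_notLeft, NatExpr.eval_reg, RamState.pt_writeNat, RamState.writeNat_nat,
      and_self, if_true, hw]
    exact (h.bb _ _ (by omega) (by omega) hg').le
  · simp only [holds_notLeft, NatExpr.eval_reg, RamState.pt_writeNat, RamState.writeNat_nat,
      and_self, if_true, hw, not_le]
    exact h.bc _ _ (by omega) (by omega) le_rfl h3
  · exact Nat.add_le_add (by simp [NatExpr.cost, NatExpr.reg]) (Nat.mul_le_mul_left _ (by omega))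
  · rintro s' - rfl
    simp

@[simp] theorem holds_belowCut (s : RamState) : belowCut.holds s ↔
    height (s.pt 8 9 0) (s.pt 11 12 0) (s.pt 8 9 (s.nat 16 0 + 1)) < 0 := by
  simp [belowCut, height]

/-- The search starts at the second corner and stops at the first edge whose end is not below the
cut. Its steps are bounded by the number of corners, so it is linear like the other scans. -/
theorem runs_findCut (h : PseudoChain w p q m) (hk : CutEdge w p q m k) (hw : s.pt 8 9 = w)
    (hm : s.nat 13 0 = m) (hp : s.nat 14 0 = p) :
    RunsWithin findCut s (findCut.maxCost + 4 + (belowCut.cost + 6) * (m + 1))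
      fun s' => s'.nat 16 0 = k ∧ s'.pt 11 12 0 = cutDir w m := by
  have h3 := h.q_lt_m
  have h4 := hk.p_le
  have h5 := hk.lt_q
  refine (RunsWithin.seq (Q₁ := fun s' => s'.nat = s.nat ∧ s'.pt 8 9 = w ∧ s'.pt 11 12 0 = cutDir w m)
    (Q₂ := fun s' => s'.nat 16 0 = k ∧ s'.pt 11 12 0 = cutDir w m)
    (c₂ := 4 + (belowCut.cost + 6) * (m + 1))
    (.of_exec rfl ⟨rfl, ?_, ?_⟩) ?_).mono ?_ fun _ _ h => h
  · rw [(exec_frame rfl s).pt 8 9 rfl rfl, hw]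
  · rw [pt_setPoint rfl (by norm_num)]
    simp [hw, hm, cutDir]
  · rintro s₁ - ⟨g1, g2, g3⟩
    refine (runs_searchFrom (x := p) (f := k) (by simp [g1, hp]) h4 ?_ ?_).mono ?_ ?_
    · intro g hg hg'
      simp only [holds_belowCut, RamState.pt_writeNat, RamState.writeNat_nat,
        and_self, if_true, g2, g3]
      exact hk.first g hg hg'
    · simp only [holds_belowCut, RamState.pt_writeNat, RamState.writeNat_nat,
        and_self, if_true, g2, g3, not_lt]
      exact hk.reach
    · exact Nat.add_le_add (by simp [NatExpr.cost, NatExpr.reg])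
        (Nat.mul_le_mul_left _ (by omega))
    · rintro s' - rfl
      simpa using g3
  · simp only [findCut, maxCost]
    omega

/-- Find the corners and the cut of a chain. -/
def findCorners : Program := .seq findSecond (.seq findThird findCut)

/-- The memory holds a pseudotriangle and a cut of it. -/
structure Prepared (p q m k : ℕ) (s : RamState) : Prop where
  chain : PseudoChain (s.pt 8 9) p q m
  cut : CutEdge (s.pt 8 9) p q m k
  last : s.nat 13 0 = m
  second : s.nat 14 0 = p
  third : s.nat 15 0 = q
  edge : s.nat 16 0 = k
  dir : s.pt 11 12 0 = cutDir (s.pt 8 9) m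

theorem runs_findCorners (h : PseudoChain w p q m) (hw : s.pt 8 9 = w) (hm : s.nat 13 0 = m) :
    RunsWithin findCorners s ((findCut.maxCost + 13) + ((notLeft 8 9 (.reg 14)).cost +
      (notLeft 8 9 (.reg 15)).cost + belowCut.cost + 18) * (m + 1))
      fun s' => s'.pt 8 9 = w ∧ ∃ k, Prepared p q m k s' := by
  obtain ⟨k, hk⟩ := h.exists_cutEdge
  refine ((runs_findSecond h hw).seq (Q₂ := fun s' => s'.nat 14 0 = p ∧ s'.nat 15 0 = q ∧
    s'.nat 16 0 = k ∧ s'.pt 11 12 0 = cutDir w m)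
    (c₂ := (6 + ((notLeft 8 9 (.reg 15)).cost + 6) * (m + 1)) +
      (findCut.maxCost + 4 + (belowCut.cost + 6) * (m + 1))) fun s₁ f₁ h₁ =>
    (runs_findThird h (by rw [f₁.pt 8 9 rfl rfl, hw]) h₁).seq fun s₂ f₂ h₂ =>
    (runs_findCut h hk (by rw [f₂.pt 8 9 rfl rfl, f₁.pt 8 9 rfl rfl, hw])
      (by rw [f₂.nat 13 rfl, f₁.nat 13 rfl, hm]) (by rw [f₂.nat 14 rfl, h₁])).mono le_rfl
      fun s₃ f₃ h₃ => ⟨?_, ?_, h₃⟩).mono ?_ fun s' f h' => ?_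
  · rw [f₃.nat 14 rfl, f₂.nat 14 rfl, h₁]
  · rw [f₃.nat 15 rfl, h₂]
  · exact le_of_eq (by ring)
  · have hw' : s'.pt 8 9 = w := by rw [f.pt 8 9 rfl rfl, hw]
    refine ⟨hw', k, ?_⟩
    rw [← hw'] at h hk h'
    exact ⟨h, hk, by rw [f.nat 13 rfl, hm], h'.1, h'.2.1, h'.2.2.1, h'.2.2.2⟩

/-- The preparation. -/
def main : Program :=
  .seq closeUp <| .seq area <| .seq orientVertices <| .seq findStart <| .seq listCorners findCorners

/-- The time for the preparation, per vertex. -/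
def cost : ℕ :=
  closeUp.maxCost + (addArea.maxCost + 17) + (copyNext.maxCost + 17) +
    (3 + ((notLeft 6 7 (.reg 12)).cost + 6)) +
    (listCorners.maxCost + 14 + 2 * (copyCorner.maxCost + 17)) +
    ((findCut.maxCost + 13) + ((notLeft 8 9 (.reg 14)).cost +
      (notLeft 8 9 (.reg 15)).cost + belowCut.cost + 18))

theorem runs_main (hv : v.IsPseudotriangle) :
    RunsWithin main (RamState.input v) (cost * (n + 1)) fun s' =>
      ∃ p q m k, m ≤ n ∧ Prepared p q m k s' ∧ v.region = chainRegion (s'.pt 8 9) p q m := by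
  classical
  have hn := hv.1.1
  have hT := hv.threeConvex
  have hin : (RamState.input v).nat 0 0 = n := by simp [RamState.input]
  have arith : ∀ a b c d e f g h : ℕ, a + (b * (n + 1) + (c * (n + 1) + ((3 + d * (n + 1)) +
      ((e + f * (n + 2)) + (g + h * (n + 1)))))) ≤
      (a + b + c + (3 + d) + (e + 2 * f) + (g + h)) * (n + 1) := by
    intro a b c d e f g h
    nlinarith [Nat.zero_le (a * n), Nat.zero_le (e * n), Nat.zero_le (g * n), Nat.zero_le (f * n)]
  refine (RunsWithin.seq (runs_closeUp (by omega)) ?_).mono (arith _ _ _ _ _ _ _ _)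
    fun _ _ h => h
  rintro s₁ f₁ ⟨a1, a2, a3⟩
  have n₁ : s₁.nat 0 0 = n := by rw [a1, hin]
  refine (runs_area n₁ a2 a3).seq fun s₂ f₂ h₂ => ?_
  have n₂ : s₂.nat 0 0 = n := by rw [f₂.nat 0 rfl, n₁]
  refine (runs_orientVertices hv.1.simplePeriodic n₂ h₂ fun i hi => by
    rw [f₂.pt 0 1 rfl rfl, a3 i hi]).seq fun s₃ f₃ h₃ => ?_
  have n₃ : s₃.nat 0 0 = n := by rw [f₃.nat 0 rfl, n₂]
  refine (runs_findStart hv h₃).seq ?_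
  rintro s₄ f₄ ⟨b1, b2, b3⟩
  have n₄ : s₄.nat 0 0 = n := by rw [f₄.nat 0 rfl, n₃]
  refine (runs_listCorners hv (fun i hi => by rw [f₄.pt 6 7 rfl rfl, h₃ i hi]) n₄ rfl
    b1 b2 b3).seq ?_
  rintro s₅ f₅ ⟨c1, c2⟩
  obtain ⟨p, q, d1, d2⟩ := hv.exists_pseudoChain b3
  rw [← c1] at d1 d2
  have hm : s₅.nat 13 0 ≤ n := c1 ▸ Nat.count_le _
  have d3 := d1.congr c2
  rw [← chainRegion_congr d1.p_lt_q.le d1.q_lt_m.le c2] at d2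
  refine (runs_findCorners d3 rfl rfl).mono ?_ ?_
  · exact Nat.add_le_add_left (Nat.mul_le_mul_left _ (by omega)) _
  · rintro s' - ⟨e1, k, e2⟩
    exact ⟨p, q, _, k, hm, e2, by rw [e1, d2]⟩

end Preparation

/-! ## The hidden set and the convex cover -/

theorem sUnion_walkPieces {L R : ℕ → Plane} {nl nr N : ℕ} {A D : Plane}
    (h : Funnel L R nl nr A D) (hN : GreedyEnd L R nl nr N) :
    ⋃₀ walkPieces L R nl nr A D N = funnelRegion L R nl nr A D := by
  rw [h.region_eq_iUnion hN]
  ext x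
  simp only [walkPieces, Set.mem_sUnion, Set.mem_ofPred_eq, Set.mem_iUnion, Set.mem_Ioc, exists_prop]
  constructor
  · rintro ⟨_, ⟨t, h1, h2, rfl⟩, h3⟩
    exact ⟨t, ⟨h1, h2⟩, h3⟩
  · rintro ⟨t, ⟨h1, h2⟩, h3⟩
    exact ⟨_, ⟨t, h1, h2, rfl⟩, h3⟩

open Classical in
theorem exists_finset_walkPieces (L R : ℕ → Plane) (nl nr : ℕ) (A D : Plane) (N : ℕ) :
    ∃ C : Finset (Set Plane), (C : Set (Set Plane)) = walkPieces L R nl nr A D N ∧ C.card ≤ N := by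
  refine ⟨(Finset.Ioc 0 N).image fun t => funnelPiece L R A D ((greedyWalk L R nl nr t).1 - 1)
    ((greedyWalk L R nl nr t).2 - 1), ?_, Finset.card_image_le.trans (by simp)⟩
  ext Q
  simp only [Finset.coe_image, Finset.coe_Ioc, Set.mem_image, Set.mem_Ioc, walkPieces,
    Set.mem_ofPred_eq]
  exact exists_congr fun t => ⟨fun h => ⟨h.1.1, h.1.2, h.2.symm⟩, fun h => ⟨⟨h.1, h.2.1⟩, h.2.2.symm⟩⟩

theorem StoredTriangles.outputs {s : RamState} {S : Set (Set Plane)} (h : StoredTriangles s S) :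
    (∀ j < s.nat 2 0, (s.outputPolygon j).IsConvex) ∧
      S = {Q | ∃ j < s.nat 2 0, Q = (s.outputPolygon j).hull} := by
  have key : ∀ j < s.nat 2 0, (s.outputPolygon j).IsConvex ∧ (s.outputPolygon j).hull =
      convexHull ℝ {s.pt 4 5 (3 * j), s.pt 4 5 (3 * j + 1), s.pt 4 5 (3 * j + 2)} := by
    intro j hj
    have h0 := h.start j hj.le
    have h1 := h.start (j + 1) hj
    have hk : s.nat 3 (j + 1) - s.nat 3 j = 3 := by omega
    refine Polygon.isConvex_of_three _ hk (fun i => ?_) (h.pos j hj)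
    have hi := i.2
    have e : s.outputPolygon j i = s.pt 4 5 (3 * j + i) := by rw [← h0]; rfl
    rw [e]
    split_ifs with a b
    · rw [a, add_zero]
    · rw [b]
    · rw [show i.1 = 2 by omega]
  refine ⟨fun j hj => (key j hj).1, ?_⟩
  rw [h.eq]
  ext Q
  refine exists_congr fun j => and_congr_right fun hj => ?_
  rw [(key j hj).2]

theorem FunnelProgram.Result.outputPoints {w : ℕ → Plane} {c nl nr : ℕ} {D : Plane} {N : ℕ}
    {S : Set (Set Plane)} {s : RamState} (h : Result w c nl nr D N S s) :
    s.outputPoints = (Finset.range N).image (walkPoint (chainAfter w c) (chainBefore w c) nl nr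
      (modeAt (stepKind (chainAfter w c) (chainBefore w c) nl nr) N)
      (stepParam (chainAfter w c) (chainBefore w c) nl nr)) := by
  rw [RamState.outputPoints, h.count]
  exact Finset.image_congr fun t ht => h.points t (by simpa using ht)

namespace PseudoChain

variable {w : ℕ → Plane} {p q m k N : ℕ}

theorem isHiddenSet_first (h : PseudoChain w p q m) (hk : CutEdge w p q m k)
    (hN : GreedyEnd (chainAfter w p) (chainBefore w p) (k + 1 - p) p N) {S : Set (Set Plane)}
    {s : RamState} (hs : FunnelProgram.Result w p (k + 1 - p) p (-cutDir w m) N S s) :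
    IsHiddenSet (chainRegion w p q m) s.outputPoints ∧ s.outputPoints.card = N := by
  have := hk.lt_q
  rw [hs.outputPoints]
  exact h.threeChains.isHiddenSet_walk rfl (h.funnel₁ hk) (by omega) (by omega) hN
    (hiddenChoice_greedy _ _ _ _ _)

theorem isHiddenSet_second (h : PseudoChain w p q m) (hk : CutEdge w p q m k)
    (hN : GreedyEnd (chainAfter w q) (chainBefore w q) (m - q) (q - k) N) {S : Set (Set Plane)}
    {s : RamState} (hs : FunnelProgram.Result w q (m - q) (q - k) (cutDir w m) N S s) :
    IsHiddenSet (chainRegion w p q m) s.outputPoints ∧ s.outputPoints.card = N := by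
  have := hk.p_le
  rw [hs.outputPoints]
  refine h.threeChains.rotate.isHiddenSet_walk ?_ (h.funnel₂ hk) le_rfl (by omega) hN
    (hiddenChoice_greedy _ _ _ _ _)
  rw [chainRegion, Set.inter_assoc, Set.inter_comm]

end PseudoChain

/-! ### The complete program and its analysis -/

namespace PseudotriangleProgram

/-- Set the parameters for the funnel at the second corner. -/
def params₁ : Program :=
  .seq (.setNat 20 (.const 0) (.reg 14)) <|
  .seq (.setNat 21 (.const 0) (.sub (.add (.reg 16) (.const 1)) (.reg 14))) <|
  .seq (.setNat 22 (.const 0) (.reg 14))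
  (.setPoint 13 14 (.const 0) (.sub ⟨.const 0, .const 0⟩ (.get 11 12 (.const 0))))

/-- Set the parameters for the funnel at the third corner. -/
def params₂ : Program :=
  .seq (.setNat 20 (.const 0) (.reg 15)) <|
  .seq (.setNat 21 (.const 0) (.sub (.reg 13) (.reg 15))) <|
  .seq (.setNat 22 (.const 0) (.sub (.reg 15) (.reg 16)))
  (.setPoint 13 14 (.const 0) (.get 11 12 (.const 0)))

/-- The program for the funnel at the second corner. -/
def first : Program := .seq params₁ FunnelProgram.main

/-- The program for the funnel at the third corner. -/
def second : Program := .seq params₂ FunnelProgram.main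

/-- Treat the two funnels, and the one with the larger hidden set last. -/
def bothFunnels : Program :=
  .seq first <| .seq (.setNat 33 (.const 0) (.reg 1)) <| .seq second <|
    .branch (.natLe (.reg 33) (.reg 1)) .skip first

/-- The program for pseudotriangles. -/
def main : Program := .seq Preparation.main bothFunnels

variable {p q m k N : ℕ} {S : Set (Set Plane)} {s : RamState} {w : ℕ → Plane}

theorem exec_params₁ (h : Preparation.Prepared p q m k s) (hw : s.pt 8 9 = w) :
    FunnelProgram.Params w p (k + 1 - p) p (-cutDir w m) (params₁.exec s) := by
  have f := exec_frame (p := params₁) rfl s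
  refine ⟨by rw [f.pt 8 9 rfl rfl, hw], ?_, ?_, ?_, ?_⟩
  · simp [params₁, exec, h.second, nat_setPoint]
  · simp [params₁, exec, h.second, h.edge, nat_setPoint]
  · simp [params₁, exec, h.second, nat_setPoint]
  · simp only [params₁, exec]
    rw [pt_setPoint rfl (by norm_num)]
    have := h.dir
    rw [hw] at this
    simp only [NatExpr.eval_const, if_true, PointExpr.eval_sub, PointExpr.eval_get,
      RamState.pt_writeNat, this]
    ext <;> simp [PointExpr.eval, RealExpr.eval]

theorem exec_params₂ (h : Preparation.Prepared p q m k s) (hw : s.pt 8 9 = w) :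
    FunnelProgram.Params w q (m - q) (q - k) (cutDir w m) (params₂.exec s) := by
  have f := exec_frame (p := params₂) rfl s
  refine ⟨by rw [f.pt 8 9 rfl rfl, hw], ?_, ?_, ?_, ?_⟩
  · simp [params₂, exec, h.third, nat_setPoint]
  · simp [params₂, exec, h.third, h.last, nat_setPoint]
  · simp [params₂, exec, h.third, h.edge, nat_setPoint]
  · simp only [params₂, exec]
    rw [pt_setPoint rfl (by norm_num)]
    have := h.dir
    rw [hw] at this
    simp only [NatExpr.eval_const, if_true, PointExpr.eval_get, RamState.pt_writeNat, this]

theorem prepared_of_frame {P : Program} {s' : RamState} (h : Preparation.Prepared p q m k s)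
    (hf : Frame P s s') (hP : (P.writesReal 8 || P.writesReal 9 || P.writesReal 11 ||
      P.writesReal 12 || P.writesNat 13 || P.writesNat 14 || P.writesNat 15 || P.writesNat 16) = false) :
    Preparation.Prepared p q m k s' := by
  simp only [Bool.or_eq_false_iff] at hP
  obtain ⟨⟨⟨⟨⟨⟨⟨h8, h9⟩, h11⟩, h12⟩, h13⟩, h14⟩, h15⟩, h16⟩ := hP
  have e := hf.pt 8 9 h8 h9
  refine ⟨?_, ?_, ?_, ?_, ?_, ?_, ?_⟩
  · rw [e]; exact h.chain
  · rw [e]; exact h.cut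
  · rw [hf.nat 13 h13, h.last]
  · rw [hf.nat 14 h14, h.second]
  · rw [hf.nat 15 h15, h.third]
  · rw [hf.nat 16 h16, h.edge]
  · rw [hf.pt 11 12 h11 h12, e, h.dir]

theorem runs_first (h : Preparation.Prepared p q m k s) (hw : s.pt 8 9 = w)
    (hN : GreedyEnd (chainAfter w p) (chainBefore w p) (k + 1 - p) p N) (hs : StoredTriangles s S) :
    RunsWithin first s (params₁.maxCost + FunnelProgram.cost * (N + 1))
      (FunnelProgram.Result w p (k + 1 - p) p (-cutDir w m) N S) := by
  subst hw
  refine (RunsWithin.of_exec (Q := fun s' => FunnelProgram.Params (s.pt 8 9) p (k + 1 - p) p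
    (-cutDir (s.pt 8 9) m) s') rfl (exec_params₁ h rfl)).seq fun s' f h' => ?_
  exact FunnelProgram.runs_main (h.chain.funnel₁ h.cut) hN h'
    (hs.congr (f.nat 2 rfl) (f.nat 3 rfl) (f.pt 4 5 rfl rfl))

theorem runs_second (h : Preparation.Prepared p q m k s) (hw : s.pt 8 9 = w)
    (hN : GreedyEnd (chainAfter w q) (chainBefore w q) (m - q) (q - k) N)
    (hs : StoredTriangles s S) :
    RunsWithin second s (params₂.maxCost + FunnelProgram.cost * (N + 1))
      (FunnelProgram.Result w q (m - q) (q - k) (cutDir w m) N S) := by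
  subst hw
  refine (RunsWithin.of_exec (Q := fun s' => FunnelProgram.Params (s.pt 8 9) q (m - q) (q - k)
    (cutDir (s.pt 8 9) m) s') rfl (exec_params₂ h rfl)).seq fun s' f h' => ?_
  exact FunnelProgram.runs_main (h.chain.funnel₂ h.cut) hN h'
    (hs.congr (f.nat 2 rfl) (f.nat 3 rfl) (f.pt 4 5 rfl rfl))

/-- The result for a region: a hidden set, and a convex cover that is at most twice as large. -/
def Solved (P : Set Plane) (s : RamState) : Prop :=
  IsHiddenSet P s.outputPoints ∧ ∃ C : Finset (Set Plane),
    s.OutputsConvexPolygons C ∧ IsConvexCover P C ∧ C.card ≤ 2 * s.outputPoints.card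

open Classical in
theorem solved_of_pieces {w : ℕ → Plane} (h : PseudoChain w p q m) (hk : CutEdge w p q m k) {N₁ N₂ : ℕ}
    (hN₁ : GreedyEnd (chainAfter w p) (chainBefore w p) (k + 1 - p) p N₁)
    (hN₂ : GreedyEnd (chainAfter w q) (chainBefore w q) (m - q) (q - k) N₂)
    (hs : StoredTriangles s
      (walkPieces (chainAfter w p) (chainBefore w p) (k + 1 - p) p (w 0) (-cutDir w m) N₁ ∪
        walkPieces (chainAfter w q) (chainBefore w q) (m - q) (q - k) (w 0) (cutDir w m) N₂))
    (hH : IsHiddenSet (chainRegion w p q m) s.outputPoints)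
    (h₁ : N₁ ≤ s.outputPoints.card) (h₂ : N₂ ≤ s.outputPoints.card) :
    Solved (chainRegion w p q m) s := by
  obtain ⟨C₁, c1, d1⟩ := exists_finset_walkPieces (chainAfter w p) (chainBefore w p) (k + 1 - p) p
    (w 0) (-cutDir w m) N₁
  obtain ⟨C₂, c2, d2⟩ := exists_finset_walkPieces (chainAfter w q) (chainBefore w q) (m - q) (q - k)
    (w 0) (cutDir w m) N₂
  have hC := hs.outputs
  rw [← c1, ← c2, ← Finset.coe_union] at hC
  refine ⟨hH, C₁ ∪ C₂, hC, ⟨fun Q hQ => ?_, ?_⟩, ?_⟩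
  · have hQ' : Q ∈ ((C₁ ∪ C₂ : Finset (Set Plane)) : Set (Set Plane)) := hQ
    rw [hC.2] at hQ'
    obtain ⟨j, hj, rfl⟩ := hQ'
    exact ⟨_, _, hC.1 j hj, rfl⟩
  · rw [Finset.coe_union, c1, c2, Set.sUnion_union, sUnion_walkPieces (h.funnel₁ hk) hN₁,
      sUnion_walkPieces (h.funnel₂ hk) hN₂, h.region_eq_funnels hk]
  · have := Finset.card_union_le C₁ C₂
    omega

/-- The time for the two funnels, per vertex. -/
def cost : ℕ := 2 * (params₁.maxCost + FunnelProgram.cost) + (params₂.maxCost + FunnelProgram.cost) + 10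

/-- The hidden points in the output are those of the funnel treated last. If the first funnel has
more of them, it is simply treated again, at the price of another linear term. -/
theorem runs_bothFunnels (h : Preparation.Prepared p q m k s) (hs : StoredTriangles s ∅) :
    RunsWithin bothFunnels s (cost * (m + 1)) (Solved (chainRegion (s.pt 8 9) p q m)) := by
  set w := s.pt 8 9 with hw
  have hc : PseudoChain w p q m := h.chain
  have hk : CutEdge w p q m k := h.cut
  have i1 := hk.p_le
  have i2 := hk.lt_q
  have i3 := hc.q_lt_m
  obtain ⟨N₁, l₁, hN₁⟩ := (hc.funnel₁ hk).exists_greedyEnd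
  obtain ⟨N₂, l₂, hN₂⟩ := (hc.funnel₂ hk).exists_greedyEnd
  have arith : ∀ a b c : ℕ, (a + b * (N₁ + 1)) + (3 + 1 + ((c + b * (N₂ + 1)) + (5 + (1 + (a + b * (N₁ + 1)))))) ≤
      (2 * (a + b) + (c + b) + 10) * (m + 1) := by
    intro a b c
    have e1 : b * (N₁ + 1) ≤ b * (m + 1) := Nat.mul_le_mul_left _ (by omega)
    have e2 : b * (N₂ + 1) ≤ b * (m + 1) := Nat.mul_le_mul_left _ (by omega)
    nlinarith [Nat.zero_le (a * m), Nat.zero_le (c * m)]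
  refine ((runs_first h rfl hN₁ hs).seq fun s₁ f₁ r₁ => ?_).mono (arith _ _ _) fun _ _ h => h
  have p₁ := prepared_of_frame h f₁ rfl
  have w₁ := f₁.pt 8 9 rfl rfl
  have t₁ := r₁.stored
  rw [Set.empty_union] at t₁
  refine (RunsWithin.of_exec (Q := fun s' => s'.nat 33 0 = N₁) rfl (by
    simp [exec, r₁.count])).mono (c' := 3 + 1) (by simp [maxCost, NatExpr.cost, NatExpr.reg])
    (fun _ _ h => h) |>.seq fun s₂ f₂ h₂ => ?_
  have p₂ := prepared_of_frame p₁ f₂ rfl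
  have w₂ := (f₂.pt 8 9 rfl rfl).trans w₁
  refine (runs_second p₂ w₂ hN₂ (t₁.congr (f₂.nat 2 rfl) (f₂.nat 3 rfl)
    (f₂.pt 4 5 rfl rfl))).seq fun s₃ f₃ r₃ => ?_
  have p₃ := prepared_of_frame p₂ f₃ rfl
  have w₃ := (f₃.pt 8 9 rfl rfl).trans w₂
  have n₃ : s₃.nat 33 0 = N₁ := by rw [f₃.nat 33 rfl, h₂]
  refine RunsWithin.branch (c := 1 + (params₁.maxCost + FunnelProgram.cost * (N₁ + 1)))
    (fun hb => ?_) (fun hb => ?_)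
  · have hb : s₃.nat 33 0 ≤ s₃.nat 1 0 := hb
    rw [n₃, r₃.count] at hb
    obtain ⟨x1, x2⟩ := hc.isHiddenSet_second hk hN₂ r₃
    refine ⟨1, s₃, by omega, .skip _, ?_⟩
    exact solved_of_pieces hc hk hN₁ hN₂ r₃.stored x1 (by omega) (by omega)
  · have hb : ¬ s₃.nat 33 0 ≤ s₃.nat 1 0 := hb
    rw [n₃, r₃.count] at hb
    refine (runs_first p₃ w₃ hN₁ r₃.stored).mono (by omega) fun s₄ f₄ r₄ => ?_
    obtain ⟨x1, x2⟩ := hc.isHiddenSet_first hk hN₁ r₄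
    have t₄ := r₄.stored
    -- The repeated run lists the triangles of the first funnel a second time, which does not change
    -- the set of their regions; so the bound by `N₁ + N₂` persists.
    rw [Set.union_right_comm, Set.union_self] at t₄
    exact solved_of_pieces hc hk hN₁ hN₂ t₄ x1 (by omega) (by omega)

theorem runs_main {n : ℕ} {v : Polygon Plane n} (hv : v.IsPseudotriangle) :
    RunsWithin main (RamState.input v) ((Preparation.cost + cost) * (n + 1)) (Solved v.region) := by
  rw [add_mul]
  refine (Preparation.runs_main hv).seq ?_
  rintro s f ⟨p, q, m, k, h1, h2, h3⟩
  rw [h3]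
  refine (runs_bothFunnels h2 ?_).mono (Nat.mul_le_mul_left _ (by omega)) fun _ _ h => h
  have n2 : s.nat 2 0 = 0 := by
    rw [f.nat 2 rfl]
    simp [RamState.input]
  have n3 : s.nat 3 0 = 0 := by
    rw [f.nat 3 rfl]
    simp [RamState.input]
  refine ⟨fun j hj => ?_, fun j hj => by omega, ?_⟩
  · obtain rfl : j = 0 := by omega
    exact n3
  · rw [n2]
    simp

end PseudotriangleProgram

theorem mainTheorem12 :
    ∃ (prog : Program) (K : ℕ),
      ∀ (n : ℕ) (v : Polygon Plane n), v.IsPseudotriangle →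
        ∃ (t : ℕ) (s : RamState) (H : Finset Plane) (C : Finset (Set Plane)),
          Runs prog (RamState.input v) t s ∧ t ≤ K * n ∧
          s.outputPoints = H ∧ s.OutputsConvexPolygons C ∧
          IsHiddenSet v.region H ∧ IsConvexCover v.region C ∧
          C.card ≤ 2 * H.card ∧
          (∀ H' : Finset Plane, IsHiddenSet v.region H' → H'.card ≤ 2 * H.card) ∧
          (∀ C' : Finset (Set Plane), IsConvexCover v.region C' → C.card ≤ 2 * C'.card) := by
  refine ⟨PseudotriangleProgram.main, 2 * (Preparation.cost + PseudotriangleProgram.cost),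
    fun n v hv => ?_⟩
  have hn : 3 ≤ n := hv.1.1
  obtain ⟨t, s, ht, hr, hH, C, hC, hcov, hcard⟩ := PseudotriangleProgram.runs_main hv
  refine ⟨t, s, s.outputPoints, C, hr, ?_, rfl, hC, hH, hcov, hcard,
    fun H' hH' => (hH'.card_le_of_cover hcov).trans hcard,
    fun C' hC' => hcard.trans (Nat.mul_le_mul_left _ (hH.card_le_of_cover hC'))⟩
  -- The time bound is a multiple of `n + 1`, and `n + 1 ≤ 2 * n` explains the factor 2 in the
  -- constant.
  refine ht.trans ?_
  generalize Preparation.cost + PseudotriangleProgram.cost = c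
  nlinarith
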